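/- **Setting.** Let $M$ be a finite-dimensional real analytic manifold and $G$ a Lie group (both Hausdorff and second countable), and let $G$ act on $M$ from the left such that $g\mapsto g\cdot x$ and $x\mapsto g\cdot x$ are analytic for all $x\in M$, $g\in G$. Assume that the action is *sated*: there are no $x\in M$ and no two different $y,z\in M\setminus\{x\}$ with $\lim_n g_n\cdot y=x=\lim_n g_n\cdot z$ for a sequence $(g_n)$ in $G$. **Conventions.** An interval is a connected subset of $\mathbb R$ with non-empty interior. An analytic immersive curve $\gamma\colon D\to M$ is the restriction to the interval $D$ of an analytic immersion of an open interval; an analytic diffeomorphism between intervals is the restriction of one between open intervals, it is positive (negative) if its derivative is $>0$ ($<0$), and $\overline\rho$ denotes the maximal analytic immersive extension of $\rho$. For intervals $A,B\subseteq D$ we write $g\cdot\gamma|_A\circ\!\sim\gamma|_B$ if $g\cdot\gamma(J)=\gamma(J')$ for non-empty open intervals $J\subseteq A$, $J'\subseteq B$ on which $\gamma$ is an embedding, and say that this holds w.r.t. $\rho$ if $\rho\colon J\to J'$ is an analytic diffeomorphism with $g\cdot\gamma|_J=\gamma\circ\rho$. An interval $A\subseteq D$ is *free* ($\gamma|_A$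 is a free segment) if $g\cdot\gamma|_A\circ\!\sim\gamma|_A$ implies $g\cdot\gamma|_A=\gamma|_A$; it is *maximal* if it is free and not properly contained in a free interval $A'\subseteq D$. The curve $\gamma$ is free if some interval $D'\subseteq D$ is free. Let $G_\gamma=\{g: g\cdot\gamma=\gamma\}$ and $[g]=g\,G_\gamma$. *$\tau$-decompositions.* Let $\tau\in\operatorname{int}D$, $D_-=D\cap(-\infty,\tau]$, $D_+=D\cap[\tau,\infty)$. A $\tau$-decomposition of $\gamma$ is a class $[g]\ne[e]$ such that $D_\pm$ are free and $g\cdot\gamma|_{B_-}=\gamma\circ\mu$ for an analytic diffeomorphism $\mu\colon B_-\to B_+$ with $B_\pm\subseteq D_\pm$ intervals, $\mu(\tau)=\tau\in B_\pm$, and $B_-=D_-$ or $B_+=D_+$. It is faithful if, whenever $g'\cdot\gamma|_{D_-}\circ\!\sim\gamma$ w.r.t. $\rho$, either $[g']=[e]$ and $\overline\rho|_{D_-}=\mathrm{id}$, or $[g']=[g]$ and $\overline\rho|_{B_-}=\mu$. *$A$-decompositions.* Let $A\subseteq\operatorname{int}D$ be compact and free. An $A$-decomposition of $\gamma$ is a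 pair $(\{a_n\}_{n\in\mathfrak n},\{[g_n]\}_{n\in\mathfrak n})$, where $\mathfrak n=\{n\in\mathbb Z\setminus\{0\}:\mathfrak n_-\le n\le\mathfrak n_+\}$ with $-\infty\le\mathfrak n_-<0<\mathfrak n_+\le\infty$, $a_n\in\operatorname{int}D$ is strictly increasing in $n$, $g_n\in G$, and the following holds. Put $A_0=[a_{-1},a_1]$, $A_n=[a_n,a_{n+1}]$ for $1\le n<\mathfrak n_+$, $A_n=[a_{n-1},a_n]$ for $\mathfrak n_-<n\le-1$, and, when $\mathfrak n_\pm$ is finite, $A_{\mathfrak n_+}=D\cap[a_{\mathfrak n_+},\infty)$, $A_{\mathfrak n_-}=D\cap(-\infty,a_{\mathfrak n_-}]$. Then $A_0=A$, $[g_{\pm1}]\neq[e]$, and for each $n\in\mathfrak n$ there is an analytic diffeomorphism $\mu_n\colon A'_n\to A_n$ with $g_n\cdot\gamma|_{A'_n}=\gamma\circ\mu_n$, where $A'_n=A$ for $n\notin\{\mathfrak n_-,\mathfrak n_+\}$, while for $n\in\{\mathfrak n_-,\mathfrak n_+\}$ $A'_n\subseteq A$ is an interval containing at least one endpoint of $A$.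 Put $g_0=e$, $\mu_0=\mathrm{id}_A$, $A_0'=A$. The decomposition is faithful if, whenever $g\cdot\gamma|_A\circ\!\sim\gamma$ w.r.t. $\rho$, there is a unique $n\in\mathfrak n\sqcup\{0\}$ with $[g]=[g_n]$ and $\overline\rho|_{A_n'}=\mu_n$. Put $h_n=g_ng_{n-1}^{-1}$ for $n>0$ and $h_n=g_ng_{n+1}^{-1}$ for $n<0$. A compact interval $A\subseteq\operatorname{int}D$ is positive (negative) if $\gamma|_{\operatorname{int}D}$ has an $A$-decomposition for which $\mu_1$ and $\mu_{-1}$ are both positive (both negative); $\gamma$ is positive (negative) if it admits a positive (negative) interval. **Theorem.** Let $D$ be an arbitrary interval and $\gamma\colon D\to M$ an analytic immersive curve that is free but not a free segment. Then exactly one of the following holds. 1. $\gamma$ admits a $\tau$-decomposition. In this case $\tau$, the class $[g]$ and the diffeomorphism $\mu$ are unique, and the decomposition is faithful. 2. There is a compact maximal interval contained in $\operatorname{int}D$. In this case, for each such interval $A$ there is a unique $A$-decomposition (including the $\mu_n$ and their domains), and it is faithful. Moreover, $\gamma$ is either positive or negative, not both, and: i) If $\gamma$ is positive, each compact maximal interval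 in $\operatorname{int}D$ is positive, and there is a unique class $[h]\ne[e]$ such that for every positive $A$ with $A$-decomposition $(\{a_n\},\{[g_n]\})$ and all $n\in\mathfrak n$ one has $[h_n]=[h^{\operatorname{sign}n}]$, $[g_n]=[h^n]$, $h^n\cdot\gamma|_{A_n'}=\gamma\circ\mu_n$, and $\mu_n$ is positive. Each $t\in\operatorname{int}D$ lies in the interior of a positive interval. More precisely, for each such $A$: if $\mathfrak n_-<n\le0$ and $b'\in\operatorname{int}A_{n-1}$, there is $b\in\operatorname{int}A_n$ with $[b',b]$ positive; and if $0\le n<\mathfrak n_+$ and $b\in\operatorname{int}A_{n+1}$, there is $b'\in\operatorname{int}A_n$ with $[b',b]$ positive. ii) If $\gamma$ is negative, each compact maximal interval in $\operatorname{int}D$ is negative, and for every $A$-decomposition $(\{a_n\},\{[g_n]\})$ of $\gamma$ the maximal intervals of $\gamma$ are exactly the $A_n$, $n\in\mathfrak n\sqcup\{0\}$; for all $n\in\mathfrak n$, $\mu_n$ is positive for even $n$ and negative for odd $n$, and $[g_n]=[g_{\sigma(\operatorname{sign}n)}\cdots g_{\sigma(n)}]$ (product of $|n|$ factors), where $\sigma(n)=(-1)^{n-1}$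 for $n>0$ and $\sigma(n)=(-1)^n$ for $n<0$. -/

import Mathlib

open Set Filter Topology
open scoped Manifold ContDiff

namespace AnalyticCurve

/-! ### Intervals, analytic diffeomorphisms between intervals

A curve with domain `D` is represented by a function on `ℝ` together with the set `D`; every notion
below depends only on the values on `D`. -/

/-- An interval: a connected subset of `ℝ` with non-empty interior. -/
def IsInterval (D : Set ℝ) : Prop :=
  D.OrdConnected ∧ (interior D).Nonempty

/-- A non-empty open interval. -/
def IsOpenInterval (J : Set ℝ) : Prop :=
  IsOpen J ∧ J.OrdConnected ∧ J.Nonempty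

/-- `δ` on the open interval `U` is an analytic immersive extension of `ρ` on `D`. -/
def IsImmersiveExtension (ρ : ℝ → ℝ) (D : Set ℝ) (δ : ℝ → ℝ) (U : Set ℝ) : Prop :=
  IsOpenInterval U ∧ D ⊆ U ∧ AnalyticOnNhd ℝ δ U ∧ (∀ t ∈ U, deriv δ t ≠ 0) ∧ EqOn δ ρ D

/-- `ρ : D → D'` is an analytic diffeomorphism: `ρ` maps `D` onto `D'` and is the restriction of an
analytic map on an open interval whose derivative vanishes nowhere, that is, of an analytic
diffeomorphism between open intervals. -/
def IsAnalyticDiffeo (ρ : ℝ → ℝ) (D D' : Set ℝ) : Prop :=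
  (∃ δ U, IsImmersiveExtension ρ D δ U) ∧ ρ '' D = D'

/-- The maximal analytic immersive extension of `ρ : J → ℝ` (the union of all its analytic immersive
extensions) is defined on `S` and equals `μ` on `S`. -/
def MaximalExtensionEq (ρ : ℝ → ℝ) (J : Set ℝ) (μ : ℝ → ℝ) (S : Set ℝ) : Prop :=
  ∃ δ U, IsImmersiveExtension ρ J δ U ∧ S ⊆ U ∧ EqOn δ μ S

/-- A diffeomorphism `μ` with domain `D` is positive. -/
def IsPos (μ : ℝ → ℝ) (D : Set ℝ) : Prop := ∀ t ∈ interior D, 0 < deriv μ t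

/-- A diffeomorphism `μ` with domain `D` is negative. -/
def IsNeg (μ : ℝ → ℝ) (D : Set ℝ) : Prop := ∀ t ∈ interior D, deriv μ t < 0

/-! ### Analytic immersive curves and relations between them -/

/-- `γ : D → M` is an analytic immersive curve: it is the restriction to `D` of an analytic
immersion defined on an open interval. -/
def IsAnalyticImmersion (E : Type*) [NormedAddCommGroup E] [NormedSpace ℝ E]
    {M : Type*} [TopologicalSpace M] [ChartedSpace E M] (γ : ℝ → M) (D : Set ℝ) : Prop :=
  ∃ (δ : ℝ → M) (U : Set ℝ), IsOpenInterval U ∧ D ⊆ U ∧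
    ContMDiffOn 𝓘(ℝ, ℝ) 𝓘(ℝ, E) ω δ U ∧
    (∀ t ∈ U, Function.Injective (mfderiv 𝓘(ℝ, ℝ) 𝓘(ℝ, E) δ t)) ∧ EqOn δ γ D

section Relations

variable {M : Type*} [TopologicalSpace M]

/-- The restriction of the analytic immersion `γ` to the open interval `J` is an embedding, that is,
a homeomorphism onto its image. -/
def EmbedsOn (γ : ℝ → M) (J : Set ℝ) : Prop :=
  Topology.IsEmbedding (fun t : J => γ t)

/-- `γ|_D` and `γ'|_D'` overlap: `γ(J) = γ'(J')` for non-empty open intervals `J ⊆ D` and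
`J' ⊆ D'` on which the curves are embeddings. -/
def Overlap (γ : ℝ → M) (D : Set ℝ) (γ' : ℝ → M) (D' : Set ℝ) : Prop :=
  ∃ J J', IsOpenInterval J ∧ IsOpenInterval J' ∧ J ⊆ D ∧ J' ⊆ D' ∧
    EmbedsOn γ J ∧ EmbedsOn γ' J' ∧ γ '' J = γ' '' J'

/-- `γ|_D` and `γ'|_D'` overlap with respect to the analytic diffeomorphism `ρ : J → J'`. -/
def OverlapVia (γ : ℝ → M) (D : Set ℝ) (γ' : ℝ → M) (D' : Set ℝ)
    (ρ : ℝ → ℝ) (J J' : Set ℝ) : Prop :=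
  IsOpenInterval J ∧ IsOpenInterval J' ∧ J ⊆ D ∧ J' ⊆ D' ∧
    EmbedsOn γ J ∧ EmbedsOn γ' J' ∧ IsAnalyticDiffeo ρ J J' ∧ ∀ t ∈ J, γ t = γ' (ρ t)

end Relations

/-! ### Group actions, free curves, maximal intervals -/

section Action

variable (G : Type*) [Group G] {M : Type*} [MulAction G M]

/-- The stabilizer of the curve `γ : D → M`. -/
def curveStab (γ : ℝ → M) (D : Set ℝ) : Subgroup G := fixingSubgroup G (γ '' D)

variable {G}

/-- The class `[g] = g · G_γ`. -/
def cls (γ : ℝ → M) (D : Set ℝ) (g : G) : G ⧸ curveStab G γ D := QuotientGroup.mk g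

/-- `g · γ|_B = γ ∘ μ` holds for the analytic diffeomorphism `μ : B → B'`. -/
def Carries (g : G) (γ : ℝ → M) (B : Set ℝ) (μ : ℝ → ℝ) (B' : Set ℝ) : Prop :=
  IsAnalyticDiffeo μ B B' ∧ ∀ t ∈ B, g • γ t = γ (μ t)

variable (G) [TopologicalSpace M]

/-- The action is sated: there are no `x` and no two different `y, z ≠ x` such that
`gₙ • y → x` and `gₙ • z → x` for a sequence `gₙ` in `G`. -/
def IsSated (M : Type*) [MulAction G M] [TopologicalSpace M] : Prop :=
  ∀ x y z : M, y ≠ x → z ≠ x → y ≠ z →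
    ¬ ∃ g : ℕ → G, Tendsto (fun n => g n • y) atTop (𝓝 x) ∧
      Tendsto (fun n => g n • z) atTop (𝓝 x)

/-- The analytic immersion `γ|_A` is a free segment. -/
def IsFreeSegment (γ : ℝ → M) (A : Set ℝ) : Prop :=
  ∀ g : G, Overlap (fun t => g • γ t) A γ A → ∀ t ∈ A, g • γ t = γ t

/-- `γ : D → M` is a free curve: some restriction to an interval is a free segment. -/
def IsFreeCurve (γ : ℝ → M) (D : Set ℝ) : Prop :=
  ∃ D', IsInterval D' ∧ D' ⊆ D ∧ IsFreeSegment G γ D'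

/-- The interval `A ⊆ D` is maximal with respect to `γ : D → M`. -/
def IsMaximalInterval (γ : ℝ → M) (D A : Set ℝ) : Prop :=
  IsInterval A ∧ A ⊆ D ∧ IsFreeSegment G γ A ∧
    ∀ A', IsInterval A' → A' ⊆ D → A ⊆ A' → IsFreeSegment G γ A' → A' = A

/-! ### `τ`-decompositions -/

variable {G}

/-- `[g]` is a `τ`-decomposition of `γ : D → M`, with corresponding diffeomorphism `μ : B → μ(B)`.
Here `D₋ = D ∩ (-∞, τ]` and `D₊ = D ∩ [τ, ∞)`. -/
structure IsTauDecomposition (γ : ℝ → M) (D : Set ℝ) (τ : ℝ) (g : G) (B : Set ℝ) (μ : ℝ → ℝ) :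
    Prop where
  mem : τ ∈ interior D
  free_left : IsFreeSegment G γ (D ∩ Iic τ)
  free_right : IsFreeSegment G γ (D ∩ Ici τ)
  ne_one : cls γ D g ≠ cls γ D 1
  interval : IsInterval B
  tau_mem : τ ∈ B
  map_tau : μ τ = τ
  subset_left : B ⊆ D ∩ Iic τ
  subset_right : μ '' B ⊆ D ∩ Ici τ
  full : B = D ∩ Iic τ ∨ μ '' B = D ∩ Ici τ
  carries : Carries g γ B μ (μ '' B)

/-- The `τ`-decomposition `[g]`, with diffeomorphism `μ` on `B`, is faithful. -/
def IsFaithfulTau (γ : ℝ → M) (D : Set ℝ) (τ : ℝ) (g : G) (B : Set ℝ) (μ : ℝ → ℝ) : Prop :=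
  ∀ (g' : G) (ρ : ℝ → ℝ) (J J' : Set ℝ),
    OverlapVia (fun t => g' • γ t) (D ∩ Iic τ) γ D ρ J J' →
      (cls γ D g' = cls γ D 1 ∧ MaximalExtensionEq ρ J id (D ∩ Iic τ)) ∨
      (cls γ D g' = cls γ D g ∧ MaximalExtensionEq ρ J μ B)

end Action

/-! ### `A`-decompositions -/

/-- The data of an `A`-decomposition: the bounds `lo`, `hi` of the index set, the points `aₙ`,
representatives `gₙ` of the classes `[gₙ]`, and the diffeomorphisms `μₙ` with their domains.
Only the values at indices in `idx ∪ {0}` (for `a`: in `idx`) matter. -/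
structure DecompositionData (G : Type*) where
  lo : WithBot ℤ
  hi : WithTop ℤ
  a : ℤ → ℝ
  g : ℤ → G
  dom : ℤ → Set ℝ
  μ : ℤ → ℝ → ℝ

namespace DecompositionData

variable {G : Type*} (d : DecompositionData G)

/-- The index set: all `n ≠ 0` with `lo ≤ n ≤ hi`. -/
def idx : Set ℤ := {n | n ≠ 0 ∧ d.lo ≤ (n : WithBot ℤ) ∧ (n : WithTop ℤ) ≤ d.hi}

/-- `n` is the smallest or the largest index. -/
def IsEnd (n : ℤ) : Prop := (n : WithBot ℤ) = d.lo ∨ (n : WithTop ℤ) = d.hi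

open Classical in
/-- The interval `Aₙ` of the decomposition of `D`. -/
noncomputable def cell (D : Set ℝ) (n : ℤ) : Set ℝ :=
  if n = 0 then Icc (d.a (-1)) (d.a 1)
  else if 0 < n then
    if (n : WithTop ℤ) = d.hi then D ∩ Ici (d.a n) else Icc (d.a n) (d.a (n + 1))
  else
    if (n : WithBot ℤ) = d.lo then D ∩ Iic (d.a n) else Icc (d.a (n - 1)) (d.a n)

/-- The elements `hₙ`, given by `gₙ · gₙ₋₁⁻¹` for `n > 0` and by `gₙ · gₙ₊₁⁻¹` for `n < 0`, where
`g₀ = 1`. -/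
def step [Group G] (n : ℤ) : G :=
  if 0 < n then d.g n * (d.g (n - 1))⁻¹ else d.g n * (d.g (n + 1))⁻¹

end DecompositionData

section ADecomposition

variable {G : Type*} [Group G] {M : Type*} [MulAction G M] [TopologicalSpace M]

/-- `d` is an `A`-decomposition of `γ : D → M`. On the inner pieces `γ|_A` is carried onto
`γ|_{Aₙ}` as a whole; onto an end piece, a subinterval of `A` containing an endpoint of `A` is
carried. -/
structure IsADecomposition (γ : ℝ → M) (D A : Set ℝ) (d : DecompositionData G) : Prop where
  free : IsFreeSegment G γ A
  lo_neg : d.lo < ((0 : ℤ) : WithBot ℤ)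
  hi_pos : ((0 : ℤ) : WithTop ℤ) < d.hi
  mem : ∀ n ∈ d.idx, d.a n ∈ interior D
  mono : ∀ m ∈ d.idx, ∀ n ∈ d.idx, m < n → d.a m < d.a n
  cell_zero : d.cell D 0 = A
  g_zero : d.g 0 = 1
  dom_zero : d.dom 0 = A
  μ_zero : EqOn (d.μ 0) id A
  ne_one : cls γ D (d.g 1) ≠ cls γ D 1
  ne_one' : cls γ D (d.g (-1)) ≠ cls γ D 1
  inner : ∀ n ∈ d.idx, ¬ d.IsEnd n → d.dom n = A
  outer : ∀ n ∈ d.idx, d.IsEnd n → IsInterval (d.dom n) ∧ d.dom n ⊆ A ∧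
    (d.dom n ∩ {d.a (-1), d.a 1}).Nonempty
  carries : ∀ n ∈ d.idx, Carries (d.g n) γ (d.dom n) (d.μ n) (d.cell D n)

/-- The `A`-decomposition `d` is faithful. -/
def IsFaithful (γ : ℝ → M) (D A : Set ℝ) (d : DecompositionData G) : Prop :=
  ∀ (g : G) (ρ : ℝ → ℝ) (J J' : Set ℝ), OverlapVia (fun t => g • γ t) A γ D ρ J J' →
    ∃! n : ℤ, n ∈ insert 0 d.idx ∧ cls γ D g = cls γ D (d.g n) ∧
      MaximalExtensionEq ρ J (d.μ n) (d.dom n)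

/-- Two data describe the same decomposition `({aₙ}, {[gₙ]})`, with the same diffeomorphisms. -/
def SameDecomposition (γ : ℝ → M) (D : Set ℝ) (d d' : DecompositionData G) : Prop :=
  d.lo = d'.lo ∧ d.hi = d'.hi ∧ ∀ n ∈ d.idx, d.a n = d'.a n ∧
    cls γ D (d.g n) = cls γ D (d'.g n) ∧ d.dom n = d'.dom n ∧ EqOn (d.μ n) (d'.μ n) (d.dom n)

variable (G)

/-- `A` is a positive interval of `γ : D → M`: the `A`-decomposition of the restriction of `γ` to
the interior of `D` has positive diffeomorphisms `μ₁` and `μ₋₁`. -/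
def IsPositiveInterval (γ : ℝ → M) (D A : Set ℝ) : Prop :=
  ∃ d : DecompositionData G, IsADecomposition γ (interior D) A d ∧
    IsPos (d.μ 1) (d.dom 1) ∧ IsPos (d.μ (-1)) (d.dom (-1))

/-- `A` is a negative interval of `γ : D → M`. -/
def IsNegativeInterval (γ : ℝ → M) (D A : Set ℝ) : Prop :=
  ∃ d : DecompositionData G, IsADecomposition γ (interior D) A d ∧
    IsNeg (d.μ 1) (d.dom 1) ∧ IsNeg (d.μ (-1)) (d.dom (-1))

/-- `γ : D → M` is positive: it admits a positive interval. -/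
def IsPositiveCurve (γ : ℝ → M) (D : Set ℝ) : Prop := ∃ A, IsPositiveInterval G γ D A

/-- `γ : D → M` is negative: it admits a negative interval. -/
def IsNegativeCurve (γ : ℝ → M) (D : Set ℝ) : Prop := ∃ A, IsNegativeInterval G γ D A

/-- The description of the decompositions of a positive curve. -/
def PositiveDescription (γ : ℝ → M) (D : Set ℝ) : Prop :=
  (∀ A, IsMaximalInterval G γ D A → IsCompact A → A ⊆ interior D → IsPositiveInterval G γ D A) ∧
  (∃! c : G ⧸ curveStab G γ D, c ≠ cls γ D 1 ∧
    ∀ A, IsPositiveInterval G γ D A → ∀ d : DecompositionData G, IsADecomposition γ D A d →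
      ∀ h : G, cls γ D h = c → ∀ n ∈ d.idx,
        cls γ D (d.step n) = cls γ D (h ^ n.sign) ∧
        cls γ D (d.g n) = cls γ D (h ^ n) ∧
        Carries (h ^ n) γ (d.dom n) (d.μ n) (d.cell D n) ∧
        IsPos (d.μ n) (d.dom n)) ∧
  (∀ t ∈ interior D, ∃ A, IsPositiveInterval G γ D A ∧ t ∈ interior A) ∧
  (∀ A, IsPositiveInterval G γ D A → ∀ d : DecompositionData G, IsADecomposition γ D A d →
    (∀ n : ℤ, d.lo < (n : WithBot ℤ) → n ≤ 0 → ∀ b' ∈ interior (d.cell D (n - 1)),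
      ∃ b ∈ interior (d.cell D n), IsPositiveInterval G γ D (Icc b' b)) ∧
    (∀ n : ℤ, 0 ≤ n → (n : WithTop ℤ) < d.hi → ∀ b ∈ interior (d.cell D (n + 1)),
      ∃ b' ∈ interior (d.cell D n), IsPositiveInterval G γ D (Icc b' b)))

/-- `σ(n) = (-1)^(n-1)` for `n > 0` and `σ(n) = (-1)^n` for `n < 0`. -/
def sigma (n : ℤ) : ℤ := if 0 < n then ((n - 1).negOnePow : ℤ) else (n.negOnePow : ℤ)

variable {G}

/-- The product `g_{σ(sign n)} · … · g_{σ(n)}`, of `|n|` factors. -/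
def sigmaWord (g : ℤ → G) (n : ℤ) : G :=
  ((List.range n.natAbs).map (fun k : ℕ => g (sigma (n.sign * ((k : ℤ) + 1))))).prod

variable (G)

/-- The description of the decompositions of a negative curve. -/
def NegativeDescription (γ : ℝ → M) (D : Set ℝ) : Prop :=
  (∀ A, IsMaximalInterval G γ D A → IsCompact A → A ⊆ interior D → IsNegativeInterval G γ D A) ∧
  ∀ A, ∀ d : DecompositionData G, IsADecomposition γ D A d →
    (∀ B, IsMaximalInterval G γ D B ↔ ∃ n ∈ insert (0 : ℤ) d.idx, B = d.cell D n) ∧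
    ∀ n ∈ d.idx,
      (Even n → IsPos (d.μ n) (d.dom n)) ∧
      (Odd n → IsNeg (d.μ n) (d.dom n)) ∧
      cls γ D (d.g n) = cls γ D (sigmaWord d.g n)

end ADecomposition

end AnalyticCurve

set_option linter.unusedSectionVars false

/-! Fix an immersive extension `δ` of `γ` to an open interval `U`. The basic objects are germs:
analytic local changes of parameter `ρ` with `g • δ = δ ∘ ρ`. Because an immersion has local
analytic left inverses, `ρ` is determined by its value at one point and continues analytically to a
maximal transition. Followed from a point of its graph towards the opposite corner of a rectangle, a
maximal transition can only leave through one of the two sides at that corner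
(`MaxTransition.continuation`). This one fact replaces most arguments about domains of definition.

Satedness is used in two forms. First, an orientation preserving germ with a fixed point comes from
the stabilizer `G_γ`: otherwise `g` or `g⁻¹` contracts a one-sided neighbourhood of the fixed point
(`mem_stab_of_fixed`). Hence a pair of points together with an orientation determines the class
`[g]` and the maximal transition. Second, two points with different images cannot be moved
simultaneously arbitrarily close to a third one (`not_accumulating`). This forbids small
translations and accumulating reflections at an end point of a free interval, and it prevents the
pieces of a decomposition from accumulating inside `D`. Orientation reversing germs have a fixed
point by the intermediate value theorem, so they are reflections.

If the curve is free without being a free segment, a free interval carries identity germs only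
(`germ_eq`): a germ of the neutral element that shifts points could be used to enlarge a maximal
free interval. At an end point `a` of a maximal free interval, with `a` interior to `D`, the failure
of every enlargement produces either a reflection at `a`, or one transition that moves the interval
directly behind itself without a gap (`exists_translation`). Consequently either a compact maximal
interval lies in the interior of `D`, or `D` splits at a reflection point into two free halves
(`dichotomy`). The second case is the `τ`-decomposition.

For a compact maximal interval `[b, a]`, each neighbour is its image under a translation taking one
end point to the other, or under a reflection at the common end point. Composing these two
elementary moves rolls the tile `[b, a]` along the curve in both directions until the boundary of
`D` is reached. The resulting cells cover `D` by satedness, and faithfulness follows from `germ_eq`.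
One translation spreads over the curve: every interior point of `D` is interior to a free segment
with the same translation. This excludes reflections and makes the class of the translation unique,
which is the positive case. Otherwise both moves are reflections, every `aₙ` is a reflection point,
and no free interval can cross one; this is the negative case. -/

namespace AnalyticCurve

/-! ### Analytic immersed curves: identity theorem, local left inverses, continuation of parameter
changes. -/

section Analysis

variable {E : Type*} [NormedAddCommGroup E] [NormedSpace ℝ E]
  {M : Type*} [TopologicalSpace M] [ChartedSpace E M]

variable (E) in
/-- `δ` is an analytic immersion of the open interval `U`. -/
structure IsOpenCurve (δ : ℝ → M) (U : Set ℝ) : Prop where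
  dom : IsOpenInterval U
  smooth : ContMDiffOn 𝓘(ℝ, ℝ) 𝓘(ℝ, E) ω δ U
  inj : ∀ t ∈ U, Function.Injective (mfderiv 𝓘(ℝ, ℝ) 𝓘(ℝ, E) δ t)

variable {δ δ₁ δ₂ : ℝ → M} {U U₁ U₂ : Set ℝ}

theorem IsOpenCurve.contMDiffAt (h : IsOpenCurve E δ U) {t : ℝ} (ht : t ∈ U) :
    ContMDiffAt 𝓘(ℝ, ℝ) 𝓘(ℝ, E) ω δ t :=
  h.smooth.contMDiffAt (h.dom.1.mem_nhds ht)

theorem IsOpenCurve.continuousAt (h : IsOpenCurve E δ U) {t : ℝ} (ht : t ∈ U) :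
    ContinuousAt δ t :=
  (h.contMDiffAt ht).continuousAt

open scoped Pointwise in
theorem IsOpenCurve.neg (h : IsOpenCurve E δ U) : IsOpenCurve E (fun t => δ (-t)) (-U) := by
  have hn : ContMDiff 𝓘(ℝ, ℝ) 𝓘(ℝ, ℝ) ω (fun t : ℝ => -t) := contDiff_neg.contMDiff
  refine ⟨⟨h.dom.1.neg, h.dom.2.1.preimage_anti fun _ _ => neg_le_neg, h.dom.2.2.neg⟩, h.smooth.comp hn.contMDiffOn fun t ht => ht, fun t ht => ?_⟩
  have hm := mfderiv_comp t (g := δ) (f := fun u : ℝ => -u) (I := 𝓘(ℝ, ℝ)) (I' := 𝓘(ℝ, ℝ))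
    (I'' := 𝓘(ℝ, E)) ((h.contMDiffAt (t := -t) ht).mdifferentiableAt (by simp))
    (hn.mdifferentiable (by simp) t)
  have hm' : mfderiv 𝓘(ℝ, ℝ) 𝓘(ℝ, E) (fun t => δ (-t)) t = _ := hm
  rw [hm']
  refine (h.inj (-t) ht).comp ?_
  rw [mfderiv_eq_fderiv]
  have : fderiv ℝ (fun u : ℝ => -u) t = -ContinuousLinearMap.id ℝ ℝ := by
    rw [fderiv_fun_neg, fderiv_fun_id]
  rw [this]
  exact neg_injective

/-- The Hausdorff property forces equal values at `t`, so both curves can be read in one chart,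
where the identity theorem for analytic functions of one variable applies. -/
theorem eventuallyEq_of_frequently_eq [CompleteSpace E] [T2Space M] {t : ℝ}
    (h₁ : ContMDiffAt 𝓘(ℝ, ℝ) 𝓘(ℝ, E) ω δ₁ t) (h₂ : ContMDiffAt 𝓘(ℝ, ℝ) 𝓘(ℝ, E) ω δ₂ t)
    (h : ∃ᶠ u in 𝓝[≠] t, δ₁ u = δ₂ u) : δ₁ =ᶠ[𝓝 t] δ₂ := by
  have h0 : δ₁ t = δ₂ t := by
    by_contra hne
    have h3 : ∀ᶠ u in 𝓝 t, δ₁ u ≠ δ₂ u :=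
      (h₁.continuousAt.prodMk h₂.continuousAt).eventually
        ((isClosed_diagonal.isOpen_compl).mem_nhds (show (δ₁ t, δ₂ t) ∈ (diagonal M)ᶜ from hne))
    exact h ((h3.filter_mono nhdsWithin_le_nhds).mono fun u hu => hu)
  set φ := extChartAt 𝓘(ℝ, E) (δ₁ t) with hφ
  have hφd : ContMDiffAt 𝓘(ℝ, E) 𝓘(ℝ, E) ω φ (δ₁ t) := contMDiffAt_extChartAt
  have a₁ : AnalyticAt ℝ (φ ∘ δ₁) t :=
    (contMDiffAt_iff_contDiffAt.1 (hφd.comp t h₁)).analyticAt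
  have a₂ : AnalyticAt ℝ (φ ∘ δ₂) t := by
    rw [h0] at hφd
    exact (contMDiffAt_iff_contDiffAt.1 (hφd.comp t h₂)).analyticAt
  have key := (a₁.frequently_eq_iff_eventually_eq a₂).1 (h.mono fun u hu => by simp [hu])
  have hs : φ.source ∈ 𝓝 (δ₁ t) := extChartAt_source_mem_nhds (I := 𝓘(ℝ, E)) (δ₁ t)
  have s₁ := h₁.continuousAt.eventually_mem hs
  have s₂ := h₂.continuousAt.eventually_mem (h0 ▸ hs)
  filter_upwards [key, s₁, s₂] with u hu hu1 hu2 using φ.injOn hu1 hu2 hu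

/-- The points near which the curves agree form an open set, and a limit point of this set sees
frequent agreement, so it belongs to the set again; connectedness does the rest. -/
theorem eqOn_of_eventuallyEq [CompleteSpace E] [T2Space M] {V : Set ℝ} (hV : IsOpen V)
    (hV' : IsPreconnected V)
    (h₁ : ContMDiffOn 𝓘(ℝ, ℝ) 𝓘(ℝ, E) ω δ₁ V) (h₂ : ContMDiffOn 𝓘(ℝ, ℝ) 𝓘(ℝ, E) ω δ₂ V)
    {t : ℝ} (ht : t ∈ V) (h : ∃ᶠ u in 𝓝[≠] t, δ₁ u = δ₂ u) : EqOn δ₁ δ₂ V := by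
  have c₁ := fun u hu => h₁.contMDiffAt (x := u) (hV.mem_nhds hu)
  have c₂ := fun u hu => h₂.contMDiffAt (x := u) (hV.mem_nhds hu)
  have hsub : V ⊆ {u | δ₁ =ᶠ[𝓝 u] δ₂} := by
    refine hV'.subset_of_closure_inter_subset isOpen_setOfPred_eventually_nhds
      ⟨t, ht, eventuallyEq_of_frequently_eq (c₁ t ht) (c₂ t ht) h⟩ ?_
    rintro u ⟨hu, huV⟩
    by_cases hu' : u ∈ {u | δ₁ =ᶠ[𝓝 u] δ₂}
    · exact hu'
    refine eventuallyEq_of_frequently_eq (c₁ u huV) (c₂ u huV) ?_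
    rw [mem_closure_iff_frequently] at hu
    rw [frequently_nhdsWithin_iff]
    refine hu.mono fun v hv => ⟨hv.self_of_nhds, ?_⟩
    rintro rfl
    exact hu' hv
  exact fun u hu => (hsub hu).self_of_nhds

variable [IsManifold 𝓘(ℝ, E) ω M]

/-- In a chart the velocity at `t` is nonzero, so some continuous functional takes the value 1 on
it. Composing with this functional gives a real analytic function with nonzero derivative, to which
the analytic inverse function theorem applies. -/
theorem exists_leftInverse (h : IsOpenCurve E δ U) {t : ℝ} (ht : t ∈ U) :
    ∃ f : M → ℝ, ContMDiffAt 𝓘(ℝ, E) 𝓘(ℝ, ℝ) ω f (δ t) ∧ ∀ᶠ u in 𝓝 t, f (δ u) = u := by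
  have hδ := h.contMDiffAt ht
  set φ := extChartAt 𝓘(ℝ, E) (δ t) with hφ
  have hφd : ContMDiffAt 𝓘(ℝ, E) 𝓘(ℝ, E) ω φ (δ t) := contMDiffAt_extChartAt
  have hφδ : ContMDiffAt 𝓘(ℝ, ℝ) 𝓘(ℝ, E) ω (φ ∘ δ) t := hφd.comp t hδ
  have hφδ' : ContDiffAt ℝ ω (φ ∘ δ) t := contMDiffAt_iff_contDiffAt.1 hφδ
  have hd : fderiv ℝ (φ ∘ δ) t 1 ≠ 0 := by
    rw [← mfderiv_eq_fderiv,
      mfderiv_comp t (hφd.mdifferentiableAt (by simp)) (hδ.mdifferentiableAt (by simp))]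
    intro h0
    have hinj : Function.Injective (mfderiv 𝓘(ℝ, E) 𝓘(ℝ, E) φ (δ t)) :=
      (isInvertible_mfderiv_extChartAt (I := 𝓘(ℝ, E))
        (mem_extChartAt_source (I := 𝓘(ℝ, E)) (δ t))).injective
    have h1 : mfderiv 𝓘(ℝ, ℝ) 𝓘(ℝ, E) δ t (1 : ℝ) = 0 :=
      hinj (Eq.trans h0 (map_zero _).symm)
    exact one_ne_zero (α := ℝ) (h.inj t ht (h1.trans (map_zero _).symm))
  obtain ⟨ℓ, hℓ⟩ := SeparatingDual.exists_eq_one (R := ℝ) (V := E) hd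
  set q : ℝ → ℝ := fun u => ℓ (φ (δ u)) with hq
  have hqa : AnalyticAt ℝ q t := by
    apply ContDiffAt.analyticAt
    exact ℓ.contDiff.contDiffAt.comp t hφδ'
  have hqd : deriv q t ≠ 0 := by
    have h1 : HasFDerivAt (φ ∘ δ) (fderiv ℝ (φ ∘ δ) t) t :=
      (hφδ'.differentiableAt (by simp)).hasFDerivAt
    have h2 : HasFDerivAt q (ℓ.comp (fderiv ℝ (φ ∘ δ) t)) t := ℓ.hasFDerivAt.comp t h1
    rw [h2.hasDerivAt.deriv]
    simp only [ContinuousLinearMap.comp_apply]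
    rw [hℓ]; exact one_ne_zero
  have hL := hqa.analyticAt_localInverse hqd
  set L := hqa.hasStrictDerivAt.localInverse q (deriv q t) t hqd with hLdef
  refine ⟨fun x => L (ℓ (φ x)), ?_, ?_⟩
  · have h1 : ContMDiffAt 𝓘(ℝ, ℝ) 𝓘(ℝ, ℝ) ω L (ℓ (φ (δ t))) :=
      contMDiffAt_iff_contDiffAt.2 hL.contDiffAt
    have h2 : ContMDiffAt 𝓘(ℝ, E) 𝓘(ℝ, ℝ) ω (fun x => ℓ (φ x)) (δ t) :=
      (ℓ.contDiff.contDiffAt.contMDiffAt).comp (δ t) hφd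
    exact h1.comp (δ t) h2
  · exact hqa.hasStrictDerivAt.eventually_left_inverse hqd

theorem exists_injOn_nhds (h : IsOpenCurve E δ U) {t : ℝ} (ht : t ∈ U) :
    ∃ W ∈ 𝓝 t, InjOn δ W := by
  obtain ⟨f, -, hf⟩ := exists_leftInverse h ht
  exact ⟨_, hf, fun u hu v hv huv => by rw [← hu, ← hv, huv]⟩

theorem exists_embedsOn (h : IsOpenCurve E δ U) {t : ℝ} (ht : t ∈ U) :
    ∃ W ∈ 𝓝 t, ∀ J ⊆ W, EmbedsOn δ J := by
  obtain ⟨f, hf, hf'⟩ := exists_leftInverse h ht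
  obtain ⟨O, hO, hOf⟩ := (contMDiffAt_iff_contMDiffOn_nhds (by simp)).1 hf
  obtain ⟨O', hO'O, hO', htO'⟩ := mem_nhds_iff.1 hO
  have hδO : ∀ᶠ u in 𝓝 t, δ u ∈ O' := (h.continuousAt ht).eventually_mem (hO'.mem_nhds htO')
  refine ⟨_, inter_mem (inter_mem hf' hδO) (h.dom.1.mem_nhds ht), fun J hJ => ?_⟩
  let i : J → O' := fun u => ⟨δ u, (hJ u.2).1.2⟩
  have hic : Continuous i := by
    refine Continuous.subtype_mk ?_ _
    exact (h.smooth.continuousOn.mono fun u hu => (hJ hu).2).domRestrict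
  have hfc : Continuous (fun x : O' => f x) :=
    (hOf.continuousOn.mono hO'O).domRestrict
  have hcomp : IsEmbedding ((fun x : O' => f x) ∘ i) := by
    have : (fun x : O' => f x) ∘ i = Subtype.val := by
      funext u
      exact (hJ u.2).1.1
    rw [this]
    exact IsEmbedding.subtypeVal
  exact IsEmbedding.subtypeVal.comp (IsEmbedding.of_comp hic hfc hcomp)

/-- If `δ₁ = δ₂ ∘ ρ` along a filter accumulating at `t`, and `ρ → w` along it, then `ρ` continues
to an analytic change of parameter around `t`. -/
theorem exists_analytic_continuation [CompleteSpace E] [T2Space M]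
    (h₁ : IsOpenCurve E δ₁ U₁) (h₂ : IsOpenCurve E δ₂ U₂) {t w : ℝ} (ht : t ∈ U₁) (hw : w ∈ U₂)
    {l : Filter ℝ} [l.NeBot] (hl : l ≤ 𝓝[≠] t) {ρ : ℝ → ℝ} (hρ : Tendsto ρ l (𝓝 w))
    (h : ∀ᶠ u in l, δ₁ u = δ₂ (ρ u)) :
    ∃ σ : ℝ → ℝ, AnalyticAt ℝ σ t ∧ σ t = w ∧ deriv σ t ≠ 0 ∧ (∀ᶠ u in 𝓝 t, δ₁ u = δ₂ (σ u)) ∧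
      ∀ᶠ u in l, σ u = ρ u := by
  -- The continuation is `f ∘ δ₁` for a left inverse `f` of `δ₂` near `w`: it is analytic at `t`
  -- whatever `ρ` is, and it agrees with `ρ` along `l`.
  obtain ⟨f, hf, hf'⟩ := exists_leftInverse h₂ hw
  have hlt : l ≤ 𝓝 t := hl.trans nhdsWithin_le_nhds
  have e : δ₁ t = δ₂ w := by
    refine tendsto_nhds_unique ((h₁.continuousAt ht).tendsto.mono_left hlt) ?_
    exact Tendsto.congr' (h.mono fun u hu => hu.symm) ((h₂.continuousAt hw).tendsto.comp hρ)
  have hσρ : ∀ᶠ u in l, f (δ₁ u) = ρ u := by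
    filter_upwards [h, hρ.eventually hf'] with u hu hu'
    rw [hu, hu']
  have hfδ : ContMDiffAt 𝓘(ℝ, ℝ) 𝓘(ℝ, ℝ) ω (fun u => f (δ₁ u)) t :=
    ContMDiffAt.comp (g := f) t (e ▸ hf) (h₁.contMDiffAt ht)
  have hσt : f (δ₁ t) = w := by rw [e]; exact hf'.self_of_nhds
  have hrel : δ₁ =ᶠ[𝓝 t] (fun u => δ₂ (f (δ₁ u))) := by
    refine eventuallyEq_of_frequently_eq (h₁.contMDiffAt ht)
      (ContMDiffAt.comp (g := δ₂) t (hσt ▸ h₂.contMDiffAt hw) hfδ) ?_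
    refine Frequently.filter_mono (Eventually.frequently ?_) hl
    filter_upwards [h, hσρ] with u hu hu'
    rw [hu', hu]
  refine ⟨fun u => f (δ₁ u), (contMDiffAt_iff_contDiffAt.1 hfδ).analyticAt, hσt, ?_, hrel, hσρ⟩
  -- A vanishing derivative of the parameter change would make the differential of `δ₁` vanish at
  -- `t`.
  intro hd
  have hd' : mfderiv 𝓘(ℝ, ℝ) 𝓘(ℝ, ℝ) (fun u => f (δ₁ u)) t = 0 := by
    rw [mfderiv_eq_fderiv]
    ext
    change fderiv ℝ (fun u => f (δ₁ u)) t 1 = 0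
    simpa using hd
  have hc : mfderiv 𝓘(ℝ, ℝ) 𝓘(ℝ, E) δ₁ t = 0 := by
    rw [hrel.mfderiv_eq]
    have hm := mfderiv_comp t (g := δ₂) (f := fun u => f (δ₁ u)) (I := 𝓘(ℝ, ℝ)) (I' := 𝓘(ℝ, ℝ))
      (I'' := 𝓘(ℝ, E)) ((hσt.symm ▸ h₂.contMDiffAt hw : ContMDiffAt 𝓘(ℝ, ℝ) 𝓘(ℝ, E) ω δ₂
        (f (δ₁ t))).mdifferentiableAt (by simp)) (hfδ.mdifferentiableAt (by simp))
    rw [hd'] at hm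
    refine Eq.trans hm ?_
    ext
    exact map_zero (mfderiv 𝓘(ℝ, ℝ) 𝓘(ℝ, E) δ₂ (f (δ₁ t)))
  have h3 := h₁.inj t ht (a₁ := (1 : ℝ)) (a₂ := (0 : ℝ)) (by rw [hc]; rfl)
  exact one_ne_zero (α := ℝ) h3

end Analysis
end AnalyticCurve

namespace AnalyticCurve

/-! ### Germs and transitions between curves, and their formal calculus. -/

section Transitions

variable {M : Type*}

/-- `δ₁ = δ₂ ∘ ρ` near `t` for an analytic `ρ` with `ρ t = s` whose derivative has the sign
of `σ`. -/
def Germ (σ : ℝ) (δ₁ : ℝ → M) (U₁ : Set ℝ) (δ₂ : ℝ → M) (U₂ : Set ℝ) (t s : ℝ) : Prop :=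
  t ∈ U₁ ∧ s ∈ U₂ ∧ ∃ ρ : ℝ → ℝ, AnalyticAt ℝ ρ t ∧ 0 < σ * deriv ρ t ∧ ρ t = s ∧
    ∀ᶠ u in 𝓝 t, δ₁ u = δ₂ (ρ u)

/-- `δ₁ = δ₂ ∘ ρ` on the open interval `V` for an analytic `ρ` whose derivative has the sign
of `σ`. -/
structure Transition (σ : ℝ) (δ₁ : ℝ → M) (U₁ : Set ℝ) (δ₂ : ℝ → M) (U₂ : Set ℝ) (ρ : ℝ → ℝ)
    (V : Set ℝ) : Prop where
  dom : IsOpenInterval V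
  sub : V ⊆ U₁
  maps : MapsTo ρ V U₂
  an : AnalyticOnNhd ℝ ρ V
  der : ∀ t ∈ V, 0 < σ * deriv ρ t
  eq : ∀ t ∈ V, δ₁ t = δ₂ (ρ t)

/-- A transition that has no proper extension. -/
structure MaxTransition (σ : ℝ) (δ₁ : ℝ → M) (U₁ : Set ℝ) (δ₂ : ℝ → M) (U₂ : Set ℝ) (ρ : ℝ → ℝ)
    (V : Set ℝ) : Prop extends Transition σ δ₁ U₁ δ₂ U₂ ρ V where
  max : ∀ ρ' V', Transition σ δ₁ U₁ δ₂ U₂ ρ' V' → (∃ t ∈ V, t ∈ V' ∧ ρ t = ρ' t) → V' ⊆ V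

variable {σ σ' : ℝ} {δ₁ δ₂ δ₃ : ℝ → M} {U₁ U₂ U₃ V V' : Set ℝ} {ρ ρ' : ℝ → ℝ} {t s r : ℝ}

/-- Only the sign of `σ` matters. Allowing arbitrary reals lets algebraic expressions, such as
products of signs or differences of end points, serve directly as orientations. -/
theorem Germ.of_sign (h : Germ σ δ₁ U₁ δ₂ U₂ t s) (hσ : 0 < σ * σ') :
    Germ σ' δ₁ U₁ δ₂ U₂ t s := by
  obtain ⟨h1, h2, ρ, h3, h4, h5⟩ := h
  refine ⟨h1, h2, ρ, h3, ?_, h5⟩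
  have := mul_pos hσ h4
  have h6 : 0 < σ ^ 2 := by
    have : σ ≠ 0 := by rintro rfl; simp at hσ
    positivity
  nlinarith

theorem Transition.of_sign (h : Transition σ δ₁ U₁ δ₂ U₂ ρ V) (hσ : 0 < σ * σ') :
    Transition σ' δ₁ U₁ δ₂ U₂ ρ V := by
  refine ⟨h.1, h.2, h.3, h.4, fun t ht => ?_, h.6⟩
  have := mul_pos hσ (h.5 t ht)
  have h6 : 0 < σ ^ 2 := by
    have : σ ≠ 0 := by rintro rfl; simp at hσ
    positivity
  nlinarith

theorem Transition.germ (h : Transition σ δ₁ U₁ δ₂ U₂ ρ V) (ht : t ∈ V) :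
    Germ σ δ₁ U₁ δ₂ U₂ t (ρ t) :=
  ⟨h.sub ht, h.maps ht, ρ, h.an t ht, h.der t ht, rfl,
    mem_of_superset (h.dom.1.mem_nhds ht) h.eq⟩

theorem exists_transition_of_analyticAt (hU₁ : IsOpen U₁) (hU₂ : IsOpen U₂) (h1 : t ∈ U₁)
    (h2 : ρ t ∈ U₂) (h3 : AnalyticAt ℝ ρ t) (h4 : 0 < σ * deriv ρ t)
    (h6 : ∀ᶠ u in 𝓝 t, δ₁ u = δ₂ (ρ u)) {W : Set ℝ} (hW : W ∈ 𝓝 t) :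
    ∃ V, Transition σ δ₁ U₁ δ₂ U₂ ρ V ∧ t ∈ V ∧ V ⊆ W := by
  have e1 := h3.eventually_analyticAt
  have e2 : ∀ᶠ u in 𝓝 t, 0 < σ * deriv ρ u :=
    (continuousAt_const.mul h3.deriv.continuousAt).eventually (lt_mem_nhds h4)
  have e3 : ∀ᶠ u in 𝓝 t, ρ u ∈ U₂ := h3.continuousAt.eventually_mem (hU₂.mem_nhds h2)
  have e4 : ∀ᶠ u in 𝓝 t, u ∈ U₁ := hU₁.mem_nhds h1
  obtain ⟨ε, hε, hb⟩ := Metric.eventually_nhds_iff_ball.1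
    (e1.and (e2.and (e3.and (e4.and (h6.and hW)))))
  refine ⟨Metric.ball t ε, ⟨⟨Metric.isOpen_ball, ?_, t, Metric.mem_ball_self hε⟩,
    fun u hu => (hb u hu).2.2.2.1, fun u hu => (hb u hu).2.2.1, fun u hu => (hb u hu).1,
    fun u hu => (hb u hu).2.1, fun u hu => (hb u hu).2.2.2.2.1⟩, Metric.mem_ball_self hε,
    fun u hu => (hb u hu).2.2.2.2.2⟩
  rw [Real.ball_eq_Ioo]
  exact ordConnected_Ioo

theorem Germ.exists_transition (hU₁ : IsOpenInterval U₁) (hU₂ : IsOpenInterval U₂)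
    (h : Germ σ δ₁ U₁ δ₂ U₂ t s) {W : Set ℝ} (hW : W ∈ 𝓝 t) :
    ∃ ρ V, Transition σ δ₁ U₁ δ₂ U₂ ρ V ∧ t ∈ V ∧ V ⊆ W ∧ ρ t = s := by
  obtain ⟨h1, h2, ρ, h3, h4, h5, h6⟩ := h
  obtain ⟨V, hV, h7, h8⟩ :=
    exists_transition_of_analyticAt hU₁.1 hU₂.1 h1 (h5.symm ▸ h2) h3 h4 h6 hW
  exact ⟨ρ, V, hV, h7, h8, h5⟩

theorem Germ.inv (h : Germ σ δ₁ U₁ δ₂ U₂ t s) : Germ σ δ₂ U₂ δ₁ U₁ s t := by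
  obtain ⟨h1, h2, ρ, h3, h4, h5, h6⟩ := h
  have hd : deriv ρ t ≠ 0 := by
    intro h0
    simp [h0] at h4
  have hL := h3.analyticAt_localInverse hd
  have hLs : h3.hasStrictDerivAt.localInverse ρ (deriv ρ t) t hd (ρ t) = t :=
    HasStrictFDerivAt.localInverse_apply_image ..
  have hr := HasStrictDerivAt.eventually_right_inverse h3.hasStrictDerivAt hd
  have hdL := (HasStrictDerivAt.to_localInverse h3.hasStrictDerivAt hd).hasDerivAt.deriv
  set L := h3.hasStrictDerivAt.localInverse ρ (deriv ρ t) t hd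
  subst h5
  refine ⟨h2, h1, L, hL, ?_, hLs, ?_⟩
  · rw [hdL]
    have h7 : 0 < (deriv ρ t)⁻¹ ^ 2 := by positivity
    have := mul_pos h4 h7
    have h8 : σ * deriv ρ t * (deriv ρ t)⁻¹ ^ 2 = σ * (deriv ρ t)⁻¹ := by field_simp
    rwa [h8] at this
  · have hc : Tendsto L (𝓝 (ρ t)) (𝓝 t) := by
      have := hL.continuousAt.tendsto
      rwa [hLs] at this
    filter_upwards [hc.eventually h6, hr] with v hv hv'
    rw [hv, hv']

theorem Germ.comp (h : Germ σ δ₁ U₁ δ₂ U₂ t s) (h' : Germ σ' δ₂ U₂ δ₃ U₃ s r) :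
    Germ (σ * σ') δ₁ U₁ δ₃ U₃ t r := by
  obtain ⟨h1, h2, ρ, h3, h4, h5, h6⟩ := h
  obtain ⟨h1', h2', ρ', h3', h4', h5', h6'⟩ := h'
  subst h5
  refine ⟨h1, h2', ρ' ∘ ρ, h3'.comp h3, ?_, h5', ?_⟩
  · rw [deriv_comp t h3'.differentiableAt h3.differentiableAt]
    have := mul_pos h4 h4'
    linarith
  · filter_upwards [h6, h3.continuousAt.eventually h6'] with u hu hu'
    rw [hu, hu']; rfl

theorem Transition.mono (h : Transition σ δ₁ U₁ δ₂ U₂ ρ V) (hV' : IsOpenInterval V')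
    (hsub : V' ⊆ V) : Transition σ δ₁ U₁ δ₂ U₂ ρ V' :=
  ⟨hV', hsub.trans h.sub, h.maps.mono_left hsub, h.an.mono hsub, fun t ht => h.der t (hsub ht),
    fun t ht => h.eq t (hsub ht)⟩

theorem Transition.congr (h : Transition σ δ₁ U₁ δ₂ U₂ ρ V) (hρ : EqOn ρ' ρ V) :
    Transition σ δ₁ U₁ δ₂ U₂ ρ' V := by
  have he : ∀ t ∈ V, ρ' =ᶠ[𝓝 t] ρ := fun t ht => hρ.eventuallyEq_of_mem (h.dom.1.mem_nhds ht)
  refine ⟨h.dom, h.sub, fun t ht => ?_, fun t ht => (h.an t ht).congr (he t ht).symm,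
    fun t ht => ?_, fun t ht => ?_⟩
  · rw [hρ ht]; exact h.maps ht
  · rw [(he t ht).deriv_eq]; exact h.der t ht
  · rw [hρ ht]; exact h.eq t ht

theorem Transition.congr_left (h : Transition σ δ₁ U₁ δ₂ U₂ ρ V) (hδ : EqOn δ₃ δ₁ U₁) :
    Transition σ δ₃ U₁ δ₂ U₂ ρ V :=
  ⟨h.dom, h.sub, h.maps, h.an, h.der, fun t ht => by rw [hδ (h.sub ht)]; exact h.eq t ht⟩

theorem MaxTransition.congr_left (h : MaxTransition σ δ₁ U₁ δ₂ U₂ ρ V) (hδ : EqOn δ₃ δ₁ U₁) :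
    MaxTransition σ δ₃ U₁ δ₂ U₂ ρ V :=
  ⟨h.1.congr_left hδ, fun ρ' V' h' => h.max ρ' V' (h'.congr_left hδ.symm)⟩

theorem MaxTransition.of_sign (h : MaxTransition σ δ₁ U₁ δ₂ U₂ ρ V) (hσ : 0 < σ * σ') :
    MaxTransition σ' δ₁ U₁ δ₂ U₂ ρ V :=
  ⟨h.1.of_sign hσ, fun ρ' V' h' => h.max ρ' V' (h'.of_sign (by linarith))⟩

theorem Transition.continuousOn (h : Transition σ δ₁ U₁ δ₂ U₂ ρ V) : ContinuousOn ρ V :=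
  h.an.continuousOn

theorem Transition.continuousAt (h : Transition σ δ₁ U₁ δ₂ U₂ ρ V) (ht : t ∈ V) :
    ContinuousAt ρ t :=
  (h.an t ht).continuousAt

theorem Transition.sign_ne_zero (h : Transition σ δ₁ U₁ δ₂ U₂ ρ V) : σ ≠ 0 := by
  rintro rfl
  obtain ⟨t, ht⟩ := h.dom.2.2
  simpa using h.der t ht

theorem Germ.sign_ne_zero (h : Germ σ δ₁ U₁ δ₂ U₂ t s) : σ ≠ 0 := by
  rintro rfl
  obtain ⟨-, -, ρ, -, h, -⟩ := h
  simp at h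

theorem Transition.strictMonoOn (h : Transition σ δ₁ U₁ δ₂ U₂ ρ V) (hσ : 0 < σ) :
    StrictMonoOn ρ V := by
  refine strictMonoOn_of_deriv_pos h.dom.2.1.convex h.continuousOn fun t ht => ?_
  exact (mul_pos_iff_of_pos_left hσ).1 (h.der t (interior_subset ht))

theorem Transition.strictAntiOn (h : Transition σ δ₁ U₁ δ₂ U₂ ρ V) (hσ : σ < 0) :
    StrictAntiOn ρ V := by
  refine strictAntiOn_of_deriv_neg h.dom.2.1.convex h.continuousOn fun t ht => ?_
  have := h.der t (interior_subset ht)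
  nlinarith

theorem Transition.injOn (h : Transition σ δ₁ U₁ δ₂ U₂ ρ V) : InjOn ρ V := by
  rcases lt_or_gt_of_ne h.sign_ne_zero with hσ | hσ
  · exact (h.strictAntiOn hσ).injOn
  · exact (h.strictMonoOn hσ).injOn

theorem Transition.isOpen_image (h : Transition σ δ₁ U₁ δ₂ U₂ ρ V) {O : Set ℝ} (hO : IsOpen O)
    (hOV : O ⊆ V) : IsOpen (ρ '' O) := by
  rw [isOpen_iff_mem_nhds]
  rintro _ ⟨t, ht, rfl⟩
  have hd : deriv ρ t ≠ 0 := by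
    intro h0
    simpa [h0] using h.der t (hOV ht)
  rw [← (h.an t (hOV ht)).hasStrictDerivAt.map_nhds_eq hd]
  exact image_mem_map (hO.mem_nhds ht)

open scoped Pointwise

theorem IsOpenInterval.neg (h : IsOpenInterval V) : IsOpenInterval (-V) :=
  ⟨h.1.neg, h.2.1.preimage_anti fun _ _ => neg_le_neg, h.2.2.neg⟩

/-- Reversing the parameter of source or target changes the orientation, so arguments about
continuation need only be made for increasing transitions followed to the right. -/
theorem Transition.neg_left (h : Transition σ δ₁ U₁ δ₂ U₂ ρ V) :
    Transition (-σ) (fun t => δ₁ (-t)) (-U₁) δ₂ U₂ (fun t => ρ (-t)) (-V) := by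
  refine ⟨h.dom.neg, fun t ht => h.sub ht, fun t ht => h.maps ht, fun t ht => ?_, fun t ht => ?_,
    fun t ht => h.eq (-t) ht⟩
  · exact (h.an (-t) ht).comp (f := fun u : ℝ => -u) analyticAt_id.neg
  · rw [deriv_comp_neg]
    linarith [h.der (-t) ht]

theorem Transition.neg_right (h : Transition σ δ₁ U₁ δ₂ U₂ ρ V) :
    Transition (-σ) δ₁ U₁ (fun t => δ₂ (-t)) (-U₂) (fun t => -ρ t) V := by
  refine ⟨h.dom, h.sub, fun t ht => by simpa using h.maps ht, fun t ht => (h.an t ht).neg,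
    fun t ht => ?_, fun t ht => by simpa using h.eq t ht⟩
  rw [deriv.fun_neg]
  linarith [h.der t ht]

theorem MaxTransition.neg_left (h : MaxTransition σ δ₁ U₁ δ₂ U₂ ρ V) :
    MaxTransition (-σ) (fun t => δ₁ (-t)) (-U₁) δ₂ U₂ (fun t => ρ (-t)) (-V) := by
  refine ⟨h.toTransition.neg_left, ?_⟩
  rintro ρ' V' h' ⟨t, ht, ht', he⟩
  have h2 := h'.neg_left
  simp only [neg_neg] at h2
  have := h.max _ _ h2 ⟨-t, ht, by simpa using ht', by simpa using he⟩
  intro u hu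
  exact this (by simpa using hu)

theorem MaxTransition.neg_right (h : MaxTransition σ δ₁ U₁ δ₂ U₂ ρ V) :
    MaxTransition (-σ) δ₁ U₁ (fun t => δ₂ (-t)) (-U₂) (fun t => -ρ t) V := by
  refine ⟨h.toTransition.neg_right, ?_⟩
  rintro ρ' V' h' ⟨t, ht, ht', he⟩
  have h2 := h'.neg_right
  simp only [neg_neg] at h2
  exact h.max _ _ h2 ⟨t, ht, ht', by linarith⟩

end Transitions

/-! ### Maximal transitions and where they can stop. -/

section Extension

variable {E : Type*} [NormedAddCommGroup E] [NormedSpace ℝ E]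
  {M : Type*} [TopologicalSpace M] [ChartedSpace E M] [IsManifold 𝓘(ℝ, E) ω M]
  {σ σ' : ℝ} {δ₁ δ₂ δ₃ : ℝ → M} {U₁ U₂ U₃ V V' : Set ℝ} {ρ ρ' : ℝ → ℝ} {t s r : ℝ}

/-- Local injectivity of `δ₂` upgrades agreement at one point to agreement nearby, and analyticity
spreads it over the overlap. The orientations need not be assumed equal. -/
theorem Transition.eqOn (h₂ : IsOpenCurve E δ₂ U₂) (h : Transition σ δ₁ U₁ δ₂ U₂ ρ V)
    (h' : Transition σ' δ₁ U₁ δ₂ U₂ ρ' V') (ht : t ∈ V) (ht' : t ∈ V') (he : ρ t = ρ' t) :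
    EqOn ρ ρ' (V ∩ V') := by
  obtain ⟨W, hW, hinj⟩ := exists_injOn_nhds h₂ (h.maps ht)
  have hev : ρ =ᶠ[𝓝 t] ρ' := by
    filter_upwards [(h.continuousAt ht).eventually_mem hW,
      (h'.continuousAt ht').eventually_mem (he ▸ hW), h.dom.1.mem_nhds ht,
      h'.dom.1.mem_nhds ht'] with u h1 h2 h3 h4
    exact hinj h1 h2 (by rw [← h.eq u h3, ← h'.eq u h4])
  exact (h.an.mono inter_subset_left).eqOn_of_preconnected_of_eventuallyEq
    (h'.an.mono inter_subset_right) (h.dom.2.1.inter h'.dom.2.1).isPreconnected ⟨ht, ht'⟩ hev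

theorem Transition.union (h₂ : IsOpenCurve E δ₂ U₂) (h : Transition σ δ₁ U₁ δ₂ U₂ ρ V)
    (h' : Transition σ δ₁ U₁ δ₂ U₂ ρ' V') (ht : t ∈ V) (ht' : t ∈ V') (he : ρ t = ρ' t) :
    ∃ ρ'', Transition σ δ₁ U₁ δ₂ U₂ ρ'' (V ∪ V') ∧ EqOn ρ'' ρ V ∧ EqOn ρ'' ρ' V' := by
  classical
  have heq := h.eqOn h₂ h' ht ht' he
  have e1 : EqOn (V.piecewise ρ ρ') ρ V := piecewise_eqOn _ _ _
  have e2 : EqOn (V.piecewise ρ ρ') ρ' V' := by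
    intro u hu
    by_cases huV : u ∈ V
    · rw [piecewise_eq_of_mem _ _ _ huV]; exact heq ⟨huV, hu⟩
    · rw [piecewise_eq_of_notMem _ _ _ huV]
  have c := h.congr e1
  have c' := h'.congr e2
  refine ⟨V.piecewise ρ ρ', ⟨⟨h.dom.1.union h'.dom.1, ?_, t, Or.inl ht⟩,
    union_subset h.sub h'.sub, ?_, ?_, ?_, ?_⟩, e1, e2⟩
  · exact ((h.dom.2.1.isPreconnected).union t ht ht' h'.dom.2.1.isPreconnected).ordConnected
  · rintro u (hu | hu)
    exacts [c.maps hu, c'.maps hu]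
  · rintro u (hu | hu)
    exacts [c.an u hu, c'.an u hu]
  · rintro u (hu | hu)
    exacts [c.der u hu, c'.der u hu]
  · rintro u (hu | hu)
    exacts [c.eq u hu, c'.eq u hu]

/-- All transitions through `(t, s)` agree where they overlap, so their union is again one, and it
absorbs every transition that meets it. -/
theorem Germ.exists_max (hU₁ : IsOpenInterval U₁) (h₂ : IsOpenCurve E δ₂ U₂)
    (h : Germ σ δ₁ U₁ δ₂ U₂ t s) :
    ∃ ρ V, MaxTransition σ δ₁ U₁ δ₂ U₂ ρ V ∧ t ∈ V ∧ ρ t = s := by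
  classical
  let F : Set ((ℝ → ℝ) × Set ℝ) :=
    {p | Transition σ δ₁ U₁ δ₂ U₂ p.1 p.2 ∧ t ∈ p.2 ∧ p.1 t = s}
  let V : Set ℝ := ⋃ p ∈ F, p.2
  let ρ : ℝ → ℝ := fun u => if h : ∃ p ∈ F, u ∈ p.2 then h.choose.1 u else 0
  have key : ∀ p ∈ F, EqOn ρ p.1 p.2 := by
    intro p hp u hu
    have hex : ∃ p ∈ F, u ∈ p.2 := ⟨p, hp, hu⟩
    have hρ : ρ u = hex.choose.1 u := dif_pos hex
    obtain ⟨hq, hq'⟩ := hex.choose_spec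
    rw [hρ]
    exact hq.1.eqOn h₂ hp.1 hq.2.1 hp.2.1 (hq.2.2.trans hp.2.2.symm) ⟨hq', hu⟩
  have hc : ∀ p ∈ F, Transition σ δ₁ U₁ δ₂ U₂ ρ p.2 := fun p hp => hp.1.congr (key p hp)
  obtain ⟨ρ₀, V₀, h0, ht0, -, hs0⟩ := h.exists_transition hU₁ h₂.dom univ_mem
  have hF0 : (ρ₀, V₀) ∈ F := ⟨h0, ht0, hs0⟩
  have hsubV : ∀ p ∈ F, p.2 ⊆ V := fun p hp => subset_biUnion_of_mem (u := fun p => p.2) hp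
  have hV : ∀ u ∈ V, ∃ p ∈ F, u ∈ p.2 := by
    intro u hu
    simpa [V] using hu
  have htV : t ∈ V := hsubV _ hF0 ht0
  have hρt : ρ t = s := by rw [key _ hF0 ht0]; exact hs0
  have hTr : Transition σ δ₁ U₁ δ₂ U₂ ρ V := by
    refine ⟨⟨isOpen_biUnion fun p hp => hp.1.dom.1, ?_, t, htV⟩, ?_, ?_, ?_, ?_, ?_⟩
    · refine IsPreconnected.ordConnected ?_
      have : V = ⋃₀ {W | ∃ p ∈ F, p.2 = W} := by
        ext u; simp only [V, mem_iUnion₂, mem_sUnion, mem_ofPred_eq]; aesop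
      rw [this]
      refine isPreconnected_sUnion t _ ?_ ?_
      · rintro W ⟨p, hp, rfl⟩
        exact hp.2.1
      · rintro W ⟨p, hp, rfl⟩
        exact hp.1.dom.2.1.isPreconnected
    all_goals intro u hu; obtain ⟨p, hp, hup⟩ := hV u hu
    · exact (hc p hp).sub hup
    · exact (hc p hp).maps hup
    · exact (hc p hp).an u hup
    · exact (hc p hp).der u hup
    · exact (hc p hp).eq u hup
  refine ⟨ρ, V, ⟨hTr, ?_⟩, htV, hρt⟩
  rintro ρ' V' h' ⟨u, huV, huV', hu⟩
  obtain ⟨ρ'', h'', e1, -⟩ := hTr.union h₂ h' huV huV' hu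
  have : ((ρ'', V ∪ V') : (ℝ → ℝ) × Set ℝ) ∈ F := ⟨h'', Or.inl htV, by rw [← hρt]; exact e1 htV⟩
  exact subset_union_right.trans (hsubV _ this)

/-- If neither exit is reached, the domain ends at some `z ≤ x` while the increasing values stay
below `y`. They then converge to a point of `U₂`, and the analytic continuation at `z` contradicts
maximality. -/
theorem MaxTransition.continuation_right [CompleteSpace E] [T2Space M]
    (h₁ : IsOpenCurve E δ₁ U₁) (h₂ : IsOpenCurve E δ₂ U₂)
    (h : MaxTransition σ δ₁ U₁ δ₂ U₂ ρ V) (hσ : 0 < σ) (ht : t ∈ V) {x y : ℝ} (hx : x ∈ U₁)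
    (hy : y ∈ U₂) (htx : t ≤ x) (hty : ρ t ≤ y) :
    (x ∈ V ∧ ρ x ≤ y) ∨ ∃ x' ∈ V, t ≤ x' ∧ x' ≤ x ∧ ρ x' = y := by
  by_contra hcon
  push Not at hcon
  obtain ⟨hc1, hc2⟩ := hcon
  have hmono := h.strictMonoOn hσ
  have hVc := h.dom.2.1
  have hlt : ∀ u ∈ V, t ≤ u → u ≤ x → ρ u < y := by
    intro u hu htu hux
    by_contra hge
    push Not at hge
    obtain ⟨v, hv, hvy⟩ := intermediate_value_Icc htu (h.continuousOn.mono (hVc.out ht hu))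
      ⟨hty, hge⟩
    exact hc2 v (hVc.out ht hu hv) hv.1 (hv.2.trans hux) hvy
  have hxV : x ∉ V := fun hxV => (hc1 hxV).not_gt (hlt x hxV htx le_rfl)
  have hVx : ∀ u ∈ V, u < x := by
    intro u hu
    by_contra hge
    push Not at hge
    exact hxV (hVc.out ht hu ⟨htx, hge⟩)
  have hbdd : BddAbove V := ⟨x, fun u hu => (hVx u hu).le⟩
  set z := sSup V with hz
  have hzx : z ≤ x := csSup_le ⟨t, ht⟩ fun u hu => (hVx u hu).le
  have hzV : z ∉ V := by
    intro hzV
    obtain ⟨ε, hε, hb⟩ := Metric.isOpen_iff.1 h.dom.1 z hzV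
    have : z + ε / 2 ∈ V := hb (by rw [Metric.mem_ball, Real.dist_eq]; rw [abs_lt]; constructor <;> linarith)
    have := le_csSup hbdd this
    linarith
  have htz : t < z := lt_of_le_of_ne (le_csSup hbdd ht) (by rintro h; exact hzV (h ▸ ht))
  have hIco : Ico t z ⊆ V := by
    intro u hu
    obtain ⟨v, hv, huv⟩ := exists_lt_of_lt_csSup ⟨t, ht⟩ hu.2
    exact hVc.out ht hv ⟨hu.1, huv.le⟩
  have hIoo : Ioo t z ⊆ V := Ioo_subset_Ico_self.trans hIco
  have hzU : z ∈ U₁ := h₁.dom.2.1.out (h.sub ht) hx ⟨htz.le, hzx⟩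
  have hbd : ∀ v ∈ ρ '' Ioo t z, v ≤ y := by
    rintro _ ⟨u, hu, rfl⟩
    exact (hlt u (hIoo hu) hu.1.le (hu.2.le.trans hzx)).le
  have hlim := MonotoneOn.tendsto_nhdsWithin_Ioo_left (nonempty_Ioo.2 htz)
    (hmono.monotoneOn.mono hIoo) ⟨y, hbd⟩
  set w := sSup (ρ '' Ioo t z)
  have hw : w ∈ U₂ := by
    refine h₂.dom.2.1.out (h.maps ht) hy ⟨?_, csSup_le ((nonempty_Ioo.2 htz).image _) hbd⟩
    obtain ⟨u, hu⟩ := nonempty_Ioo.2 htz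
    exact (hmono.monotoneOn ht (hIoo hu) hu.1.le).trans (le_csSup ⟨y, hbd⟩ ⟨u, hu, rfl⟩)
  have hIl : ∀ᶠ u in 𝓝[<] z, u ∈ V := mem_of_superset (Ioo_mem_nhdsLT htz) hIoo
  obtain ⟨κ, k1, k2, k3, k4, k5⟩ := exists_analytic_continuation h₁ h₂ hzU hw
    (l := 𝓝[<] z) (nhdsWithin_mono _ fun u hu => ne_of_lt hu) hlim (hIl.mono h.eq)
  obtain ⟨W, hW, hzW, -⟩ := exists_transition_of_analyticAt (σ := deriv κ z) h₁.dom.1 h₂.dom.1 hzU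
    (k2.symm ▸ hw) k1 (mul_self_pos.2 k3) k4 univ_mem
  obtain ⟨u, ⟨hu, huV⟩, huW⟩ := ((k5.and hIl).and
    (nhdsWithin_le_nhds (hW.dom.1.mem_nhds hzW))).exists
  have heq := h.toTransition.eqOn h₂ hW huV huW hu.symm
  have hd : deriv ρ u = deriv κ u :=
    (heq.eventuallyEq_of_mem ((h.dom.1.inter hW.dom.1).mem_nhds ⟨huV, huW⟩)).deriv_eq
  -- The continuation was built with its own orientation `deriv κ z`; comparing derivatives at a
  -- common point `u` shows that it is that of `ρ`.
  have hs : 0 < deriv κ z * σ := by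
    have p1 := h.der u huV
    have p2 := hW.der u huW
    rw [hd] at p1
    have p3 : 0 < deriv κ u := (mul_pos_iff_of_pos_left hσ).1 p1
    exact mul_pos ((mul_pos_iff_of_pos_right p3).1 p2) hσ
  exact hzV (h.max κ W (hW.of_sign hs) ⟨u, huV, huW, hu.symm⟩ hzW)

open scoped Pointwise

/-- A maximal transition, followed from `t` towards `x`, leaves the rectangle with opposite
corners `(t, ρ t)` and `(x, y)` through one of the two sides at `(x, y)`. -/
theorem MaxTransition.continuation [CompleteSpace E] [T2Space M]
    (h₁ : IsOpenCurve E δ₁ U₁) (h₂ : IsOpenCurve E δ₂ U₂)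
    (h : MaxTransition σ δ₁ U₁ δ₂ U₂ ρ V) (ht : t ∈ V) {x y : ℝ} (hx : x ∈ U₁)
    (hy : y ∈ U₂) (hxy : 0 ≤ σ * ((x - t) * (y - ρ t))) :
    (x ∈ V ∧ ρ x ∈ uIcc (ρ t) y) ∨ ∃ x' ∈ V, x' ∈ uIcc t x ∧ ρ x' = y := by
  rcases eq_or_ne x t with rfl | hxt
  · exact Or.inl ⟨ht, left_mem_uIcc⟩
  rcases eq_or_ne y (ρ t) with rfl | hyt
  · exact Or.inr ⟨t, ht, left_mem_uIcc, rfl⟩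
  -- The four combinations of orientation and direction reduce to `continuation_right` by reversing
  -- the source, the target, both or neither.
  rcases lt_or_gt_of_ne h.sign_ne_zero with hσ | hσ <;> rcases lt_or_gt_of_ne hxt with hxt | hxt
  · have hyt' : ρ t < y := by
      refine lt_of_le_of_ne ?_ hyt.symm
      by_contra hlt
      push Not at hlt
      have : 0 < (x - t) * (y - ρ t) := mul_pos_of_neg_of_neg (by linarith) (by linarith)
      nlinarith
    have c := h.neg_left.continuation_right h₁.neg h₂ (by linarith) (t := -t) (x := -x) (y := y)
      (by simpa using ht) (by simpa using hx) hy (by linarith) (by simpa using hyt'.le)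
    rw [uIcc_of_le hyt'.le, uIcc_of_ge hxt.le]
    rcases c with ⟨c1, c2⟩ | ⟨x', c1, c2, c3, c4⟩
    · have hxV : x ∈ V := by simpa using c1
      exact Or.inl ⟨hxV, (h.strictAntiOn hσ hxV ht hxt).le, by simpa using c2⟩
    · exact Or.inr ⟨-x', c1, ⟨by linarith, by linarith⟩, c4⟩
  · have hyt' : y < ρ t := by
      refine lt_of_le_of_ne ?_ hyt
      by_contra hlt
      push Not at hlt
      have : 0 < (x - t) * (y - ρ t) := mul_pos (by linarith) (by linarith)
      nlinarith
    have c := h.neg_right.continuation_right h₁ h₂.neg (by linarith) (t := t) (x := x) (y := -y)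
      ht hx (by simpa using hy) hxt.le (by linarith)
    rw [uIcc_of_ge hyt'.le, uIcc_of_le hxt.le]
    rcases c with ⟨c1, c2⟩ | ⟨x', c1, c2, c3, c4⟩
    · exact Or.inl ⟨c1, by linarith, (h.strictAntiOn hσ ht c1 hxt).le⟩
    · exact Or.inr ⟨x', c1, ⟨by linarith, by linarith⟩, by linarith⟩
  · have hyt' : y < ρ t := by
      refine lt_of_le_of_ne ?_ hyt
      by_contra hlt
      push Not at hlt
      have : (x - t) * (y - ρ t) < 0 := mul_neg_of_neg_of_pos (by linarith) (by linarith)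
      nlinarith
    have c := h.neg_left.neg_right.continuation_right h₁.neg h₂.neg (by linarith) (t := -t)
      (x := -x) (y := -y) (by simpa using ht) (by simpa using hx) (by simpa using hy)
      (by linarith) (by simpa using hyt'.le)
    rw [uIcc_of_ge hyt'.le, uIcc_of_ge hxt.le]
    rcases c with ⟨c1, c2⟩ | ⟨x', c1, c2, c3, c4⟩
    · have hxV : x ∈ V := by simpa using c1
      exact Or.inl ⟨hxV, by simpa using c2, (h.strictMonoOn hσ hxV ht hxt).le⟩
    · exact Or.inr ⟨-x', c1, ⟨by linarith, by linarith⟩, by linarith⟩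
  · have hyt' : ρ t < y := by
      refine lt_of_le_of_ne ?_ hyt.symm
      by_contra hlt
      push Not at hlt
      have : (x - t) * (y - ρ t) < 0 := mul_neg_of_pos_of_neg (by linarith) (by linarith)
      nlinarith
    have c := h.continuation_right h₁ h₂ hσ (t := t) (x := x) (y := y)
      ht hx hy hxt.le hyt'.le
    rw [uIcc_of_le hyt'.le, uIcc_of_le hxt.le]
    rcases c with ⟨c1, c2⟩ | ⟨x', c1, c2, c3, c4⟩
    · exact Or.inl ⟨c1, (h.strictMonoOn hσ ht c1 hxt).le, c2⟩
    · exact Or.inr ⟨x', c1, ⟨by linarith, by linarith⟩, by linarith⟩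

end Extension

end AnalyticCurve

namespace AnalyticCurve

/-! ### Rigidity of germs under a sated action. -/

section ActedCurves

variable {E : Type*} [NormedAddCommGroup E] [NormedSpace ℝ E]
  {M : Type*} [TopologicalSpace M] [ChartedSpace E M]
  {G : Type*} [Group G] [MulAction G M]

variable (E G) in
/-- An analytic immersion of an open interval into a manifold with a sated analytic action. -/
structure ActedCurve (δ : ℝ → M) (U : Set ℝ) : Prop where
  curve : IsOpenCurve E δ U
  act : ∀ g : G, ContMDiff 𝓘(ℝ, E) 𝓘(ℝ, E) ω (fun x : M => g • x)
  sated : IsSated G M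

/-- `g • δ = δ ∘ ρ` near `t` for an analytic `ρ` with `ρ t = s` whose derivative has the sign
of `σ`. -/
abbrev GGerm (δ : ℝ → M) (U : Set ℝ) (σ : ℝ) (g : G) (t s : ℝ) : Prop :=
  Germ σ (fun u => g • δ u) U δ U t s

abbrev GTransition (δ : ℝ → M) (U : Set ℝ) (σ : ℝ) (g : G) (ρ : ℝ → ℝ) (V : Set ℝ) : Prop :=
  Transition σ (fun u => g • δ u) U δ U ρ V

abbrev GMaxTransition (δ : ℝ → M) (U : Set ℝ) (σ : ℝ) (g : G) (ρ : ℝ → ℝ) (V : Set ℝ) : Prop :=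
  MaxTransition σ (fun u => g • δ u) U δ U ρ V

variable (G) in
/-- Germs inside `A` come from the stabilizer of the curve only. -/
def IsFree (δ : ℝ → M) (U A : Set ℝ) : Prop :=
  ∀ (σ : ℝ) (g : G) (t s : ℝ), t ∈ interior A → s ∈ interior A → GGerm δ U σ g t s →
    g ∈ curveStab G δ U

variable {δ γ : ℝ → M} {U A V V' : Set ℝ} {σ σ' : ℝ} {g g' : G} {t s r : ℝ} {ρ ρ' : ℝ → ℝ}

theorem mem_curveStab : g ∈ curveStab G γ A ↔ ∀ t ∈ A, g • γ t = γ t := by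
  rw [curveStab, mem_fixingSubgroup_iff]
  simp

theorem cls_eq_iff : cls γ A g = cls γ A g' ↔ g⁻¹ * g' ∈ curveStab G γ A :=
  QuotientGroup.eq

theorem cls_ne_one_iff : cls γ A g ≠ cls γ A 1 ↔ g ∉ curveStab G γ A := by
  rw [Ne, cls_eq_iff, mul_one, inv_mem_iff]

theorem GGerm.inv (h : GGerm δ U σ g t s) : GGerm δ U σ g⁻¹ s t := by
  obtain ⟨h1, h2, ρ, h3, h4, h5, h6⟩ := Germ.inv h
  refine ⟨h1, h2, ρ, h3, h4, h5, h6.mono fun u hu => ?_⟩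
  simp only at hu ⊢
  rw [hu, inv_smul_smul]

theorem GGerm.comp (h : GGerm δ U σ g t s) (h' : GGerm δ U σ' g' s r) :
    GGerm δ U (σ * σ') (g' * g) t r := by
  obtain ⟨h1, h2, ρ, h3, h4, h5, h6⟩ := h
  have hc : Germ σ (fun u => (g' * g) • δ u) U (fun u => g' • δ u) U t s :=
    ⟨h1, h2, ρ, h3, h4, h5, h6.mono fun u hu => by simp only at hu ⊢; rw [mul_smul, hu]⟩
  exact hc.comp h'

theorem GGerm.of_mem_stab (hU : t ∈ U) (h : IsOpen U) (hg : g ∈ curveStab G δ U) :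
    GGerm δ U 1 g t t :=
  ⟨hU, hU, id, analyticAt_id, by simp, rfl, mem_of_superset (h.mem_nhds hU)
    fun u hu => mem_curveStab.1 hg u hu⟩

theorem gTransition_id (hU : IsOpenInterval U) (hg : g ∈ curveStab G δ U) :
    GTransition δ U 1 g id U :=
  ⟨hU, subset_rfl, fun _ h => h, fun _ _ => analyticAt_id, by simp,
    fun t ht => mem_curveStab.1 hg t ht⟩

theorem gMaxTransition_id (hU : IsOpenInterval U) (hg : g ∈ curveStab G δ U) :
    GMaxTransition δ U 1 g id U :=
  ⟨gTransition_id hU hg, fun _ _ h _ => h.sub⟩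

theorem curveStab_smul_eqOn (h : g⁻¹ * g' ∈ curveStab G δ U) :
    EqOn (fun u => g' • δ u) (fun u => g • δ u) U := by
  intro u hu
  have := mem_curveStab.1 h u hu
  rw [mul_smul, inv_smul_eq_iff] at this
  exact this

variable [IsManifold 𝓘(ℝ, E) ω M]

theorem ActedCurve.smul (h : ActedCurve E G δ U) (g : G) :
    IsOpenCurve E (fun t => g • δ t) U := by
  refine ⟨h.curve.dom, (h.act g).comp_contMDiffOn h.curve.smooth, fun t ht => ?_⟩
  have hs : ContMDiffAt 𝓘(ℝ, ℝ) 𝓘(ℝ, E) ω (fun t => g • δ t) t :=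
    ((h.act g).contMDiffAt).comp t (h.curve.contMDiffAt ht)
  have hm := mfderiv_comp t (g := fun x : M => g⁻¹ • x) (f := fun u => g • δ u) (I := 𝓘(ℝ, ℝ))
    (I' := 𝓘(ℝ, E)) (I'' := 𝓘(ℝ, E)) ((h.act g⁻¹).contMDiffAt.mdifferentiableAt (by simp))
    (hs.mdifferentiableAt (by simp))
  have he : (fun x : M => g⁻¹ • x) ∘ (fun u => g • δ u) = δ := by
    funext u
    simp
  rw [he] at hm
  have := h.curve.inj t ht
  rw [hm] at this
  exact Function.Injective.of_comp (f := mfderiv 𝓘(ℝ, E) 𝓘(ℝ, E) (fun x : M => g⁻¹ • x) (g • δ t))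
    this

theorem ActedCurve.exists_max (h : ActedCurve E G δ U) (hg : GGerm δ U σ g t s) :
    ∃ ρ V, GMaxTransition δ U σ g ρ V ∧ t ∈ V ∧ ρ t = s :=
  Germ.exists_max h.curve.dom h.curve hg

theorem ActedCurve.exists_transition (h : ActedCurve E G δ U) (hg : GGerm δ U σ g t s)
    {W : Set ℝ} (hW : W ∈ 𝓝 t) :
    ∃ ρ V, GTransition δ U σ g ρ V ∧ t ∈ V ∧ V ⊆ W ∧ ρ t = s :=
  Germ.exists_transition h.curve.dom h.curve.dom hg hW

/-- Points of `(t, c]` cannot all be contracted towards `t` by one group element. -/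
theorem ActedCurve.not_contracting (h : ActedCurve E G δ U) {c : ℝ} (htc : t < c)
    (htU : t ∈ U) (hinj : InjOn δ (Icc t c)) {f : ℝ → ℝ} {k : G}
    (hf : ∀ v ∈ Ioc t c, f v ∈ Ioo t v) (hk : ∀ v ∈ Ioc t c, k • δ v = δ (f v))
    (hlim : ∀ ℓ ∈ Ioc t c, ∀ v : ℕ → ℝ, (∀ n, v n ∈ Ioc t c) → Tendsto v atTop (𝓝 ℓ) →
      Tendsto (fun n => f (v n)) atTop (𝓝 ℓ) → False) : False := by
  -- No continuity of `f` is assumed: `hlim` replaces continuity and the absence of fixed points in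
  -- `(t, c]`, so the decreasing iterates of `f` can only converge to `t`.
  have key : ∀ x ∈ Ioc t c, Tendsto (fun n => k ^ n • δ x) atTop (𝓝 (δ t)) := by
    intro x hx
    have hmem : ∀ n, f^[n] x ∈ Ioc t c := by
      intro n
      induction n with
      | zero => exact hx
      | succ n ih =>
        rw [Function.iterate_succ_apply']
        exact ⟨(hf _ ih).1, (hf _ ih).2.le.trans ih.2⟩
    have hanti : Antitone fun n => f^[n] x := by
      refine antitone_nat_of_succ_le fun n => ?_
      rw [Function.iterate_succ_apply']
      exact (hf _ (hmem n)).2.le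
    have hbdd : BddBelow (range fun n => f^[n] x) := ⟨t, by rintro _ ⟨n, rfl⟩; exact (hmem n).1.le⟩
    have hlimx := tendsto_atTop_ciInf hanti hbdd
    set ℓ := ⨅ n, f^[n] x
    have hℓt : t ≤ ℓ := le_ciInf fun n => (hmem n).1.le
    have hℓc : ℓ ≤ c := (ciInf_le hbdd 0).trans hx.2
    have hℓ : ℓ = t := by
      by_contra hne
      refine hlim ℓ ⟨lt_of_le_of_ne hℓt (Ne.symm hne), hℓc⟩ _ hmem hlimx ?_
      have := (tendsto_add_atTop_iff_nat 1).2 hlimx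
      simpa only [Function.iterate_succ_apply'] using this
    rw [hℓ] at hlimx
    have hkn : ∀ n, k ^ n • δ x = δ (f^[n] x) := by
      intro n
      induction n with
      | zero => simp
      | succ n ih => rw [pow_succ', mul_smul, ih, hk _ (hmem n), Function.iterate_succ_apply']
    simp only [hkn]
    exact (h.curve.continuousAt htU).tendsto.comp hlimx
  have hm : (t + c) / 2 ∈ Ioc t c := ⟨by linarith, by linarith⟩
  have hc : c ∈ Ioc t c := ⟨htc, le_rfl⟩
  have ht' : t ∈ Icc t c := ⟨le_rfl, htc.le⟩
  refine h.sated (δ t) (δ c) (δ ((t + c) / 2)) (fun e => ?_) (fun e => ?_) (fun e => ?_)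
    ⟨fun n => k ^ n, key c hc, key _ hm⟩
  · have := hinj (Ioc_subset_Icc_self hc) ht' e
    linarith
  · have := hinj (Ioc_subset_Icc_self hm) ht' e
    linarith
  · have := hinj (Ioc_subset_Icc_self hc) (Ioc_subset_Icc_self hm) e
    linarith

variable [CompleteSpace E] [T2Space M]

theorem ActedCurve.mem_stab_of_frequently (h : ActedCurve E G δ U) (ht : t ∈ U)
    (hf : ∃ᶠ u in 𝓝[≠] t, g • δ u = δ u) : g ∈ curveStab G δ U :=
  mem_curveStab.2 (eqOn_of_eventuallyEq h.curve.dom.1 h.curve.dom.2.1.isPreconnected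
    (h.smul g).smooth h.curve.smooth ht hf)

/-- An orientation preserving germ with a fixed point comes from the stabilizer. -/
theorem ActedCurve.mem_stab_of_fixed (h : ActedCurve E G δ U) (hg : GGerm δ U σ g t t)
    (hσ : 0 < σ) : g ∈ curveStab G δ U := by
  obtain ⟨W, hW, hinj⟩ := exists_injOn_nhds h.curve hg.1
  obtain ⟨ρ, V, hρ, htV, hVW, hρt⟩ := h.exists_transition hg hW
  -- Fixed points accumulating at `t` give `g • δ = δ` by the identity theorem. Without them, `ρ u -
  -- u` keeps its sign on some `(t, c]`, and `g` or `g⁻¹` contracts this interval towards `t`.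
  by_cases hfr : ∃ᶠ u in 𝓝[≠] t, ρ u = u
  · refine h.mem_stab_of_frequently hg.1 ((hfr.and_eventually
      (nhdsWithin_le_nhds (hρ.dom.1.mem_nhds htV))).mono fun u hu => ?_)
    have := hρ.eq u hu.2
    rwa [hu.1] at this
  exfalso
  rw [not_frequently] at hfr
  have hfr' : ∀ᶠ u in 𝓝[>] t, ρ u ≠ u ∧ u ∈ V :=
    (hfr.filter_mono (nhdsWithin_mono _ fun u hu => ne_of_gt hu)).and
      (nhdsWithin_le_nhds (hρ.dom.1.mem_nhds htV))
  obtain ⟨c, hc, hcs⟩ := mem_nhdsGT_iff_exists_Ioc_subset.1 hfr'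
  have hc : t < c := hc
  have hIV : Icc t c ⊆ V := hρ.dom.2.1.out htV (hcs ⟨hc, le_rfl⟩).2
  have hmono := hρ.strictMonoOn hσ
  have hne : ∀ u ∈ Ioc t c, ρ u ≠ u := fun u hu => (hcs hu).1
  have hgt : ∀ u ∈ Ioc t c, t < ρ u := by
    intro u hu
    have := hmono htV (hIV (Ioc_subset_Icc_self hu)) hu.1
    rwa [hρt] at this
  have hcont : ∀ ℓ ∈ Ioc t c, ContinuousAt ρ ℓ :=
    fun ℓ hℓ => hρ.continuousAt (hIV (Ioc_subset_Icc_self hℓ))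
  have hsame : ∀ u ∈ Ioc t c, ∀ v ∈ Ioc t c, ρ u < u → v < ρ v → False := by
    intro u hu v hv h1 h2
    have hsub : uIcc u v ⊆ Ioc t c := ordConnected_Ioc.uIcc_subset hu hv
    obtain ⟨w, hw, hw0⟩ := intermediate_value_uIcc (a := u) (b := v) (f := fun x => ρ x - x)
      ((hρ.continuousOn.mono (hsub.trans (Ioc_subset_Icc_self.trans hIV))).sub continuousOn_id)
      (show (0 : ℝ) ∈ _ from mem_uIcc.2 (Or.inl ⟨by linarith, by linarith⟩))
    exact hne w (hsub hw) (by simpa [sub_eq_zero] using hw0)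
  rcases lt_or_gt_of_ne (hne c ⟨hc, le_rfl⟩) with hlt | hlt
  · have hf : ∀ v ∈ Ioc t c, ρ v ∈ Ioo t v := fun v hv =>
      ⟨hgt v hv, lt_of_le_of_ne (not_lt.1 fun h' => hsame c ⟨hc, le_rfl⟩ v hv hlt h') (hne v hv)⟩
    refine h.not_contracting hc hg.1 (hinj.mono (hIV.trans hVW)) hf
      (fun v hv => hρ.eq v (hIV (Ioc_subset_Icc_self hv))) fun ℓ hℓ v _ h1 h2 => ?_
    exact hne ℓ hℓ (tendsto_nhds_unique ((hcont ℓ hℓ).tendsto.comp h1) h2)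
  -- In the expanding case the inverse branch of `ρ`, realised by `g⁻¹`, is the contraction.
  · have hex : ∀ v ∈ Ioc t c, ∃ u, u ∈ Ioo t v ∧ ρ u = v := by
      intro v hv
      have hv' : v < ρ v :=
        lt_of_le_of_ne (not_lt.1 fun h' => hsame v hv c ⟨hc, le_rfl⟩ h' hlt) (hne v hv).symm
      obtain ⟨u, hu, huv⟩ := intermediate_value_Ioo hv.1.le
        (hρ.continuousOn.mono ((Icc_subset_Icc_right hv.2).trans hIV))
        (show v ∈ Ioo (ρ t) (ρ v) from ⟨by rw [hρt]; exact hv.1, hv'⟩)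
      exact ⟨u, hu, huv⟩
    choose! f hf hf' using hex
    refine h.not_contracting (k := g⁻¹) hc hg.1 (hinj.mono (hIV.trans hVW)) hf (fun v hv => ?_)
      fun ℓ hℓ v hv h1 h2 => ?_
    · have h1 : g • δ (f v) = δ (ρ (f v)) :=
        hρ.eq (f v) (hIV ⟨(hf v hv).1.le, (hf v hv).2.le.trans hv.2⟩)
      rw [hf' v hv] at h1
      rw [← h1, inv_smul_smul]
    · refine hne ℓ hℓ (tendsto_nhds_unique ((hcont ℓ hℓ).tendsto.comp h2) ?_)
      refine h1.congr fun n => ?_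
      exact (hf' (v n) (hv n)).symm

/-- The second germ followed by the inverse of the first fixes `t` and preserves orientation. -/
theorem ActedCurve.stab_of_germs (h : ActedCurve E G δ U) (h₁ : GGerm δ U σ g t s)
    (h₂ : GGerm δ U σ' g' t s) (hσ : 0 < σ * σ') : g⁻¹ * g' ∈ curveStab G δ U := by
  exact h.mem_stab_of_fixed (h₂.comp h₁.inv) (by linarith)

theorem ActedCurve.eqOn_of_stab (h : ActedCurve E G δ U) (h₁ : GTransition δ U σ g ρ V)
    (h₂ : GTransition δ U σ' g' ρ' V') (hg : g⁻¹ * g' ∈ curveStab G δ U) (ht : t ∈ V)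
    (ht' : t ∈ V') (he : ρ t = ρ' t) : EqOn ρ ρ' (V ∩ V') :=
  h₁.eqOn h.curve (h₂.congr_left (curveStab_smul_eqOn hg).symm) ht ht' he

/-- Two maximal transitions of the same orientation that agree at one point are equal. -/
theorem ActedCurve.max_unique (h : ActedCurve E G δ U) (h₁ : GMaxTransition δ U σ g ρ V)
    (h₂ : GMaxTransition δ U σ' g' ρ' V') (hσ : 0 < σ * σ') (ht : t ∈ V) (ht' : t ∈ V')
    (he : ρ t = ρ' t) : g⁻¹ * g' ∈ curveStab G δ U ∧ V = V' ∧ EqOn ρ ρ' V := by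
  have hg := h.stab_of_germs (h₁.germ ht) (he ▸ h₂.germ ht') hσ
  have e := h₂.congr_left (curveStab_smul_eqOn hg).symm
  have e1 := e.of_sign (σ' := σ) (by linarith)
  have hV : V = V' := (e1.max _ _ h₁.toTransition ⟨t, ht', ht, he.symm⟩).antisymm
    (h₁.max _ _ e1.toTransition ⟨t, ht, ht', he⟩)
  refine ⟨hg, hV, ?_⟩
  have := h.eqOn_of_stab h₁.toTransition h₂.toTransition hg ht ht' he
  rwa [← hV, inter_self] at this

/-- An element of the stabilizer also induces the identity transition. By uniqueness through `(t,
t)` the germ would be the identity, whose derivative is 1. -/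
theorem ActedCurve.not_mem_stab_of_neg (h : ActedCurve E G δ U) (hg : GGerm δ U σ g t t)
    (hσ : σ < 0) : g ∉ curveStab G δ U := by
  intro hgs
  obtain ⟨ρ, V, hρ, htV, -, hρt⟩ := h.exists_transition hg univ_mem
  have := hρ.eqOn h.curve (gTransition_id h.curve.dom hgs) htV hg.1 hρt
  have hd : deriv ρ t = 1 := by
    rw [(this.eventuallyEq_of_mem ((hρ.dom.1.inter h.curve.dom.1).mem_nhds
      ⟨htV, hg.1⟩)).deriv_eq, deriv_id]
  have := hρ.der t htV
  rw [hd] at this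
  linarith

/-- A change of sign of `ρ x - x` would give a fixed point, hence a stabilizing `g` and `ρ = id` on
all of `V`. -/
theorem ActedCurve.lt_of_lt (h : ActedCurve E G δ U) (hρ : GTransition δ U σ g ρ V) (hσ : 0 < σ)
    (ht : t ∈ V) (hlt : t < ρ t) : ∀ x ∈ V, x < ρ x := by
  intro x hx
  by_contra hge
  push Not at hge
  have hsub : uIcc x t ⊆ V := hρ.dom.2.1.uIcc_subset hx ht
  obtain ⟨z, hz, hz0⟩ := intermediate_value_uIcc (a := x) (b := t) (f := fun x => ρ x - x)
    ((hρ.continuousOn.mono hsub).sub continuousOn_id)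
    (show (0 : ℝ) ∈ _ from mem_uIcc.2 (Or.inl ⟨by linarith, by linarith⟩))
  have hz0 : ρ z = z := by simpa [sub_eq_zero] using hz0
  have hzV := hsub hz
  have hgz := hρ.germ hzV
  rw [hz0] at hgz
  have hst := h.mem_stab_of_fixed hgz hσ
  have := hρ.eqOn h.curve (gTransition_id h.curve.dom hst) hzV (hρ.sub hzV) hz0 ⟨ht, hρ.sub ht⟩
  simp only [id] at this
  linarith

/-- An orientation reversing germ has a fixed point between its source and its target. -/
theorem ActedCurve.exists_fixed (h : ActedCurve E G δ U) (hg : GGerm δ U σ g t s) (hσ : σ < 0) :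
    ∃ τ ∈ uIcc t s, GGerm δ U σ g τ τ := by
  have main : ∀ {t s : ℝ} {g : G}, t ≤ s → GGerm δ U σ g t s →
      ∃ τ ∈ Icc t s, GGerm δ U σ g τ τ := by
    intro t s g hts hg
    obtain ⟨ρ, V, hρ, htV, hρt⟩ := h.exists_max hg
    have fin : ∀ x ∈ V, t ≤ x → x ≤ s → ρ x ≤ x → ∃ τ ∈ Icc t s, GGerm δ U σ g τ τ := by
      intro x hx htx hxs hle
      have hsub : Icc t x ⊆ V := hρ.dom.2.1.out htV hx
      obtain ⟨z, hz, hz0⟩ := intermediate_value_Icc' (a := t) (b := x) (f := fun x => ρ x - x)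
        htx ((hρ.continuousOn.mono hsub).sub continuousOn_id)
        (show (0 : ℝ) ∈ _ from ⟨by simpa using hle, by simp [hρt, hts]⟩)
      have hz0 : ρ z = z := by simpa [sub_eq_zero] using hz0
      have hgz := hρ.germ (hsub hz)
      rw [hz0] at hgz
      exact ⟨z, ⟨hz.1, hz.2.trans hxs⟩, hgz⟩
    -- The rectangle has the opposite corners `(t, s)` and `(s, t)`. Both exits lie on or below the
    -- diagonal while the start lies on or above it, so the graph meets the diagonal.
    rcases hρ.continuation (h.smul g) h.curve htV hg.2.1 hg.1 (x := s) (y := t)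
      (by rw [hρt]; nlinarith [mul_nonneg (sub_nonneg.2 hts) (sub_nonneg.2 hts)]) with
      ⟨h1, h2⟩ | ⟨x', h1, h2, h3⟩
    · refine fin s h1 hts le_rfl ?_
      rw [hρt, uIcc_of_ge hts] at h2
      exact h2.2
    · rw [uIcc_of_le hts] at h2
      exact fin x' h1 h2.1 h2.2 (h3 ▸ h2.1)
  rcases le_total t s with hts | hts
  · rw [uIcc_of_le hts]
    exact main hts hg
  · rw [uIcc_of_ge hts]
    obtain ⟨τ, h1, h2⟩ := main hts hg.inv
    exact ⟨τ, h1, by simpa using h2.inv⟩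

end ActedCurves

end AnalyticCurve

namespace AnalyticCurve

/-! ### Elementary facts about intervals and their interiors. -/

section Intervals

variable {A B D V : Set ℝ} {t p q : ℝ}

theorem mem_interior_of_between (hA : A.OrdConnected) (hp : p ∈ A) (hq : q ∈ A) (hpt : p < t)
    (htq : t < q) : t ∈ interior A :=
  mem_interior.2 ⟨Ioo p q, Ioo_subset_Icc_self.trans (hA.out hp hq), isOpen_Ioo, hpt, htq⟩

theorem exists_gt_mem_of_mem_interior (h : t ∈ interior A) : ∃ q ∈ A, t < q := by
  have h0 : ∀ᶠ q in 𝓝[>] t, q ∈ A := nhdsWithin_le_nhds (mem_interior_iff_mem_nhds.1 h)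
  obtain ⟨q, h1, h2⟩ := (h0.and self_mem_nhdsWithin).exists
  exact ⟨q, h1, h2⟩

theorem exists_lt_mem_of_mem_interior (h : t ∈ interior A) : ∃ q ∈ A, q < t := by
  have h0 : ∀ᶠ q in 𝓝[<] t, q ∈ A := nhdsWithin_le_nhds (mem_interior_iff_mem_nhds.1 h)
  obtain ⟨q, h1, h2⟩ := (h0.and self_mem_nhdsWithin).exists
  exact ⟨q, h1, h2⟩

theorem exists_isOpenInterval_of_mem_nhds (h : A ∈ 𝓝 t) : ∃ J, IsOpenInterval J ∧ t ∈ J ∧ J ⊆ A := by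
  obtain ⟨l, u, h1, h2⟩ := mem_nhds_iff_exists_Ioo_subset.1 h
  exact ⟨Ioo l u, ⟨isOpen_Ioo, ordConnected_Ioo, t, h1⟩, h1, h2⟩

theorem IsOpenInterval.isInterval (h : IsOpenInterval A) : IsInterval A :=
  ⟨h.2.1, by rw [h.1.interior_eq]; exact h.2.2⟩

theorem isInterval_Icc (h : p < q) : IsInterval (Icc p q) :=
  ⟨ordConnected_Icc, by rw [interior_Icc]; exact nonempty_Ioo.2 h⟩

theorem IsInterval.interior_interval (h : IsInterval A) : IsInterval (interior A) :=
  ⟨(h.1.convex (𝕜 := ℝ)).interior.ordConnected, by rw [interior_interior]; exact h.2⟩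

theorem IsInterval.subset_closure_interior (h : IsInterval A) : A ⊆ closure (interior A) := by
  rw [(h.1.convex (𝕜 := ℝ)).closure_interior_eq_closure_of_nonempty_interior h.2]
  exact subset_closure

open scoped Pointwise

theorem interior_neg_eq (A : Set ℝ) : interior (-A) = -interior A :=
  ((Homeomorph.neg ℝ).preimage_interior A).symm

theorem IsInterval.neg (h : IsInterval A) : IsInterval (-A) :=
  ⟨h.1.preimage_anti fun _ _ => neg_le_neg, by rw [interior_neg_eq]; exact h.2.neg⟩

end Intervals

/-! ### Free segments in terms of germs, and maximal free intervals. -/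

section FreeSegments

variable {E : Type*} [NormedAddCommGroup E] [NormedSpace ℝ E] [CompleteSpace E]
  {M : Type*} [TopologicalSpace M] [ChartedSpace E M] [IsManifold 𝓘(ℝ, E) ω M] [T2Space M]
  {G : Type*} [Group G] [MulAction G M]
  {δ γ : ℝ → M} {U A B D V V' : Set ℝ} {σ σ' : ℝ} {g g' : G} {t s r : ℝ} {ρ ρ' : ℝ → ℝ}

theorem EmbedsOn.congr {J : Set ℝ} (h : EmbedsOn δ J) (he : EqOn γ δ J) : EmbedsOn γ J := by
  have : (fun t : J => γ t) = fun t : J => δ t := funext fun t => he t.2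
  rw [EmbedsOn, this]
  exact h

/-- A germ restricts to an overlap on a small interval where both curves embed. Conversely,
embedding makes the point correspondence of an overlap continuous, and a continuous correspondence
is analytic by `exists_analytic_continuation`. -/
theorem ActedCurve.isFreeSegment_iff (h : ActedCurve E G δ U) (hAU : A ⊆ U)
    (he : EqOn γ δ A) : IsFreeSegment G γ A ↔ IsFree G δ U A := by
  constructor
  · intro hf σ g t s ht hs hg
    have htA := interior_subset ht
    obtain ⟨W₁, hW₁, hW₁'⟩ := exists_embedsOn (h.smul g) hg.1
    obtain ⟨W₂, hW₂, hW₂'⟩ := exists_embedsOn h.curve hg.2.1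
    obtain ⟨ρ, V, hρ, htV, hVW, hρt⟩ := h.exists_transition hg
      (inter_mem hW₁ (mem_interior_iff_mem_nhds.1 ht))
    obtain ⟨J, hJ, htJ, hJV⟩ := exists_isOpenInterval_of_mem_nhds
      (inter_mem (hρ.dom.1.mem_nhds htV) ((hρ.continuousAt htV).preimage_mem_nhds
        (hρt.symm ▸ inter_mem hW₂ (mem_interior_iff_mem_nhds.1 hs))))
    have hJ1 : J ⊆ V := fun u hu => (hJV hu).1
    have hJA : J ⊆ A := fun u hu => (hVW (hJ1 hu)).2
    have hρA : ρ '' J ⊆ A := by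
      rintro _ ⟨u, hu, rfl⟩
      exact (hJV hu).2.2
    have hov : Overlap (fun t => g • γ t) A γ A := by
      refine ⟨J, ρ '' J, hJ, ⟨hρ.isOpen_image hJ.1 hJ1, ?_, hJ.2.2.image _⟩, hJA, hρA, ?_, ?_, ?_⟩
      · exact (hJ.2.1.isPreconnected.image _ (hρ.continuousOn.mono hJ1)).ordConnected
      · exact (hW₁' J fun u hu => (hVW (hJ1 hu)).1).congr fun u hu => by simp only [he (hJA hu)]
      · refine (hW₂' (ρ '' J) ?_).congr (he.mono hρA)
        rintro _ ⟨u, hu, rfl⟩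
        exact (hJV hu).2.1
      · rw [image_image]
        refine image_congr fun u hu => ?_
        rw [he (hJA hu), he (hρA (mem_image_of_mem _ hu))]
        exact hρ.eq u (hJ1 hu)
    refine h.mem_stab_of_frequently hg.1 (Eventually.frequently (nhdsWithin_le_nhds ?_))
    filter_upwards [mem_interior_iff_mem_nhds.1 ht] with u hu
    have := hf g hov u hu
    rwa [he hu] at this
  · rintro hf g ⟨J, J', hJ, hJ', hJA, hJA', e, e', heq⟩
    have hex : ∀ u ∈ J, ∃ v ∈ J', γ v = g • γ u := fun u hu => by
      have : g • γ u ∈ γ '' J' := heq ▸ mem_image_of_mem (fun t => g • γ t) hu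
      exact this
    choose! ρ hρ hρ' using hex
    obtain ⟨t, ht⟩ := hJ.2.2
    have hc : ContinuousAt ρ t := by
      have h1 : Continuous (fun u : J => (⟨ρ u, hρ u u.2⟩ : J')) := by
        rw [e'.isInducing.continuous_iff]
        have : (fun t : J' => γ t) ∘ (fun u : J => (⟨ρ u, hρ u u.2⟩ : J')) =
            fun u : J => g • γ u := funext fun u => hρ' u u.2
        rw [this]
        exact e.continuous
      have h2 : ContinuousOn ρ J := by
        rw [continuousOn_iff_continuous_domRestrict]
        exact continuous_subtype_val.comp h1
      exact h2.continuousAt (hJ.1.mem_nhds ht)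
    obtain ⟨κ, k1, k2, k3, k4, -⟩ := exists_analytic_continuation (h.smul g) h.curve
      (hAU (hJA ht)) (hAU (hJA' (hρ t ht))) (l := 𝓝[≠] t) le_rfl
      (hc.tendsto.mono_left nhdsWithin_le_nhds) (nhdsWithin_le_nhds (by
        filter_upwards [hJ.1.mem_nhds ht] with u hu
        rw [← he (hJA hu), ← he (hJA' (hρ u hu)), hρ' u hu]))
    have hst := hf (deriv κ t) g t (ρ t) (interior_maximal hJA hJ.1 ht)
      (interior_maximal hJA' hJ'.1 (hρ t ht))
      ⟨hAU (hJA ht), hAU (hJA' (hρ t ht)), κ, k1, mul_self_pos.2 k3, k2, k4⟩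
    intro u hu
    rw [he hu]
    exact mem_curveStab.1 hst u (hAU hu)

/-- By the identity theorem an element fixing the curve on some interval fixes all of it, so the
classes `[g]` do not depend on the interval. -/
theorem ActedCurve.curveStab_eq (h : ActedCurve E G δ U) (hA : IsInterval A) (hAU : A ⊆ U)
    (he : EqOn γ δ A) : curveStab G γ A = curveStab G δ U := by
  ext g
  constructor
  · intro hg
    obtain ⟨t, ht⟩ := hA.2
    refine h.mem_stab_of_frequently (hAU (interior_subset ht))
      (Eventually.frequently (nhdsWithin_le_nhds ?_))
    filter_upwards [mem_interior_iff_mem_nhds.1 ht] with u hu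
    have := mem_curveStab.1 hg u hu
    rwa [he hu] at this
  · intro hg
    refine mem_curveStab.2 fun u hu => ?_
    rw [he hu]
    exact mem_curveStab.1 hg u (hAU hu)

theorem IsFree.mono (hA : IsFree G δ U A) (hB : interior B ⊆ interior A) : IsFree G δ U B :=
  fun σ g t s ht hs hg => hA σ g t s (hB ht) (hB hs) hg

/-- A germ persists at nearby points, and only finitely many of these have source or target `c`.
When intervals are glued at `c`, the gluing point can thus be ignored. -/
theorem ActedCurve.isFree_of_avoid (h : ActedCurve E G δ U) (c : ℝ)
    (hA : ∀ (σ : ℝ) (g : G) (t s : ℝ), t ∈ interior A → s ∈ interior A → t ≠ c → s ≠ c →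
      GGerm δ U σ g t s → g ∈ curveStab G δ U) : IsFree G δ U A := by
  intro σ g t s ht hs hg
  obtain ⟨ρ, V, hρ, htV, hVA, hρt⟩ := h.exists_transition hg (isOpen_interior.mem_nhds ht)
  have hO : V ∩ ρ ⁻¹' interior A ∈ 𝓝 t := inter_mem (hρ.dom.1.mem_nhds htV)
    ((hρ.continuousAt htV).preimage_mem_nhds (hρt.symm ▸ isOpen_interior.mem_nhds hs))
  have hinf : (V ∩ ρ ⁻¹' interior A).Infinite := infinite_of_mem_nhds t hO
  have hfin : (({c} : Set ℝ) ∪ (V ∩ ρ ⁻¹' {c})).Finite := by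
    refine (finite_singleton c).union (Set.Subsingleton.finite ?_)
    intro u hu v hv
    exact hρ.injOn hu.1 hv.1 (hu.2.trans hv.2.symm)
  obtain ⟨u, hu, hu'⟩ := (hinf.sdiff hfin).nonempty
  simp only [mem_union, mem_singleton_iff, mem_inter_iff, mem_preimage, not_or, not_and] at hu'
  exact hA σ g u (ρ u) (hVA hu.1) hu.2 hu'.1 (hu'.2 hu.1) (hρ.germ hu.1)

/-- Conjugating a germ by germs of the neutral element leaves its group element unchanged. -/
theorem isFree_of_transport (hA : IsFree G δ U A)
    (hB : ∀ p ∈ interior B, ∃ p' ∈ interior A, GGerm δ U 1 (1 : G) p p') : IsFree G δ U B := by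
  intro σ g t s ht hs hg
  obtain ⟨t', ht', h1⟩ := hB t ht
  obtain ⟨s', hs', h2⟩ := hB s hs
  have := hA _ _ t' s' ht' hs' ((h1.inv.comp hg).comp h2)
  simpa using this

variable (G) in
/-- `A ⊆ D` is a free interval that is not contained in a larger one. -/
structure IsMaxFree (δ : ℝ → M) (U D A : Set ℝ) : Prop where
  interval : IsInterval A
  sub : A ⊆ D
  free : IsFree G δ U A
  max : ∀ A', IsInterval A' → A' ⊆ D → A ⊆ A' → IsFree G δ U A' → A' ⊆ A

/-- Zorn's lemma applies because two interior points of the union of a chain are both interior to a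
single member. -/
theorem exists_isMaxFree (hA : IsInterval A) (hAD : A ⊆ D) (hf : IsFree G δ U A) :
    ∃ A', A ⊆ A' ∧ IsMaxFree G δ U D A' := by
  have hz : ∀ c ⊆ {B : Set ℝ | IsInterval B ∧ B ⊆ D ∧ IsFree G δ U B}, IsChain (· ⊆ ·) c →
      c.Nonempty → ∃ ub ∈ {B : Set ℝ | IsInterval B ∧ B ⊆ D ∧ IsFree G δ U B}, ∀ s ∈ c, s ⊆ ub := by
    intro c hc hch hne
    have hdir : ∀ x ∈ ⋃₀ c, ∀ y ∈ ⋃₀ c, ∃ B ∈ c, x ∈ B ∧ y ∈ B := by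
      rintro x ⟨B₁, h1, hx⟩ y ⟨B₂, h2, hy⟩
      rcases hch.total h1 h2 with h | h
      · exact ⟨B₂, h2, h hx, hy⟩
      · exact ⟨B₁, h1, hx, h hy⟩
    have hord : (⋃₀ c).OrdConnected := by
      refine ⟨fun x hx y hy z hz => ?_⟩
      obtain ⟨B, hB, hxB, hyB⟩ := hdir x hx y hy
      exact ⟨B, hB, (hc hB).1.1.out hxB hyB hz⟩
    have hin : ∀ t ∈ interior (⋃₀ c), ∃ p ∈ ⋃₀ c, ∃ q ∈ ⋃₀ c, p < t ∧ t < q := by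
      intro t ht
      obtain ⟨p, hp, hpt⟩ := exists_lt_mem_of_mem_interior ht
      obtain ⟨q, hq, hqt⟩ := exists_gt_mem_of_mem_interior ht
      exact ⟨p, hp, q, hq, hpt, hqt⟩
    have hin' : ∀ t ∈ interior (⋃₀ c), ∃ B ∈ c, t ∈ interior B := by
      intro t ht
      obtain ⟨p, hp, q, hq, hpt, hqt⟩ := hin t ht
      obtain ⟨B, hB, hpB, hqB⟩ := hdir p hp q hq
      exact ⟨B, hB, mem_interior_of_between (hc hB).1.1 hpB hqB hpt hqt⟩
    refine ⟨⋃₀ c, ⟨⟨hord, ?_⟩, sUnion_subset fun B hB => (hc hB).2.1, ?_⟩,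
      fun B hB => subset_sUnion_of_mem hB⟩
    · obtain ⟨B, hB⟩ := hne
      exact (hc hB).1.2.mono (interior_mono (subset_sUnion_of_mem hB))
    · intro σ g t s ht hs hg
      obtain ⟨B₁, h1, hx⟩ := hin' t ht
      obtain ⟨B₂, h2, hy⟩ := hin' s hs
      rcases hch.total h1 h2 with h | h
      · exact (hc h2).2.2 σ g t s (interior_mono h hx) hy hg
      · exact (hc h1).2.2 σ g t s hx (interior_mono h hy) hg
  obtain ⟨B, hAB, hB⟩ := zorn_subset_nonempty _ hz A ⟨hA, hAD, hf⟩
  exact ⟨B, hAB, hB.prop.1, hB.prop.2.1, hB.prop.2.2, fun A' h1 h2 h3 h4 =>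
    hB.le_of_ge ⟨h1, h2, h4⟩ h3⟩

/-- Freeness depends on the interior alone, and adding limit points to an interval does not change
its interior. -/
theorem IsMaxFree.mem_of_closure (h : IsMaxFree G δ U D A) (hD : D.OrdConnected)
    (htD : t ∈ D) (ht : t ∈ closure A) : t ∈ A := by
  have hint : interior (D ∩ closure A) ⊆ interior A := by
    rw [← (h.interval.1.convex (𝕜 := ℝ)).interior_closure_eq_interior_of_nonempty_interior h.interval.2]
    exact interior_mono inter_subset_right
  refine h.max (D ∩ closure A) ⟨hD.inter h.interval.1.convex.closure.ordConnected, ?_⟩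
    inter_subset_left (subset_inter h.sub subset_closure) (h.free.mono hint) ⟨htD, ht⟩
  exact h.interval.2.mono (interior_mono (subset_inter h.sub subset_closure))

variable (E G) in
/-- The setting: a free analytic immersive curve on the interval `D` that is not a free segment,
with an analytic immersive extension to the open interval `U`. -/
structure FreeCurve (δ : ℝ → M) (U D : Set ℝ) : Prop extends ActedCurve E G δ U where
  interval : IsInterval D
  sub : D ⊆ U
  exists_free : ∃ A, IsInterval A ∧ A ⊆ D ∧ IsFree G δ U A
  not_free : ¬ IsFree G δ U D

/-- Positive and negative intervals are defined through the restriction of the curve to the interior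
of `D`. -/
theorem FreeCurve.interior_curve (h : FreeCurve E G δ U D) : FreeCurve E G δ U (interior D) := by
  refine ⟨h.toActedCurve, h.interval.interior_interval, interior_subset.trans h.sub, ?_, ?_⟩
  · obtain ⟨A, h1, h2, h3⟩ := h.exists_free
    exact ⟨interior A, h1.interior_interval, interior_mono h2, h3.mono (by rw [interior_interior])⟩
  · intro hf
    exact h.not_free (hf.mono (by rw [interior_interior]))

open scoped Pointwise

theorem GGerm.neg (h : ActedCurve E G δ U) (hg : GGerm δ U σ g t s) :
    GGerm (fun t => δ (-t)) (-U) σ g (-t) (-s) := by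
  obtain ⟨ρ, V, hρ, htV, -, hρt⟩ := h.exists_transition hg univ_mem
  have h1 := hρ.neg_left.neg_right
  rw [neg_neg] at h1
  have := h1.germ (t := -t) (by simpa using htV)
  simpa [hρt] using this

theorem ActedCurve.neg (h : ActedCurve E G δ U) : ActedCurve E G (fun t => δ (-t)) (-U) :=
  ⟨h.curve.neg, h.act, h.sated⟩

theorem GGerm.of_neg (h : ActedCurve E G δ U)
    (hg : GGerm (fun t => δ (-t)) (-U) σ g t s) : GGerm δ U σ g (-t) (-s) := by
  simpa using GGerm.neg h.neg hg

theorem curveStab_neg : curveStab G (fun t => δ (-t)) (-U) = curveStab G δ U := by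
  ext g
  rw [mem_curveStab, mem_curveStab]
  exact ⟨fun h t ht => by simpa using h (-t) (by simpa using ht), fun h t ht => h (-t) ht⟩

theorem IsFree.neg (h : ActedCurve E G δ U) (hA : IsFree G δ U A) :
    IsFree G (fun t => δ (-t)) (-U) (-A) := by
  intro σ g t s ht hs hg
  rw [curveStab_neg]
  rw [interior_neg_eq] at ht hs
  exact hA σ g (-t) (-s) ht hs (hg.of_neg h)

theorem IsFree.of_neg (h : ActedCurve E G δ U) (hA : IsFree G (fun t => δ (-t)) (-U) (-A)) :
    IsFree G δ U A := by
  simpa using IsFree.neg h.neg hA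

theorem IsMaxFree.neg (h : ActedCurve E G δ U) (hA : IsMaxFree G δ U D A) :
    IsMaxFree G (fun t => δ (-t)) (-U) (-D) (-A) := by
  refine ⟨hA.interval.neg, neg_subset_neg.2 hA.sub, hA.free.neg h, fun A' h1 h2 h3 h4 => ?_⟩
  have := hA.max (-A') h1.neg (by simpa using neg_subset_neg.2 h2) (by simpa using neg_subset_neg.2 h3)
    (IsFree.of_neg h (by simpa using h4))
  simpa using neg_subset_neg.2 this

theorem FreeCurve.neg (h : FreeCurve E G δ U D) : FreeCurve E G (fun t => δ (-t)) (-U) (-D) := by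
  refine ⟨h.toActedCurve.neg, h.interval.neg, neg_subset_neg.2 h.sub, ?_, fun hf =>
    h.not_free (hf.of_neg h.toActedCurve)⟩
  obtain ⟨A, h1, h2, h3⟩ := h.exists_free
  exact ⟨-A, h1.neg, neg_subset_neg.2 h2, h3.neg h.toActedCurve⟩

end FreeSegments

end AnalyticCurve

namespace AnalyticCurve

/-! ### On free intervals of a curve that is not a free segment, all germs are identities. -/

section StrongFreeness

variable {E : Type*} [NormedAddCommGroup E] [NormedSpace ℝ E] [CompleteSpace E]
  {M : Type*} [TopologicalSpace M] [ChartedSpace E M] [IsManifold 𝓘(ℝ, E) ω M] [T2Space M]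
  {G : Type*} [Group G] [MulAction G M]
  {δ γ : ℝ → M} {U A B D V V' : Set ℝ} {σ σ' : ℝ} {g g' : G} {t s r : ℝ} {ρ ρ' : ℝ → ℝ}

theorem OrdConnected_union_of_mem {A B : Set ℝ} (hA : A.OrdConnected) (hB : B.OrdConnected) {a : ℝ}
    (ha : a ∈ A) (hb : a ∈ B) : (A ∪ B).OrdConnected :=
  (hA.isPreconnected.union a ha hb hB.isPreconnected).ordConnected

theorem forall_lt_or_forall_gt_of_notMem {A : Set ℝ} (hA : A.OrdConnected) {x : ℝ} (hx : x ∉ A) :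
    (∀ y ∈ A, y < x) ∨ ∀ y ∈ A, x < y := by
  by_contra hcon
  push Not at hcon
  obtain ⟨⟨y, hy, hxy⟩, z, hz, hzx⟩ := hcon
  exact hx (hA.out hz hy ⟨hzx, hxy⟩)

theorem interior_union_Icc_subset {A : Set ℝ} {a c p : ℝ} (hp : p ∈ interior (A ∪ Icc a c))
    (hpa : p < a) : p ∈ interior A := by
  refine mem_interior.2 ⟨interior (A ∪ Icc a c) ∩ Iio a, ?_, isOpen_interior.inter isOpen_Iio,
    hp, hpa⟩
  rintro q ⟨hq, hqa⟩
  rcases interior_subset hq with h | h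
  · exact h
  · exact absurd h.1 (not_le.2 hqa)

theorem FreeCurve.isGreatest_sSup (h : FreeCurve E G δ U D) (hA : IsMaxFree G δ U D A) {x : ℝ}
    (hx : x ∈ D) (hxA : ∀ y ∈ A, y < x) : sSup A ∈ A ∧ ∀ y ∈ A, y ≤ sSup A := by
  obtain ⟨t, ht⟩ := hA.interval.2
  have htA := interior_subset ht
  have hbdd : BddAbove A := ⟨x, fun y hy => (hxA y hy).le⟩
  refine ⟨hA.mem_of_closure h.interval.1 ?_ (csSup_mem_closure ⟨t, htA⟩ hbdd),
    fun y hy => le_csSup hbdd hy⟩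
  exact h.interval.1.out (hA.sub htA) hx
    ⟨le_csSup hbdd htA, csSup_le ⟨t, htA⟩ fun y hy => (hxA y hy).le⟩

/-- The transition moves points to the right, so followed rightwards it attains `sSup A` at an
interior point of `A`. Its inverse then maps a right neighbourhood of `sSup A` into `A` by germs of
the neutral element, and `A` could be enlarged. -/
theorem FreeCurve.not_trivial_germ_of_gt (h : FreeCurve E G δ U D) (hA : IsMaxFree G δ U D A)
    {x : ℝ} (hx : x ∈ D) (hxA : ∀ y ∈ A, y < x) (ht : t ∈ interior A) (hs : s ∈ interior A)
    (hg : GGerm δ U 1 (1 : G) t s) (hts : t < s) : False := by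
  obtain ⟨haA, hAa⟩ := h.isGreatest_sSup hA hx hxA
  set a := sSup A
  have hat : t < a := hts.trans_le (hAa s (interior_subset hs))
  have hax := hxA a haA
  have haU := h.sub (hA.sub haA)
  obtain ⟨ρ, V, hρ, htV, hρt⟩ := h.exists_max hg
  have hlt := h.lt_of_lt hρ.toTransition one_pos htV (by rwa [hρt])
  obtain ⟨x₀, hx₀V, hx₀, hx₀a⟩ : ∃ x₀ ∈ V, x₀ ∈ Icc t a ∧ ρ x₀ = a := by
    rcases hρ.continuation (h.smul 1) h.curve htV haU haU (by
      rw [hρt, one_mul]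
      exact mul_nonneg (by linarith) (by linarith [hAa s (interior_subset hs)])) with
      ⟨h1, h2⟩ | ⟨x', h1, h2, h3⟩
    · rw [hρt, uIcc_of_le (hAa s (interior_subset hs))] at h2
      exact absurd h2.2 (not_le.2 (hlt a h1))
    · rw [uIcc_of_le hat.le] at h2
      exact ⟨x', h1, h2, h3⟩
  have hx₀lt : x₀ < a := hx₀a ▸ hlt x₀ hx₀V
  have hx₀A : x₀ ∈ interior A := by
    obtain ⟨p, hp, hpt⟩ := exists_lt_mem_of_mem_interior ht
    exact mem_interior_of_between hA.interval.1 hp haA (hpt.trans_le hx₀.1) hx₀lt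
  have hgi : GGerm δ U 1 (1 : G) a x₀ := by
    have := GGerm.inv (hρ.germ hx₀V)
    rwa [hx₀a, inv_one] at this
  obtain ⟨κ, W, hκ, haW, -, hκa⟩ := h.exists_transition hgi univ_mem
  obtain ⟨ε, hε, hball⟩ := Metric.mem_nhds_iff.1 (inter_mem (hκ.dom.1.mem_nhds haW)
    ((hκ.continuousAt haW).preimage_mem_nhds (hκa.symm ▸ isOpen_interior.mem_nhds hx₀A)))
  set c := min x (a + ε / 2)
  have hac : a < c := lt_min hax (by linarith)
  have hcx : c ≤ x := min_le_left _ _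
  have hcε : c ≤ a + ε / 2 := min_le_right _ _
  have hBD : A ∪ Icc a c ⊆ D := by
    refine union_subset hA.sub fun u hu => h.interval.1.out (hA.sub haA) hx ⟨hu.1, hu.2.trans hcx⟩
  have := hA.max (A ∪ Icc a c) ⟨OrdConnected_union_of_mem hA.interval.1 ordConnected_Icc haA
    (left_mem_Icc.2 hac.le), hA.interval.2.mono (interior_mono subset_union_left)⟩ hBD
    subset_union_left (isFree_of_transport hA.free fun p hp => ?_)
  · exact absurd (hAa c (this (Or.inr (right_mem_Icc.2 hac.le)))) (not_le.2 hac)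
  · rcases lt_or_ge p a with hpa | hpa
    · have hpA := interior_union_Icc_subset hp hpa
      exact ⟨p, hpA, GGerm.of_mem_stab (h.sub (hA.sub (interior_subset hpA))) h.curve.dom.1
        (one_mem _)⟩
    · have hpc : p ≤ c := by
        rcases interior_subset hp with h' | h'
        · exact (hAa p h').trans hac.le
        · exact h'.2
      have hpb : p ∈ Metric.ball a ε := by
        rw [Metric.mem_ball, Real.dist_eq, abs_lt]
        constructor <;> linarith
      exact ⟨κ p, (hball hpb).2, hκ.germ (hball hpb).1⟩

/-- On a free interval of a curve that is not free, only identity germs occur. -/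
theorem FreeCurve.germ_eq (h : FreeCurve E G δ U D) (hA : IsInterval A) (hAD : A ⊆ D)
    (hf : IsFree G δ U A) (ht : t ∈ interior A) (hs : s ∈ interior A) (hg : GGerm δ U σ g t s) :
    g ∈ curveStab G δ U ∧ t = s ∧ 0 < σ := by
  have hst := hf σ g t s ht hs hg
  have hg1 : GGerm δ U σ (1 : G) t s := by
    have := hg.comp (GGerm.of_mem_stab hg.2.1 h.curve.dom.1 (inv_mem hst))
    simpa using this
  refine ⟨hst, ?_⟩
  rcases lt_or_gt_of_ne hg.sign_ne_zero with hσ | hσ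
  · exfalso
    obtain ⟨τ, -, hτ⟩ := h.exists_fixed hg1 hσ
    exact h.not_mem_stab_of_neg hτ hσ (one_mem _)
  refine ⟨?_, hσ⟩
  have hg1 : GGerm δ U 1 (1 : G) t s := hg1.of_sign (by linarith)
  obtain ⟨A', hAA', hA'⟩ := exists_isMaxFree hA hAD hf
  -- Since `D` is not free, a maximal free interval has an end inside `D`, where it can be tested
  -- for enlargement.
  obtain ⟨x, hxD, hxA⟩ : ∃ x ∈ D, x ∉ A' := by
    by_contra hcon
    push Not at hcon
    exact h.not_free (hA'.free.mono (interior_mono hcon))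
  have ht' := interior_mono hAA' ht
  have hs' := interior_mono hAA' hs
  have hg1' : GGerm δ U 1 (1 : G) s t := by simpa using hg1.inv
  by_contra hne
  rcases forall_lt_or_forall_gt_of_notMem hA'.interval.1 hxA with hx | hx
  · rcases lt_or_gt_of_ne hne with hlt | hlt
    · exact h.not_trivial_germ_of_gt hA' hxD hx ht' hs' hg1 hlt
    · exact h.not_trivial_germ_of_gt hA' hxD hx hs' ht' hg1' hlt
  · have hn := hA'.neg h.toActedCurve
    have hx' : ∀ y ∈ -A', y < -x := fun y hy => by have := hx (-y) hy; linarith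
    have hmem : ∀ u ∈ interior A', -u ∈ interior (-A') := fun u hu => by
      rw [interior_neg_eq]; simpa using hu
    rcases lt_or_gt_of_ne hne with hlt | hlt
    · exact h.neg.not_trivial_germ_of_gt hn (by simpa using hxD) hx' (hmem s hs') (hmem t ht')
        (hg1'.neg h.toActedCurve) (by linarith)
    · exact h.neg.not_trivial_germ_of_gt hn (by simpa using hxD) hx' (hmem t ht') (hmem s hs')
        (hg1.neg h.toActedCurve) (by linarith)

/-- The inverse germ carries interior points of `A` near `s` to interior points of `A`, where
`germ_eq` shows that it is the identity; continuity settles the point `s` itself. -/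
theorem FreeCurve.germ_eq_of_mem (h : FreeCurve E G δ U D) (hA : IsInterval A) (hAD : A ⊆ D)
    (hf : IsFree G δ U A) (ht : t ∈ interior A) (hs : s ∈ A) (hg : GGerm δ U σ g t s) :
    g ∈ curveStab G δ U ∧ t = s ∧ 0 < σ := by
  obtain ⟨κ, W, hκ, hsW, -, hκs⟩ := h.exists_transition hg.inv univ_mem
  have hfr : ∃ᶠ v in 𝓝 s, v ∈ interior A :=
    mem_closure_iff_frequently.1 (hA.subset_closure_interior hs)
  have hW : ∀ᶠ v in 𝓝 s, v ∈ W := hκ.dom.1.mem_nhds hsW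
  have hfr2 := hfr.and_eventually (hW.and
    ((hκ.continuousAt hsW).eventually_mem (hκs.symm ▸ isOpen_interior.mem_nhds ht)))
  have hfr3 : ∃ᶠ v in 𝓝 s, g ∈ curveStab G δ U ∧ v = κ v ∧ 0 < σ := by
    refine hfr2.mono fun v ⟨h1, h2, h3⟩ => ?_
    obtain ⟨e1, e2⟩ := h.germ_eq hA hAD hf h1 h3 (hκ.germ h2)
    exact ⟨by simpa using e1, e2⟩
  obtain ⟨v, h1, -, h3⟩ := hfr3.exists
  refine ⟨h1, ?_, h3⟩
  by_contra hne
  have : ∀ᶠ v in 𝓝 s, v ≠ κ v := by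
    have hc : ContinuousAt (fun v => v - κ v) s := continuousAt_id.sub (hκ.continuousAt hsW)
    have h0 : s - κ s ≠ 0 := by rw [hκs, sub_ne_zero]; exact Ne.symm hne
    filter_upwards [hc.eventually_ne h0] with v hv
    exact sub_ne_zero.1 hv
  obtain ⟨v, ⟨-, h2, -⟩, h3⟩ := (hfr3.and_eventually this).exists
  exact h3 h2

theorem FreeCurve.germ_eq_of_mem' (h : FreeCurve E G δ U D) (hA : IsInterval A) (hAD : A ⊆ D)
    (hf : IsFree G δ U A) (ht : t ∈ A) (hs : s ∈ interior A) (hg : GGerm δ U σ g t s) :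
    g ∈ curveStab G δ U ∧ t = s ∧ 0 < σ := by
  obtain ⟨e1, e2, e3⟩ := h.germ_eq_of_mem hA hAD hf hs ht hg.inv
  exact ⟨by simpa using e1, e2.symm, e3⟩

end StrongFreeness

end AnalyticCurve

namespace AnalyticCurve

/-! ### Translations and reflections near an end point of a free interval. -/

section Discreteness

variable {E : Type*} [NormedAddCommGroup E] [NormedSpace ℝ E] [CompleteSpace E]
  {M : Type*} [TopologicalSpace M] [ChartedSpace E M] [IsManifold 𝓘(ℝ, E) ω M] [T2Space M]
  {G : Type*} [Group G] [MulAction G M]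
  {δ γ : ℝ → M} {U A B D V V' : Set ℝ} {σ σ' : ℝ} {g g' : G} {t s r a p : ℝ} {ρ ρ' : ℝ → ℝ}

/-- This is satedness along `θ = 1 / (n + 1)`, in the quantitative form used below. -/
theorem ActedCurve.not_accumulating (h : ActedCurve E G δ U) (ha : a ∈ U) {u₁ u₂ : ℝ}
    (h1 : δ u₁ ≠ δ a) (h2 : δ u₂ ≠ δ a) (h12 : δ u₁ ≠ δ u₂)
    (H : ∀ θ > 0, ∃ (g : G) (v₁ v₂ : ℝ), |v₁ - a| < θ ∧ |v₂ - a| < θ ∧ g • δ u₁ = δ v₁ ∧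
      g • δ u₂ = δ v₂) : False := by
  have H' : ∀ n : ℕ, ∃ (g : G) (v₁ v₂ : ℝ), |v₁ - a| < 1 / ((n : ℝ) + 1) ∧
      |v₂ - a| < 1 / ((n : ℝ) + 1) ∧ g • δ u₁ = δ v₁ ∧ g • δ u₂ = δ v₂ :=
    fun n => H _ (by positivity)
  choose g v₁ v₂ e1 e2 e3 e4 using H'
  have hlim : ∀ v : ℕ → ℝ, (∀ n : ℕ, |v n - a| < 1 / ((n : ℝ) + 1)) →
      Tendsto (fun n => δ (v n)) atTop (𝓝 (δ a)) := by
    intro v hv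
    refine (h.curve.continuousAt ha).tendsto.comp ?_
    rw [tendsto_iff_dist_tendsto_zero]
    refine squeeze_zero (fun _ => dist_nonneg) (fun n => ?_) tendsto_one_div_add_atTop_nhds_zero_nat
    rw [Real.dist_eq]
    exact (hv n).le
  refine h.sated (δ a) (δ u₁) (δ u₂) h1 h2 h12 ⟨g, ?_, ?_⟩
  · simp only [e3]
    exact hlim v₁ e1
  · simp only [e4]
    exact hlim v₂ e2

theorem ActedCurve.exists_points_left (h : ActedCurve E G δ U) (ha : a ∈ U) (hpa : p < a) :
    ∃ u₁ u₂, p < u₁ ∧ u₁ < u₂ ∧ u₂ < a ∧ δ u₁ ≠ δ a ∧ δ u₂ ≠ δ a ∧ δ u₁ ≠ δ u₂ := by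
  obtain ⟨W, hW, hinj⟩ := exists_injOn_nhds h.curve ha
  obtain ⟨l, ⟨hl, hla⟩, hlW⟩ := exists_Ioc_subset_of_mem_nhds' hW hpa
  obtain ⟨u₁, h1, h1'⟩ := exists_between hla
  obtain ⟨u₂, h2, h2'⟩ := exists_between h1'
  have m1 : u₁ ∈ W := hlW ⟨h1, h1'.le⟩
  have m2 : u₂ ∈ W := hlW ⟨h1.trans h2, h2'.le⟩
  have m3 : a ∈ W := hlW ⟨hla, le_rfl⟩
  exact ⟨u₁, u₂, hl.trans_lt h1, h2, h2', fun e => h1'.ne (hinj m1 m3 e),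
    fun e => h2'.ne (hinj m2 m3 e), fun e => h2.ne (hinj m1 m2 e)⟩

theorem isInterval_Ioo (hpa : p < a) : IsInterval (Ioo p a) :=
  IsOpenInterval.isInterval ⟨isOpen_Ioo, ordConnected_Ioo, nonempty_Ioo.2 hpa⟩

/-- Near an end point of a free segment there are no small translations. -/
theorem FreeCurve.exists_discrete (h : FreeCurve E G δ U D) (hpa : p < a) (hpD : Ioo p a ⊆ D)
    (hf : IsFree G δ U (Ioo p a)) (haD : a ∈ D) :
    ∃ η > 0, ∀ (g : G) (t s : ℝ), |t - a| < η → |s - a| < η → GGerm δ U 1 g t s → t = s := by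
  by_contra hcon
  push Not at hcon
  have hcon' : ∀ η > 0, ∃ (g : G) (t s : ℝ), |t - a| < η ∧ |s - a| < η ∧ GGerm δ U 1 g t s ∧
      t < s := by
    intro η hη
    obtain ⟨g, t, s, h1, h2, h3, h4⟩ := hcon η hη
    rcases lt_or_gt_of_ne h4 with h5 | h5
    · exact ⟨g, t, s, h1, h2, h3, h5⟩
    · exact ⟨g⁻¹, s, t, h2, h1, h3.inv, h5⟩
  obtain ⟨u₁, u₂, h1, h2, h3, n1, n2, n12⟩ := h.exists_points_left (h.sub haD) hpa
  refine h.not_accumulating (h.sub haD) n1 n2 n12 fun θ hθ => ?_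
  obtain ⟨g, t, s, ht, hs, hg, hts⟩ := hcon' (min θ (a - u₂)) (lt_min hθ (by linarith))
  obtain ⟨ρ, V, hρ, htV, hρt⟩ := h.exists_max hg
  have hlt := h.lt_of_lt hρ.toTransition one_pos htV (by rwa [hρt])
  have ht' : u₂ < t := by
    have := (abs_lt.1 (ht.trans_le (min_le_right _ _))).1
    linarith
  -- Followed to the left, the shift never leaves its domain before `u`, as its values stay above
  -- the diagonal. The image of `u` cannot lie in the free interval `(p, a)`, so it is squeezed
  -- between `a` and `s`. Hence one element brings both `u₁` and `u₂` close to `a`.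
  have key : ∀ u ∈ Ioo p a, u < t → ∃ v, |v - a| < θ ∧ g • δ u = δ v := by
    intro u hu hut
    have huV : u ∈ V ∧ ρ u ≤ s := by
      rcases hρ.continuation (h.smul g) h.curve htV (h.sub (hpD hu)) (h.sub (hpD hu))
        (by rw [hρt, one_mul]; exact mul_nonneg_of_nonpos_of_nonpos (by linarith) (by linarith)) with
        ⟨e1, e2⟩ | ⟨x', e1, e2, e3⟩
      · rw [hρt, uIcc_of_ge (by linarith)] at e2
        exact ⟨e1, e2.2⟩
      · rw [uIcc_of_ge hut.le] at e2
        exact absurd (e3 ▸ hlt x' e1) (not_lt.2 e2.1)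
    refine ⟨ρ u, ?_, hρ.eq u huV.1⟩
    have ha : a ≤ ρ u := by
      by_contra hcon
      push Not at hcon
      have := (h.germ_eq (isInterval_Ioo hpa) hpD hf (by rwa [interior_Ioo])
        (by rw [interior_Ioo]; exact ⟨hu.1.trans (hlt u huV.1), hcon⟩) (hρ.germ huV.1)).2.1
      exact absurd this (hlt u huV.1).ne
    have := (abs_lt.1 (hs.trans_le (min_le_left _ _))).2
    rw [abs_lt]
    constructor <;> linarith [huV.2]
  obtain ⟨v₁, e1, e1'⟩ := key u₁ ⟨h1, h2.trans h3⟩ (h2.trans ht')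
  obtain ⟨v₂, e2, e2'⟩ := key u₂ ⟨h1.trans h2, h3⟩ ht'
  exact ⟨g, v₁, v₂, e1, e2, e1', e2'⟩

/-- Reflection points do not accumulate at an end point of a free segment. -/
theorem FreeCurve.exists_no_reflection (h : FreeCurve E G δ U D) (hpa : p < a) (hpD : Ioo p a ⊆ D)
    (hf : IsFree G δ U (Ioo p a)) (haD : a ∈ interior D) :
    ∃ θ > 0, ∀ τ ∈ Ioo a (a + θ), ∀ g : G, ¬ GGerm δ U (-1) g τ τ := by
  have haD' := interior_subset haD
  have haU := h.sub haD'
  obtain ⟨η, hη, hdisc⟩ := h.exists_discrete hpa hpD hf haD'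
  obtain ⟨q, hqD, haq⟩ := exists_gt_mem_of_mem_interior haD
  obtain ⟨u₁, u₂, h1, h2, h3, n1, n2, n12⟩ := h.exists_points_left haU
    (max_lt hpa (show a - η < a by linarith))
  rw [max_lt_iff] at h1
  -- If reflections at points `τ` tending to `a` carried `u₁` ever closer to `a`, they would do the
  -- same with `u₂`, which lies between `u₁` and `τ`; satedness forbids this.
  obtain ⟨θ₁, hθ₁, hθ⟩ : ∃ θ₁ > 0, ∀ τ ∈ Ioo a (a + θ₁), ∀ (g : G) (ρ : ℝ → ℝ) (V : Set ℝ),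
      GMaxTransition δ U (-1) g ρ V → τ ∈ V → ρ τ = τ → ¬ (u₁ ∈ V ∧ ρ u₁ ≤ a + θ₁) := by
    by_contra hcon
    push Not at hcon
    refine h.not_accumulating haU n1 n2 n12 fun θ hθ => ?_
    obtain ⟨τ, hτ, g, ρ, V, hρ, hτV, hρτ, huV, hle⟩ := hcon (θ / 2) (by linarith)
    have hanti := hρ.strictAntiOn (by norm_num)
    have hu₂V : u₂ ∈ V := hρ.dom.2.1.out huV hτV ⟨h2.le, (h3.trans hτ.1).le⟩
    have e1 := hanti huV hu₂V h2
    have e2 := hanti hu₂V hτV (h3.trans hτ.1)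
    rw [hρτ] at e2
    refine ⟨g, ρ u₁, ρ u₂, ?_, ?_, hρ.eq _ huV, hρ.eq _ hu₂V⟩
    all_goals rw [abs_lt]; constructor <;> linarith [hτ.1]
  set θ₂ := min θ₁ (min η (q - a))
  have hθ₂ : 0 < θ₂ := lt_min hθ₁ (lt_min hη (by linarith))
  have hθ₂1 : θ₂ ≤ θ₁ := min_le_left _ _
  have hθ₂η : θ₂ ≤ η := (min_le_right _ _).trans (min_le_left _ _)
  have hθ₂q : θ₂ ≤ q - a := (min_le_right _ _).trans (min_le_right _ _)
  -- By the choice of `θ₁`, the reflection at `τ₂` followed to the left reaches the value `a + θ₂`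
  -- before `u₁`, so it takes the value `τ₁` at some `z ≤ τ₂`. Composed with the reflection at `τ₁`
  -- it gives a translation from `τ₁` to `z` within distance `η` of `a`.
  have two : ∀ τ₁ τ₂ (g₁ g₂ : G), a < τ₂ → τ₂ < τ₁ → τ₁ < a + θ₂ → GGerm δ U (-1) g₁ τ₁ τ₁ →
      ¬ GGerm δ U (-1) g₂ τ₂ τ₂ := by
    intro τ₁ τ₂ g₁ g₂ haτ hττ hτθ hg₁ hg₂
    obtain ⟨ρ, V, hρ, hτV, hρτ⟩ := h.exists_max hg₂
    have hyD : a + θ₂ ∈ D := h.interval.1.out haD' hqD ⟨by linarith, by linarith⟩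
    rcases hρ.continuation (h.smul g₂) h.curve hτV (x := u₁) (y := a + θ₂)
      (h.sub (hpD ⟨h1.1, h2.trans h3⟩)) (h.sub hyD) (by
        rw [hρτ]
        nlinarith [mul_nonneg (show (0 : ℝ) ≤ τ₂ - u₁ by linarith)
          (show (0 : ℝ) ≤ a + θ₂ - τ₂ by linarith)]) with ⟨e1, e2⟩ | ⟨x', e1, e2, e3⟩
    · refine hθ τ₂ ⟨haτ, by linarith⟩ g₂ ρ V hρ hτV hρτ ⟨e1, ?_⟩
      rw [hρτ, uIcc_of_le (by linarith)] at e2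
      linarith [e2.2]
    · rw [uIcc_of_ge (by linarith)] at e2
      obtain ⟨z, hz, hzτ⟩ := intermediate_value_Icc' e2.2
        (hρ.continuousOn.mono (hρ.dom.2.1.out e1 hτV)) (show τ₁ ∈ Icc (ρ τ₂) (ρ x') from
          ⟨by rw [hρτ]; exact hττ.le, by rw [e3]; exact hτθ.le⟩)
      have hzg := hρ.germ (hρ.dom.2.1.out e1 hτV hz)
      rw [hzτ] at hzg
      have hc := hg₁.comp (GGerm.inv hzg)
      have := hdisc _ τ₁ z (by rw [abs_lt]; constructor <;> linarith)
        (by rw [abs_lt]; constructor <;> linarith [hz.1, hz.2, e2.1])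
        (hc.of_sign (by norm_num))
      linarith [hz.2]
  -- At most one reflection point remains in `(a, a + θ₂)`; if there is one, the neighbourhood is
  -- cut off before it.
  by_cases hex : ∃ τ₁ ∈ Ioo a (a + θ₂), ∃ g₁ : G, GGerm δ U (-1) g₁ τ₁ τ₁
  · obtain ⟨τ₁, hτ₁, g₁, hg₁⟩ := hex
    refine ⟨τ₁ - a, by linarith [hτ₁.1], fun τ hτ g hg => ?_⟩
    exact two τ₁ τ g₁ g hτ.1 (by linarith [hτ.2]) hτ₁.2 hg₁ hg
  · push Not at hex
    exact ⟨θ₂, hθ₂, hex⟩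

/-- At the right end point of a maximal free interval there is a reflection, or there are
translations that carry interior points of the interval close to the end point. -/
theorem FreeCurve.reflection_or_germs (h : FreeCurve E G δ U D) (hA : IsMaxFree G δ U D A)
    (haA : a ∈ A) (hAa : ∀ y ∈ A, y ≤ a) (haD : a ∈ interior D)
    (hno : ∀ g : G, ¬ GGerm δ U (-1) g a a) :
    ∀ θ > 0, ∃ (g : G) (t s : ℝ), t ∈ interior A ∧ s ∈ Ioo a (a + θ) ∧ GGerm δ U 1 g t s := by
  obtain ⟨p, hpA, hpa⟩ : ∃ p ∈ A, p < a := by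
    obtain ⟨t, ht⟩ := hA.interval.2
    obtain ⟨q, hq, htq⟩ := exists_gt_mem_of_mem_interior ht
    exact ⟨t, interior_subset ht, htq.trans_le (hAa q hq)⟩
  have hpA' : Ioo p a ⊆ A := Ioo_subset_Icc_self.trans (hA.interval.1.out hpA haA)
  have hfp : IsFree G δ U (Ioo p a) := hA.free.mono (interior_mono hpA')
  have haD' := interior_subset haD
  obtain ⟨η, hη, hdisc⟩ := h.exists_discrete hpa (hpA'.trans hA.sub) hfp haD'
  obtain ⟨θ₀, hθ₀, hrefl⟩ := h.exists_no_reflection hpa (hpA'.trans hA.sub) hfp haD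
  obtain ⟨q, hqD, haq⟩ := exists_gt_mem_of_mem_interior haD
  intro θ' hθ'
  obtain ⟨θ, hθ, hle⟩ : ∃ θ > 0, θ ≤ θ' ∧ θ ≤ η ∧ θ ≤ θ₀ ∧ θ ≤ q - a :=
    ⟨min θ' (min η (min θ₀ (q - a))), by
      refine lt_min hθ' (lt_min hη (lt_min hθ₀ (by linarith))), by simp⟩
  obtain ⟨hle1, hle2, hle3, hle4⟩ := hle
  have hB : ¬ IsFree G δ U (A ∪ Icc a (a + θ)) := by
    intro hf
    have := hA.max (A ∪ Icc a (a + θ)) ⟨OrdConnected_union_of_mem hA.interval.1 ordConnected_Icc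
      haA (left_mem_Icc.2 (by linarith)), hA.interval.2.mono (interior_mono subset_union_left)⟩
      (union_subset hA.sub fun u hu => h.interval.1.out haD' hqD ⟨hu.1, by linarith [hu.2]⟩)
      subset_union_left hf (Or.inr (right_mem_Icc.2 (by linarith)))
    linarith [hAa _ this]
  by_contra hcon
  push Not at hcon
  refine hB (h.isFree_of_avoid a fun σ g t s ht hs hta hsa hg => ?_)
  have hcases : ∀ u ∈ interior (A ∪ Icc a (a + θ)), u ≠ a → u ∈ interior A ∨ u ∈ Ioo a (a + θ) := by
    intro u hu hua
    rcases lt_or_gt_of_ne hua with hlt | hlt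
    · exact Or.inl (interior_union_Icc_subset hu hlt)
    · refine Or.inr ⟨hlt, ?_⟩
      obtain ⟨v, hv, huv⟩ := exists_gt_mem_of_mem_interior hu
      rcases hv with hv | hv
      · linarith [hAa v hv]
      · exact huv.trans_le hv.2
  -- A reversing germ has a fixed point between `t` and `s`. It can lie neither in `A` by freeness,
  -- nor at `a` by hypothesis, nor beyond `a` by the choice of `θ₀`.
  have mixed : ∀ (g : G) (t s : ℝ), t ∈ interior A → s ∈ Ioo a (a + θ) → ¬ GGerm δ U σ g t s := by
    intro g t s ht hs hg
    rcases lt_or_gt_of_ne hg.sign_ne_zero with hσ | hσ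
    · obtain ⟨τ, hτ, hgτ⟩ := h.exists_fixed hg hσ
      have hta : t < a := by
        obtain ⟨v, hv, htv⟩ := exists_gt_mem_of_mem_interior ht
        exact htv.trans_le (hAa v hv)
      rw [uIcc_of_le (by linarith [hs.1])] at hτ
      rcases lt_trichotomy τ a with h1 | h1 | h1
      · have hτA : τ ∈ interior A := by
          obtain ⟨v, hv, hvt⟩ := exists_lt_mem_of_mem_interior ht
          exact mem_interior_of_between hA.interval.1 hv haA (hvt.trans_le hτ.1) h1
        exact absurd (h.germ_eq hA.interval hA.sub hA.free hτA hτA hgτ).2.2 (not_lt.2 hσ.le)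
      · rw [h1] at hgτ
        exact hno g (hgτ.of_sign (by linarith))
      · exact hrefl τ ⟨h1, by linarith [hτ.2, hs.2]⟩ g (hgτ.of_sign (by linarith))
    · exact hcon g t s ht ⟨hs.1, by linarith [hs.2]⟩ (hg.of_sign (by linarith))
  rcases hcases t ht hta with ht | ht <;> rcases hcases s hs hsa with hs | hs
  · exact (h.germ_eq hA.interval hA.sub hA.free ht hs hg).1
  · exact absurd hg (mixed g t s ht hs)
  · exact absurd hg.inv (mixed g⁻¹ s t hs ht)
  · rcases lt_or_gt_of_ne hg.sign_ne_zero with hσ | hσ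
    · obtain ⟨τ, hτ, hgτ⟩ := h.exists_fixed hg hσ
      have hτ' := ordConnected_Ioo.uIcc_subset ht hs hτ
      exact absurd (hgτ.of_sign (by linarith)) (hrefl τ ⟨hτ'.1, by linarith [hτ'.2]⟩ g)
    · have : t = s := hdisc g t s (by rw [abs_lt]; constructor <;> linarith [ht.1, ht.2])
        (by rw [abs_lt]; constructor <;> linarith [hs.1, hs.2]) (hg.of_sign (by linarith))
      rw [← this] at hg
      exact h.mem_stab_of_fixed hg hσ

/-- If there is no reflection at the right end point of a maximal free interval, then one
transition translates the interval to the right of itself, without a gap. -/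
theorem FreeCurve.exists_translation (h : FreeCurve E G δ U D) (hA : IsMaxFree G δ U D A)
    (haA : a ∈ A) (hAa : ∀ y ∈ A, y ≤ a) (haD : a ∈ interior D)
    (hno : ∀ g : G, ¬ GGerm δ U (-1) g a a) :
    ∃ (g : G) (ρ : ℝ → ℝ) (V : Set ℝ) (t₁ : ℝ), GMaxTransition δ U 1 g ρ V ∧ t₁ ∈ interior A ∧
      t₁ ∈ V ∧ (∀ u ∈ interior A, u ≤ t₁ → u ∈ V ∧ a < ρ u) ∧
      ∀ θ > 0, ∃ u ∈ interior A, u ≤ t₁ ∧ ρ u < a + θ := by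
  have hgerms := h.reflection_or_germs hA haA hAa haD hno
  have haD' := interior_subset haD
  have hlta : ∀ u ∈ interior A, u < a := fun u hu => by
    obtain ⟨v, hv, htv⟩ := exists_gt_mem_of_mem_interior hu
    exact htv.trans_le (hAa v hv)
  obtain ⟨p, hpA⟩ := hA.interval.2
  have hpa := hlta p hpA
  have hpA' : Ioo p a ⊆ A :=
    Ioo_subset_Icc_self.trans (hA.interval.1.out (interior_subset hpA) haA)
  obtain ⟨η, hη, hdisc⟩ := h.exists_discrete hpa (hpA'.trans hA.sub)
    (hA.free.mono (interior_mono hpA')) haD'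
  -- A positive germ from `A` to the right of `a`, followed to the left, cannot attain the value `a`
  -- on the interior of `A`, so it extends over everything to the left of `t` there.
  have hext : ∀ (g : G) (ρ : ℝ → ℝ) (V : Set ℝ) (t : ℝ), GMaxTransition δ U 1 g ρ V →
      t ∈ interior A → t ∈ V → a < ρ t → ∀ u ∈ interior A, u ≤ t → u ∈ V ∧ a < ρ u := by
    intro g ρ V t hρ ht htV hat
    have hlt := h.lt_of_lt hρ.toTransition one_pos htV ((hlta t ht).trans hat)
    have hne : ∀ x ∈ V, x ∈ interior A → ρ x ≠ a := by
      intro x hxV hx hxa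
      have hg := (hρ.germ hxV)
      have := (h.germ_eq_of_mem hA.interval hA.sub hA.free hx (by rwa [hxa]) hg).2.1
      exact (hlt x hxV).ne this
    intro u hu hut
    rcases hρ.continuation (h.smul g) h.curve htV (h.sub (hA.sub (interior_subset hu)))
      (h.sub haD') (by
        rw [one_mul]
        exact mul_nonneg_of_nonpos_of_nonpos (by linarith) (by linarith)) with ⟨e1, e2⟩ | ⟨x', e1, e2, e3⟩
    · rw [uIcc_of_ge hat.le] at e2
      exact ⟨e1, lt_of_le_of_ne e2.1 (hne u e1 hu).symm⟩
    · rw [uIcc_of_ge hut] at e2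
      exact absurd e3 (hne x' e1 (hA.interval.interior_interval.1.out hu ht e2))
  obtain ⟨g₁, t₁, s₁, ht₁, hs₁, hg₁⟩ := hgerms η hη
  obtain ⟨ρ₁, V₁, hρ₁, htV₁, hρt₁⟩ := h.exists_max hg₁
  have hext₁ := hext g₁ ρ₁ V₁ t₁ hρ₁ ht₁ htV₁ (by rw [hρt₁]; exact hs₁.1)
  have hmono₁ := hρ₁.strictMonoOn one_pos
  refine ⟨g₁, ρ₁, V₁, t₁, hρ₁, ht₁, htV₁, hext₁, fun θ hθ => ?_⟩
  obtain ⟨g₂, t₂, s₂, ht₂, hs₂, hg₂⟩ := hgerms (min θ η) (lt_min hθ hη)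
  obtain ⟨ρ₂, V₂, hρ₂, htV₂, hρt₂⟩ := h.exists_max hg₂
  have hext₂ := hext g₂ ρ₂ V₂ t₂ hρ₂ ht₂ htV₂ (by rw [hρt₂]; exact hs₂.1)
  have hmono₂ := hρ₂.strictMonoOn one_pos
  have hu : min t₁ t₂ ∈ interior A := by
    rcases min_choice t₁ t₂ with e | e <;> rw [e] <;> assumption
  obtain ⟨m1, m1'⟩ := hext₁ _ hu (min_le_left _ _)
  obtain ⟨m2, m2'⟩ := hext₂ _ hu (min_le_right _ _)
  have b1 : ρ₁ (min t₁ t₂) ≤ s₁ := hρt₁ ▸ hmono₁.monotoneOn m1 htV₁ (min_le_left _ _)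
  have b2 : ρ₂ (min t₁ t₂) ≤ s₂ := hρt₂ ▸ hmono₂.monotoneOn m2 htV₂ (min_le_right _ _)
  have hs₂' := hs₂.2
  have c1 : min θ η ≤ θ := min_le_left _ _
  have c2 : min θ η ≤ η := min_le_right _ _
  -- The two images of the same point are within `η` of `a` and are related by a translation germ,
  -- so they coincide. Thus the first transition also comes within `θ` of `a`.
  have heq := hdisc _ _ _ (by rw [abs_lt]; constructor <;> linarith [hs₁.2])
    (by rw [abs_lt]; constructor <;> linarith)
    ((GGerm.comp (GGerm.inv (hρ₁.germ m1)) (hρ₂.germ m2)).of_sign (by norm_num))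
  exact ⟨_, hu, min_le_left _ _, by rw [heq]; linarith⟩

end Discreteness

end AnalyticCurve

namespace AnalyticCurve

/-! ### Neighbours of maximal intervals, and the dichotomy. -/

section Classification

variable {E : Type*} [NormedAddCommGroup E] [NormedSpace ℝ E] [CompleteSpace E]
  {M : Type*} [TopologicalSpace M] [ChartedSpace E M] [IsManifold 𝓘(ℝ, E) ω M] [T2Space M]
  {G : Type*} [Group G] [MulAction G M]
  {δ γ : ℝ → M} {U A B D V V' : Set ℝ} {σ σ' : ℝ} {g g' : G} {t s r a b p : ℝ} {ρ ρ' : ℝ → ℝ}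

/-- An interval is free if its points, with one exception, lift injectively to a free interval. -/
theorem FreeCurve.isFree_of_lift (h : FreeCurve E G δ U D) (hA : IsInterval A) (hAD : A ⊆ D)
    (hf : IsFree G δ U A) (c : ℝ) (ψ τ : ℝ → ℝ) (k : ℝ → G)
    (hlift : ∀ v ∈ interior B, v ≠ c → ψ v ∈ interior A ∧ GGerm δ U (τ v) (k v) (ψ v) v)
    (hinj : ∀ v ∈ interior B, ∀ w ∈ interior B, v ≠ c → w ≠ c → ψ v = ψ w → v = w) :
    IsFree G δ U B := by
  refine h.isFree_of_avoid c fun σ g v w hv hw hvc hwc hg => ?_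
  obtain ⟨hv', gv⟩ := hlift v hv hvc
  obtain ⟨hw', gw⟩ := hlift w hw hwc
  -- Conjugated by the lifting germs, the germ lives on `A` and is an identity there. Injectivity
  -- turns it into a fixed point, and the two equal lifting signs cancel, which leaves `0 < σ`.
  obtain ⟨-, e, hs⟩ := h.germ_eq hA hAD hf hv' hw' (GGerm.comp (gv.comp hg) gw.inv)
  have hvw := hinj v hv w hw hvc hwc e
  rw [← hvw] at hg hs
  refine h.mem_stab_of_fixed hg ?_
  have := mul_self_pos.2 gv.sign_ne_zero
  by_contra hσ
  push Not at hσ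
  nlinarith

/-- A free interval that is glued from the image of the right part and the image of the left part
of a free interval under two transitions. -/
theorem FreeCurve.isFree_of_shift (h : FreeCurve E G δ U D) (hA : IsInterval A) (hAD : A ⊆ D)
    (hf : IsFree G δ U A) {ρ₁ ρ₂ : ℝ → ℝ} {V₁ V₂ : Set ℝ} {g₁ g₂ : G} {x : ℝ} (c : ℝ)
    (h₁ : GTransition δ U 1 g₁ ρ₁ V₁) (h₂ : GTransition δ U 1 g₂ ρ₂ V₂)
    (hl : ∀ v ∈ interior B, v ≠ c → (∃ v' ∈ interior A, v' ∈ V₁ ∧ x < v' ∧ ρ₁ v' = v) ∨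
      ∃ v' ∈ interior A, v' ∈ V₂ ∧ v' < x ∧ ρ₂ v' = v) : IsFree G δ U B := by
  have hl' : ∀ v : ℝ, ∃ (v' : ℝ) (k : G), v ∈ interior B → v ≠ c → v' ∈ interior A ∧
      GGerm δ U 1 k v' v ∧ ((x < v' ∧ ρ₁ v' = v) ∨ (v' < x ∧ ρ₂ v' = v)) := by
    intro v
    by_cases hv : v ∈ interior B ∧ v ≠ c
    · rcases hl v hv.1 hv.2 with ⟨v', e1, e2, e3, e4⟩ | ⟨v', e1, e2, e3, e4⟩
      · exact ⟨v', g₁, fun _ _ => ⟨e1, e4 ▸ h₁.germ e2, Or.inl ⟨e3, e4⟩⟩⟩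
      · exact ⟨v', g₂, fun _ _ => ⟨e1, e4 ▸ h₂.germ e2, Or.inr ⟨e3, e4⟩⟩⟩
    · exact ⟨0, 1, fun h1 h2 => absurd ⟨h1, h2⟩ hv⟩
  choose ψ k hψ using hl'
  refine h.isFree_of_lift hA hAD hf c ψ (fun _ => 1) k
    (fun v hv hvc => ⟨(hψ v hv hvc).1, (hψ v hv hvc).2.1⟩) fun v hv w hw hvc hwc e => ?_
  rcases (hψ v hv hvc).2.2 with ⟨e1, e2⟩ | ⟨e1, e2⟩ <;>
    rcases (hψ w hw hwc).2.2 with ⟨e3, e4⟩ | ⟨e3, e4⟩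
  · rw [← e2, ← e4, e]
  · linarith
  · linarith
  · rw [← e2, ← e4, e]

variable (G) in
/-- A compact free interval in the interior of `D` whose neighbours on both sides are its images,
by a translation or by a reflection at the common end point. -/
structure Tile (δ : ℝ → M) (U D : Set ℝ) (b a : ℝ) (kb ka : G) (eb ea : ℝ) : Prop where
  lt : b < a
  left : b ∈ interior D
  right : a ∈ interior D
  free : IsFree G δ U (Icc b a)
  nbr_left : (eb = a ∧ GGerm δ U 1 kb a b) ∨ (eb = b ∧ GGerm δ U (-1) kb b b)
  nbr_right : (ea = b ∧ GGerm δ U 1 ka b a) ∨ (ea = a ∧ GGerm δ U (-1) ka a a)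

variable {ka kb k : G} {ea eb : ℝ}

theorem FreeCurve.Icc_subset (h : FreeCurve E G δ U D) (hb : b ∈ interior D) (ha : a ∈ interior D) :
    Icc b a ⊆ D :=
  h.interval.1.out (interior_subset hb) (interior_subset ha)

/-- A larger free interval has `b` or `a` in its interior, where the neighbour germ is a nontrivial
germ inside a free interval. -/
theorem Tile.isMaxFree (hT : Tile G δ U D b a kb ka eb ea) (h : FreeCurve E G δ U D) :
    IsMaxFree G δ U D (Icc b a) := by
  refine ⟨isInterval_Icc hT.lt, h.Icc_subset hT.left hT.right, hT.free, ?_⟩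
  intro A' h1 h2 h3 h4 x hx
  have hbA : b ∈ A' := h3 (left_mem_Icc.2 hT.lt.le)
  have haA : a ∈ A' := h3 (right_mem_Icc.2 hT.lt.le)
  by_contra hcon
  rw [mem_Icc, not_and_or, not_le, not_le] at hcon
  rcases hcon with hxb | hxa
  · have hb := mem_interior_of_between h1.1 hx haA hxb hT.lt
    rcases hT.nbr_left with ⟨-, hg⟩ | ⟨-, hg⟩
    · exact hT.lt.ne' (h.germ_eq_of_mem' h1 h2 h4 haA hb hg).2.1
    · have := (h.germ_eq h1 h2 h4 hb hb hg).2.2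
      linarith
  · have ha := mem_interior_of_between h1.1 hbA hx hT.lt hxa
    rcases hT.nbr_right with ⟨-, hg⟩ | ⟨-, hg⟩
    · exact hT.lt.ne (h.germ_eq_of_mem' h1 h2 h4 hbA ha hg).2.1
    · have := (h.germ_eq h1 h2 h4 ha ha hg).2.2
      linarith

theorem Tile.of_translation (hba : b < a) (hb : b ∈ interior D) (ha : a ∈ interior D)
    (hf : IsFree G δ U (Icc b a)) (hg : GGerm δ U 1 k b a) : Tile G δ U D b a k⁻¹ k a b :=
  ⟨hba, hb, ha, hf, Or.inl ⟨rfl, hg.inv⟩, Or.inl ⟨rfl, hg⟩⟩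

/-- Without a reflection at `a`, the gapless translation is followed to the left until `b`. Its
values exceed `a` on the interior but come arbitrarily close to `a`, so `a` is the image of `b`. -/
theorem FreeCurve.right_neighbour (h : FreeCurve E G δ U D) (hba : b < a)
    (hA : IsMaxFree G δ U D (Icc b a)) (ha : a ∈ interior D) :
    (∃ k : G, GGerm δ U 1 k b a) ∨ ∃ k : G, GGerm δ U (-1) k a a := by
  by_contra hcon
  push Not at hcon
  obtain ⟨hno1, hno2⟩ := hcon
  obtain ⟨g, ρ, V, t₁, hρ, ht₁, htV, h1, h2⟩ := h.exists_translation hA (right_mem_Icc.2 hba.le)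
    (fun y hy => hy.2) ha hno2
  have hat := (h1 t₁ ht₁ le_rfl).2
  have hbD : b ∈ D := hA.sub (left_mem_Icc.2 hba.le)
  have hmono := hρ.strictMonoOn one_pos
  rw [interior_Icc] at ht₁ h1 h2
  rcases hρ.continuation (h.smul g) h.curve htV (h.sub hbD) (h.sub (interior_subset ha)) (by
      rw [one_mul]
      exact mul_nonneg_of_nonpos_of_nonpos (by linarith [ht₁.1]) (by linarith)) with
      ⟨e1, e2⟩ | ⟨x', e1, e2, e3⟩
  · rw [uIcc_of_ge hat.le] at e2
    refine hno1 g ?_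
    have : ρ b = a := by
      by_contra hne
      obtain ⟨u, hu, hu1, hu2⟩ := h2 (ρ b - a) (sub_pos.2 (lt_of_le_of_ne e2.1 (Ne.symm hne)))
      have := hmono e1 (h1 u hu hu1).1 hu.1
      linarith
    exact this ▸ hρ.germ e1
  · rw [uIcc_of_ge ht₁.1.le] at e2
    rcases eq_or_lt_of_le e2.1 with hb | hb
    · refine hno1 g ?_
      rw [← e3, hb]
      exact hρ.germ e1
    · have := (h1 x' ⟨hb, e2.2.trans_lt ht₁.2⟩ e2.2).2
      linarith

theorem IsMaxFree.of_neg (h : ActedCurve E G δ U)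
    (hA : IsMaxFree G (fun t => δ (-t)) (-U) (-D) (-A)) : IsMaxFree G δ U D A := by
  simpa using IsMaxFree.neg h.neg hA

theorem FreeCurve.exists_tile (h : FreeCurve E G δ U D) (hba : b < a)
    (hA : IsMaxFree G δ U D (Icc b a)) (hb : b ∈ interior D) (ha : a ∈ interior D) :
    ∃ (kb ka : G) (eb ea : ℝ), Tile G δ U D b a kb ka eb ea := by
  have hn := hA.neg h.toActedCurve
  rw [neg_Icc] at hn
  have hr : ∃ (ka : G) (ea : ℝ), (ea = b ∧ GGerm δ U 1 ka b a) ∨ (ea = a ∧ GGerm δ U (-1) ka a a) := by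
    rcases h.right_neighbour hba hA ha with ⟨k, hk⟩ | ⟨k, hk⟩
    · exact ⟨k, b, Or.inl ⟨rfl, hk⟩⟩
    · exact ⟨k, a, Or.inr ⟨rfl, hk⟩⟩
  have hl : ∃ (kb : G) (eb : ℝ), (eb = a ∧ GGerm δ U 1 kb a b) ∨ (eb = b ∧ GGerm δ U (-1) kb b b) := by
    rcases h.neg.right_neighbour (neg_lt_neg hba) hn (by rw [interior_neg_eq]; simpa using hb) with
      ⟨k, hk⟩ | ⟨k, hk⟩
    · exact ⟨k, a, Or.inl ⟨rfl, by simpa using hk.of_neg h.toActedCurve⟩⟩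
    · exact ⟨k, b, Or.inr ⟨rfl, by simpa using hk.of_neg h.toActedCurve⟩⟩
  obtain ⟨ka, ea, hr⟩ := hr
  obtain ⟨kb, eb, hl⟩ := hl
  exact ⟨kb, ka, eb, ea, hba, hb, ha, hA.free, hl, hr⟩

/-- For `u` in `A` translated to `ρ u` slightly beyond `a`, the interval `[u, ρ u]` is glued from
`[u, a]` and the translate of the points of `A` just left of `u`. It is free, and the translation
from `u` to `ρ u` makes it a tile. This works even when `A` is not compact. -/
theorem FreeCurve.exists_compact_of_no_reflection (h : FreeCurve E G δ U D)
    (hA : IsMaxFree G δ U D A)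
    (haA : a ∈ A) (hAa : ∀ y ∈ A, y ≤ a) (haD : a ∈ interior D)
    (hno : ∀ g : G, ¬ GGerm δ U (-1) g a a) :
    ∃ b' a' : ℝ, b' < a' ∧ b' ∈ interior D ∧ a' ∈ interior D ∧ IsMaxFree G δ U D (Icc b' a') := by
  obtain ⟨g, ρ, V, t₁, hρ, ht₁, htV, h1, h2⟩ := h.exists_translation hA haA hAa haD hno
  obtain ⟨q, hqD, haq⟩ := exists_gt_mem_of_mem_interior haD
  obtain ⟨u, hu, hut, hρu⟩ := h2 (q - a) (by linarith)
  obtain ⟨huV, hau⟩ := h1 u hu hut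
  have hmono := hρ.strictMonoOn one_pos
  have hua : u < a := by
    obtain ⟨v, hv, htv⟩ := exists_gt_mem_of_mem_interior hu
    exact htv.trans_le (hAa v hv)
  have huD : u ∈ interior D := interior_mono hA.sub hu
  have hρD : ρ u ∈ interior D :=
    mem_interior_of_between h.interval.1 (hA.sub haA) hqD hau (by linarith)
  refine ⟨u, ρ u, hua.trans hau, huD, hρD, (Tile.of_translation (hua.trans hau) huD hρD
    (h.isFree_of_shift hA.interval hA.sub hA.free (x := u) a
      (gTransition_id h.curve.dom (one_mem _)) hρ.toTransition ?_) (hρ.germ huV)).isMaxFree h⟩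
  intro v hv hva
  rw [interior_Icc] at hv
  obtain ⟨y, hyA, hyu⟩ := exists_lt_mem_of_mem_interior hu
  rcases lt_or_gt_of_ne hva with hva | hva
  · have hvA : v ∈ interior A := mem_interior_of_between hA.interval.1 hyA haA (hyu.trans hv.1) hva
    exact Or.inl ⟨v, hvA, h.sub (hA.sub (interior_subset hvA)), hv.1, rfl⟩
  · obtain ⟨u', hu', hut', hρu'⟩ := h2 (v - a) (by linarith)
    obtain ⟨huV', -⟩ := h1 u' hu' hut'
    have huu : u' < u := by
      by_contra hge
      push Not at hge
      linarith [hmono.monotoneOn huV huV' hge, hv.2]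
    obtain ⟨z, hz, hzv⟩ := intermediate_value_Ioo huu.le
      (hρ.continuousOn.mono (hρ.dom.2.1.out huV' huV)) (show v ∈ Ioo (ρ u') (ρ u) from
        ⟨by linarith, hv.2⟩)
    exact Or.inr ⟨z, hA.interval.interior_interval.1.out hu' hu ⟨hz.1.le, hz.2.le⟩,
      hρ.dom.2.1.out huV' huV ⟨hz.1.le, hz.2.le⟩, hz.2, hzv⟩

theorem FreeCurve.sSup_mem_interior (h : FreeCurve E G δ U D) (hA : IsMaxFree G δ U D A) {x : ℝ}
    (hx : x ∈ D) (hxA : ∀ y ∈ A, y < x) : sSup A ∈ interior D := by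
  obtain ⟨haA, hAa⟩ := h.isGreatest_sSup hA hx hxA
  obtain ⟨t, ht⟩ := hA.interval.2
  obtain ⟨q, hq, htq⟩ := exists_gt_mem_of_mem_interior ht
  exact mem_interior_of_between h.interval.1 (hA.sub (interior_subset ht)) hx
    (htq.trans_le (hAa q hq)) (hxA _ haA)

theorem FreeCurve.eq_Icc_of_bounded (h : FreeCurve E G δ U D) (hA : IsMaxFree G δ U D A)
    {x y : ℝ} (hx : x ∈ D) (hxA : ∀ z ∈ A, z < x) (hy : y ∈ D) (hyA : ∀ z ∈ A, y < z) :
    ∃ b a : ℝ, b < a ∧ b ∈ interior D ∧ a ∈ interior D ∧ A = Icc b a := by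
  have hn := hA.neg h.toActedCurve
  have hyA' : ∀ z ∈ -A, z < -y := fun z hz => by have := hyA (-z) hz; linarith
  obtain ⟨haA, hAa⟩ := h.isGreatest_sSup hA hx hxA
  obtain ⟨hbA, hAb⟩ := h.neg.isGreatest_sSup hn (x := -y) (by simpa using hy) hyA'
  have hbD := h.neg.sSup_mem_interior hn (x := -y) (by simpa using hy) hyA'
  rw [interior_neg_eq] at hbD
  have hAb' : ∀ z ∈ A, -sSup (-A) ≤ z := fun z hz => by
    have := hAb (-z) (by simpa using hz)
    linarith
  have hAeq : A = Icc (-sSup (-A)) (sSup A) :=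
    Subset.antisymm (fun z hz => ⟨hAb' z hz, hAa z hz⟩) (hA.interval.1.out hbA haA)
  refine ⟨_, _, ?_, hbD, h.sSup_mem_interior hA hx hxA, hAeq⟩
  obtain ⟨t, ht⟩ := hA.interval.2
  rw [hAeq, interior_Icc] at ht
  exact ht.1.trans ht.2

/-- Only a reflection at `a` with `A` filling `D` to the left of `a` needs work. Folding by the
reflection makes a right neighbourhood of `a` free; a maximal free interval around it starts at `a`,
and either fills the rest of `D` or is compact. -/
theorem FreeCurve.dichotomy_right (h : FreeCurve E G δ U D) (hA : IsMaxFree G δ U D A) {x : ℝ}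
    (hx : x ∈ D) (hxA : ∀ y ∈ A, y < x) :
    (∃ b a : ℝ, b < a ∧ b ∈ interior D ∧ a ∈ interior D ∧ IsMaxFree G δ U D (Icc b a)) ∨
    ∃ τ ∈ interior D, ∃ g : G, GGerm δ U (-1) g τ τ ∧ IsFree G δ U (D ∩ Iic τ) ∧
      IsFree G δ U (D ∩ Ici τ) := by
  obtain ⟨haA, hAa⟩ := h.isGreatest_sSup hA hx hxA
  have haD := h.sSup_mem_interior hA hx hxA
  set a := sSup A
  by_cases hno : ∀ g : G, ¬ GGerm δ U (-1) g a a
  · exact Or.inl (h.exists_compact_of_no_reflection hA haA hAa haD hno)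
  push Not at hno
  obtain ⟨g, hg⟩ := hno
  by_cases hy : ∃ y ∈ D, ∀ z ∈ A, y < z
  · obtain ⟨y, hyD, hyA⟩ := hy
    obtain ⟨b, a', h1, h2, h3, hAba⟩ := h.eq_Icc_of_bounded hA hx hxA hyD hyA
    exact Or.inl ⟨b, a', h1, h2, h3, hAba ▸ hA⟩
  have hAeq : D ∩ Iic a ⊆ A := by
    rintro u ⟨huD, hua⟩
    by_contra huA
    rcases forall_lt_or_forall_gt_of_notMem hA.interval.1 huA with h1 | h1
    · exact absurd (h1 a haA) (not_lt.2 hua)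
    · exact hy ⟨u, huD, h1⟩
  obtain ⟨κ, W, hκ, haW, hWD, hκa⟩ := h.exists_transition hg.inv (isOpen_interior.mem_nhds haD)
  have hanti := hκ.strictAntiOn (by norm_num)
  obtain ⟨ε, hε, hball⟩ := Metric.mem_nhds_iff.1 (inter_mem (hκ.dom.1.mem_nhds haW)
    ((hκ.continuousAt haW).preimage_mem_nhds (hκa.symm ▸ isOpen_interior.mem_nhds haD)))
  have hIcc : Icc a (a + ε / 2) ⊆ Metric.ball a ε := by
    intro u hu
    rw [Metric.mem_ball, Real.dist_eq, abs_lt]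
    constructor <;> linarith [hu.1, hu.2]
  have hIccD : Icc a (a + ε / 2) ⊆ D := fun u hu => interior_subset (hWD (hball (hIcc hu)).1)
  have hfree : IsFree G δ U (Icc a (a + ε / 2)) := by
    refine h.isFree_of_lift hA.interval hA.sub hA.free a κ (fun _ => -1) (fun _ => g)
      (fun v hv _ => ⟨?_, ?_⟩) fun v hv w hw _ _ e => ?_
    · rw [interior_Icc] at hv
      have hv' := hball (hIcc ⟨hv.1.le, hv.2.le⟩)
      have hlt := hanti haW hv'.1 hv.1
      rw [hκa] at hlt
      refine mem_interior.2 ⟨interior D ∩ Iio a, ?_, isOpen_interior.inter isOpen_Iio, hv'.2, hlt⟩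
      exact fun u hu => hAeq ⟨interior_subset hu.1, le_of_lt (show u < a from hu.2)⟩
    · have := GGerm.inv (hκ.germ (hball (hIcc (interior_subset hv))).1)
      simpa using this
    · exact hκ.injOn (hball (hIcc (interior_subset hv))).1 (hball (hIcc (interior_subset hw))).1 e
  obtain ⟨B, hB, hBm⟩ := exists_isMaxFree (isInterval_Icc (by linarith)) hIccD hfree
  have haB : a ∈ B := hB (left_mem_Icc.2 (by linarith))
  -- Otherwise the reflection point `a` would be interior to the free interval `B`.
  have hBa : ∀ y ∈ B, a ≤ y := by
    intro y hyB
    by_contra hya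
    push Not at hya
    have := mem_interior_of_between hBm.interval.1 hyB
      (hB (right_mem_Icc.2 (show a ≤ a + ε / 2 by linarith))) hya (by linarith)
    linarith [(h.germ_eq hBm.interval hBm.sub hBm.free this this hg).2.2]
  by_cases hDB : D ∩ Ici a ⊆ B
  · exact Or.inr ⟨a, haD, g, hg, hA.free.mono (interior_mono hAeq),
      hBm.free.mono (interior_mono hDB)⟩
  · obtain ⟨y, ⟨hyD, hay⟩, hyB⟩ := not_subset.1 hDB
    have hBy : ∀ z ∈ B, z < y := by
      rcases forall_lt_or_forall_gt_of_notMem hBm.interval.1 hyB with h1 | h1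
      · exact h1
      · exact absurd (h1 a haB) (not_lt.2 hay)
    obtain ⟨q, hqD, hqa⟩ := exists_lt_mem_of_mem_interior haD
    obtain ⟨b', a', h1, h2, h3, rfl⟩ := h.eq_Icc_of_bounded hBm hyD hBy hqD
      fun z hz => hqa.trans_le (hBa z hz)
    exact Or.inl ⟨b', a', h1, h2, h3, hBm⟩

/-- A free curve that is not a free segment has a compact maximal interval in the interior of its
domain, or it consists of two free segments that meet at a reflection point. -/
theorem FreeCurve.dichotomy (h : FreeCurve E G δ U D) :
    (∃ b a : ℝ, b < a ∧ b ∈ interior D ∧ a ∈ interior D ∧ IsMaxFree G δ U D (Icc b a)) ∨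
    ∃ τ ∈ interior D, ∃ g : G, GGerm δ U (-1) g τ τ ∧ IsFree G δ U (D ∩ Iic τ) ∧
      IsFree G δ U (D ∩ Ici τ) := by
  obtain ⟨A₀, h1, h2, h3⟩ := h.exists_free
  obtain ⟨A, -, hA⟩ := exists_isMaxFree h1 h2 h3
  obtain ⟨x, hxD, hxA⟩ : ∃ x ∈ D, x ∉ A := by
    by_contra hcon
    push Not at hcon
    exact h.not_free (hA.free.mono (interior_mono hcon))
  rcases forall_lt_or_forall_gt_of_notMem hA.interval.1 hxA with hx | hx
  · exact h.dichotomy_right hA hxD hx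
  · rcases h.neg.dichotomy_right (hA.neg h.toActedCurve) (x := -x) (by simpa using hxD)
      (fun y hy => by have := hx (-y) hy; linarith) with
      ⟨b, a, h1, h2, h3, h4⟩ | ⟨τ, h1, g, h2, h3, h4⟩
    · rw [interior_neg_eq] at h2 h3
      refine Or.inl ⟨-a, -b, by linarith, h3, h2, IsMaxFree.of_neg h.toActedCurve ?_⟩
      rwa [neg_Icc, neg_neg, neg_neg]
    · rw [interior_neg_eq] at h1
      refine Or.inr ⟨-τ, h1, g, h2.of_neg h.toActedCurve, IsFree.of_neg h.toActedCurve ?_,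
        IsFree.of_neg h.toActedCurve ?_⟩
      · rwa [inter_neg, neg_Iic, neg_neg]
      · rwa [inter_neg, neg_Ici, neg_neg]

end Classification

end AnalyticCurve

namespace AnalyticCurve

/-! ### Translation between overlaps, carried pieces and transitions. -/

section Interface

variable {E : Type*} [NormedAddCommGroup E] [NormedSpace ℝ E] [CompleteSpace E]
  {M : Type*} [TopologicalSpace M] [ChartedSpace E M] [IsManifold 𝓘(ℝ, E) ω M] [T2Space M]
  {G : Type*} [Group G] [MulAction G M]
  {δ γ : ℝ → M} {U A B C D J J' V V' : Set ℝ} {σ σ' : ℝ} {g g' : G} {t s r : ℝ}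
  {μ ρ ρ' f : ℝ → ℝ}

theorem ActedCurve.isMaximalInterval_iff (h : ActedCurve E G δ U) (hDU : D ⊆ U)
    (he : EqOn γ δ D) : IsMaximalInterval G γ D A ↔ IsMaxFree G δ U D A := by
  constructor
  · rintro ⟨h1, h2, h3, h4⟩
    refine ⟨h1, h2, (h.isFreeSegment_iff (h2.trans hDU) (he.mono h2)).1 h3, ?_⟩
    intro A' hA' hA'D hAA' hf
    exact (h4 A' hA' hA'D hAA'
      ((h.isFreeSegment_iff (hA'D.trans hDU) (he.mono hA'D)).2 hf)).subset
  · rintro ⟨h1, h2, h3, h4⟩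
    refine ⟨h1, h2, (h.isFreeSegment_iff (h2.trans hDU) (he.mono h2)).2 h3, ?_⟩
    intro A' hA' hA'D hAA' hf
    exact (h4 A' hA' hA'D hAA'
      ((h.isFreeSegment_iff (hA'D.trans hDU) (he.mono hA'D)).1 hf)).antisymm hAA'

theorem exists_sign_of_deriv_ne_zero (hU : IsOpenInterval U) (hf : AnalyticOnNhd ℝ f U)
    (hd : ∀ t ∈ U, deriv f t ≠ 0) : ∃ σ : ℝ, (σ = 1 ∨ σ = -1) ∧ ∀ t ∈ U, 0 < σ * deriv f t := by
  obtain ⟨x, hx⟩ := hU.2.2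
  have hpre : IsPreconnected (deriv f '' U) :=
    hU.2.1.isPreconnected.image _ hf.deriv.continuousOn
  rcases lt_or_gt_of_ne (hd x hx) with h | h
  · refine ⟨-1, Or.inr rfl, fun t ht => ?_⟩
    by_contra hcon
    have : (0 : ℝ) ∈ deriv f '' U :=
      hpre.ordConnected.out ⟨x, hx, rfl⟩ ⟨t, ht, rfl⟩ ⟨h.le, by linarith⟩
    obtain ⟨z, hz, hz0⟩ := this
    exact hd z hz hz0
  · refine ⟨1, Or.inl rfl, fun t ht => ?_⟩
    by_contra hcon
    have : (0 : ℝ) ∈ deriv f '' U :=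
      hpre.ordConnected.out ⟨t, ht, rfl⟩ ⟨x, hx, rfl⟩ ⟨by linarith, h.le⟩
    obtain ⟨z, hz, hz0⟩ := this
    exact hd z hz hz0

/-- An immersive extension of a map carrying `γ|_B` into `γ` is a transition wherever this makes
sense. -/
theorem ActedCurve.exists_gTransition (h : ActedCurve E G δ U) (hB : IsInterval B) (hBU : B ⊆ U)
    {U₁ : Set ℝ} (hf : IsImmersiveExtension μ B f U₁) (hμ : MapsTo μ B U)
    (hg : ∀ t ∈ B, g • δ t = δ (μ t)) :
    ∃ σ : ℝ, (σ = 1 ∨ σ = -1) ∧ GTransition δ U σ g f (U₁ ∩ U ∩ f ⁻¹' U) ∧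
      B ⊆ U₁ ∩ U ∩ f ⁻¹' U := by
  obtain ⟨hU₁, hBU₁, han, hder, heq⟩ := hf
  obtain ⟨σ, hσ, hpos⟩ := exists_sign_of_deriv_ne_zero hU₁ han hder
  have hsub : B ⊆ U₁ ∩ U ∩ f ⁻¹' U := fun t ht =>
    ⟨⟨hBU₁ ht, hBU ht⟩, by rw [mem_preimage, heq ht]; exact hμ ht⟩
  have hU := h.curve.dom
  have hmon : MonotoneOn f U₁ ∨ AntitoneOn f U₁ := by
    rcases hσ with rfl | rfl
    · refine Or.inl (monotoneOn_of_deriv_nonneg hU₁.2.1.convex han.continuousOn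
        (fun t ht => (han t (interior_subset ht)).differentiableAt.differentiableWithinAt)
        fun t ht => ?_)
      have := hpos t (interior_subset ht)
      linarith
    · refine Or.inr (antitoneOn_of_deriv_nonpos hU₁.2.1.convex han.continuousOn
        (fun t ht => (han t (interior_subset ht)).differentiableAt.differentiableWithinAt)
        fun t ht => ?_)
      have := hpos t (interior_subset ht)
      linarith
  have hopen : IsOpen (U₁ ∩ U ∩ f ⁻¹' U) :=
    (han.continuousOn.mono inter_subset_left).isOpen_inter_preimage (hU₁.1.inter hU.1) hU.1
  -- Monotonicity of `f` makes the set on which it stays inside `U` an interval; the relation `g • δ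
  -- = δ ∘ f` then spreads from `B` over it by the identity theorem.
  have hord : (U₁ ∩ U ∩ f ⁻¹' U).OrdConnected := by
    constructor
    rintro x ⟨⟨hx1, hx2⟩, hx3⟩ y ⟨⟨hy1, hy2⟩, hy3⟩ z hz
    have hz1 := hU₁.2.1.out hx1 hy1 hz
    refine ⟨⟨hz1, hU.2.1.out hx2 hy2 hz⟩, ?_⟩
    rcases hmon with hm | hm
    · exact hU.2.1.out hx3 hy3 ⟨hm hx1 hz1 hz.1, hm hz1 hy1 hz.2⟩
    · exact hU.2.1.out hy3 hx3 ⟨hm hz1 hy1 hz.2, hm hx1 hz1 hz.1⟩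
  obtain ⟨x, hx⟩ := hB.2
  have hxV := hsub (interior_subset hx)
  have hdom : IsOpenInterval (U₁ ∩ U ∩ f ⁻¹' U) := ⟨hopen, hord, ⟨x, hxV⟩⟩
  refine ⟨σ, hσ, ⟨hdom, fun t ht => ht.1.2, fun t ht => ht.2, fun t ht => han t ht.1.1,
    fun t ht => hpos t ht.1.1, ?_⟩, hsub⟩
  refine eqOn_of_eventuallyEq (E := E) hopen hord.isPreconnected
    (((h.smul g).smooth).mono fun t ht => ht.1.2) ?_ hxV ?_
  · refine h.curve.smooth.comp (I' := 𝓘(ℝ, ℝ)) ?_ fun t ht => ht.2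
    intro t ht
    exact (han t ht.1.1).contDiffAt.contMDiffAt.contMDiffWithinAt
  · refine Eventually.frequently ?_
    filter_upwards [mem_nhdsWithin_of_mem_nhds (isOpen_interior.mem_nhds hx)] with u hu
    have hu' := interior_subset hu
    show g • δ u = δ (f u)
    rw [heq hu', hg u hu']

theorem ActedCurve.subset_of_transition (h : ActedCurve E G δ U)
    (h₁ : GTransition δ U σ g ρ V) (hB : IsInterval B) (hBV : B ⊆ V) :
    ∃ ρ' V', GMaxTransition δ U σ g ρ' V' ∧ V ⊆ V' ∧ EqOn ρ ρ' V := by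
  obtain ⟨x, hx⟩ := hB.2
  have hxV := hBV (interior_subset hx)
  obtain ⟨ρ', V', hm, hx', he⟩ := h.exists_max (h₁.germ hxV)
  have hsub : V ⊆ V' := hm.max ρ V h₁ ⟨x, hx', hxV, he⟩
  refine ⟨ρ', V', hm, hsub, ?_⟩
  have := Transition.eqOn h.curve h₁ hm.toTransition hxV hx' he.symm
  exact fun t ht => this ⟨ht, hsub ht⟩

/-- Every diffeomorphism occurring in a decomposition is a restriction of a maximal transition, so
the rigidity of transitions applies to arbitrary decompositions and not only to constructed ones. -/
theorem ActedCurve.exists_max_of_carries (h : ActedCurve E G δ U) (hDU : D ⊆ U)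
    (he : EqOn γ δ D) (hB : IsInterval B) (hBD : B ⊆ D) (hCD : C ⊆ D)
    (hc : Carries g γ B μ C) :
    ∃ (σ : ℝ) (ρ : ℝ → ℝ) (V : Set ℝ), (σ = 1 ∨ σ = -1) ∧ GMaxTransition δ U σ g ρ V ∧
      B ⊆ V ∧ EqOn μ ρ B ∧ ρ '' B = C := by
  obtain ⟨⟨⟨f, U₁, hf⟩, himg⟩, hcar⟩ := hc
  have hmap : MapsTo μ B D := fun t ht => hCD (himg ▸ mem_image_of_mem μ ht)
  obtain ⟨σ, hσ, htr, hsub⟩ := h.exists_gTransition (g := g) hB (hBD.trans hDU) hf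
    (fun t ht => hDU (hmap ht)) (fun t ht => by
      rw [← he (hBD ht), ← he (hmap ht)]; exact hcar t ht)
  obtain ⟨ρ, V, hm, hV, hρ⟩ := h.subset_of_transition htr hB hsub
  have hμρ : EqOn μ ρ B := fun t ht => (hf.2.2.2.2 ht).symm.trans (hρ (hsub ht))
  exact ⟨σ, ρ, V, hσ, hm, hsub.trans hV, hμρ, himg ▸ (hμρ.image_eq).symm⟩

theorem Transition.carries (hm : GTransition δ U σ g ρ V) (he : EqOn γ δ D) (hBD : B ⊆ D)
    (hCD : ρ '' B ⊆ D) (hBV : B ⊆ V) : Carries g γ B ρ (ρ '' B) := by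
  refine ⟨⟨⟨ρ, V, hm.dom, hBV, hm.an, fun t ht h0 => ?_, fun t _ => rfl⟩, rfl⟩, fun t ht => ?_⟩
  · have := hm.der t ht
    rw [h0] at this
    simp at this
  · rw [he (hBD ht), he (hCD ⟨t, ht, rfl⟩)]
    exact hm.eq t (hBV ht)

theorem Transition.maximalExtensionEq {δ₁ δ₂ : ℝ → M} {U₁ U₂ S : Set ℝ}
    (hm : Transition σ δ₁ U₁ δ₂ U₂ ρ' V) (hJ : J ⊆ V) (hρ : EqOn ρ ρ' J) (hS : S ⊆ V)
    (hμ : EqOn μ ρ' S) : MaximalExtensionEq ρ J μ S := by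
  refine ⟨ρ', V, ⟨hm.dom, hJ, hm.an, fun t ht h0 => ?_, hρ.symm⟩, hS, hμ.symm⟩
  have := hm.der t ht
  rw [h0] at this
  simp at this

theorem ActedCurve.exists_transition_of_overlapVia (h : ActedCurve E G δ U) (hDU : D ⊆ U)
    (he : EqOn γ δ D) (hAD : A ⊆ D) (ho : OverlapVia (fun t => g • γ t) A γ D ρ J J') :
    ∃ σ : ℝ, (σ = 1 ∨ σ = -1) ∧ GTransition δ U σ g ρ J ∧ MapsTo ρ J (interior D) := by
  obtain ⟨hJ, hJ', hJA, hJD, -, -, ⟨⟨f, U₁, hf⟩, himg⟩, heq⟩ := ho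
  have hmap : MapsTo ρ J D := fun t ht => hJD (himg ▸ mem_image_of_mem ρ ht)
  obtain ⟨σ, hσ, htr, hsub⟩ := h.exists_gTransition (g := g) hJ.isInterval
    (hJA.trans (hAD.trans hDU)) hf
    (fun t ht => hDU (hmap ht)) (fun t ht => by
      rw [← he (hAD (hJA ht)), ← he (hmap ht)]; exact heq t ht)
  refine ⟨σ, hσ, (htr.mono hJ hsub).congr hf.2.2.2.2.symm, fun t ht => ?_⟩
  exact interior_maximal hJD hJ'.1 (himg ▸ mem_image_of_mem ρ ht)

/-- Two overlaps whose maximal extension restricts to the maps of two transitions. -/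
theorem ActedCurve.max_of_maximalExtensionEq (h : ActedCurve E G δ U) (hDU : D ⊆ U)
    {S : Set ℝ} {gn : G} {ρn : ℝ → ℝ} {Vn : Set ℝ} (hJ : IsOpenInterval J) (hJU : J ⊆ U)
    (htr : GTransition δ U σ g ρ J) (hS : IsInterval S) (hSU : S ⊆ D) (hSD : MapsTo μ S D)
    (hm : GMaxTransition δ U σ' gn ρn Vn) (hSV : S ⊆ Vn) (hμ : EqOn μ ρn S)
    (hcls : g⁻¹ * gn ∈ curveStab G δ U) (hext : MaximalExtensionEq ρ J μ S) :
    J ⊆ Vn ∧ EqOn ρ ρn J ∧ 0 < σ * σ' := by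
  obtain ⟨f, U₁, hf, hSU₁, hfμ⟩ := hext
  obtain ⟨σ₁, hσ₁, htr₁, hsub⟩ := h.exists_gTransition (g := g) hJ.isInterval hJU hf
    htr.maps htr.eq
  have hSV₁ : S ⊆ U₁ ∩ U ∩ f ⁻¹' U := fun t ht =>
    ⟨⟨hSU₁ ht, hDU (hSU ht)⟩, by rw [mem_preimage, hfμ ht]; exact hDU (hSD ht)⟩
  have htr₂ : GTransition δ U σ₁ gn f (U₁ ∩ U ∩ f ⁻¹' U) :=
    htr₁.congr_left (curveStab_smul_eqOn hcls)
  obtain ⟨x, hx⟩ := hS.2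
  have hxS := interior_subset hx
  have hfn : EqOn f ρn S := hfμ.trans hμ
  have hder : deriv f x = deriv ρn x := by
    refine Filter.EventuallyEq.deriv_eq ?_
    filter_upwards [isOpen_interior.mem_nhds hx] with u hu using hfn (interior_subset hu)
  have hσσ : 0 < σ₁ * σ' := by
    have h1 := htr₂.der x (hSV₁ hxS)
    have h2 := hm.der x (hSV hxS)
    rw [hder] at h1
    have h3 : 0 < σ₁ * σ' * (deriv ρn x * deriv ρn x) := by nlinarith [mul_pos h1 h2]
    exact pos_of_mul_pos_left h3 (mul_self_nonneg _)
  have hsub₂ : U₁ ∩ U ∩ f ⁻¹' U ⊆ Vn := hm.max f _ (htr₂.of_sign (by linarith))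
    ⟨x, hSV hxS, hSV₁ hxS, (hfn hxS).symm⟩
  have hE := Transition.eqOn h.curve htr₂ hm.toTransition (hSV₁ hxS) (hSV hxS) (hfn hxS)
  have hJV : J ⊆ Vn := hsub.trans hsub₂
  have hρn : EqOn ρ ρn J := fun t ht => (hf.2.2.2.2 ht).symm.trans (hE ⟨hsub ht, hJV ht⟩)
  refine ⟨hJV, hρn, ?_⟩
  obtain ⟨y, hy⟩ := hJ.2.2
  have hdy : deriv ρ y = deriv ρn y := by
    refine Filter.EventuallyEq.deriv_eq ?_
    filter_upwards [hJ.1.mem_nhds hy] with u hu using hρn hu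
  have h1 := htr.der y hy
  have h2 := hm.der y (hJV hy)
  rw [hdy] at h1
  have h3 : 0 < σ * σ' * (deriv ρn y * deriv ρn y) := by nlinarith [mul_pos h1 h2]
  exact pos_of_mul_pos_left h3 (mul_self_nonneg _)

theorem Transition.isPos {δ₁ δ₂ : ℝ → M} {U₁ U₂ S : Set ℝ}
    (hm : Transition σ δ₁ U₁ δ₂ U₂ ρ V) (hS : S ⊆ V) (hμ : EqOn μ ρ S) (hσ : 0 < σ) :
    IsPos μ S := by
  intro t ht
  have : deriv μ t = deriv ρ t := by
    refine Filter.EventuallyEq.deriv_eq ?_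
    filter_upwards [isOpen_interior.mem_nhds ht] with u hu using hμ (interior_subset hu)
  rw [this]
  exact (pos_iff_pos_of_mul_pos (hm.der t (hS (interior_subset ht)))).1 hσ

theorem Transition.isNeg {δ₁ δ₂ : ℝ → M} {U₁ U₂ S : Set ℝ}
    (hm : Transition σ δ₁ U₁ δ₂ U₂ ρ V) (hS : S ⊆ V) (hμ : EqOn μ ρ S) (hσ : σ < 0) :
    IsNeg μ S := by
  intro t ht
  have : deriv μ t = deriv ρ t := by
    refine Filter.EventuallyEq.deriv_eq ?_
    filter_upwards [isOpen_interior.mem_nhds ht] with u hu using hμ (interior_subset hu)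
  rw [this]
  have := hm.der t (hS (interior_subset ht))
  by_contra hcon
  push Not at hcon
  nlinarith

end Interface

end AnalyticCurve

namespace AnalyticCurve

/-! ### Curves that split at a reflection point. -/

section TauCase

variable {E : Type*} [NormedAddCommGroup E] [NormedSpace ℝ E] [CompleteSpace E]
  {M : Type*} [TopologicalSpace M] [ChartedSpace E M] [IsManifold 𝓘(ℝ, E) ω M] [T2Space M]
  {G : Type*} [Group G] [MulAction G M]
  {δ γ : ℝ → M} {U A B C D J J' V V' : Set ℝ} {σ σ' : ℝ} {g g' : G} {t s r τ τ' : ℝ}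
  {μ ρ ρ' f : ℝ → ℝ}

theorem Transition.ordConnected_dom {δ₁ δ₂ : ℝ → M} {U₁ U₂ : Set ℝ}
    (hm : Transition σ δ₁ U₁ δ₂ U₂ ρ V) (hA : A.OrdConnected) (hD : D.OrdConnected) :
    {t | t ∈ A ∧ t ∈ V ∧ ρ t ∈ D}.OrdConnected := by
  constructor
  rintro x ⟨hx1, hx2, hx3⟩ y ⟨hy1, hy2, hy3⟩ z hz
  have hzV := hm.dom.2.1.out hx2 hy2 hz
  refine ⟨hA.out hx1 hy1 hz, hzV, ?_⟩
  rcases lt_or_gt_of_ne hm.sign_ne_zero with hσ | hσ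
  · have := (hm.strictAntiOn hσ).antitoneOn
    exact hD.out hy3 hx3 ⟨this hzV hy2 hz.2, this hx2 hzV hz.1⟩
  · have := (hm.strictMonoOn hσ).monotoneOn
    exact hD.out hx3 hy3 ⟨this hx2 hzV hz.1, this hzV hy2 hz.2⟩

theorem FreeCurve.cls_eq_cls_iff (h : FreeCurve E G δ U D) (he : EqOn γ δ D) :
    cls γ D g = cls γ D g' ↔ g⁻¹ * g' ∈ curveStab G δ U := by
  rw [cls_eq_iff, h.curveStab_eq h.interval h.sub he]

theorem FreeCurve.cls_ne_cls_one_iff (h : FreeCurve E G δ U D) (he : EqOn γ δ D) :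
    cls γ D g ≠ cls γ D 1 ↔ g ∉ curveStab G δ U := by
  rw [cls_ne_one_iff, h.curveStab_eq h.interval h.sub he]

theorem FreeCurve.isInterval_left (h : FreeCurve E G δ U D) (hτ : τ ∈ interior D) :
    IsInterval (D ∩ Iic τ) := by
  obtain ⟨q, hq, hqτ⟩ := exists_lt_mem_of_mem_interior hτ
  have hord : (D ∩ Iic τ).OrdConnected := h.interval.1.inter ordConnected_Iic
  refine ⟨hord, (q + τ) / 2, ?_⟩
  exact mem_interior_of_between hord ⟨hq, hqτ.le⟩ ⟨interior_subset hτ, self_mem_Iic⟩ (by linarith)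
    (by linarith)

theorem FreeCurve.isInterval_right (h : FreeCurve E G δ U D) (hτ : τ ∈ interior D) :
    IsInterval (D ∩ Ici τ) := by
  obtain ⟨q, hq, hqτ⟩ := exists_gt_mem_of_mem_interior hτ
  have hord : (D ∩ Ici τ).OrdConnected := h.interval.1.inter ordConnected_Ici
  refine ⟨hord, (q + τ) / 2, ?_⟩
  exact mem_interior_of_between hord ⟨interior_subset hτ, self_mem_Ici⟩ ⟨hq, hqτ.le⟩ (by linarith)
    (by linarith)

/-- A reflection point at which the curve falls apart into two free halves. -/
structure IsReflectionPoint (G : Type*) [Group G] [MulAction G M] (δ : ℝ → M) (U D : Set ℝ)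
    (τ : ℝ) (g : G) : Prop where
  mem : τ ∈ interior D
  germ : GGerm δ U (-1) g τ τ
  left : IsFree G δ U (D ∩ Iic τ)
  right : IsFree G δ U (D ∩ Ici τ)

theorem FreeCurve.isReflectionPoint_of (h : FreeCurve E G δ U D) (he : EqOn γ δ D)
    (hd : IsTauDecomposition γ D τ g B μ) :
    IsReflectionPoint G δ U D τ g ∧ ∃ (ρ : ℝ → ℝ) (V : Set ℝ), GMaxTransition δ U (-1) g ρ V ∧
      B ⊆ V ∧ EqOn μ ρ B ∧ ρ τ = τ := by
  obtain ⟨σ, ρ, V, hσ, hm, hBV, hμ, -⟩ := h.toActedCurve.exists_max_of_carries h.sub he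
    hd.interval (hd.subset_left.trans inter_subset_left)
    (hd.subset_right.trans inter_subset_left) hd.carries
  have hfix : ρ τ = τ := by rw [← hμ hd.tau_mem]; exact hd.map_tau
  have hg := hm.germ (hBV hd.tau_mem)
  rw [hfix] at hg
  -- `μ` fixes `τ`, so with positive orientation `g` would stabilize the curve, against `[g] ≠ [e]`.
  have hσ' : σ = -1 := by
    refine hσ.resolve_left fun h1 => ?_
    exact (h.cls_ne_cls_one_iff he).1 hd.ne_one
      (h.mem_stab_of_fixed hg (by rw [h1]; norm_num))
  subst hσ'
  refine ⟨⟨hd.mem, hg, ?_, ?_⟩, ρ, V, hm, hBV, hμ, hfix⟩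
  · exact (h.toActedCurve.isFreeSegment_iff (inter_subset_left.trans h.sub)
      (he.mono inter_subset_left)).1 hd.free_left
  · exact (h.toActedCurve.isFreeSegment_iff (inter_subset_left.trans h.sub)
      (he.mono inter_subset_left)).1 hd.free_right

/-- Any other reflection point would be interior to one of the two free halves. -/
theorem IsReflectionPoint.eq_of_germ (hr : IsReflectionPoint G δ U D τ g)
    (h : FreeCurve E G δ U D) (hτ' : τ' ∈ interior D) (hg : GGerm δ U (-1) g' τ' τ') :
    τ' = τ := by
  rcases lt_trichotomy τ' τ with hlt | heq | hgt
  · have hi : τ' ∈ interior (D ∩ Iic τ) := by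
      rw [interior_inter, interior_Iic]; exact ⟨hτ', hlt⟩
    have := (h.germ_eq (h.isInterval_left hr.mem) inter_subset_left hr.left hi hi hg).2.2
    norm_num at this
  · exact heq
  · have hi : τ' ∈ interior (D ∩ Ici τ) := by
      rw [interior_inter, interior_Ici]; exact ⟨hτ', hgt⟩
    have := (h.germ_eq (h.isInterval_right hr.mem) inter_subset_left hr.right hi hi hg).2.2
    norm_num at this

/-- A maximal interval cannot contain `τ` in its interior, so it lies in one free half, equals it by
maximality, and thus reaches the end of `D`. -/
theorem IsReflectionPoint.not_compact (hr : IsReflectionPoint G δ U D τ g)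
    (h : FreeCurve E G δ U D) (hA : IsMaxFree G δ U D A) (hc : IsCompact A)
    (hAD : A ⊆ interior D) : False := by
  have hne : A.Nonempty := hA.interval.2.mono interior_subset
  have hτ : τ ∉ interior A := fun hτ => by
    have := (h.germ_eq hA.interval hA.sub hA.free hτ hτ hr.germ).2.2
    norm_num at this
  rcases forall_lt_or_forall_gt_of_notMem hA.interval.interior_interval.1 hτ with hlt | hgt
  · have hsub : A ⊆ D ∩ Iic τ := fun t ht => ⟨hA.sub ht,
      (closure_minimal (fun y hy => (hlt y hy).le) isClosed_Iic)
        (hA.interval.subset_closure_interior ht)⟩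
    have hL := hA.max _ (h.isInterval_left hr.mem) inter_subset_left hsub hr.left
    obtain ⟨x, hx⟩ := hc.exists_isLeast hne
    obtain ⟨q, hq, hqx⟩ := exists_lt_mem_of_mem_interior (hAD hx.1)
    exact absurd (hx.2 (hL ⟨hq, hqx.le.trans (hsub hx.1).2⟩)) (not_le.2 hqx)
  · have hsub : A ⊆ D ∩ Ici τ := fun t ht => ⟨hA.sub ht,
      (closure_minimal (fun y hy => (hgt y hy).le) isClosed_Ici)
        (hA.interval.subset_closure_interior ht)⟩
    have hR := hA.max _ (h.isInterval_right hr.mem) inter_subset_left hsub hr.right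
    obtain ⟨x, hx⟩ := hc.exists_isGreatest hne
    obtain ⟨q, hq, hqx⟩ := exists_gt_mem_of_mem_interior (hAD hx.1)
    exact absurd (hx.2 (hR ⟨hq, le_trans (hsub hx.1).2 hqx.le⟩)) (not_le.2 hqx)

theorem IsReflectionPoint.exists_decomposition (hr : IsReflectionPoint G δ U D τ g)
    (h : FreeCurve E G δ U D) (he : EqOn γ δ D) :
    ∃ (B : Set ℝ) (μ : ℝ → ℝ), IsTauDecomposition γ D τ g B μ ∧ IsFaithfulTau γ D τ g B μ ∧
      ∀ (τ' : ℝ) (g' : G) (B' : Set ℝ) (μ' : ℝ → ℝ), IsTauDecomposition γ D τ' g' B' μ' →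
        τ' = τ ∧ cls γ D g' = cls γ D g ∧ B' = B ∧ EqOn μ' μ B := by
  obtain ⟨r, V, hm, hτV, hrτ⟩ := h.exists_max hr.germ
  have hL := h.isInterval_left hr.mem
  have hR := h.isInterval_right hr.mem
  have hanti := hm.strictAntiOn (by norm_num)
  have hτD := interior_subset hr.mem
  set B : Set ℝ := {t | t ∈ D ∩ Iic τ ∧ t ∈ V ∧ r t ∈ D} with hB
  have hge : ∀ t ∈ V, t ≤ τ → τ ≤ r t := fun t ht htτ => by
    have := hanti.antitoneOn ht hτV htτ
    rwa [hrτ] at this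
  have hBL : B ⊆ D ∩ Iic τ := fun t ht => ht.1
  have hBR : r '' B ⊆ D ∩ Ici τ := by
    rintro _ ⟨t, ht, rfl⟩
    exact ⟨ht.2.2, hge t ht.2.1 ht.1.2⟩
  have hBi : IsInterval B := by
    have hord : B.OrdConnected := hm.ordConnected_dom hL.1 h.interval.1
    refine ⟨hord, ?_⟩
    have h1 : ∀ᶠ t in 𝓝 τ, t ∈ D ∧ t ∈ V ∧ r t ∈ D := by
      have hD := mem_interior_iff_mem_nhds.1 hr.mem
      filter_upwards [hD, hm.dom.1.mem_nhds hτV,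
        (hm.continuousAt hτV).preimage_mem_nhds (hrτ.symm ▸ hD)] with t h1 h2 h3
        using ⟨h1, h2, h3⟩
    obtain ⟨p, hpτ, hp⟩ := (((h1.filter_mono nhdsWithin_le_nhds).and
      (self_mem_nhdsWithin : Iio τ ∈ 𝓝[<] τ)).exists)
    have hp' : p < τ := hp
    exact ⟨(p + τ) / 2, mem_interior_of_between hord ⟨⟨hpτ.1, hp'.le⟩, hpτ.2⟩
      ⟨⟨hτD, self_mem_Iic⟩, hτV, by rwa [hrτ]⟩ (by linarith) (by linarith)⟩
  -- If `x` in the left half and `y` in the right half were both missed, following the reflection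
  -- towards the corner `(x, y)` would place one of them in `B` or in its image.
  have hfull : B = D ∩ Iic τ ∨ r '' B = D ∩ Ici τ := by
    by_contra hcon
    push Not at hcon
    obtain ⟨x, hx, hxB⟩ := not_subset.1 fun hs => hcon.1 (hBL.antisymm hs)
    obtain ⟨y, hy, hyB⟩ := not_subset.1 fun hs => hcon.2 (hBR.antisymm hs)
    have hxτ : x ≤ τ := hx.2
    have hyτ : τ ≤ y := hy.2
    rcases hm.continuation (h.toActedCurve.smul g) h.curve hτV (h.sub hx.1) (h.sub hy.1)
      (by rw [hrτ]; nlinarith [mul_nonneg (sub_nonneg.2 hxτ) (sub_nonneg.2 hyτ)]) with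
      ⟨h1, h2⟩ | ⟨x', h1, h2, h3⟩
    · rw [hrτ] at h2
      exact hxB ⟨hx, h1, h.interval.1.uIcc_subset hτD hy.1 h2⟩
    · rw [uIcc_of_ge hxτ] at h2
      refine hyB ⟨x', ⟨⟨h.interval.1.out hx.1 hτD h2, h2.2⟩, h1, ?_⟩, h3⟩
      rw [h3]; exact hy.1
  refine ⟨B, r, ?_, ?_, ?_⟩
  · exact
    { mem := hr.mem
      free_left := (h.toActedCurve.isFreeSegment_iff (inter_subset_left.trans h.sub)
        (he.mono inter_subset_left)).2 hr.left
      free_right := (h.toActedCurve.isFreeSegment_iff (inter_subset_left.trans h.sub)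
        (he.mono inter_subset_left)).2 hr.right
      ne_one := (h.cls_ne_cls_one_iff he).2 (h.not_mem_stab_of_neg hr.germ (by norm_num))
      interval := hBi
      tau_mem := ⟨⟨hτD, self_mem_Iic⟩, hτV, by rwa [hrτ]⟩
      map_tau := hrτ
      subset_left := hBL
      subset_right := hBR
      full := hfull
      carries := hm.carries he (hBL.trans inter_subset_left) (hBR.trans inter_subset_left)
        fun t ht => ht.2.1 }
  · intro g' ρ J J' ho
    obtain ⟨σ, hσ, htr, hmap⟩ := h.toActedCurve.exists_transition_of_overlapVia h.sub he
      inter_subset_left ho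
    have hJL : J ⊆ D ∩ Iic τ := ho.2.2.1
    have hJi : J ⊆ interior (D ∩ Iic τ) := interior_maximal hJL ho.1.1
    obtain ⟨t, ht⟩ := ho.1.2.2
    have hg := htr.germ ht
    have hs := hmap ht
    rcases le_or_gt (ρ t) τ with hle | hlt
    · obtain ⟨h1, h2, h3⟩ := h.germ_eq_of_mem hL inter_subset_left hr.left (hJi ht)
        ⟨interior_subset hs, hle⟩ hg
      refine Or.inl ⟨(h.cls_eq_cls_iff he).2 (by simpa using h1), ?_⟩
      have hid := gTransition_id h.curve.dom h1
      have hJU : J ⊆ U := htr.sub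
      have := Transition.eqOn h.curve htr hid ht (hJU ht) h2.symm
      exact hid.maximalExtensionEq hJU (fun u hu => this ⟨hu, hJU hu⟩)
        (inter_subset_left.trans h.sub) fun u _ => rfl
    -- A common target of `r` and `ρ` gives a germ from `u` to `t` inside the free left half. So `u
    -- = t`, the classes agree and `ρ` is a restriction of `r`. Such a `u` comes from freeness of
    -- the right half if `B` is the whole left half, and directly otherwise.
    · have key : ∀ u ∈ B, r u = ρ t → cls γ D g' = cls γ D g ∧ MaximalExtensionEq ρ J r B := by
        intro u hu hru
        have hgu : GGerm δ U (-1) g u (ρ t) := hru ▸ hm.germ hu.2.1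
        obtain ⟨h1, h2, h3⟩ := h.germ_eq_of_mem' hL inter_subset_left hr.left (hBL hu) (hJi ht)
          (GGerm.comp hgu (GGerm.inv hg))
        subst h2
        have htr' : GTransition δ U (-1) g ρ J :=
          (htr.congr_left (curveStab_smul_eqOn h1)).of_sign (by linarith)
        have hJV := hm.max ρ J htr' ⟨u, hu.2.1, ht, hru⟩
        have := Transition.eqOn h.curve htr' hm.toTransition ht (hJV ht) hru.symm
        exact ⟨(h.cls_eq_cls_iff he).2 h1, hm.toTransition.maximalExtensionEq hJV
          (fun v hv => this ⟨hv, hJV hv⟩) (fun v hv => hv.2.1) fun v _ => rfl⟩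
      right
      rcases hfull with hf | hf
      · have htB : t ∈ B := hf ▸ hJL ht
        have hgt := hm.germ htB.2.1
        have hsi : ρ t ∈ interior (D ∩ Ici τ) := by
          rw [interior_inter, interior_Ici]; exact ⟨hs, hlt⟩
        obtain ⟨-, h2, -⟩ := h.germ_eq_of_mem' hR inter_subset_left hr.right
          (hBR ⟨t, htB, rfl⟩) hsi (GGerm.comp (GGerm.inv hgt) hg)
        exact key t htB h2
      · obtain ⟨u, hu, hru⟩ : ρ t ∈ r '' B := hf ▸ ⟨interior_subset hs, hlt.le⟩
        exact key u hu hru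
  · intro τ' g' B' μ' hd'
    obtain ⟨hr', ρ', V', hm', hBV', hμ', hfix'⟩ := h.isReflectionPoint_of he hd'
    obtain rfl := hr.eq_of_germ h hr'.mem hr'.germ
    obtain ⟨hst, rfl, heq⟩ := h.toActedCurve.max_unique hm hm' (by norm_num) hτV
      (hBV' hd'.tau_mem) (hrτ.trans hfix'.symm)
    have hμr : EqOn μ' r B' := fun t ht => (hμ' ht).trans (heq (hBV' ht)).symm
    have hBB : B' = B := by
      refine Subset.antisymm (fun t ht => ⟨hd'.subset_left ht, hBV' ht, ?_⟩) fun t ht => ?_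
      · rw [← hμr ht]; exact (hd'.subset_right ⟨t, ht, rfl⟩).1
      · rcases hd'.full with hf | hf
        · exact hf ▸ ht.1
        · obtain ⟨u, hu, hut⟩ : r t ∈ μ' '' B' := hf ▸ hBR ⟨t, ht, rfl⟩
          rw [hμr hu] at hut
          rwa [← hm.injOn (hBV' hu) ht.2.1 hut]
    refine ⟨rfl, ((h.cls_eq_cls_iff he).2 hst).symm, hBB, hBB ▸ hμr⟩

end TauCase

end AnalyticCurve

namespace AnalyticCurve

/-! ### Bookkeeping for the index sets of decompositions. -/

namespace DecompositionData

variable {G : Type*} {d d' : DecompositionData G} {D : Set ℝ} {n m s : ℤ} {t : ℝ}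

theorem one_mem_idx (hlo : d.lo < ((0 : ℤ) : WithBot ℤ)) (hhi : ((0 : ℤ) : WithTop ℤ) < d.hi) :
    (1 : ℤ) ∈ d.idx := by
  refine ⟨one_ne_zero, ?_, ?_⟩
  · generalize d.lo = lo at *
    induction lo using WithBot.recBotCoe with
    | bot => exact bot_le
    | coe l => simp only [WithBot.coe_lt_coe, WithBot.coe_le_coe] at *; omega
  · generalize d.hi = hi at *
    induction hi using WithTop.recTopCoe with
    | top => exact le_top
    | coe l => simp only [WithTop.coe_lt_coe, WithTop.coe_le_coe] at *; omega

theorem neg_one_mem_idx (hlo : d.lo < ((0 : ℤ) : WithBot ℤ))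
    (hhi : ((0 : ℤ) : WithTop ℤ) < d.hi) : (-1 : ℤ) ∈ d.idx := by
  refine ⟨by norm_num, ?_, ?_⟩
  · generalize d.lo = lo at *
    induction lo using WithBot.recBotCoe with
    | bot => exact bot_le
    | coe l => simp only [WithBot.coe_lt_coe, WithBot.coe_le_coe] at *; omega
  · generalize d.hi = hi at *
    induction hi using WithTop.recTopCoe with
    | top => exact le_top
    | coe l => simp only [WithTop.coe_lt_coe, WithTop.coe_le_coe] at *; omega

theorem lo_lt_of_pos (hlo : d.lo < ((0 : ℤ) : WithBot ℤ)) (hn : 0 < n) :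
    d.lo < (n : WithBot ℤ) := hlo.trans (WithBot.coe_lt_coe.2 hn)

theorem lt_hi_of_neg (hhi : ((0 : ℤ) : WithTop ℤ) < d.hi) (hn : n < 0) :
    (n : WithTop ℤ) < d.hi := (WithTop.coe_lt_coe.2 hn).trans hhi

theorem mem_idx_of_pos (hlo : d.lo < ((0 : ℤ) : WithBot ℤ)) (hn : 0 < n) :
    n ∈ d.idx ↔ (n : WithTop ℤ) ≤ d.hi :=
  ⟨fun h => h.2.2, fun h => ⟨hn.ne', (lo_lt_of_pos hlo hn).le, h⟩⟩

theorem mem_idx_of_neg (hhi : ((0 : ℤ) : WithTop ℤ) < d.hi) (hn : n < 0) :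
    n ∈ d.idx ↔ d.lo ≤ (n : WithBot ℤ) :=
  ⟨fun h => h.2.1, fun h => ⟨hn.ne, h, (lt_hi_of_neg hhi hn).le⟩⟩

theorem isEnd_of_pos (hlo : d.lo < ((0 : ℤ) : WithBot ℤ)) (hn : 0 < n) :
    d.IsEnd n ↔ (n : WithTop ℤ) = d.hi :=
  ⟨fun h => h.resolve_left (lo_lt_of_pos hlo hn).ne', Or.inr⟩

theorem isEnd_of_neg (hhi : ((0 : ℤ) : WithTop ℤ) < d.hi) (hn : n < 0) :
    d.IsEnd n ↔ (n : WithBot ℤ) = d.lo :=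
  ⟨fun h => h.resolve_right (lt_hi_of_neg hhi hn).ne, Or.inl⟩

/-- The sign `s` names a side of `0`, and `0 < s * n` says that `n` is on it; `n + s` is the next
index outwards. This lets both sides be treated by one argument. -/
theorem next_mem (hlo : d.lo < ((0 : ℤ) : WithBot ℤ)) (hhi : ((0 : ℤ) : WithTop ℤ) < d.hi)
    (hs : s = 1 ∨ s = -1) (hsn : 0 < s * n) :
    n + s ∈ d.idx ↔ n ∈ d.idx ∧ ¬ d.IsEnd n := by
  rcases hs with rfl | rfl
  · have hn : 0 < n := by omega
    rw [mem_idx_of_pos hlo (by omega : 0 < n + 1), mem_idx_of_pos hlo hn, isEnd_of_pos hlo hn]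
    generalize d.hi = hi
    induction hi using WithTop.recTopCoe with
    | top => simp
    | coe l => simp only [WithTop.coe_le_coe, WithTop.coe_inj]; omega
  · have hn : n < 0 := by omega
    rw [mem_idx_of_neg hhi (by omega : n + -1 < 0), mem_idx_of_neg hhi hn, isEnd_of_neg hhi hn]
    generalize d.lo = lo
    induction lo using WithBot.recBotCoe with
    | bot => simp
    | coe l => simp only [WithBot.coe_le_coe, WithBot.coe_inj]; omega

theorem mem_cell_end (hlo : d.lo < ((0 : ℤ) : WithBot ℤ)) (hhi : ((0 : ℤ) : WithTop ℤ) < d.hi)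
    (hs : s = 1 ∨ s = -1) (hsn : 0 < s * n) (he : d.IsEnd n) :
    t ∈ d.cell D n ↔ t ∈ D ∧ 0 ≤ (s : ℝ) * (t - d.a n) := by
  rcases hs with rfl | rfl
  · have hn : 0 < n := by omega
    rw [isEnd_of_pos hlo hn] at he
    simp [cell, hn.ne', hn, he]
  · have hn : n < 0 := by omega
    rw [isEnd_of_neg hhi hn] at he
    simp [cell, hn.ne, hn.not_gt, he]

theorem mem_cell_inner (hlo : d.lo < ((0 : ℤ) : WithBot ℤ)) (hhi : ((0 : ℤ) : WithTop ℤ) < d.hi)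
    (hs : s = 1 ∨ s = -1) (hsn : 0 < s * n) (he : ¬ d.IsEnd n) :
    t ∈ d.cell D n ↔ 0 ≤ (s : ℝ) * (t - d.a n) ∧ (s : ℝ) * (t - d.a (n + s)) ≤ 0 := by
  rcases hs with rfl | rfl
  · have hn : 0 < n := by omega
    rw [isEnd_of_pos hlo hn] at he
    simp [cell, hn.ne', hn, he]
  · have hn : n < 0 := by omega
    rw [isEnd_of_neg hhi hn] at he
    simp [cell, hn.ne, hn.not_gt, he, ← sub_eq_add_neg, and_comm]

theorem sub_one_mem_idx (hhi : ((0 : ℤ) : WithTop ℤ) < d.hi) (hn : n ≤ 0)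
    (h : d.lo < (n : WithBot ℤ)) : n - 1 ∈ d.idx := by
  rw [mem_idx_of_neg hhi (by omega)]
  generalize d.lo = lo at h
  induction lo using WithBot.recBotCoe with
  | bot => exact bot_le
  | coe l => simp only [WithBot.coe_lt_coe, WithBot.coe_le_coe] at *; omega

theorem add_one_mem_idx (hlo : d.lo < ((0 : ℤ) : WithBot ℤ)) (hn : 0 ≤ n)
    (h : (n : WithTop ℤ) < d.hi) : n + 1 ∈ d.idx := by
  rw [mem_idx_of_pos hlo (by omega)]
  generalize d.hi = hi at h
  induction hi using WithTop.recTopCoe with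
  | top => exact le_top
  | coe l => simp only [WithTop.coe_lt_coe, WithTop.coe_le_coe] at *; omega

theorem exists_sign (hn : n ≠ 0) : ∃ s : ℤ, (s = 1 ∨ s = -1) ∧ 0 < s * n := by
  rcases lt_or_gt_of_ne hn with h | h
  · exact ⟨-1, Or.inr rfl, by omega⟩
  · exact ⟨1, Or.inl rfl, by omega⟩

/-- Induction over the indices on one side of `0`. -/
theorem side_induction (hlo : d.lo < ((0 : ℤ) : WithBot ℤ))
    (hhi : ((0 : ℤ) : WithTop ℤ) < d.hi) (hs : s = 1 ∨ s = -1) {P : ℤ → Prop} (h1 : P s)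
    (hstep : ∀ n, n ∈ d.idx → 0 < s * n → ¬ d.IsEnd n → n + s ∈ d.idx → P n → P (n + s))
    (hn : n ∈ d.idx) (hsn : 0 < s * n) : P n := by
  obtain ⟨k, rfl⟩ : ∃ k : ℕ, n = s * ((k : ℤ) + 1) := by
    refine ⟨(s * n - 1).toNat, ?_⟩
    rcases hs with rfl | rfl <;> omega
  induction k with
  | zero => simpa using h1
  | succ k ih =>
    have hpos : 0 < s * (s * ((k : ℤ) + 1)) := by rcases hs with rfl | rfl <;> omega
    have heq : s * (((k + 1 : ℕ) : ℤ) + 1) = s * ((k : ℤ) + 1) + s := by push_cast; ring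
    rw [heq] at hn hsn ⊢
    have := (next_mem hlo hhi hs hpos).1 hn
    exact hstep _ this.1 hpos this.2 hn (ih this.1 hpos)

theorem lo_hi_eq_of_idx_eq (hlo : d.lo < ((0 : ℤ) : WithBot ℤ))
    (hhi : ((0 : ℤ) : WithTop ℤ) < d.hi) (hlo' : d'.lo < ((0 : ℤ) : WithBot ℤ))
    (hhi' : ((0 : ℤ) : WithTop ℤ) < d'.hi) (he : d.idx = d'.idx) :
    d.lo = d'.lo ∧ d.hi = d'.hi := by
  constructor
  · have key : ∀ n : ℤ, n < 0 → (d.lo ≤ (n : WithBot ℤ) ↔ d'.lo ≤ (n : WithBot ℤ)) := fun n hn => by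
      rw [← mem_idx_of_neg hhi hn, ← mem_idx_of_neg hhi' hn, he]
    generalize d.lo = lo at *
    generalize d'.lo = lo' at *
    induction lo using WithBot.recBotCoe with
    | bot =>
      induction lo' using WithBot.recBotCoe with
      | bot => rfl
      | coe l =>
        simp only [WithBot.coe_le_coe, WithBot.coe_lt_coe, bot_le, true_iff] at *
        have := key (l - 1) (by omega)
        omega
    | coe l =>
      induction lo' using WithBot.recBotCoe with
      | bot =>
        simp only [WithBot.coe_le_coe, WithBot.coe_lt_coe, bot_le, iff_true] at *
        have := key (l - 1) (by omega)
        omega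
      | coe l' =>
        simp only [WithBot.coe_le_coe, WithBot.coe_lt_coe, WithBot.coe_inj] at *
        have := key l (by omega)
        have := key l' (by omega)
        omega
  · have key : ∀ n : ℤ, 0 < n → ((n : WithTop ℤ) ≤ d.hi ↔ (n : WithTop ℤ) ≤ d'.hi) := fun n hn => by
      rw [← mem_idx_of_pos hlo hn, ← mem_idx_of_pos hlo' hn, he]
    generalize d.hi = hi at *
    generalize d'.hi = hi' at *
    induction hi using WithTop.recTopCoe with
    | top =>
      induction hi' using WithTop.recTopCoe with
      | top => rfl
      | coe l =>
        simp only [WithTop.coe_le_coe, WithTop.coe_lt_coe, le_top, true_iff] at *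
        have := key (l + 1) (by omega)
        omega
    | coe l =>
      induction hi' using WithTop.recTopCoe with
      | top =>
        simp only [WithTop.coe_le_coe, WithTop.coe_lt_coe, le_top, iff_true] at *
        have := key (l + 1) (by omega)
        omega
      | coe l' =>
        simp only [WithTop.coe_le_coe, WithTop.coe_lt_coe, WithTop.coe_inj] at *
        have := key l (by omega)
        have := key l' (by omega)
        omega

end DecompositionData

/-- The length of the initial segment of the natural numbers on which `F` holds, as the upper bound
of an index set. -/
theorem exists_hi {F : ℕ → Prop} (h0 : F 0) : ∃ hi : WithTop ℤ, ((0 : ℤ) : WithTop ℤ) < hi ∧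
    (∀ n : ℕ, (((n : ℤ) : WithTop ℤ) ≤ hi ↔ ∀ m < n, F m)) ∧
    ∀ n : ℕ, (((n : ℤ) : WithTop ℤ) = hi ↔ (∀ m < n, F m) ∧ ¬ F n) := by
  classical
  by_cases hall : ∀ n, F n
  · exact ⟨⊤, WithTop.coe_lt_top _, fun n => ⟨fun _ m _ => hall m, fun _ => le_top⟩,
      fun n => ⟨fun h => absurd h (WithTop.coe_ne_top), fun h => absurd (hall n) h.2⟩⟩
  · push Not at hall
    refine ⟨((Nat.find hall : ℤ) : WithTop ℤ), ?_, fun n => ?_, fun n => ?_⟩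
    · rw [WithTop.coe_lt_coe]
      have : Nat.find hall ≠ 0 := fun hz => (hz ▸ Nat.find_spec hall) h0
      omega
    · rw [WithTop.coe_le_coe, Nat.cast_le]
      refine ⟨fun h m hm => not_not.1 (Nat.find_min hall (hm.trans_le h)), fun h => ?_⟩
      by_contra hcon
      exact Nat.find_spec hall (h _ (not_le.1 hcon))
    · rw [WithTop.coe_inj, Nat.cast_inj]
      refine ⟨?_, fun h => ?_⟩
      · rintro rfl
        exact ⟨fun m hm => not_not.1 (Nat.find_min hall hm), Nat.find_spec hall⟩
      · refine le_antisymm ?_ (Nat.find_min' hall h.2)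
        by_contra hcon
        exact Nat.find_spec hall (h.1 _ (not_le.1 hcon))

theorem exists_lo {F : ℕ → Prop} (h0 : F 0) : ∃ lo : WithBot ℤ, lo < ((0 : ℤ) : WithBot ℤ) ∧
    (∀ n : ℕ, (lo ≤ ((-(n : ℤ) : ℤ) : WithBot ℤ) ↔ ∀ m < n, F m)) ∧
    ∀ n : ℕ, (((-(n : ℤ) : ℤ) : WithBot ℤ) = lo ↔ (∀ m < n, F m) ∧ ¬ F n) := by
  obtain ⟨hi, h1, h2, h3⟩ := exists_hi h0
  induction hi using WithTop.recTopCoe with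
  | top =>
    refine ⟨⊥, WithBot.bot_lt_coe _, fun n => ?_, fun n => ?_⟩
    · rw [← h2]; simp
    · rw [← h3]; simp
  | coe l =>
    refine ⟨((-l : ℤ) : WithBot ℤ), ?_, fun n => ?_, fun n => ?_⟩
    · rw [WithTop.coe_lt_coe] at h1; rw [WithBot.coe_lt_coe]; omega
    · rw [← h2, WithTop.coe_le_coe, WithBot.coe_le_coe]; omega
    · rw [← h3, WithTop.coe_inj, WithBot.coe_inj]; omega

end AnalyticCurve

/-! ### Pieces: images of the tile under successive moves. -/

namespace AnalyticCurve

/-- A candidate for a piece of a decomposition: a group element, the end point of the initial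
interval at which the piece starts, and the diffeomorphism with its maximal domain. -/
structure PieceData (G : Type*) where
  g : G
  e : ℝ
  ρ : ℝ → ℝ
  V : Set ℝ

namespace PieceData

variable {G : Type*}

/-- The whole initial interval `[b, a]` is carried into the interior of `D`. -/
def IsFull (D : Set ℝ) (b a : ℝ) (p : PieceData G) : Prop :=
  a + b - p.e ∈ p.V ∧ p.ρ (a + b - p.e) ∈ interior D

/-- The part of `[b, a]` that is carried into `D`. -/
def dom (D : Set ℝ) (b a : ℝ) (p : PieceData G) : Set ℝ := {t | t ∈ Icc b a ∧ t ∈ p.V ∧ p.ρ t ∈ D}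

end PieceData

section Pieces

variable {E : Type*} [NormedAddCommGroup E] [NormedSpace ℝ E] [CompleteSpace E]
  {M : Type*} [TopologicalSpace M] [ChartedSpace E M] [IsManifold 𝓘(ℝ, E) ω M] [T2Space M]
  {G : Type*} [Group G] [MulAction G M]
  {δ γ : ℝ → M} {U A B C D J J' V V' : Set ℝ} {σ σ' : ℝ} {g g' : G} {t s r a b y : ℝ}
  {μ ρ ρ' f : ℝ → ℝ} {p q : PieceData G}

theorem Transition.mul_sub_pos {δ₁ δ₂ : ℝ → M} {U₁ U₂ : Set ℝ}
    (hm : Transition σ δ₁ U₁ δ₂ U₂ ρ V) (ht : t ∈ V) (hs : s ∈ V) (hts : t ≠ s) :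
    0 < σ * ((t - s) * (ρ t - ρ s)) := by
  rcases lt_or_gt_of_ne hm.sign_ne_zero with hσ | hσ
  · have hanti := hm.strictAntiOn hσ
    refine mul_pos_of_neg_of_neg hσ ?_
    rcases lt_or_gt_of_ne hts with h | h
    · exact mul_neg_of_neg_of_pos (sub_neg.2 h) (sub_pos.2 (hanti ht hs h))
    · exact mul_neg_of_pos_of_neg (sub_pos.2 h) (sub_neg.2 (hanti hs ht h))
  · have hmono := hm.strictMonoOn hσ
    refine mul_pos hσ ?_
    rcases lt_or_gt_of_ne hts with h | h
    · exact mul_pos_of_neg_of_neg (sub_neg.2 h) (sub_neg.2 (hmono ht hs h))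
    · exact mul_pos (sub_pos.2 h) (sub_pos.2 (hmono hs ht h))

/-- `p` is a piece over `[b, a]`, extending from its starting point in the direction `s`. -/
structure IsPiece (δ : ℝ → M) (U D : Set ℝ) (b a s : ℝ) (p : PieceData G) : Prop where
  mem : p.e = b ∨ p.e = a
  max : GMaxTransition δ U (s * (a + b - 2 * p.e)) p.g p.ρ p.V
  memV : p.e ∈ p.V
  start : p.ρ p.e ∈ interior D

/-- The number `a + b - 2 * p.e` points from the end point `p.e` to the opposite one, `a + b - p.e`.
The orientation `s * (a + b - 2 * p.e)` is therefore the one for which leaving `p.e` into the tile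
means moving in direction `s` on the curve. -/
theorem IsPiece.strictly_ahead (hp : IsPiece δ U D b a s p) (ht : t ∈ Icc b a) (htV : t ∈ p.V)
    (hte : t ≠ p.e) : 0 < s * (p.ρ t - p.ρ p.e) := by
  have h1 := hp.max.toTransition.mul_sub_pos htV hp.memV hte
  have h2 : 0 ≤ (a + b - 2 * p.e) * (t - p.e) := by
    rcases hp.mem with h | h <;> rw [h] <;> nlinarith [ht.1, ht.2, mul_nonneg
      (sub_nonneg.2 ht.1) (sub_nonneg.2 (ht.1.trans ht.2)), mul_nonneg
      (sub_nonneg.2 ht.2) (sub_nonneg.2 (ht.1.trans ht.2))]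
  have h3 : 0 < s * (p.ρ t - p.ρ p.e) * ((a + b - 2 * p.e) * (t - p.e)) := by
    nlinarith [h1]
  exact pos_of_mul_pos_left h3 h2

theorem IsPiece.ahead (hp : IsPiece δ U D b a s p) (ht : t ∈ Icc b a) (htV : t ∈ p.V) :
    0 ≤ s * (p.ρ t - p.ρ p.e) := by
  by_cases hte : t = p.e
  · simp [hte]
  · exact (hp.strictly_ahead ht htV hte).le

theorem IsPiece.e_mem (hp : IsPiece δ U D b a s p) (hba : b < a) : p.e ∈ Icc b a := by
  rcases hp.mem with h | h <;> rw [h]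
  · exact left_mem_Icc.2 hba.le
  · exact right_mem_Icc.2 hba.le

theorem IsPiece.e_mem_dom (hp : IsPiece δ U D b a s p) (hba : b < a) : p.e ∈ p.dom D b a :=
  ⟨hp.e_mem hba, hp.memV, interior_subset hp.start⟩

theorem IsPiece.uIcc_eq (hp : IsPiece δ U D b a s p) (hba : b < a) :
    uIcc p.e (a + b - p.e) = Icc b a := by
  rcases hp.mem with h | h <;> rw [h]
  · rw [uIcc_of_le (by linarith)]; congr 1; ring
  · rw [uIcc_of_ge (by linarith)]; congr 1; ring

theorem IsPiece.other_mem (hp : IsPiece δ U D b a s p) (hba : b < a) :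
    a + b - p.e ∈ Icc b a := by
  rw [← hp.uIcc_eq hba]; exact right_mem_uIcc

theorem IsPiece.other_ne (hp : IsPiece δ U D b a s p) (hba : b < a) :
    a + b - p.e ≠ p.e := by
  rcases hp.mem with h | h <;> rw [h] <;> intro h' <;> linarith

/-- The maximal transition is followed towards the corner given by the opposite end of the tile and
`y`: it attains `y`, or uses up the whole tile before `y`. -/
theorem IsPiece.mem_image (hp : IsPiece δ U D b a s p) (h : FreeCurve E G δ U D) (hba : b < a)
    (hAD : Icc b a ⊆ D) (hy : y ∈ D) (hys : 0 ≤ s * (y - p.ρ p.e)) :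
    y ∈ p.ρ '' p.dom D b a ∨ (a + b - p.e ∈ p.V ∧ s * (p.ρ (a + b - p.e) - y) < 0) := by
  have hs : s ≠ 0 := fun h0 => hp.max.sign_ne_zero (by rw [h0, zero_mul])
  have hsgn : 0 ≤ s * (a + b - 2 * p.e) * ((a + b - p.e - p.e) * (y - p.ρ p.e)) := by
    have : s * (a + b - 2 * p.e) * ((a + b - p.e - p.e) * (y - p.ρ p.e)) =
        (a + b - 2 * p.e) ^ 2 * (s * (y - p.ρ p.e)) := by ring
    rw [this]
    positivity
  rcases hp.max.continuation (h.toActedCurve.smul p.g) h.curve hp.memV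
    (h.sub (hAD (hp.other_mem hba))) (h.sub hy) hsgn with ⟨h1, h2⟩ | ⟨x', h1, h2, h3⟩
  · by_cases heq : p.ρ (a + b - p.e) = y
    · exact Or.inl ⟨_, ⟨hp.other_mem hba, h1, heq.symm ▸ hy⟩, heq⟩
    · refine Or.inr ⟨h1, ?_⟩
      rcases lt_or_gt_of_ne hs with hs' | hs'
      · have : y ≤ p.ρ p.e := by nlinarith
        rw [uIcc_of_ge this] at h2
        have := lt_of_le_of_ne h2.1 (Ne.symm heq)
        nlinarith
      · have : p.ρ p.e ≤ y := by nlinarith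
        rw [uIcc_of_le this] at h2
        have := lt_of_le_of_ne h2.2 heq
        nlinarith
  · rw [hp.uIcc_eq hba] at h2
    exact Or.inl ⟨x', ⟨h2, h1, h3.symm ▸ hy⟩, h3⟩

/-- If the tile were used up before some `y` in `D`, its far end would land strictly between two
points of `D`, hence in the interior, and the piece would be full. -/
theorem IsPiece.image_of_not_full (hp : IsPiece δ U D b a s p) (h : FreeCurve E G δ U D)
    (hba : b < a) (hAD : Icc b a ⊆ D) (hnf : ¬ p.IsFull D b a) :
    p.ρ '' p.dom D b a = {y | y ∈ D ∧ 0 ≤ s * (y - p.ρ p.e)} := by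
  refine Subset.antisymm ?_ ?_
  · rintro _ ⟨t, ht, rfl⟩
    exact ⟨ht.2.2, hp.ahead ht.1 ht.2.1⟩
  · rintro y ⟨hy, hys⟩
    refine (hp.mem_image h hba hAD hy hys).resolve_right fun ⟨h1, h2⟩ => hnf ⟨h1, ?_⟩
    have h3 := hp.strictly_ahead (hp.other_mem hba) h1 (hp.other_ne hba)
    have hs : s ≠ 0 := fun h0 => hp.max.sign_ne_zero (by rw [h0, zero_mul])
    rcases lt_or_gt_of_ne hs with hs' | hs'
    · exact mem_interior_of_between h.interval.1 hy (interior_subset hp.start) (by nlinarith)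
        (by nlinarith)
    · exact mem_interior_of_between h.interval.1 (interior_subset hp.start) hy (by nlinarith)
        (by nlinarith)

theorem IsPiece.dom_of_full (hp : IsPiece δ U D b a s p) (h : FreeCurve E G δ U D)
    (hba : b < a) (hf : p.IsFull D b a) : p.dom D b a = Icc b a := by
  have hord := hp.max.toTransition.ordConnected_dom (A := Icc b a) ordConnected_Icc h.interval.1
  refine Subset.antisymm (fun t ht => ht.1) ?_
  have := hord.uIcc_subset (hp.e_mem_dom hba) ⟨hp.other_mem hba, hf.1, interior_subset hf.2⟩
  rwa [hp.uIcc_eq hba] at this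

theorem IsPiece.next_pos (hp : IsPiece δ U D b a s p) (hba : b < a)
    (hf : p.IsFull D b a) : 0 < s * (p.ρ (a + b - p.e) - p.ρ p.e) :=
  hp.strictly_ahead (hp.other_mem hba) hf.1 (hp.other_ne hba)

theorem IsPiece.image_of_full (hp : IsPiece δ U D b a s p) (h : FreeCurve E G δ U D)
    (hba : b < a) (hAD : Icc b a ⊆ D) (hf : p.IsFull D b a) :
    p.ρ '' p.dom D b a =
      {y | 0 ≤ s * (y - p.ρ p.e) ∧ s * (y - p.ρ (a + b - p.e)) ≤ 0} := by
  have hs : s ≠ 0 := fun h0 => hp.max.sign_ne_zero (by rw [h0, zero_mul])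
  refine Subset.antisymm ?_ ?_
  · rintro _ ⟨t, ht, rfl⟩
    refine ⟨hp.ahead ht.1 ht.2.1, ?_⟩
    by_cases hte : t = a + b - p.e
    · simp [hte]
    have h1 := hp.max.toTransition.mul_sub_pos ht.2.1 hf.1 hte
    have h2 : (a + b - 2 * p.e) * (t - (a + b - p.e)) ≤ 0 := by
      have h3 := ht.1
      rcases hp.mem with h | h <;> rw [h] <;> nlinarith [h3.1, h3.2, mul_nonneg
        (sub_nonneg.2 h3.1) (sub_nonneg.2 (h3.1.trans h3.2)), mul_nonneg
        (sub_nonneg.2 h3.2) (sub_nonneg.2 (h3.1.trans h3.2))]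
    have h3 : 0 < s * (p.ρ t - p.ρ (a + b - p.e)) *
        ((a + b - 2 * p.e) * (t - (a + b - p.e))) := by nlinarith [h1]
    exact (neg_of_mul_pos_left h3 h2).le
  · rintro y ⟨hy1, hy2⟩
    have hyD : y ∈ D := by
      rcases lt_or_gt_of_ne hs with hs' | hs'
      · exact h.interval.1.out (interior_subset hf.2) (interior_subset hp.start)
          ⟨by nlinarith, by nlinarith⟩
      · exact h.interval.1.out (interior_subset hp.start) (interior_subset hf.2)
          ⟨by nlinarith, by nlinarith⟩
    refine (hp.mem_image h hba hAD hyD hy1).resolve_right fun ⟨_, h2⟩ => ?_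
    nlinarith

theorem IsPiece.isInterval_dom (hp : IsPiece δ U D b a s p) (h : FreeCurve E G δ U D)
    (hba : b < a) : IsInterval (p.dom D b a) := by
  have hord : (p.dom D b a).OrdConnected :=
    hp.max.toTransition.ordConnected_dom ordConnected_Icc h.interval.1
  refine ⟨hord, ?_⟩
  have h1 : ∀ᶠ u in 𝓝 p.e, u ∈ p.V ∧ p.ρ u ∈ D := by
    filter_upwards [hp.max.dom.1.mem_nhds hp.memV,
      (hp.max.toTransition.continuousAt hp.memV).preimage_mem_nhds
      (mem_interior_iff_mem_nhds.1 hp.start)] with u h1 h2 using ⟨h1, h2⟩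
  have h2 : ∃ᶠ u in 𝓝 p.e, u ∈ Ioo b a := by
    rw [← mem_closure_iff_frequently, closure_Ioo hba.ne]
    exact hp.e_mem hba
  obtain ⟨u, hu, hu'⟩ := (h2.and_eventually h1).exists
  have hud : u ∈ p.dom D b a := ⟨Ioo_subset_Icc_self hu, hu'⟩
  have hed := hp.e_mem_dom hba (D := D)
  have hne : u ≠ p.e := by
    rcases hp.mem with h | h <;> rw [h]
    · exact hu.1.ne'
    · exact hu.2.ne
  rcases lt_or_gt_of_ne hne with hlt | hlt
  · exact ⟨(u + p.e) / 2, mem_interior_of_between hord hud hed (by linarith) (by linarith)⟩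
  · exact ⟨(u + p.e) / 2, mem_interior_of_between hord hed hud (by linarith) (by linarith)⟩

theorem ActedCurve.exists_isPiece (h : ActedCurve E G δ U) {e c : ℝ} (he : e = b ∨ e = a)
    (hc : c ∈ interior D) (hg : GGerm δ U (s * (a + b - 2 * e)) g e c) :
    ∃ p : PieceData G, IsPiece δ U D b a s p ∧ p.g = g ∧ p.e = e ∧ p.ρ p.e = c := by
  obtain ⟨ρ, V, hm, heV, hρ⟩ := h.exists_max hg
  exact ⟨⟨g, e, ρ, V⟩, ⟨he, hm, heV, show ρ e ∈ interior D by rwa [hρ]⟩, rfl, rfl, hρ⟩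

/-- The end point of `[b, a]` that is carried to `x ∈ {a, b}` when passing from `[b, a]` to the
neighbouring piece at `x`. -/
noncomputable def turn (a eb ea : ℝ) (x : ℝ) : ℝ := if x = a then ea else eb

/-- The group element by which one passes from `[b, a]` to the neighbouring piece at `x`. -/
noncomputable def turnElt (a : ℝ) (kb ka : G) (x : ℝ) : G := if x = a then ka else kb

/-- The sign expression is positive when the two end points differ (translation) and negative when
they coincide (reflection), so both kinds of neighbour obey one formula. -/
theorem Tile.germ_turn {kb ka : G} {eb ea x : ℝ} (hT : Tile G δ U D b a kb ka eb ea)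
    (hx : x = b ∨ x = a) : (turn a eb ea x = b ∨ turn a eb ea x = a) ∧
    GGerm δ U (-((a + b - 2 * turn a eb ea x) * (a + b - 2 * x))) (turnElt a kb ka x)
      (turn a eb ea x) x := by
  have hba := hT.lt
  have hpos : 0 < (a - b) * (a - b) := mul_pos (by linarith) (by linarith)
  rcases hx with rfl | rfl
  · rw [turn, turnElt, if_neg hba.ne, if_neg hba.ne]
    rcases hT.nbr_left with ⟨rfl, hg⟩ | ⟨rfl, hg⟩
    · exact ⟨Or.inr rfl, hg.of_sign (by nlinarith)⟩
    · exact ⟨Or.inl rfl, hg.of_sign (by nlinarith)⟩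
  · rw [turn, turnElt, if_pos rfl, if_pos rfl]
    rcases hT.nbr_right with ⟨rfl, hg⟩ | ⟨rfl, hg⟩
    · exact ⟨Or.inl rfl, hg.of_sign (by nlinarith)⟩
    · exact ⟨Or.inr rfl, hg.of_sign (by nlinarith)⟩

/-- `q` is the piece following `p`. -/
structure IsNext (a b : ℝ) (kb ka : G) (eb ea : ℝ) (p q : PieceData G) : Prop where
  g_eq : q.g = p.g * turnElt a kb ka (a + b - p.e)
  e_eq : q.e = turn a eb ea (a + b - p.e)
  start_eq : q.ρ q.e = p.ρ (a + b - p.e)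

theorem Tile.exists_next {kb ka : G} {eb ea : ℝ} (hT : Tile G δ U D b a kb ka eb ea)
    (h : ActedCurve E G δ U) (hp : IsPiece δ U D b a s p) (hf : p.IsFull D b a) :
    ∃ q : PieceData G, IsPiece δ U D b a s q ∧ IsNext a b kb ka eb ea p q := by
  have hx : a + b - p.e = b ∨ a + b - p.e = a := by
    rcases hp.mem with h | h <;> rw [h]
    · right; ring
    · left; ring
  obtain ⟨h1, h2⟩ := hT.germ_turn hx
  have h3 := hp.max.toTransition.germ hf.1
  have hs : s ≠ 0 := fun h0 => hp.max.sign_ne_zero (by rw [h0, zero_mul])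
  have ho : a + b - 2 * p.e ≠ 0 := fun h0 => hp.max.sign_ne_zero (by rw [h0, mul_zero])
  have ho' : a + b - 2 * turn a eb ea (a + b - p.e) ≠ 0 := fun h0 => h2.sign_ne_zero (by
    rw [h0, zero_mul, neg_zero])
  -- The next piece first moves the tile onto its neighbour at the far end, then applies `p`. The
  -- orientations match because their product is a square.
  have h4 := (GGerm.comp h2 h3).of_sign
    (σ' := s * (a + b - 2 * turn a eb ea (a + b - p.e))) (by
      have : -((a + b - 2 * turn a eb ea (a + b - p.e)) * (a + b - 2 * (a + b - p.e))) *
          (s * (a + b - 2 * p.e)) * (s * (a + b - 2 * turn a eb ea (a + b - p.e))) =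
          (s * (a + b - 2 * p.e) * (a + b - 2 * turn a eb ea (a + b - p.e))) ^ 2 := by ring
      rw [this]
      positivity)
  obtain ⟨q, hq, hg, he, hc⟩ := h.exists_isPiece h1 hf.2 h4
  exact ⟨q, hq, hg, he, hc⟩

theorem Tile.exists_seq {kb ka : G} {eb ea : ℝ} (hT : Tile G δ U D b a kb ka eb ea)
    (h : ActedCurve E G δ U) (s : ℝ) (p : PieceData G) :
    ∃ P : ℕ → PieceData G, P 0 = p ∧ ∀ n, IsPiece δ U D b a s (P n) → (P n).IsFull D b a →
      IsPiece δ U D b a s (P (n + 1)) ∧ IsNext a b kb ka eb ea (P n) (P (n + 1)) := by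
  have : ∀ p : PieceData G, ∃ q : PieceData G, IsPiece δ U D b a s p → p.IsFull D b a →
      IsPiece δ U D b a s q ∧ IsNext a b kb ka eb ea p q := fun p => by
    by_cases hp : IsPiece δ U D b a s p ∧ p.IsFull D b a
    · obtain ⟨q, hq⟩ := hT.exists_next h hp.1 hp.2
      exact ⟨q, fun _ _ => hq⟩
    -- Once a piece is not full the sequence continues with a dummy value; indices beyond that point
    -- are discarded later.
    · exact ⟨p, fun h1 h2 => absurd ⟨h1, h2⟩ hp⟩
  choose F hF using this
  exact ⟨fun n => Nat.rec p (fun _ q => F q) n, rfl, fun n => hF _⟩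

end Pieces

end AnalyticCurve

namespace AnalyticCurve

/-! ### The family of all pieces over a tile. -/

section Family

variable {E : Type*} [NormedAddCommGroup E] [NormedSpace ℝ E] [CompleteSpace E]
  {M : Type*} [TopologicalSpace M] [ChartedSpace E M] [IsManifold 𝓘(ℝ, E) ω M] [T2Space M]
  {G : Type*} [Group G] [MulAction G M]
  {δ γ : ℝ → M} {U A B C D J J' V V' : Set ℝ} {g g' : G} {t r a b y eb ea : ℝ} {kb ka : G}
  {μ ρ ρ' f : ℝ → ℝ} {p q : PieceData G} {d : DecompositionData G} {Q : ℤ → PieceData G}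
  {s n m : ℤ}

/-- The pieces `Q` make up the decomposition data `d` over the tile `[b, a]`. -/
structure PieceFamily (δ : ℝ → M) (U D : Set ℝ) (b a : ℝ) (kb ka : G) (eb ea : ℝ)
    (d : DecompositionData G) (Q : ℤ → PieceData G) : Prop where
  lo_neg : d.lo < ((0 : ℤ) : WithBot ℤ)
  hi_pos : ((0 : ℤ) : WithTop ℤ) < d.hi
  zero : (Q 0).g = 1 ∧ (Q 0).ρ = id ∧ (Q 0).V = U
  piece : ∀ s n : ℤ, (s = 1 ∨ s = -1) → 0 < s * n → n ∈ d.idx → IsPiece δ U D b a s (Q n)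
  full : ∀ n ∈ d.idx, d.IsEnd n ↔ ¬ (Q n).IsFull D b a
  next : ∀ s n : ℤ, (s = 1 ∨ s = -1) → 0 < s * n → n ∈ d.idx → ¬ d.IsEnd n →
    IsNext a b kb ka eb ea (Q n) (Q (n + s))
  one : (Q 1).g = ka ∧ (Q 1).e = ea ∧ (Q 1).ρ (Q 1).e = a
  neg_one : (Q (-1)).g = kb ∧ (Q (-1)).e = eb ∧ (Q (-1)).ρ (Q (-1)).e = b
  a_eq : ∀ n, d.a n = (Q n).ρ (Q n).e
  g_eq : ∀ n, d.g n = (Q n).g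
  dom_eq : ∀ n, d.dom n = (Q n).dom D b a
  μ_eq : ∀ n, d.μ n = (Q n).ρ

theorem isPiece_of_forall_full {P : ℕ → PieceData G} {s : ℝ} (h0 : IsPiece δ U D b a s (P 0))
    (hP : ∀ n, IsPiece δ U D b a s (P n) → (P n).IsFull D b a → IsPiece δ U D b a s (P (n + 1)) ∧
      IsNext a b kb ka eb ea (P n) (P (n + 1))) (n : ℕ) (hn : ∀ m < n, (P m).IsFull D b a) :
    IsPiece δ U D b a s (P n) := by
  induction n with
  | zero => exact h0
  | succ n ih =>
    exact (hP n (ih fun m hm => hn m (hm.trans n.lt_succ_self)) (hn n n.lt_succ_self)).1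

theorem Tile.exists_family (hT : Tile G δ U D b a kb ka eb ea) (h : FreeCurve E G δ U D) :
    ∃ (d : DecompositionData G) (Q : ℤ → PieceData G),
      PieceFamily δ U D b a kb ka eb ea d Q := by
  have hba := hT.lt
  have hbU := h.sub (interior_subset hT.left)
  have haU := h.sub (interior_subset hT.right)
  have hid := gMaxTransition_id (G := G) (δ := δ) h.curve.dom (one_mem _)
  -- Both sequences start with the identity piece, once read to the right from `b` and once to the
  -- left from `a`. The first piece that is not full becomes the last index on its side.
  obtain ⟨P, hP0, hP⟩ := hT.exists_seq h.toActedCurve (1 : ℝ) ⟨1, b, id, U⟩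
  obtain ⟨N, hN0, hN⟩ := hT.exists_seq h.toActedCurve (-1 : ℝ) ⟨1, a, id, U⟩
  have hpP : IsPiece δ U D b a 1 (P 0) := by
    rw [hP0]
    exact ⟨Or.inl rfl, hid.of_sign (by show 0 < 1 * (1 * (a + b - 2 * b)); linarith), hbU,
      hT.left⟩
  have hpN : IsPiece δ U D b a (-1) (N 0) := by
    rw [hN0]
    exact ⟨Or.inr rfl, hid.of_sign (by show 0 < 1 * (-1 * (a + b - 2 * a)); linarith), haU,
      hT.right⟩
  have hfP : (P 0).IsFull D b a := by
    rw [hP0]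
    have : a + b - b = a := by ring
    exact ⟨show a + b - b ∈ U by rwa [this], show a + b - b ∈ interior D by
      rw [this]; exact hT.right⟩
  have hfN : (N 0).IsFull D b a := by
    rw [hN0]
    have : a + b - a = b := by ring
    exact ⟨show a + b - a ∈ U by rwa [this], show a + b - a ∈ interior D by
      rw [this]; exact hT.left⟩
  have hPpiece := isPiece_of_forall_full hpP hP
  have hNpiece := isPiece_of_forall_full hpN hN
  obtain ⟨hi, hhi, hhi1, hhi2⟩ := exists_hi (F := fun n => (P n).IsFull D b a) hfP
  obtain ⟨lo, hlo, hlo1, hlo2⟩ := exists_lo (F := fun n => (N n).IsFull D b a) hfN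
  let Q : ℤ → PieceData G := fun n => if 0 < n then P n.toNat else N (-n).toNat
  have hQP : ∀ k : ℕ, 0 < k → Q k = P k := fun k hk => by
    simp [Q, hk]
  have hQN : ∀ k : ℕ, Q (-(k : ℤ)) = N k := fun k => by
    simp [Q]
  let d : DecompositionData G := ⟨lo, hi, fun n => (Q n).ρ (Q n).e, fun n => (Q n).g,
    fun n => (Q n).dom D b a, fun n => (Q n).ρ⟩
  have hdP : ∀ k : ℕ, 0 < k → ((k : ℤ) ∈ d.idx ↔ ∀ m < k, (P m).IsFull D b a) := fun k hk => by
    rw [DecompositionData.mem_idx_of_pos (d := d) hlo (by omega)]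
    exact hhi1 k
  have hdN : ∀ k : ℕ, 0 < k → (-(k : ℤ) ∈ d.idx ↔ ∀ m < k, (N m).IsFull D b a) := fun k hk => by
    rw [DecompositionData.mem_idx_of_neg (d := d) hhi (by omega)]
    exact hlo1 k
  have heP : ∀ k : ℕ, 0 < k → (k : ℤ) ∈ d.idx → (d.IsEnd k ↔ ¬ (P k).IsFull D b a) :=
    fun k hk hki => by
      rw [DecompositionData.isEnd_of_pos (d := d) hlo (by omega)]
      exact (hhi2 k).trans ⟨fun h => h.2, fun h => ⟨(hdP k hk).1 hki, h⟩⟩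
  have heN : ∀ k : ℕ, 0 < k → -(k : ℤ) ∈ d.idx → (d.IsEnd (-(k : ℤ)) ↔ ¬ (N k).IsFull D b a) :=
    fun k hk hki => by
      rw [DecompositionData.isEnd_of_neg (d := d) hhi (by omega)]
      exact (hlo2 k).trans ⟨fun h => h.2, fun h => ⟨(hdN k hk).1 hki, h⟩⟩
  have hrep : ∀ s n : ℤ, (s = 1 ∨ s = -1) → 0 < s * n → ∃ k : ℕ, 0 < k ∧
      ((s = 1 ∧ n = k) ∨ (s = -1 ∧ n = -(k : ℤ))) := by
    rintro s n (rfl | rfl) hn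
    · exact ⟨n.toNat, by omega, Or.inl ⟨rfl, by omega⟩⟩
    · exact ⟨(-n).toNat, by omega, Or.inr ⟨rfl, by omega⟩⟩
  refine ⟨d, Q, hlo, hhi, ?_, ?_, ?_, ?_, ?_, ?_, fun _ => rfl, fun _ => rfl, fun _ => rfl,
    fun _ => rfl⟩
  · have := hQN 0
    simp only [Nat.cast_zero, neg_zero] at this
    rw [this, hN0]
    exact ⟨rfl, rfl, rfl⟩
  · intro s n hs hsn hn
    obtain ⟨k, hk, ⟨rfl, rfl⟩ | ⟨rfl, rfl⟩⟩ := hrep s n hs hsn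
    · rw [hQP k hk, Int.cast_one]
      exact hPpiece k ((hdP k hk).1 hn)
    · rw [hQN k, Int.cast_neg, Int.cast_one]
      exact hNpiece k ((hdN k hk).1 hn)
  · intro n hn
    obtain ⟨s, hs, hsn⟩ := DecompositionData.exists_sign hn.1
    obtain ⟨k, hk, ⟨rfl, rfl⟩ | ⟨rfl, rfl⟩⟩ := hrep s n hs hsn
    · rw [hQP k hk]; exact heP k hk hn
    · rw [hQN k]; exact heN k hk hn
  · intro s n hs hsn hn hne
    obtain ⟨k, hk, ⟨rfl, rfl⟩ | ⟨rfl, rfl⟩⟩ := hrep s n hs hsn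
    · rw [heP k hk hn, not_not] at hne
      have : ((k : ℤ) + 1) = ((k + 1 : ℕ) : ℤ) := by push_cast; rfl
      rw [this, hQP k hk, hQP (k + 1) (by omega)]
      exact (hP k (hPpiece k ((hdP k hk).1 hn)) hne).2
    · rw [heN k hk hn, not_not] at hne
      have : (-(k : ℤ) + -1) = -((k + 1 : ℕ) : ℤ) := by push_cast; ring
      rw [this, hQN k, hQN (k + 1)]
      exact (hN k (hNpiece k ((hdN k hk).1 hn)) hne).2
  · have h1 := hQP 1 one_pos
    rw [Nat.cast_one] at h1
    rw [h1]
    have h2 := (hP 0 hpP hfP).2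
    have h3 : a + b - (P 0).e = a := by rw [hP0]; show a + b - b = a; ring
    refine ⟨?_, ?_, ?_⟩
    · rw [h2.g_eq, h3, hP0, turnElt, if_pos rfl]; exact one_mul _
    · rw [h2.e_eq, h3, turn, if_pos rfl]
    · rw [h2.start_eq, h3, hP0]; rfl
  · have h1 := hQN 1
    rw [Nat.cast_one] at h1
    rw [h1]
    have h2 := (hN 0 hpN hfN).2
    have h3 : a + b - (N 0).e = b := by rw [hN0]; show a + b - a = b; ring
    refine ⟨?_, ?_, ?_⟩
    · rw [h2.g_eq, h3, hN0, turnElt, if_neg hba.ne]; exact one_mul _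
    · rw [h2.e_eq, h3, turn, if_neg hba.ne]
    · rw [h2.start_eq, h3, hN0]; rfl

theorem Tile.neg (hT : Tile G δ U D b a kb ka eb ea) (h : ActedCurve E G δ U) :
    Tile G (fun t => δ (-t)) (-U) (-D) (-a) (-b) ka kb (-ea) (-eb) := by
  have hl := hT.left
  have hr := hT.right
  refine ⟨neg_lt_neg hT.lt, ?_, ?_, ?_, ?_, ?_⟩
  · rw [interior_neg_eq]; simpa using hr
  · rw [interior_neg_eq]; simpa using hl
  · have := hT.free.neg h
    rwa [Set.neg_Icc] at this
  · rcases hT.nbr_right with ⟨rfl, hg⟩ | ⟨rfl, hg⟩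
    · exact Or.inl ⟨rfl, hg.neg h⟩
    · exact Or.inr ⟨rfl, hg.neg h⟩
  · rcases hT.nbr_left with ⟨rfl, hg⟩ | ⟨rfl, hg⟩
    · exact Or.inl ⟨rfl, hg.neg h⟩
    · exact Or.inr ⟨rfl, hg.neg h⟩

/-- A reflection never stabilizes. If a translation did, its inverse would carry points just beyond
`a` into the tile by stabilizing elements, and the tile could be enlarged. -/
theorem Tile.right_not_mem (hT : Tile G δ U D b a kb ka eb ea) (h : FreeCurve E G δ U D) :
    ka ∉ curveStab G δ U := by
  intro hk
  have hba := hT.lt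
  rcases hT.nbr_right with ⟨rfl, hg⟩ | ⟨rfl, hg⟩
  · have hW : (interior D ∩ Ioi ea) ∈ 𝓝 a :=
      Filter.inter_mem (isOpen_interior.mem_nhds hT.right) (Ioi_mem_nhds hba)
    obtain ⟨ρ, V, hm, haV, hVW, hρ⟩ := h.toActedCurve.exists_transition (GGerm.inv hg) hW
    have hmono := hm.strictMonoOn one_pos
    have h1 : ∀ᶠ v in 𝓝 a, v ∈ V ∧ ρ v < a := by
      filter_upwards [hm.dom.1.mem_nhds haV, (hm.continuousAt haV).preimage_mem_nhds
        (hρ.symm ▸ Iio_mem_nhds hba)] with v h1 h2 using ⟨h1, h2⟩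
    obtain ⟨c, ⟨hcV, hρc⟩, hca⟩ := ((h1.filter_mono nhdsWithin_le_nhds).and
      (self_mem_nhdsWithin : Ioi a ∈ 𝓝[>] a)).exists
    have hca' : a < c := hca
    have hac : Icc a c ⊆ V := hm.dom.2.1.out haV hcV
    have hlift : ∀ v ∈ interior (Icc ea c), v ≠ a →
        ∃ k ∈ curveStab G δ U, ∃ v' ∈ interior (Icc ea a), GGerm δ U 1 k v v' := by
      intro v hv hva
      rw [interior_Icc] at hv ⊢
      rcases lt_or_gt_of_ne hva with hlt | hgt
      · refine ⟨1, one_mem _, v, ⟨hv.1, hlt⟩, GGerm.of_mem_stab (h.sub ?_) h.curve.dom.1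
          (one_mem _)⟩
        exact h.Icc_subset hT.left hT.right ⟨hv.1.le, hlt.le⟩
      · have hvV := hac ⟨hgt.le, hv.2.le⟩
        refine ⟨ka⁻¹, inv_mem hk, ρ v, ⟨?_, ?_⟩, hm.germ hvV⟩
        · have := hmono haV hvV hgt
          rwa [hρ] at this
        · exact (hmono hvV hcV hv.2).trans hρc
    have hfree : IsFree G δ U (Icc ea c) := by
      refine h.isFree_of_avoid a fun σ g t s ht hs hta hsa hg => ?_
      obtain ⟨k₁, hk₁, t', ht', hg₁⟩ := hlift t ht hta
      obtain ⟨k₂, hk₂, s', hs', hg₂⟩ := hlift s hs hsa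
      have := hT.free _ _ _ _ ht' hs' (GGerm.comp (GGerm.inv hg₁) (GGerm.comp hg hg₂))
      have h3 := mul_mem (mul_mem (inv_mem hk₂) this) hk₁
      simpa [mul_assoc] using h3
    have := (hT.isMaxFree h).max (Icc ea c) (isInterval_Icc (hba.trans hca'))
      (h.Icc_subset hT.left (hVW hcV).1) (Icc_subset_Icc_right hca'.le) hfree
      (right_mem_Icc.2 (hba.trans hca').le)
    exact absurd this.2 (not_le.2 hca')
  · exact h.not_mem_stab_of_neg hg (by norm_num) hk

theorem Tile.left_not_mem (hT : Tile G δ U D b a kb ka eb ea) (h : FreeCurve E G δ U D) :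
    kb ∉ curveStab G δ U := by
  have := (hT.neg h.toActedCurve).right_not_mem h.neg
  rwa [curveStab_neg] at this

end Family

end AnalyticCurve

namespace AnalyticCurve

/-! ### The cells are ordered and cover the domain. -/

section Cells

variable {E : Type*} [NormedAddCommGroup E] [NormedSpace ℝ E] [CompleteSpace E]
  {M : Type*} [TopologicalSpace M] [ChartedSpace E M] [IsManifold 𝓘(ℝ, E) ω M] [T2Space M]
  {G : Type*} [Group G] [MulAction G M]
  {δ γ : ℝ → M} {U A B C D J J' V V' : Set ℝ} {g g' : G} {t r a b x y eb ea : ℝ} {kb ka : G}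
  {μ ρ ρ' f : ℝ → ℝ} {p q : PieceData G} {d : DecompositionData G} {Q : ℤ → PieceData G}
  {s n m : ℤ}

theorem IsADecomposition.neg_one_lt (hd : IsADecomposition γ D A d) : d.a (-1) < d.a 1 :=
  hd.mono _ (DecompositionData.neg_one_mem_idx hd.lo_neg hd.hi_pos) _
    (DecompositionData.one_mem_idx hd.lo_neg hd.hi_pos) (by norm_num)

theorem IsADecomposition.eq_Icc (hd : IsADecomposition γ D A d) :
    A = Icc (d.a (-1)) (d.a 1) := by
  rw [← hd.cell_zero]; simp [DecompositionData.cell]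

theorem IsADecomposition.le_of_le (hd : IsADecomposition γ D A d) (hn : n ∈ d.idx)
    (hm : m ∈ d.idx) (hnm : n ≤ m) : d.a n ≤ d.a m := by
  rcases hnm.eq_or_lt with rfl | hlt
  · exact le_rfl
  · exact (hd.mono n hn m hm hlt).le

/-- There is no point `a₀`: cells with negative index have their upper end at `aₙ`, the others at
`aₙ₊₁`. The hypothesis of a later index `m` ensures that this upper end exists. -/
theorem IsADecomposition.le_upper (hd : IsADecomposition γ D A d) (hn : n ∈ insert 0 d.idx)
    (hm : m ∈ insert 0 d.idx) (hnm : n < m) (hx : x ∈ d.cell D n) :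
    x ≤ d.a (if n < 0 then n else n + 1) := by
  rcases lt_trichotomy n 0 with hlt | rfl | hgt
  · have hni : n ∈ d.idx := hn.resolve_left hlt.ne
    rw [if_pos hlt]
    by_cases hend : d.IsEnd n
    · rw [DecompositionData.mem_cell_end hd.lo_neg hd.hi_pos (Or.inr rfl) (by omega) hend] at hx
      have := hx.2
      push_cast at this
      linarith
    · rw [DecompositionData.mem_cell_inner hd.lo_neg hd.hi_pos (Or.inr rfl) (by omega) hend] at hx
      have := hx.1
      push_cast at this
      linarith
  · rw [hd.cell_zero, hd.eq_Icc] at hx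
    simpa using hx.2
  · have hni : n ∈ d.idx := hn.resolve_left hgt.ne'
    have hmi : m ∈ d.idx := hm.resolve_left (by omega)
    rw [if_neg (by omega)]
    have hend : ¬ d.IsEnd n := by
      rw [DecompositionData.isEnd_of_pos hd.lo_neg hgt]
      intro he
      have := hmi.2.2
      rw [← he, WithTop.coe_le_coe] at this
      omega
    rw [DecompositionData.mem_cell_inner hd.lo_neg hd.hi_pos (Or.inl rfl) (by omega) hend] at hx
    have := hx.2
    push_cast at this
    linarith

theorem IsADecomposition.lower_le (hd : IsADecomposition γ D A d) (hn : n ∈ insert 0 d.idx)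
    (hm : m ∈ insert 0 d.idx) (hnm : n < m) (hx : x ∈ d.cell D m) :
    d.a (if 0 < m then m else m - 1) ≤ x := by
  rcases lt_trichotomy m 0 with hlt | rfl | hgt
  · have hni : n ∈ d.idx := hn.resolve_left (by omega)
    have hmi : m ∈ d.idx := hm.resolve_left hlt.ne
    rw [if_neg (by omega)]
    have hend : ¬ d.IsEnd m := by
      rw [DecompositionData.isEnd_of_neg hd.hi_pos hlt]
      intro he
      have := hni.2.1
      rw [← he, WithBot.coe_le_coe] at this
      omega
    rw [DecompositionData.mem_cell_inner hd.lo_neg hd.hi_pos (Or.inr rfl) (by omega) hend] at hx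
    have := hx.2
    rw [← sub_eq_add_neg] at this
    push_cast at this
    linarith
  · rw [hd.cell_zero, hd.eq_Icc] at hx
    simpa using hx.1
  · have hmi : m ∈ d.idx := hm.resolve_left hgt.ne'
    rw [if_pos hgt]
    by_cases hend : d.IsEnd m
    · rw [DecompositionData.mem_cell_end hd.lo_neg hd.hi_pos (Or.inl rfl) (by omega) hend] at hx
      have := hx.2
      push_cast at this
      linarith
    · rw [DecompositionData.mem_cell_inner hd.lo_neg hd.hi_pos (Or.inl rfl) (by omega) hend] at hx
      have := hx.1
      push_cast at this
      linarith

theorem IsADecomposition.mem_idx_of_between (hd : IsADecomposition γ D A d)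
    (hn : n ∈ insert 0 d.idx) (hm : m ∈ insert 0 d.idx) {k : ℤ} (hk : k ≠ 0) (hnk : n ≤ k)
    (hkm : k ≤ m) : k ∈ d.idx := by
  rcases lt_or_gt_of_ne hk with hlt | hgt
  · rw [DecompositionData.mem_idx_of_neg hd.hi_pos hlt]
    exact (hn.resolve_left (by omega)).2.1.trans (WithBot.coe_le_coe.2 hnk)
  · rw [DecompositionData.mem_idx_of_pos hd.lo_neg hgt]
    exact (WithTop.coe_le_coe.2 hkm).trans (hm.resolve_left (by omega)).2.2

theorem IsADecomposition.le_of_mem_cells (hd : IsADecomposition γ D A d)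
    (hn : n ∈ insert 0 d.idx) (hm : m ∈ insert 0 d.idx) (hnm : n < m) (hx : x ∈ d.cell D n)
    (hy : y ∈ d.cell D m) : x ≤ y := by
  have h1 := hd.le_upper hn hm hnm hx
  have h2 := hd.lower_le hn hm hnm hy
  refine h1.trans (le_trans (hd.le_of_le ?_ ?_ ?_) h2)
  · split_ifs with h0
    · exact hn.resolve_left h0.ne
    · exact hd.mem_idx_of_between hn hm (by omega) (by omega) (by omega)
  · split_ifs with h0
    · exact hm.resolve_left h0.ne'
    · exact hd.mem_idx_of_between hn hm (by omega) (by omega) (by omega)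
  · split_ifs <;> omega

theorem IsADecomposition.eq_of_cell_eq (hd : IsADecomposition γ D A d)
    (hn : n ∈ insert 0 d.idx) (hm : m ∈ insert 0 d.idx) (hx : x ∈ d.cell D n ∩ d.cell D m)
    (hy : y ∈ d.cell D n ∩ d.cell D m) (hxy : x < y) : n = m := by
  by_contra hne
  rcases lt_or_gt_of_ne hne with hlt | hgt
  · exact absurd (hd.le_of_mem_cells hn hm hlt hy.1 hx.2) (not_le.2 hxy)
  · exact absurd (hd.le_of_mem_cells hm hn hgt hy.2 hx.1) (not_le.2 hxy)

/-- A point missed on one side forces infinitely many cells there, each the image of all of `A`. The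
`aₙ` then converge inside `D`, and the elements `gₙ` move `A` arbitrarily close to the limit point,
against satedness. -/
theorem IsADecomposition.exists_mem_cell (hd : IsADecomposition γ D A d)
    (h : FreeCurve E G δ U D) (he : EqOn γ δ D) (ht : t ∈ D) :
    ∃ n ∈ insert 0 d.idx, t ∈ d.cell D n := by
  by_contra hno
  push Not at hno
  have h1i := DecompositionData.one_mem_idx hd.lo_neg hd.hi_pos
  have h2i := DecompositionData.neg_one_mem_idx hd.lo_neg hd.hi_pos
  obtain ⟨s, hs, hst⟩ : ∃ s : ℤ, (s = 1 ∨ s = -1) ∧ 0 ≤ (s : ℝ) * (t - d.a s) := by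
    have h0 := hno 0 (mem_insert _ _)
    rw [hd.cell_zero, hd.eq_Icc, mem_Icc, not_and_or, not_le, not_le] at h0
    rcases h0 with h0 | h0
    · exact ⟨-1, Or.inr rfl, by push_cast; linarith⟩
    · exact ⟨1, Or.inl rfl, by push_cast; linarith⟩
  have hsk : ∀ k : ℕ, 0 < s * (s * ((k : ℤ) + 1)) := fun k => by
    rcases hs with rfl | rfl <;> omega
  have hsucc : ∀ k : ℕ, s * (((k + 1 : ℕ) : ℤ) + 1) = s * ((k : ℤ) + 1) + s := fun k => by
    push_cast; ring
  have hall : ∀ k : ℕ, s * ((k : ℤ) + 1) ∈ d.idx ∧ 0 ≤ (s : ℝ) * (t - d.a (s * ((k : ℤ) + 1))) ∧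
      ¬ d.IsEnd (s * ((k : ℤ) + 1)) := by
    have hnend : ∀ k : ℕ, s * ((k : ℤ) + 1) ∈ d.idx →
        0 ≤ (s : ℝ) * (t - d.a (s * ((k : ℤ) + 1))) → ¬ d.IsEnd (s * ((k : ℤ) + 1)) :=
      fun k h1 h2 hend => hno _ (mem_insert_of_mem _ h1)
        ((DecompositionData.mem_cell_end hd.lo_neg hd.hi_pos hs (hsk k) hend).2 ⟨ht, h2⟩)
    intro k
    induction k with
    | zero =>
      have hsi : s * (((0 : ℕ) : ℤ) + 1) ∈ d.idx := by
        rcases hs with rfl | rfl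
        · exact h1i
        · exact h2i
      have hst' : 0 ≤ (s : ℝ) * (t - d.a (s * (((0 : ℕ) : ℤ) + 1))) := by simpa using hst
      exact ⟨hsi, hst', hnend 0 hsi hst'⟩
    | succ k ih =>
      obtain ⟨h1, h2, h3⟩ := ih
      have h4 := (DecompositionData.next_mem hd.lo_neg hd.hi_pos hs (hsk k)).2 ⟨h1, h3⟩
      have h5 := hno _ (mem_insert_of_mem _ h1)
      rw [DecompositionData.mem_cell_inner hd.lo_neg hd.hi_pos hs (hsk k) h3, not_and, not_le] at h5
      have h6 := h5 h2
      rw [← hsucc] at h4 h6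
      exact ⟨h4, h6.le, hnend (k + 1) h4 h6.le⟩
  have hmono : Monotone fun k : ℕ => (s : ℝ) * d.a (s * ((k : ℤ) + 1)) := by
    refine monotone_nat_of_le_succ fun k => ?_
    rcases hs with rfl | rfl
    · have := hd.le_of_le (hall k).1 (hall (k + 1)).1 (by push_cast; omega)
      push_cast at this ⊢
      linarith
    · have := hd.le_of_le (hall (k + 1)).1 (hall k).1 (by push_cast; omega)
      push_cast at this ⊢
      linarith
  have hbdd : BddAbove (range fun k : ℕ => (s : ℝ) * d.a (s * ((k : ℤ) + 1))) := by
    refine ⟨s * t, ?_⟩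
    rintro _ ⟨k, rfl⟩
    have := (hall k).2.1
    show (s : ℝ) * d.a (s * ((k : ℤ) + 1)) ≤ s * t
    linarith
  have hlim := tendsto_atTop_ciSup hmono hbdd
  have hle := le_ciSup hbdd
  set ℓ := ⨆ k : ℕ, (s : ℝ) * d.a (s * ((k : ℤ) + 1)) with hℓ
  have hℓt : ℓ ≤ s * t := by
    refine ciSup_le fun k => ?_
    have := (hall k).2.1
    linarith
  have hcD : (s : ℝ) * ℓ ∈ D := by
    have h0 := hle 0
    have hD0 := interior_subset (hd.mem _ (hall 0).1)
    rcases hs with rfl | rfl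
    · simp only [Int.cast_one, one_mul] at hℓt h0 ⊢
      exact h.interval.1.out hD0 ht ⟨h0, hℓt⟩
    · simp only [Int.cast_neg, Int.cast_one, neg_mul, one_mul] at hℓt h0 ⊢
      exact h.interval.1.out ht hD0 ⟨by linarith, by simp only [neg_mul, one_mul]; linarith⟩
  have haU := h.sub (interior_subset (hd.mem 1 h1i))
  obtain ⟨u₁, u₂, hu1, hu12, hu2, hd1, hd2, hd12⟩ :=
    h.toActedCurve.exists_points_left haU hd.neg_one_lt
  -- Among three points of `A` with different images, at most one has the image of the limit point.
  obtain ⟨v₁, v₂, hv1, hv2, he1, he2, he12⟩ : ∃ v₁ v₂, v₁ ∈ Icc (d.a (-1)) (d.a 1) ∧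
      v₂ ∈ Icc (d.a (-1)) (d.a 1) ∧ δ v₁ ≠ δ (s * ℓ) ∧ δ v₂ ≠ δ (s * ℓ) ∧ δ v₁ ≠ δ v₂ := by
    have m1 : u₁ ∈ Icc (d.a (-1)) (d.a 1) := ⟨hu1.le, (hu12.trans hu2).le⟩
    have m2 : u₂ ∈ Icc (d.a (-1)) (d.a 1) := ⟨(hu1.trans hu12).le, hu2.le⟩
    have m3 : d.a 1 ∈ Icc (d.a (-1)) (d.a 1) := right_mem_Icc.2 hd.neg_one_lt.le
    by_cases c1 : δ u₁ = δ (s * ℓ)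
    · exact ⟨u₂, d.a 1, m2, m3, fun hh => hd12 (c1.trans hh.symm),
        fun hh => hd1 (c1.trans hh.symm), hd2⟩
    · by_cases c2 : δ u₂ = δ (s * ℓ)
      · exact ⟨u₁, d.a 1, m1, m3, c1, fun hh => hd2 (c2.trans hh.symm), hd1⟩
      · exact ⟨u₁, u₂, m1, m2, c1, c2, hd12⟩
  have hAD : Icc (d.a (-1)) (d.a 1) ⊆ D :=
    h.Icc_subset (hd.mem _ h2i) (hd.mem _ h1i)
  refine h.toActedCurve.not_accumulating (h.sub hcD) he1 he2 he12 fun θ hθ => ?_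
  obtain ⟨k, hk⟩ := (hlim.eventually (lt_mem_nhds (show ℓ - θ < ℓ by linarith))).exists
  obtain ⟨hki, -, hkend⟩ := hall k
  have hdom := hd.inner _ hki hkend
  have hcar := hd.carries _ hki
  rw [hdom, hd.eq_Icc] at hcar
  have hcell : ∀ v ∈ d.cell D (s * ((k : ℤ) + 1)), |v - s * ℓ| < θ ∧ v ∈ D := by
    intro v hv
    rw [DecompositionData.mem_cell_inner hd.lo_neg hd.hi_pos hs (hsk k) hkend, ← hsucc] at hv
    have h3 := hle (k + 1)
    have hk1 := interior_subset (hd.mem _ hki)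
    have hk2 := interior_subset (hd.mem _ (hall (k + 1)).1)
    rcases hs with rfl | rfl
    · simp only [Int.cast_one, one_mul] at hv h3 hk hk1 hk2 ⊢
      exact ⟨abs_lt.2 ⟨by linarith, by linarith⟩, h.interval.1.out hk1 hk2
        ⟨by linarith, by linarith⟩⟩
    · simp only [Int.cast_neg, Int.cast_one, neg_mul, one_mul] at hv h3 hk hk1 hk2 ⊢
      exact ⟨abs_lt.2 ⟨by linarith, by linarith⟩, h.interval.1.out hk2 hk1
        ⟨by linarith, by linarith⟩⟩
  have hmap : ∀ v ∈ Icc (d.a (-1)) (d.a 1), |d.μ (s * ((k : ℤ) + 1)) v - s * ℓ| < θ ∧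
      d.g (s * ((k : ℤ) + 1)) • δ v = δ (d.μ (s * ((k : ℤ) + 1)) v) := by
    intro v hv
    obtain ⟨h1, h2⟩ := hcell _ (hcar.1.2 ▸ mem_image_of_mem _ hv)
    refine ⟨h1, ?_⟩
    rw [← he (hAD hv), ← he h2]
    exact hcar.2 v hv
  exact ⟨_, _, _, (hmap v₁ hv1).1, (hmap v₂ hv2).1, (hmap v₁ hv1).2, (hmap v₂ hv2).2⟩

end Cells

end AnalyticCurve

namespace AnalyticCurve

/-! ### The pieces form a faithful decomposition. -/

section FamilyDecomposition

variable {E : Type*} [NormedAddCommGroup E] [NormedSpace ℝ E] [CompleteSpace E]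
  {M : Type*} [TopologicalSpace M] [ChartedSpace E M] [IsManifold 𝓘(ℝ, E) ω M] [T2Space M]
  {G : Type*} [Group G] [MulAction G M]
  {δ γ : ℝ → M} {U A B C D J J' V V' : Set ℝ} {g g' : G} {t r a b x y eb ea : ℝ} {kb ka : G}
  {μ ρ ρ' f : ℝ → ℝ} {p q : PieceData G} {d : DecompositionData G} {Q : ℤ → PieceData G}
  {s n m : ℤ}

theorem PieceFamily.a_one (F : PieceFamily δ U D b a kb ka eb ea d Q) : d.a 1 = a := by
  rw [F.a_eq]; exact F.one.2.2

theorem PieceFamily.a_neg_one (F : PieceFamily δ U D b a kb ka eb ea d Q) : d.a (-1) = b := by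
  rw [F.a_eq]; exact F.neg_one.2.2

theorem PieceFamily.a_next (F : PieceFamily δ U D b a kb ka eb ea d Q) (hs : s = 1 ∨ s = -1)
    (hsn : 0 < s * n) (hn : n ∈ d.idx) (hend : ¬ d.IsEnd n) :
    d.a (n + s) = (Q n).ρ (a + b - (Q n).e) := by
  rw [F.a_eq, (F.next s n hs hsn hn hend).start_eq]

theorem PieceFamily.step_pos (F : PieceFamily δ U D b a kb ka eb ea d Q) (hba : b < a)
    (hs : s = 1 ∨ s = -1)
    (hsn : 0 < s * n) (hn : n ∈ d.idx) (hend : ¬ d.IsEnd n) :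
    0 < (s : ℝ) * (d.a (n + s) - d.a n) := by
  rw [F.a_next hs hsn hn hend, F.a_eq]
  have := F.full n hn
  exact (F.piece s n hs hsn hn).next_pos hba (not_not.1 fun hf => hend (this.2 hf))

theorem PieceFamily.side_mono (F : PieceFamily δ U D b a kb ka eb ea d Q) (hba : b < a)
    (hs : s = 1 ∨ s = -1) (hsn : 0 < s * n) (hn : n ∈ d.idx) :
    ∀ m, 0 < s * m → s * m < s * n → 0 < (s : ℝ) * (d.a n - d.a m) := by
  refine DecompositionData.side_induction F.lo_neg F.hi_pos hs
    (P := fun n => ∀ m, 0 < s * m → s * m < s * n → 0 < (s : ℝ) * (d.a n - d.a m)) ?_ ?_ hn hsn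
  · intro m h1 h2
    rcases hs with rfl | rfl <;> omega
  · intro n hn hsn hend _ ih m hm hmn
    have h1 := F.step_pos hba hs hsn hn hend
    by_cases hmn' : m = n
    · rwa [hmn']
    · have h2 := ih m hm (by rcases hs with rfl | rfl <;> omega)
      have : (s : ℝ) * (d.a (n + s) - d.a m) =
        (s : ℝ) * (d.a (n + s) - d.a n) + (s : ℝ) * (d.a n - d.a m) := by ring
      linarith

theorem PieceFamily.mono (F : PieceFamily δ U D b a kb ka eb ea d Q) (hba : b < a)
    (hm : m ∈ d.idx) (hn : n ∈ d.idx) (hmn : m < n) : d.a m < d.a n := by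
  have hpos : ∀ n ∈ d.idx, 0 < n → d.a 1 ≤ d.a n := fun n hn h0 => by
    rcases (by omega : n = 1 ∨ 1 < n) with rfl | h1
    · exact le_rfl
    · have := F.side_mono hba (Or.inl rfl) (by omega) hn 1 (by norm_num) (by omega)
      push_cast at this
      linarith
  have hneg : ∀ n ∈ d.idx, n < 0 → d.a n ≤ d.a (-1) := fun n hn h0 => by
    rcases (by omega : n = -1 ∨ n < -1) with rfl | h1
    · exact le_rfl
    · have := F.side_mono hba (Or.inr rfl) (by omega) hn (-1) (by norm_num) (by omega)
      push_cast at this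
      linarith
  rcases lt_or_gt_of_ne hm.1 with h1 | h1
  · rcases lt_or_gt_of_ne hn.1 with h2 | h2
    · have := F.side_mono hba (Or.inr rfl) (by omega) hm n (by omega) (by omega)
      push_cast at this
      linarith
    · have h3 := hneg m hm h1
      have h4 := hpos n hn h2
      rw [F.a_neg_one] at h3
      rw [F.a_one] at h4
      linarith
  · have := F.side_mono hba (Or.inl rfl) (by omega) hn m (by omega) (by omega)
    push_cast at this
    linarith

theorem PieceFamily.image_eq_cell (F : PieceFamily δ U D b a kb ka eb ea d Q)
    (h : FreeCurve E G δ U D) (hba : b < a) (hAD : Icc b a ⊆ D) (hn : n ∈ d.idx) :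
    (Q n).ρ '' (Q n).dom D b a = d.cell D n := by
  obtain ⟨s, hs, hsn⟩ := DecompositionData.exists_sign hn.1
  have hp := F.piece s n hs hsn hn
  by_cases hend : d.IsEnd n
  · rw [hp.image_of_not_full h hba hAD ((F.full n hn).1 hend)]
    ext y
    rw [DecompositionData.mem_cell_end F.lo_neg F.hi_pos hs hsn hend, F.a_eq]
    rfl
  · rw [hp.image_of_full h hba hAD (not_not.1 fun hf => hend ((F.full n hn).2 hf))]
    ext y
    rw [DecompositionData.mem_cell_inner F.lo_neg F.hi_pos hs hsn hend, F.a_eq n,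
      F.a_next hs hsn hn hend]
    rfl

theorem PieceFamily.cell_zero (F : PieceFamily δ U D b a kb ka eb ea d Q) :
    d.cell D 0 = Icc b a := by
  rw [DecompositionData.cell, if_pos rfl, F.a_one, F.a_neg_one]

theorem PieceFamily.dom_zero (F : PieceFamily δ U D b a kb ka eb ea d Q) (hDU : D ⊆ U)
    (hAD : Icc b a ⊆ D) : (Q 0).dom D b a = Icc b a := by
  refine Subset.antisymm (fun t ht => ht.1) fun t ht => ⟨ht, ?_, ?_⟩
  · rw [F.zero.2.2]; exact hDU (hAD ht)
  · rw [F.zero.2.1]; exact hAD ht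

/-- Every index comes with a maximal transition. -/
theorem PieceFamily.exists_max (F : PieceFamily δ U D b a kb ka eb ea d Q)
    (h : FreeCurve E G δ U D) (hba : b < a) (hAD : Icc b a ⊆ D) (hn : n ∈ insert 0 d.idx) :
    (∃ σ : ℝ, GMaxTransition δ U σ (d.g n) (Q n).ρ (Q n).V) ∧ IsInterval ((Q n).dom D b a) ∧
      (Q n).ρ '' (Q n).dom D b a = d.cell D n := by
  rcases hn with rfl | hn
  · rw [F.dom_zero h.sub hAD, F.cell_zero, F.g_eq, F.zero.1, F.zero.2.1, F.zero.2.2, image_id]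
    exact ⟨⟨1, gMaxTransition_id h.curve.dom (one_mem _)⟩, isInterval_Icc hba, rfl⟩
  · obtain ⟨s, hs, hsn⟩ := DecompositionData.exists_sign hn.1
    have hp := F.piece s n hs hsn hn
    rw [F.g_eq]
    exact ⟨⟨_, hp.max⟩, hp.isInterval_dom h hba, F.image_eq_cell h hba hAD hn⟩

theorem PieceFamily.isADecomposition (F : PieceFamily δ U D b a kb ka eb ea d Q)
    (h : FreeCurve E G δ U D) (hT : Tile G δ U D b a kb ka eb ea) (he : EqOn γ δ D) :
    IsADecomposition γ D (Icc b a) d := by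
  have hba := hT.lt
  have hAD := h.Icc_subset hT.left hT.right
  refine ⟨?_, F.lo_neg, F.hi_pos, ?_, fun m hm n hn hmn => F.mono hba hm hn hmn, F.cell_zero,
    ?_, ?_, ?_, ?_, ?_, ?_, ?_, ?_⟩
  · exact (h.toActedCurve.isFreeSegment_iff (hAD.trans h.sub) (he.mono hAD)).2 hT.free
  · intro n hn
    obtain ⟨s, hs, hsn⟩ := DecompositionData.exists_sign hn.1
    rw [F.a_eq]
    exact (F.piece s n hs hsn hn).start
  · rw [F.g_eq, F.zero.1]
  · rw [F.dom_eq, F.dom_zero h.sub hAD]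
  · rw [F.μ_eq, F.zero.2.1]
    exact fun _ _ => rfl
  · rw [h.cls_ne_cls_one_iff he, F.g_eq, F.one.1]
    exact hT.right_not_mem h
  · rw [h.cls_ne_cls_one_iff he, F.g_eq, F.neg_one.1]
    exact hT.left_not_mem h
  · intro n hn hend
    obtain ⟨s, hs, hsn⟩ := DecompositionData.exists_sign hn.1
    rw [F.dom_eq, (F.piece s n hs hsn hn).dom_of_full h hba
      (not_not.1 fun hf => hend ((F.full n hn).2 hf))]
  · intro n hn _
    obtain ⟨s, hs, hsn⟩ := DecompositionData.exists_sign hn.1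
    have hp := F.piece s n hs hsn hn
    rw [F.dom_eq, F.a_one, F.a_neg_one]
    exact ⟨hp.isInterval_dom h hba, fun t ht => ht.1, (Q n).e, hp.e_mem_dom hba, hp.mem⟩
  · intro n hn
    obtain ⟨s, hs, hsn⟩ := DecompositionData.exists_sign hn.1
    have hp := F.piece s n hs hsn hn
    rw [F.dom_eq, F.μ_eq, F.g_eq, ← F.image_eq_cell h hba hAD hn]
    refine hp.max.toTransition.carries he (fun t ht => hAD ht.1) ?_ fun t ht => ht.2.1
    rintro _ ⟨t, ht, rfl⟩
    exact ht.2.2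

/-- The target of an overlap lies in some cell, so it is also the image of a point of the tile under
that piece. The two sources are joined by a germ inside the tile, hence coincide, and the overlap is
a restriction of the piece. Two indices that fit would have equal cells, and equal cells share more
than one point. -/
theorem PieceFamily.isFaithful (F : PieceFamily δ U D b a kb ka eb ea d Q)
    (h : FreeCurve E G δ U D) (hT : Tile G δ U D b a kb ka eb ea) (he : EqOn γ δ D) :
    IsFaithful γ D (Icc b a) d := by
  have hba := hT.lt
  have hAD := h.Icc_subset hT.left hT.right
  have hd := F.isADecomposition h hT he
  intro g ρ J J' ho
  obtain ⟨σ, hσ, htr, hmap⟩ := h.toActedCurve.exists_transition_of_overlapVia h.sub he hAD ho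
  have hJi : J ⊆ interior (Icc b a) := interior_maximal ho.2.2.1 ho.1.1
  obtain ⟨t, ht⟩ := ho.1.2.2
  obtain ⟨n, hn, hcell⟩ := hd.exists_mem_cell h he (interior_subset (hmap ht))
  obtain ⟨⟨σn, hm⟩, hdi, himg⟩ := F.exists_max h hba hAD hn
  obtain ⟨u, hu, hue⟩ : ρ t ∈ (Q n).ρ '' (Q n).dom D b a := himg ▸ hcell
  have hgu := hm.germ hu.2.1
  rw [hue] at hgu
  obtain ⟨hst, hut, hsgn⟩ := h.germ_eq_of_mem' (isInterval_Icc hba) hAD hT.free hu.1 (hJi ht)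
    (GGerm.comp hgu (GGerm.inv (htr.germ ht)))
  subst hut
  have htr' : GTransition δ U σn (d.g n) ρ J :=
    (htr.congr_left (curveStab_smul_eqOn hst)).of_sign (by linarith)
  have hJV := hm.max ρ J htr' ⟨u, hu.2.1, ht, hue⟩
  have hEq := Transition.eqOn h.curve htr' hm.toTransition ht (hJV ht) hue.symm
  have hρ : EqOn ρ (Q n).ρ J := fun v hv => hEq ⟨hv, hJV hv⟩
  refine ⟨n, ⟨hn, (h.cls_eq_cls_iff he).2 hst, ?_⟩, ?_⟩
  · rw [F.μ_eq, F.dom_eq]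
    exact hm.toTransition.maximalExtensionEq hJV hρ (fun v hv => hv.2.1) fun _ _ => rfl
  · rintro m ⟨hmi, hcls, hext⟩
    rw [F.μ_eq, F.dom_eq] at hext
    obtain ⟨⟨σm, hmm⟩, hdim, himgm⟩ := F.exists_max h hba hAD hmi
    obtain ⟨h1, h2, h3⟩ := h.toActedCurve.max_of_maximalExtensionEq h.sub ho.1
      (ho.2.2.1.trans (hAD.trans h.sub)) htr hdim (fun v hv => hAD hv.1) (fun v hv => hv.2.2) hmm
      (fun v hv => hv.2.1) (fun _ _ => rfl) ((h.cls_eq_cls_iff he).1 hcls) hext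
    obtain ⟨-, hVV, hEE⟩ := h.toActedCurve.max_unique hm hmm
      (by
        have h4 : 0 < (σn * σm) * (σ * σ) := by nlinarith [mul_pos hsgn h3]
        exact pos_of_mul_pos_left h4 (mul_self_nonneg _)) (hJV ht) (h1 ht)
      ((hρ ht).symm.trans (h2 ht))
    have hdom : (Q m).dom D b a = (Q n).dom D b a := by
      ext v
      constructor
      · rintro ⟨h5, h6, h7⟩
        rw [← hVV] at h6
        exact ⟨h5, h6, by rwa [hEE h6]⟩
      · rintro ⟨h5, h6, h7⟩
        exact ⟨h5, hVV ▸ h6, by rwa [← hEE h6]⟩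
    have hcells : d.cell D m = d.cell D n := by
      rw [← himgm, ← himg, hdom]
      exact (image_congr fun v hv => (hEE hv.2.1)).symm
    obtain ⟨x, hx⟩ := hdi.2
    obtain ⟨y, hy, hxy⟩ := exists_gt_mem_of_mem_interior hx
    have hx' := interior_subset hx
    have hne : (Q n).ρ x ≠ (Q n).ρ y := fun hh => hxy.ne (hm.injOn hx'.2.1 hy.2.1 hh)
    have hxc : (Q n).ρ x ∈ d.cell D n := himg ▸ mem_image_of_mem _ hx'
    have hyc : (Q n).ρ y ∈ d.cell D n := himg ▸ mem_image_of_mem _ hy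
    rcases lt_or_gt_of_ne hne with hlt | hgt
    · exact hd.eq_of_cell_eq hmi hn ⟨hcells ▸ hxc, hxc⟩ ⟨hcells ▸ hyc, hyc⟩ hlt
    · exact hd.eq_of_cell_eq hmi hn ⟨hcells ▸ hyc, hyc⟩ ⟨hcells ▸ hxc, hxc⟩ hgt

end FamilyDecomposition

end AnalyticCurve

namespace AnalyticCurve

/-! ### Uniqueness of the decomposition of a given interval. -/

section Uniqueness

variable {E : Type*} [NormedAddCommGroup E] [NormedSpace ℝ E] [CompleteSpace E]
  {M : Type*} [TopologicalSpace M] [ChartedSpace E M] [IsManifold 𝓘(ℝ, E) ω M] [T2Space M]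
  {G : Type*} [Group G] [MulAction G M]
  {δ γ : ℝ → M} {U A B C D J J' V V' : Set ℝ} {g g' : G} {t r a b x y eb ea : ℝ} {kb ka : G}
  {μ ρ ρ' f : ℝ → ℝ} {d d' : DecompositionData G} {s n m : ℤ}

theorem IsADecomposition.subset (hd : IsADecomposition γ D A d) (h : FreeCurve E G δ U D) :
    A ⊆ D := by
  rw [hd.eq_Icc]
  exact h.Icc_subset (hd.mem _ (DecompositionData.neg_one_mem_idx hd.lo_neg hd.hi_pos))
    (hd.mem _ (DecompositionData.one_mem_idx hd.lo_neg hd.hi_pos))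

theorem IsADecomposition.isInterval (hd : IsADecomposition γ D A d) : IsInterval A := by
  rw [hd.eq_Icc]; exact isInterval_Icc hd.neg_one_lt

theorem IsADecomposition.isFree (hd : IsADecomposition γ D A d) (h : FreeCurve E G δ U D)
    (he : EqOn γ δ D) : IsFree G δ U A :=
  (h.toActedCurve.isFreeSegment_iff ((hd.subset h).trans h.sub) (he.mono (hd.subset h))).1 hd.free

theorem IsADecomposition.dom_interval (hd : IsADecomposition γ D A d) (hn : n ∈ d.idx) :
    IsInterval (d.dom n) ∧ d.dom n ⊆ A := by
  by_cases hend : d.IsEnd n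
  · exact ⟨(hd.outer n hn hend).1, (hd.outer n hn hend).2.1⟩
  · rw [hd.inner n hn hend]
    exact ⟨hd.isInterval, Subset.rfl⟩

theorem IsADecomposition.next_mem (hd : IsADecomposition γ D A d) (hs : s = 1 ∨ s = -1)
    (hsn : 0 < s * n) (hn : n ∈ d.idx) (hend : ¬ d.IsEnd n) : n + s ∈ d.idx :=
  (DecompositionData.next_mem hd.lo_neg hd.hi_pos hs hsn).2 ⟨hn, hend⟩

theorem IsADecomposition.step_pos (hd : IsADecomposition γ D A d) (hs : s = 1 ∨ s = -1)
    (hsn : 0 < s * n) (hn : n ∈ d.idx) (hend : ¬ d.IsEnd n) :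
    0 < (s : ℝ) * (d.a (n + s) - d.a n) := by
  have hn' := hd.next_mem hs hsn hn hend
  rcases hs with rfl | rfl
  · have := hd.mono n hn _ hn' (by omega)
    push_cast
    linarith
  · have := hd.mono _ hn' n hn (by omega)
    push_cast
    linarith

theorem IsADecomposition.mem_cell_end (hd : IsADecomposition γ D A d) (hs : s = 1 ∨ s = -1)
    (hsn : 0 < s * n) (hend : d.IsEnd n) :
    t ∈ d.cell D n ↔ t ∈ D ∧ 0 ≤ (s : ℝ) * (t - d.a n) :=
  DecompositionData.mem_cell_end hd.lo_neg hd.hi_pos hs hsn hend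

theorem IsADecomposition.mem_cell_inner (hd : IsADecomposition γ D A d) (hs : s = 1 ∨ s = -1)
    (hsn : 0 < s * n) (hend : ¬ d.IsEnd n) :
    t ∈ d.cell D n ↔ 0 ≤ (s : ℝ) * (t - d.a n) ∧ (s : ℝ) * (t - d.a (n + s)) ≤ 0 :=
  DecompositionData.mem_cell_inner hd.lo_neg hd.hi_pos hs hsn hend

theorem IsADecomposition.cell_subset (hd : IsADecomposition γ D A d) (h : FreeCurve E G δ U D)
    (hn : n ∈ insert 0 d.idx) : d.cell D n ⊆ D := by
  rcases hn with rfl | hn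
  · rw [hd.cell_zero]; exact hd.subset h
  obtain ⟨s, hs, hsn⟩ := DecompositionData.exists_sign hn.1
  intro t ht
  by_cases hend : d.IsEnd n
  · exact ((hd.mem_cell_end hs hsn hend).1 ht).1
  · have hn' := interior_subset (hd.mem _ (hd.next_mem hs hsn hn hend))
    have hn0 := interior_subset (hd.mem _ hn)
    rw [hd.mem_cell_inner hs hsn hend] at ht
    rcases hs with rfl | rfl
    · push_cast at ht
      exact h.interval.1.out hn0 hn' ⟨by linarith, by linarith⟩
    · push_cast at ht
      exact h.interval.1.out hn' hn0 ⟨by linarith, by linarith⟩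

theorem IsADecomposition.exists_max (hd : IsADecomposition γ D A d) (h : FreeCurve E G δ U D)
    (he : EqOn γ δ D) (hn : n ∈ d.idx) :
    ∃ (σ : ℝ) (ρ : ℝ → ℝ) (V : Set ℝ), (σ = 1 ∨ σ = -1) ∧ GMaxTransition δ U σ (d.g n) ρ V ∧
      d.dom n ⊆ V ∧ EqOn (d.μ n) ρ (d.dom n) ∧ ρ '' d.dom n = d.cell D n :=
  h.toActedCurve.exists_max_of_carries h.sub he (hd.dom_interval hn).1
    ((hd.dom_interval hn).2.trans (hd.subset h)) (hd.cell_subset h (mem_insert_of_mem _ hn))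
    (hd.carries n hn)

theorem IsADecomposition.exists_initial (hd : IsADecomposition γ D A d)
    (h : FreeCurve E G δ U D) (hs : s = 1 ∨ s = -1) (hsn : 0 < s * n) (hn : n ∈ d.idx) :
    ∃ ε > 0, ∀ y : ℝ, 0 ≤ (s : ℝ) * (y - d.a n) → (s : ℝ) * (y - d.a n) ≤ ε → y ∈ d.cell D n := by
  by_cases hend : d.IsEnd n
  · have hD := hd.mem n hn
    rcases hs with rfl | rfl
    · obtain ⟨q, hq, hlt⟩ := exists_gt_mem_of_mem_interior hD
      refine ⟨q - d.a n, by linarith, fun y h1 h2 => ?_⟩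
      refine (hd.mem_cell_end (Or.inl rfl) hsn hend).2 ⟨?_, h1⟩
      push_cast at h1 h2
      exact h.interval.1.out (interior_subset hD) hq ⟨by linarith, by linarith⟩
    · obtain ⟨q, hq, hlt⟩ := exists_lt_mem_of_mem_interior hD
      refine ⟨d.a n - q, by linarith, fun y h1 h2 => ?_⟩
      refine (hd.mem_cell_end (Or.inr rfl) hsn hend).2 ⟨?_, h1⟩
      push_cast at h1 h2
      exact h.interval.1.out hq (interior_subset hD) ⟨by linarith, by linarith⟩
  · refine ⟨_, hd.step_pos hs hsn hn hend, fun y h1 h2 => ?_⟩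
    exact (hd.mem_cell_inner hs hsn hend).2 ⟨h1, by linarith⟩

theorem IsADecomposition.beyond (hd : IsADecomposition γ D A d) (hs : s = 1 ∨ s = -1)
    (hn : n ∈ d.idx) : ∃ q ∈ D, 0 < (s : ℝ) * (q - d.a n) := by
  have hD := hd.mem n hn
  rcases hs with rfl | rfl
  · obtain ⟨q, hq, hlt⟩ := exists_gt_mem_of_mem_interior hD
    exact ⟨q, hq, by push_cast; linarith⟩
  · obtain ⟨q, hq, hlt⟩ := exists_lt_mem_of_mem_interior hD
    exact ⟨q, hq, by push_cast; linarith⟩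

/-- Two decompositions of the same interval with a common point `aₙ` have the same `n`-th maximal
transition. -/
theorem IsADecomposition.common_max (hd : IsADecomposition γ D A d)
    (hd' : IsADecomposition γ D A d') (h : FreeCurve E G δ U D) (he : EqOn γ δ D)
    (hs : s = 1 ∨ s = -1) (hsn : 0 < s * n) (hn : n ∈ d.idx) (hn' : n ∈ d'.idx)
    (ha : d.a n = d'.a n) :
    (d.g n)⁻¹ * d'.g n ∈ curveStab G δ U ∧ ∃ (ρ : ℝ → ℝ) (V : Set ℝ), InjOn ρ V ∧
      d.dom n ⊆ V ∧ d'.dom n ⊆ V ∧ EqOn (d.μ n) ρ (d.dom n) ∧ EqOn (d'.μ n) ρ (d'.dom n) ∧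
      ρ '' d.dom n = d.cell D n ∧ ρ '' d'.dom n = d'.cell D n := by
  obtain ⟨σ, ρ, V, hσ, hm, hV, hμ, himg⟩ := hd.exists_max h he hn
  obtain ⟨σ', ρ', V', hσ', hm', hV', hμ', himg'⟩ := hd'.exists_max h he hn'
  obtain ⟨ε, hε, hc⟩ := hd.exists_initial h hs hsn hn
  obtain ⟨ε', hε', hc'⟩ := hd'.exists_initial h hs hsn hn'
  have hss : (s : ℝ) * s = 1 := by rcases hs with rfl | rfl <;> norm_num
  have hmin : 0 < min ε ε' := lt_min hε hε'
  -- All points between `aₙ` and `w` belong to the `n`-th cell of both decompositions. The midpoint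
  -- of the preimages of `aₙ` and `w` is interior to `A`, as comparison by `germ_eq_of_mem`
  -- requires.
  set w := d.a n + s * min ε ε' with hw
  have hsw : (s : ℝ) * (w - d.a n) = min ε ε' := by
    rw [hw, add_sub_cancel_left, ← mul_assoc, hss, one_mul]
  obtain ⟨u0, hu0, hue0⟩ : d.a n ∈ ρ '' d.dom n := himg ▸ hc _ (by simp) (by simpa using hε.le)
  obtain ⟨u1, hu1, hue1⟩ : w ∈ ρ '' d.dom n :=
    himg ▸ hc _ (by rw [hsw]; exact hmin.le) (by rw [hsw]; exact min_le_left _ _)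
  have hwa : w ≠ d.a n := fun hh => by rw [hh, sub_self, mul_zero] at hsw; linarith
  have hu01 : u0 ≠ u1 := fun hh => hwa (by rw [← hue0, ← hue1, hh])
  have hord := hm.toTransition.ordConnected_dom (A := univ) ordConnected_univ
    (ordConnected_uIcc (a := d.a n) (b := w))
  have hum := hord.uIcc_subset (x := u0) (y := u1)
    ⟨mem_univ _, hV hu0, by rw [hue0]; exact left_mem_uIcc⟩
    ⟨mem_univ _, hV hu1, by rw [hue1]; exact right_mem_uIcc⟩
    (show (u0 + u1) / 2 ∈ uIcc u0 u1 by
      rcases le_total u0 u1 with hle | hle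
      · rw [uIcc_of_le hle]; constructor <;> linarith
      · rw [uIcc_of_ge hle]; constructor <;> linarith)
  have hdA := (hd.dom_interval hn).2
  have humA : (u0 + u1) / 2 ∈ interior A := by
    rcases lt_or_gt_of_ne hu01 with hlt | hlt
    · exact mem_interior_of_between hd.isInterval.1 (hdA hu0) (hdA hu1) (by linarith) (by linarith)
    · exact mem_interior_of_between hd.isInterval.1 (hdA hu1) (hdA hu0) (by linarith) (by linarith)
  have hvc : ρ ((u0 + u1) / 2) ∈ d'.cell D n := by
    have h1 := hum.2.2
    have h2 : 0 ≤ (s : ℝ) * (ρ ((u0 + u1) / 2) - d.a n) ∧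
        (s : ℝ) * (ρ ((u0 + u1) / 2) - d.a n) ≤ min ε ε' := by
      rcases hs with rfl | rfl
      · push_cast at hsw ⊢
        rw [uIcc_of_le (by linarith)] at h1
        constructor <;> linarith [h1.1, h1.2]
      · push_cast at hsw ⊢
        rw [uIcc_of_ge (by linarith)] at h1
        constructor <;> linarith [h1.1, h1.2]
    refine hc' _ ?_ ?_
    · rw [← ha]; exact h2.1
    · rw [← ha]; exact h2.2.trans (min_le_right _ _)
  obtain ⟨u', hu', hue'⟩ : ρ ((u0 + u1) / 2) ∈ ρ' '' d'.dom n := himg' ▸ hvc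
  have hg' := hm'.germ (hV' hu')
  rw [hue'] at hg'
  obtain ⟨-, h2, h3⟩ := h.germ_eq_of_mem hd.isInterval (hd.subset h) (hd.isFree h he) humA
    ((hd'.dom_interval hn').2 hu') (GGerm.comp (hm.germ hum.2.1) (GGerm.inv hg'))
  subst h2
  obtain ⟨h4, rfl, h5⟩ := h.toActedCurve.max_unique hm hm' h3 hum.2.1 (hV' hu') hue'.symm
  refine ⟨h4, ρ, V, hm.injOn, hV, hV', hμ, fun t ht => (hμ' ht).trans (h5 (hV' ht)).symm, himg, ?_⟩
  rw [← himg']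
  exact image_congr fun t ht => h5 (hV' ht)

/-- An end cell contains everything in `D` beyond `aₙ`, while its source is only a part of `A`. It
would thus lie in the inner cell of the other decomposition, which stops before the end of `D`. -/
theorem IsADecomposition.isEnd_of_isEnd (hd : IsADecomposition γ D A d)
    (hd' : IsADecomposition γ D A d') (h : FreeCurve E G δ U D) (he : EqOn γ δ D)
    (hs : s = 1 ∨ s = -1) (hsn : 0 < s * n) (hn : n ∈ d.idx) (hn' : n ∈ d'.idx)
    (ha : d.a n = d'.a n) (hend : d'.IsEnd n) : d.IsEnd n := by
  by_contra hne
  obtain ⟨-, ρ, V, -, hV, hV', -, -, himg, himg'⟩ := hd.common_max hd' h he hs hsn hn hn' ha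
  have hsub : d'.cell D n ⊆ d.cell D n := by
    rw [← himg, ← himg', hd.inner n hn hne]
    exact image_mono (hd'.dom_interval hn').2
  obtain ⟨q, hq, hqs⟩ := hd.beyond hs (hd.next_mem hs hsn hn hne)
  have hst := hd.step_pos hs hsn hn hne
  have hqc : q ∈ d'.cell D n := (hd'.mem_cell_end hs hsn hend).2 ⟨hq, by rw [← ha]; linarith⟩
  have := ((hd.mem_cell_inner hs hsn hne).1 (hsub hqc)).2
  linarith

theorem IsADecomposition.a_eq (hd : IsADecomposition γ D A d)
    (hd' : IsADecomposition γ D A d') (h : FreeCurve E G δ U D) (he : EqOn γ δ D)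
    (hn : n ∈ d.idx) : n ∈ d'.idx ∧ d.a n = d'.a n := by
  obtain ⟨s, hs, hsn⟩ := DecompositionData.exists_sign hn.1
  refine DecompositionData.side_induction hd.lo_neg hd.hi_pos hs
    (P := fun n => n ∈ d'.idx ∧ d.a n = d'.a n) ?_ ?_ hn hsn
  · have hIcc : Icc (d.a (-1)) (d.a 1) = Icc (d'.a (-1)) (d'.a 1) := by
      rw [← hd.eq_Icc, ← hd'.eq_Icc]
    rw [Icc_eq_Icc_iff hd.neg_one_lt.le] at hIcc
    rcases hs with rfl | rfl
    · exact ⟨DecompositionData.one_mem_idx hd'.lo_neg hd'.hi_pos, hIcc.2⟩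
    · exact ⟨DecompositionData.neg_one_mem_idx hd'.lo_neg hd'.hi_pos, hIcc.1⟩
  · rintro n hn hsn hne hni ⟨hn', ha⟩
    have hne' : ¬ d'.IsEnd n := fun hend => hne (hd.isEnd_of_isEnd hd' h he hs hsn hn hn' ha hend)
    refine ⟨hd'.next_mem hs hsn hn' hne', ?_⟩
    obtain ⟨-, ρ, V, -, hV, hV', -, -, himg, himg'⟩ := hd.common_max hd' h he hs hsn hn hn' ha
    rw [hd.inner n hn hne] at himg
    rw [hd'.inner n hn' hne'] at himg'
    have hcell : d.cell D n = d'.cell D n := himg.symm.trans himg'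
    have h1 : d.a (n + s) ∈ d'.cell D n := by
      rw [← hcell, hd.mem_cell_inner hs hsn hne]
      exact ⟨(hd.step_pos hs hsn hn hne).le, by simp⟩
    have h2 : d'.a (n + s) ∈ d.cell D n := by
      rw [hcell, hd'.mem_cell_inner hs hsn hne']
      exact ⟨(hd'.step_pos hs hsn hn' hne').le, by simp⟩
    have h3 := ((hd'.mem_cell_inner hs hsn hne').1 h1).2
    have h4 := ((hd.mem_cell_inner hs hsn hne).1 h2).2
    rcases hs with rfl | rfl
    · push_cast at h3 h4
      linarith
    · push_cast at h3 h4
      linarith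

theorem IsADecomposition.same (hd : IsADecomposition γ D A d)
    (hd' : IsADecomposition γ D A d') (h : FreeCurve E G δ U D) (he : EqOn γ δ D) :
    SameDecomposition γ D d d' := by
  have hidx : d.idx = d'.idx := Subset.antisymm (fun n hn => (hd.a_eq hd' h he hn).1)
    fun n hn => (hd'.a_eq hd h he hn).1
  obtain ⟨h1, h2⟩ :=
    DecompositionData.lo_hi_eq_of_idx_eq hd.lo_neg hd.hi_pos hd'.lo_neg hd'.hi_pos hidx
  refine ⟨h1, h2, fun n hn => ?_⟩
  obtain ⟨hn', ha⟩ := hd.a_eq hd' h he hn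
  obtain ⟨s, hs, hsn⟩ := DecompositionData.exists_sign hn.1
  obtain ⟨hst, ρ, V, hinj, hV, hV', hμ, hμ', himg, himg'⟩ :=
    hd.common_max hd' h he hs hsn hn hn' ha
  have hdom : d.dom n = d'.dom n := by
    by_cases hend : d.IsEnd n
    · have hend' := hd'.isEnd_of_isEnd hd h he hs hsn hn' hn ha.symm hend
      have hcell : d.cell D n = d'.cell D n := by
        ext t
        rw [hd.mem_cell_end hs hsn hend, hd'.mem_cell_end hs hsn hend', ha]
      rw [← himg, ← himg'] at hcell
      exact (hinj.image_eq_image_iff hV hV').1 hcell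
    · have hend' : ¬ d'.IsEnd n := fun hh =>
        hend (hd.isEnd_of_isEnd hd' h he hs hsn hn hn' ha hh)
      rw [hd.inner n hn hend, hd'.inner n hn' hend']
  exact ⟨ha, (h.cls_eq_cls_iff he).2 hst, hdom,
    fun t ht => (hμ ht).trans (hμ' (hdom ▸ ht)).symm⟩

theorem SameDecomposition.idx_eq (hs : SameDecomposition γ D d d') : d.idx = d'.idx := by
  ext m; rw [DecompositionData.idx, DecompositionData.idx, hs.1, hs.2.1]

theorem SameDecomposition.cell_eq (hs : SameDecomposition γ D d d')
    (hd : IsADecomposition γ D A d) (hd' : IsADecomposition γ D A d') :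
    ∀ m ∈ insert 0 d.idx, d.cell D m = d'.cell D m := by
  rintro m (rfl | hm)
  · rw [hd.cell_zero, hd'.cell_zero]
  · rw [← (hd.carries m hm).1.2, ← (hd'.carries m (hs.idx_eq ▸ hm)).1.2,
      ← (hs.2.2 m hm).2.2.1]
    exact image_congr (hs.2.2 m hm).2.2.2

/-- The preimage of `aₛ` is an end point of `A`, since an interior one would force `[gₛ] = [e]`. At
the opposite end point, the direction of the cell makes `μₛ` increasing; at `aₛ` itself there is a
fixed point, so `μₛ` must be decreasing. -/
theorem IsADecomposition.neighbour (hd : IsADecomposition γ D A d) (h : FreeCurve E G δ U D)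
    (he : EqOn γ δ D) (hs : s = 1 ∨ s = -1) :
    (GGerm δ U 1 (d.g s) (d.a (-s)) (d.a s) ∧ IsPos (d.μ s) (d.dom s)) ∨
      (GGerm δ U (-1) (d.g s) (d.a s) (d.a s) ∧ IsNeg (d.μ s) (d.dom s)) := by
  have hn : s ∈ d.idx := by
    rcases hs with rfl | rfl
    · exact DecompositionData.one_mem_idx hd.lo_neg hd.hi_pos
    · exact DecompositionData.neg_one_mem_idx hd.lo_neg hd.hi_pos
  have hns : d.g s ∉ curveStab G δ U := by
    rcases hs with rfl | rfl
    · exact (h.cls_ne_cls_one_iff he).1 hd.ne_one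
    · exact (h.cls_ne_cls_one_iff he).1 hd.ne_one'
  have hss : 0 < s * s := by rcases hs with rfl | rfl <;> norm_num
  obtain ⟨σ, ρ, V, hσ, hm, hV, hμ, himg⟩ := hd.exists_max h he hn
  obtain ⟨ε, hε, hc⟩ := hd.exists_initial h hs hss hn
  obtain ⟨x, hx, hxe⟩ : d.a s ∈ ρ '' d.dom s := himg ▸ hc _ (by simp) (by simpa using hε.le)
  have hg := hm.germ (hV hx)
  rw [hxe] at hg
  have haA : d.a s ∈ A := by
    rw [hd.eq_Icc]
    rcases hs with rfl | rfl
    · exact right_mem_Icc.2 hd.neg_one_lt.le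
    · exact left_mem_Icc.2 hd.neg_one_lt.le
  have hxA := (hd.dom_interval hn).2 hx
  have hxi : x ∉ interior A := fun hxi => hns
    (h.germ_eq_of_mem hd.isInterval (hd.subset h) (hd.isFree h he) hxi haA hg).1
  rw [hd.eq_Icc] at hxA hxi
  rw [interior_Icc] at hxi
  have hor : x = d.a (-s) ∨ x = d.a s := by
    have : x = d.a (-1) ∨ x = d.a 1 := by
      by_contra hcon
      push Not at hcon
      exact hxi ⟨lt_of_le_of_ne hxA.1 hcon.1.symm, lt_of_le_of_ne hxA.2 hcon.2⟩
    rcases hs with rfl | rfl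
    · exact this
    · rw [neg_neg]; exact this.symm
  rcases hor with rfl | rfl
  · obtain ⟨p, hp, hpne⟩ : ∃ p ∈ d.dom s, p ≠ d.a (-s) := by
      obtain ⟨p, hp⟩ := (hd.dom_interval hn).1.2
      obtain ⟨q, hq, hlt⟩ := exists_gt_mem_of_mem_interior hp
      by_cases hpx : p = d.a (-s)
      · exact ⟨q, hq, fun hh => hlt.ne (hpx.trans hh.symm)⟩
      · exact ⟨p, interior_subset hp, hpx⟩
    have h1 := hm.toTransition.mul_sub_pos (hV hp) (hV hx) hpne
    have h2 : 0 ≤ (s : ℝ) * (p - d.a (-s)) := by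
      have hpA := (hd.dom_interval hn).2 hp
      rw [hd.eq_Icc] at hpA
      rcases hs with rfl | rfl
      · push_cast; linarith [hpA.1]
      · rw [neg_neg]; push_cast; linarith [hpA.2]
    have h3 : 0 ≤ (s : ℝ) * (ρ p - d.a s) := by
      have : ρ p ∈ d.cell D s := himg ▸ mem_image_of_mem _ hp
      by_cases hend : d.IsEnd s
      · exact ((hd.mem_cell_end hs hss hend).1 this).2
      · exact ((hd.mem_cell_inner hs hss hend).1 this).1
    have h4 : 0 ≤ (p - d.a (-s)) * (ρ p - d.a s) := by
      have : (p - d.a (-s)) * (ρ p - d.a s) =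
          ((s : ℝ) * (p - d.a (-s))) * ((s : ℝ) * (ρ p - d.a s)) := by
        rcases hs with rfl | rfl <;> push_cast <;> ring
      rw [this]; positivity
    rw [hxe] at h1
    have hσ1 : 0 < σ := pos_of_mul_pos_left h1 h4
    exact Or.inl ⟨hg.of_sign (by linarith), hm.toTransition.isPos hV hμ hσ1⟩
  · have hσ1 : σ < 0 := by
      by_contra hcon
      exact hns (h.mem_stab_of_fixed hg (lt_of_le_of_ne (not_lt.1 hcon) hg.sign_ne_zero.symm))
    exact Or.inr ⟨hg.of_sign (by linarith), hm.toTransition.isNeg hV hμ hσ1⟩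

end Uniqueness

end AnalyticCurve

namespace AnalyticCurve

/-! ### Decompositions generated by a single translation. -/

section Translation

variable {E : Type*} [NormedAddCommGroup E] [NormedSpace ℝ E] [CompleteSpace E]
  {M : Type*} [TopologicalSpace M] [ChartedSpace E M] [IsManifold 𝓘(ℝ, E) ω M] [T2Space M]
  {G : Type*} [Group G] [MulAction G M]
  {δ γ : ℝ → M} {U A B C D J J' V V' : Set ℝ} {g g' k k' : G} {t r a b a' b' x y eb ea σ : ℝ}
  {kb ka : G} {μ ρ ρ' f : ℝ → ℝ} {d d' : DecompositionData G} {s n m p : ℤ}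
  {Q : ℤ → PieceData G}

/-- `[b, a]` is free and `k` translates its left end point to its right end point. -/
structure IsTranslationSegment (δ : ℝ → M) (U D : Set ℝ) (b a : ℝ) (k : G) : Prop where
  lt : b < a
  left : b ∈ interior D
  right : a ∈ interior D
  free : IsFree G δ U (Icc b a)
  germ : GGerm δ U 1 k b a

theorem IsTranslationSegment.tile (hS : IsTranslationSegment δ U D b a k) :
    Tile G δ U D b a k⁻¹ k a b :=
  Tile.of_translation hS.lt hS.left hS.right hS.free hS.germ

theorem IsTranslationSegment.neg (hS : IsTranslationSegment δ U D b a k)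
    (h : ActedCurve E G δ U) :
    IsTranslationSegment (fun t => δ (-t)) (-U) (-D) (-a) (-b) k⁻¹ := by
  have hT := hS.tile.neg h
  exact ⟨hT.lt, hT.left, hT.right, hT.free, GGerm.neg h (GGerm.inv hS.germ)⟩

theorem GGerm.congr_stab {s t : ℝ} (hg : GGerm δ U σ g t s) (hU : IsOpen U)
    (hst : g⁻¹ * g' ∈ curveStab G δ U) : GGerm δ U σ g' t s := by
  have := GGerm.comp (GGerm.of_mem_stab hg.1 hU hst) hg
  rw [one_mul, mul_inv_cancel_left] at this
  exact this

theorem IsTranslationSegment.congr (hS : IsTranslationSegment δ U D b a k) (hU : IsOpen U)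
    (hst : k⁻¹ * k' ∈ curveStab G δ U) : IsTranslationSegment δ U D b a k' :=
  ⟨hS.lt, hS.left, hS.right, hS.free, hS.germ.congr_stab hU hst⟩

theorem PieceFamily.translation (F : PieceFamily δ U D b a k⁻¹ k a b d Q) (hba : b < a)
    (hs : s = 1 ∨ s = -1) (hsn : 0 < s * n) (hn : n ∈ d.idx) :
    (Q n).g = k ^ n ∧ (Q n).e = if s = 1 then b else a := by
  refine DecompositionData.side_induction F.lo_neg F.hi_pos hs
    (P := fun n => (Q n).g = k ^ n ∧ (Q n).e = if s = 1 then b else a) ?_ ?_ hn hsn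
  · rcases hs with rfl | rfl
    · simpa using ⟨F.one.1, F.one.2.1⟩
    · simpa using ⟨F.neg_one.1, F.neg_one.2.1⟩
  · rintro n hn hsn hend - ⟨ih1, ih2⟩
    have hnx := F.next s n hs hsn hn hend
    rcases hs with rfl | rfl
    · have h3 : a + b - (Q n).e = a := by rw [ih2]; simp
      refine ⟨?_, ?_⟩
      · rw [hnx.g_eq, h3, turnElt, if_pos rfl, ih1, zpow_add_one]
      · rw [hnx.e_eq, h3, turn, if_pos rfl, if_pos rfl]
    · have h3 : a + b - (Q n).e = b := by rw [ih2]; simp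
      refine ⟨?_, ?_⟩
      · rw [hnx.g_eq, h3, turnElt, if_neg hba.ne, ih1, ← sub_eq_add_neg, zpow_sub_one]
      · rw [hnx.e_eq, h3, turn, if_neg hba.ne, if_neg (by norm_num)]

theorem PieceFamily.max_translation (F : PieceFamily δ U D b a k⁻¹ k a b d Q)
    (h : ActedCurve E G δ U) (hba : b < a) (hn : n ∈ insert 0 d.idx) :
    GMaxTransition δ U 1 (k ^ n) (Q n).ρ (Q n).V := by
  rcases hn with rfl | hn
  · rw [F.zero.2.1, F.zero.2.2, zpow_zero]
    exact gMaxTransition_id h.curve.dom (one_mem _)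
  · obtain ⟨s, hs, hsn⟩ := DecompositionData.exists_sign hn.1
    obtain ⟨h1, h2⟩ := F.translation hba hs hsn hn
    have hm := (F.piece s n hs hsn hn).max
    rw [h1, h2] at hm
    refine hm.of_sign ?_
    rcases hs with rfl | rfl
    · simp only [if_true]; push_cast; linarith
    · rw [if_neg (by norm_num)]; push_cast; linarith

theorem PieceFamily.isFull_of_next (F : PieceFamily δ U D b a kb ka eb ea d Q)
    (hs : s = 1 ∨ s = -1) (hsn : 0 < s * n) (hn : n + s ∈ d.idx) :
    n ∈ d.idx ∧ ¬ d.IsEnd n ∧ (Q n).IsFull D b a := by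
  obtain ⟨h1, h2⟩ := (DecompositionData.next_mem F.lo_neg F.hi_pos hs hsn).1 hn
  exact ⟨h1, h2, not_not.1 fun hf => h2 ((F.full n h1).2 hf)⟩

/-- Neighbouring pieces of a translation decomposition meet in a common point. -/
theorem PieceFamily.junction (F : PieceFamily δ U D b a k⁻¹ k a b d Q) (hba : b < a)
    (haU : a ∈ U) (hbU : b ∈ U)
    (hp : p ∈ insert 0 d.idx) (hp' : p + 1 ∈ insert 0 d.idx) :
    a ∈ (Q p).V ∧ b ∈ (Q (p + 1)).V ∧ (Q p).ρ a = (Q (p + 1)).ρ b := by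
  rcases lt_trichotomy p 0 with hlt | rfl | hgt
  · have hpi := hp.resolve_left hlt.ne
    have hpp := F.piece (-1) p (Or.inr rfl) (by omega) hpi
    have he := (F.translation hba (Or.inr rfl) (by omega) hpi).2
    rw [if_neg (by norm_num)] at he
    have haV := hpp.memV
    rw [he] at haV
    rcases (by omega : p = -1 ∨ p + 1 < 0) with rfl | hlt'
    · have h1 := F.neg_one.2.2
      rw [he] at h1
      refine ⟨haV, ?_, ?_⟩
      · rw [neg_add_cancel, F.zero.2.2]; exact hbU
      · rw [neg_add_cancel, F.zero.2.1, h1]; rfl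
    · have hfull := F.isFull_of_next (s := -1) (n := p + 1) (Or.inr rfl) (by omega)
        (by rwa [add_neg_cancel_right])
      have he' := (F.translation hba (Or.inr rfl) (by omega) hfull.1).2
      rw [if_neg (by norm_num)] at he'
      have h1 := F.a_next (s := -1) (n := p + 1) (Or.inr rfl) (by omega) hfull.1 hfull.2.1
      rw [add_neg_cancel_right, F.a_eq, he', he, add_sub_cancel_left] at h1
      have h2 := hfull.2.2.1
      rw [he', add_sub_cancel_left] at h2
      exact ⟨haV, h2, h1⟩
  · have hpi := hp'.resolve_left (by norm_num)
    have hpp := F.piece 1 1 (Or.inl rfl) (by norm_num) (by simpa using hpi)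
    have he := F.one.2.1
    have h1 := hpp.memV
    have h2 := F.one.2.2
    rw [he] at h1 h2
    refine ⟨by rw [F.zero.2.2]; exact haU, by simpa using h1, ?_⟩
    rw [zero_add, h2, F.zero.2.1]; rfl
  · have hpi := hp'.resolve_left (by omega)
    have hpp := F.piece 1 (p + 1) (Or.inl rfl) (by omega) hpi
    have he := (F.translation hba (Or.inl rfl) (by omega) hpi).2
    rw [if_pos rfl] at he
    have hbV := hpp.memV
    rw [he] at hbV
    have hfull := F.isFull_of_next (s := 1) (n := p) (Or.inl rfl) (by omega) hpi
    have he' := (F.translation hba (Or.inl rfl) (by omega) hfull.1).2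
    rw [if_pos rfl] at he'
    have h1 := F.a_next (s := 1) (n := p) (Or.inl rfl) (by omega) hfull.1 hfull.2.1
    rw [F.a_eq, he', he, add_sub_cancel_right] at h1
    have h2 := hfull.2.2.1
    rw [he', add_sub_cancel_right] at h2
    exact ⟨h2, hbV, h1.symm⟩

/-- The segment consists of the part of one cell after the image of `x` and the part of the next
cell before it, meeting at the junction. Together these are one shifted copy of the tile, cut at
`x`. -/
theorem PieceFamily.shifted_segment (F : PieceFamily δ U D b a k⁻¹ k a b d Q)
    (h : FreeCurve E G δ U D) (hS : IsTranslationSegment δ U D b a k)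
    (hp : p ∈ insert 0 d.idx) (hp' : p + 1 ∈ insert 0 d.idx) (hx : x ∈ Ioo b a)
    (hxp : x ∈ (Q p).V) (hxp' : x ∈ (Q (p + 1)).V) (hD : (Q p).ρ x ∈ interior D)
    (hD' : (Q (p + 1)).ρ x ∈ interior D) :
    IsTranslationSegment δ U D ((Q p).ρ x) ((Q (p + 1)).ρ x) k := by
  have hba := hS.lt
  have hAD := h.Icc_subset hS.left hS.right
  obtain ⟨haV, hbV, hj⟩ := F.junction hba (h.sub (interior_subset hS.right))
    (h.sub (interior_subset hS.left)) hp hp'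
  have h₁ := (F.max_translation h.toActedCurve hba hp).toTransition
  have h₂ := (F.max_translation h.toActedCurve hba hp').toTransition
  have m₁ := h₁.strictMonoOn one_pos
  have m₂ := h₂.strictMonoOn one_pos
  have l₁ := m₁ hxp haV hx.2
  have l₂ := m₂ hbV hxp' hx.1
  refine ⟨by linarith, hD, hD', ?_, ?_⟩
  · refine h.isFree_of_shift (isInterval_Icc hba) hAD hS.free (x := x) ((Q p).ρ a) h₁ h₂ ?_
    intro v hv hva
    rw [interior_Icc] at hv ⊢
    rcases lt_or_gt_of_ne hva with hlt | hgt
    · left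
      have hsub : Icc x a ⊆ (Q p).V := h₁.dom.2.1.out hxp haV
      obtain ⟨v', hv', hve⟩ := intermediate_value_Ioo hx.2.le (h₁.continuousOn.mono hsub)
        ⟨hv.1, hlt⟩
      exact ⟨v', ⟨hx.1.trans hv'.1, hv'.2⟩, hsub (Ioo_subset_Icc_self hv'), hv'.1, hve⟩
    · right
      have hsub : Icc b x ⊆ (Q (p + 1)).V := h₂.dom.2.1.out hbV hxp'
      obtain ⟨v', hv', hve⟩ := intermediate_value_Ioo hx.1.le (h₂.continuousOn.mono hsub)
        ⟨hj ▸ hgt, hv.2⟩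
      exact ⟨v', ⟨hv'.1, hv'.2.trans hx.2⟩, hsub (Ioo_subset_Icc_self hv'), hv'.2, hve⟩
  · have := GGerm.comp (GGerm.inv (h₁.germ hxp)) (h₂.germ hxp')
    have hk : k ^ (p + 1) * (k ^ p)⁻¹ = k := by
      rw [← zpow_neg, ← zpow_add, show p + 1 + -p = 1 by ring, zpow_one]
    rwa [hk, one_mul] at this

theorem IsADecomposition.ordConnected_cell (hd : IsADecomposition γ D A d)
    (h : FreeCurve E G δ U D) (hn : n ∈ insert 0 d.idx) : (d.cell D n).OrdConnected := by
  rcases hn with rfl | hn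
  · rw [hd.cell_zero]; exact hd.isInterval.1
  obtain ⟨s, hs, hsn⟩ := DecompositionData.exists_sign hn.1
  constructor
  intro x hx y hy z hz
  by_cases hend : d.IsEnd n
  · rw [hd.mem_cell_end hs hsn hend] at *
    refine ⟨h.interval.1.out hx.1 hy.1 hz, ?_⟩
    rcases hs with rfl | rfl
    · push_cast at *; linarith [hz.1]
    · push_cast at *; linarith [hz.2]
  · rw [hd.mem_cell_inner hs hsn hend] at *
    rcases hs with rfl | rfl
    · push_cast at *; constructor <;> linarith [hz.1, hz.2]
    · push_cast at *; constructor <;> linarith [hz.1, hz.2]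

theorem IsADecomposition.isInterval_cell (hd : IsADecomposition γ D A d)
    (h : FreeCurve E G δ U D) (hn : n ∈ insert 0 d.idx) : IsInterval (d.cell D n) := by
  refine ⟨hd.ordConnected_cell h hn, ?_⟩
  rcases hn with rfl | hn
  · rw [hd.cell_zero]; exact hd.isInterval.2
  obtain ⟨s, hs, hsn⟩ := DecompositionData.exists_sign hn.1
  obtain ⟨ε, hε, hc⟩ := hd.exists_initial h hs hsn hn
  have hss : (s : ℝ) * s = 1 := by rcases hs with rfl | rfl <;> norm_num
  have h0 : d.a n ∈ d.cell D n := hc _ (by simp) (by simpa using hε.le)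
  have h1 : d.a n + s * ε ∈ d.cell D n := by
    have : (s : ℝ) * (d.a n + s * ε - d.a n) = ε := by
      rw [add_sub_cancel_left, ← mul_assoc, hss, one_mul]
    exact hc _ (by rw [this]; exact hε.le) this.le
  have hord := hd.ordConnected_cell h (mem_insert_of_mem _ hn)
  rcases hs with rfl | rfl
  · push_cast at h1
    exact ⟨d.a n + ε / 2, mem_interior_of_between hord h0 h1 (by linarith) (by linarith)⟩
  · push_cast at h1
    exact ⟨d.a n - ε / 2, mem_interior_of_between hord h1 h0 (by linarith) (by linarith)⟩

/-- Every interior point of a piece comes from an interior point of the initial interval. -/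
theorem PieceFamily.exists_preimage (F : PieceFamily δ U D b a kb ka eb ea d Q)
    (h : FreeCurve E G δ U D) (hba : b < a) (hAD : Icc b a ⊆ D) (hn : n ∈ insert 0 d.idx)
    (hy : y ∈ interior (d.cell D n)) :
    ∃ x ∈ Ioo b a, x ∈ (Q n).V ∧ (Q n).ρ x = y := by
  obtain ⟨⟨σ, hm⟩, hdi, himg⟩ := F.exists_max h hba hAD hn
  obtain ⟨y₁, hy₁, hlt₁⟩ := exists_lt_mem_of_mem_interior hy
  obtain ⟨y₂, hy₂, hlt₂⟩ := exists_gt_mem_of_mem_interior hy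
  obtain ⟨x, hx, hxe⟩ : y ∈ (Q n).ρ '' (Q n).dom D b a := himg ▸ interior_subset hy
  obtain ⟨x₁, hx₁, hxe₁⟩ : y₁ ∈ (Q n).ρ '' (Q n).dom D b a := himg ▸ hy₁
  obtain ⟨x₂, hx₂, hxe₂⟩ : y₂ ∈ (Q n).ρ '' (Q n).dom D b a := himg ▸ hy₂
  refine ⟨x, ?_, hx.2.1, hxe⟩
  rcases lt_or_gt_of_ne hm.sign_ne_zero with hσ | hσ
  · have hanti := hm.strictAntiOn hσ
    have e₁ : x < x₁ := (hanti.lt_iff_gt hx₁.2.1 hx.2.1).1 (by rw [hxe, hxe₁]; exact hlt₁)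
    have e₂ : x₂ < x := (hanti.lt_iff_gt hx.2.1 hx₂.2.1).1 (by rw [hxe, hxe₂]; exact hlt₂)
    exact ⟨lt_of_le_of_lt hx₂.1.1 e₂, lt_of_lt_of_le e₁ hx₁.1.2⟩
  · have hmono := hm.strictMonoOn hσ
    have e₁ : x₁ < x := (hmono.lt_iff_lt hx₁.2.1 hx.2.1).1 (by rw [hxe, hxe₁]; exact hlt₁)
    have e₂ : x < x₂ := (hmono.lt_iff_lt hx.2.1 hx₂.2.1).1 (by rw [hxe, hxe₂]; exact hlt₂)
    exact ⟨lt_of_le_of_lt hx₁.1.1 e₁, lt_of_lt_of_le e₂ hx₂.1.2⟩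

/-- A full piece carries the interior of the initial interval into the interior of its cell. -/
theorem PieceFamily.mem_interior_cell (F : PieceFamily δ U D b a k⁻¹ k a b d Q)
    (h : FreeCurve E G δ U D) (hT : IsTranslationSegment δ U D b a k) (he : EqOn γ δ D)
    (hn : n ∈ insert 0 d.idx) (hdom : (Q n).dom D b a = Icc b a) (hx : x ∈ Ioo b a) :
    x ∈ (Q n).V ∧ (Q n).ρ x ∈ interior (d.cell D n) := by
  have hba := hT.lt
  have hAD := h.Icc_subset hT.left hT.right
  have hd := F.isADecomposition h hT.tile he
  obtain ⟨-, -, himg⟩ := F.exists_max h hba hAD hn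
  have hmono := (F.max_translation h.toActedCurve hba hn).strictMonoOn one_pos
  have hV : Icc b a ⊆ (Q n).V := fun t ht => by
    rw [← hdom] at ht; exact ht.2.1
  rw [hdom] at himg
  have hxV := hV (Ioo_subset_Icc_self hx)
  have hb := left_mem_Icc.2 hba.le
  have ha := right_mem_Icc.2 hba.le
  exact ⟨hxV, mem_interior_of_between (hd.ordConnected_cell h hn) (himg ▸ mem_image_of_mem _ hb)
    (himg ▸ mem_image_of_mem _ ha) (hmono (hV hb) hxV hx.1) (hmono hxV (hV ha) hx.2)⟩

/-- The cell `n` is a full copy of the tile, so the tile parameter of `y` has an image in it too,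
and the two images bound a shifted segment. -/
theorem PieceFamily.exists_segment_right (F : PieceFamily δ U D b a k⁻¹ k a b d Q)
    (h : FreeCurve E G δ U D) (hS : IsTranslationSegment δ U D b a k) (he : EqOn γ δ D)
    (hn : n ≤ 0) (hlo : d.lo < (n : WithBot ℤ)) (hy : y ∈ interior (d.cell D (n - 1))) :
    ∃ x ∈ interior (d.cell D n), IsTranslationSegment δ U D y x k := by
  have hba := hS.lt
  have hAD := h.Icc_subset hS.left hS.right
  have hd := F.isADecomposition h hS.tile he
  have hn1 := DecompositionData.sub_one_mem_idx F.hi_pos hn hlo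
  have hn0 : n ∈ insert 0 d.idx ∧ (Q n).dom D b a = Icc b a := by
    rcases hn.eq_or_lt with rfl | hlt
    · exact ⟨mem_insert _ _, F.dom_zero h.sub hAD⟩
    · have hf := F.isFull_of_next (s := -1) (n := n) (Or.inr rfl) (by omega) hn1
      exact ⟨mem_insert_of_mem _ hf.1, (F.piece (-1) n (Or.inr rfl) (by omega) hf.1).dom_of_full
        h hba hf.2.2⟩
  obtain ⟨x, hx, hxV, rfl⟩ := F.exists_preimage h hba hAD (mem_insert_of_mem _ hn1) hy
  obtain ⟨hxV', hxi⟩ := F.mem_interior_cell h hS he hn0.1 hn0.2 hx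
  refine ⟨_, hxi, ?_⟩
  have := F.shifted_segment h hS (p := n - 1) (mem_insert_of_mem _ hn1)
    (by rw [sub_add_cancel]; exact hn0.1) hx hxV (by rwa [sub_add_cancel])
    (interior_mono (hd.cell_subset h (mem_insert_of_mem _ hn1)) hy)
    (by rw [sub_add_cancel]; exact interior_mono (hd.cell_subset h hn0.1) hxi)
  rwa [sub_add_cancel] at this

theorem PieceFamily.exists_segment_left (F : PieceFamily δ U D b a k⁻¹ k a b d Q)
    (h : FreeCurve E G δ U D) (hS : IsTranslationSegment δ U D b a k) (he : EqOn γ δ D)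
    (hn : 0 ≤ n) (hhi : (n : WithTop ℤ) < d.hi) (hy : y ∈ interior (d.cell D (n + 1))) :
    ∃ x ∈ interior (d.cell D n), IsTranslationSegment δ U D x y k := by
  have hba := hS.lt
  have hAD := h.Icc_subset hS.left hS.right
  have hd := F.isADecomposition h hS.tile he
  have hn1 := DecompositionData.add_one_mem_idx F.lo_neg hn hhi
  have hn0 : n ∈ insert 0 d.idx ∧ (Q n).dom D b a = Icc b a := by
    rcases hn.eq_or_lt with rfl | hlt
    · exact ⟨mem_insert _ _, F.dom_zero h.sub hAD⟩
    · have hf := F.isFull_of_next (s := 1) (n := n) (Or.inl rfl) (by omega) hn1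
      exact ⟨mem_insert_of_mem _ hf.1, (F.piece 1 n (Or.inl rfl) (by omega) hf.1).dom_of_full
        h hba hf.2.2⟩
  obtain ⟨x, hx, hxV, rfl⟩ := F.exists_preimage h hba hAD (mem_insert_of_mem _ hn1) hy
  obtain ⟨hxV', hxi⟩ := F.mem_interior_cell h hS he hn0.1 hn0.2 hx
  exact ⟨_, hxi, F.shifted_segment h hS hn0.1 (mem_insert_of_mem _ hn1) hx hxV' hxV
    (interior_mono (hd.cell_subset h hn0.1) hxi)
    (interior_mono (hd.cell_subset h (mem_insert_of_mem _ hn1)) hy)⟩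

end Translation

end AnalyticCurve

namespace AnalyticCurve

/-! ### Consequences of the existence of one translation segment. -/

section PositiveSegments

variable {E : Type*} [NormedAddCommGroup E] [NormedSpace ℝ E] [CompleteSpace E]
  {M : Type*} [TopologicalSpace M] [ChartedSpace E M] [IsManifold 𝓘(ℝ, E) ω M] [T2Space M]
  {G : Type*} [Group G] [MulAction G M]
  {δ γ : ℝ → M} {U A B C D J J' V V' : Set ℝ} {g g' k k' : G} {t r a b a' b' x y eb ea σ : ℝ}
  {kb ka : G} {μ ρ ρ' f : ℝ → ℝ} {d d' : DecompositionData G} {s n m p : ℤ}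
  {Q : ℤ → PieceData G}

/-- A point `y` of the same cell slightly before `t` has its translate in the interior of the next
cell, hence behind `t`. If `t` is the lower end of its cell, the neighbouring cell on the left is
used instead. -/
theorem IsTranslationSegment.exists_left (hS : IsTranslationSegment δ U D b a k)
    (h : FreeCurve E G δ U D) (ht : t ∈ interior D) (htb : t ≤ b) :
    ∃ b₁ a₁, IsTranslationSegment δ U D b₁ a₁ k ∧ t ∈ Ioo b₁ a₁ := by
  obtain ⟨d, Q, F⟩ := hS.tile.exists_family h
  have hd := F.isADecomposition h hS.tile (fun _ _ => rfl)
  have hs : ((-1 : ℤ) = 1 ∨ (-1 : ℤ) = -1) := Or.inr rfl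
  have hlower : ∀ n < 0, n ∈ d.idx → t ∈ d.cell D n → (∃ q ∈ d.cell D n, q < t) →
      ∃ b₁ a₁, IsTranslationSegment δ U D b₁ a₁ k ∧ t ∈ Ioo b₁ a₁ := by
    rintro n hn hni htc ⟨q, hq, hqt⟩
    have hord := hd.ordConnected_cell h (mem_insert_of_mem _ hni)
    have hy := mem_interior_of_between hord hq htc (t := (q + t) / 2) (by linarith) (by linarith)
    have hlo : d.lo < ((n + 1 : ℤ) : WithBot ℤ) :=
      lt_of_le_of_lt hni.2.1 (WithBot.coe_lt_coe.2 (by omega))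
    obtain ⟨x, hx, hseg⟩ := F.exists_segment_right h hS (fun _ _ => rfl) (n := n + 1) (by omega)
      hlo (by rwa [add_sub_cancel_right])
    obtain ⟨q', hq', hlt⟩ := exists_lt_mem_of_mem_interior hx
    have hn1 : n + 1 ∈ insert 0 d.idx := by
      by_cases h0 : n + 1 = 0
      · rw [h0]; exact mem_insert _ _
      · exact mem_insert_of_mem _ (hd.mem_idx_of_between (mem_insert_of_mem _ hni)
          (mem_insert _ _) h0 (by omega) (by omega))
    have := hd.le_of_mem_cells (mem_insert_of_mem _ hni) hn1 (by omega) htc hq'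
    exact ⟨_, _, hseg, by linarith, by linarith⟩
  have hall : ∀ n < 0, n ∈ d.idx → t ∈ d.cell D n →
      ∃ b₁ a₁, IsTranslationSegment δ U D b₁ a₁ k ∧ t ∈ Ioo b₁ a₁ := by
    intro n hn hni htc
    by_cases hq : ∃ q ∈ d.cell D n, q < t
    · exact hlower n hn hni htc hq
    · have hsn : 0 < -1 * n := by omega
      have hend : ¬ d.IsEnd n := fun hend => by
        obtain ⟨q, hqD, hqt⟩ := exists_lt_mem_of_mem_interior ht
        rw [hd.mem_cell_end hs hsn hend] at htc
        refine hq ⟨q, (hd.mem_cell_end hs hsn hend).2 ⟨hqD, ?_⟩, hqt⟩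
        have := htc.2
        push_cast at this ⊢
        linarith
      have hn' := hd.next_mem hs hsn hni hend
      have h1 : d.a (n + -1) ∈ d.cell D n := (hd.mem_cell_inner hs hsn hend).2
        ⟨(hd.step_pos hs hsn hni hend).le, by simp⟩
      have h2 : t ≤ d.a (n + -1) := not_lt.1 fun hlt => hq ⟨_, h1, hlt⟩
      have h3 := ((hd.mem_cell_inner hs hsn hend).1 htc).2
      have h4 : t = d.a (n + -1) := le_antisymm h2 (by push_cast at h3; linarith)
      obtain ⟨ε, hε, hc⟩ := hd.exists_initial h hs (by omega) hn'
      refine hlower (n + -1) (by omega) hn' (hc t (by simp [h4]) (by simpa [h4] using hε.le))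
        ⟨t - ε, hc _ ?_ ?_, by linarith⟩
      · rw [h4]; push_cast; linarith
      · rw [h4]; push_cast; linarith
  obtain ⟨n, hn, htc⟩ := hd.exists_mem_cell h (fun _ _ => rfl) (interior_subset ht)
  by_cases hn0 : n < 0
  · exact hall n hn0 (hn.resolve_left hn0.ne) htc
  · have h1i := DecompositionData.neg_one_mem_idx hd.lo_neg hd.hi_pos
    obtain ⟨ε, hε, hc⟩ := hd.exists_initial h hs (by omega) h1i
    have h1 : d.a (-1) ∈ d.cell D (-1) := hc _ (by simp) (by simpa using hε.le)
    have h2 := hd.le_of_mem_cells (mem_insert_of_mem _ h1i) hn (by omega) h1 htc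
    rw [F.a_neg_one] at h1 h2
    have h3 : t = b := le_antisymm htb h2
    exact hall (-1) (by norm_num) h1i (h3 ▸ h1)

theorem IsTranslationSegment.exists_mem_Ioo (hS : IsTranslationSegment δ U D b a k)
    (h : FreeCurve E G δ U D) (ht : t ∈ interior D) :
    ∃ b₁ a₁, IsTranslationSegment δ U D b₁ a₁ k ∧ t ∈ Ioo b₁ a₁ := by
  rcases le_or_gt t b with htb | htb
  · exact hS.exists_left h ht htb
  rcases lt_or_ge t a with hta | hta
  · exact ⟨b, a, hS, htb, hta⟩
  · obtain ⟨b₁, a₁, hS₁, ht₁⟩ := (hS.neg h.toActedCurve).exists_left h.neg (t := -t)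
      (by rw [interior_neg_eq]; simpa using ht) (neg_le_neg hta)
    have := hS₁.neg h.toActedCurve.neg
    simp only [neg_neg, inv_inv] at this
    exact ⟨_, _, this, by linarith [ht₁.2], by linarith [ht₁.1]⟩

theorem IsTranslationSegment.no_reflection (hS : IsTranslationSegment δ U D b a k)
    (h : FreeCurve E G δ U D) (ht : t ∈ interior D) : ¬ GGerm δ U (-1) g t t := by
  intro hg
  obtain ⟨b₁, a₁, hS₁, ht₁⟩ := hS.exists_mem_Ioo h ht
  have hi : t ∈ interior (Icc b₁ a₁) := by rwa [interior_Icc]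
  have := (h.germ_eq (isInterval_Icc hS₁.lt) (h.Icc_subset hS₁.left hS₁.right) hS₁.free hi hi hg).2.2
  norm_num at this

/-- A translation on one side makes every interior point of `D` interior to a free segment, so a
reflection on the other side is impossible. -/
theorem Tile.translation_or_reflection (hT : Tile G δ U D b a kb ka eb ea)
    (h : FreeCurve E G δ U D) : IsTranslationSegment δ U D b a ka ∨
      (eb = b ∧ ea = a ∧ GGerm δ U (-1) kb b b ∧ GGerm δ U (-1) ka a a) := by
  rcases hT.nbr_right with ⟨-, hg⟩ | ⟨rfl, hg⟩
  · exact Or.inl ⟨hT.lt, hT.left, hT.right, hT.free, hg⟩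
  · rcases hT.nbr_left with ⟨rfl, hg'⟩ | ⟨rfl, hg'⟩
    · have hS : IsTranslationSegment δ U D b eb kb⁻¹ :=
        ⟨hT.lt, hT.left, hT.right, hT.free, GGerm.inv hg'⟩
      exact absurd hg (hS.no_reflection h hT.right)
    · exact Or.inr ⟨rfl, rfl, hg', hg⟩

/-- Let `[p, q]` be a segment of `k` with `b'` in its interior. Following `k⁻¹` from `q` towards
`a'`, either `a'` is moved back into `[p, q]`, and freeness there identifies the classes; or `b'` is
attained before `a'`, which would give a nontrivial germ of `k' * k⁻¹` inside the free interval
`[b', a']`. -/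
theorem IsTranslationSegment.cls_eq (hS : IsTranslationSegment δ U D b a k)
    (h : FreeCurve E G δ U D) (hS' : IsTranslationSegment δ U D b' a' k') :
    k⁻¹ * k' ∈ curveStab G δ U := by
  obtain ⟨p, q, hP, hpb, hbq⟩ := hS.exists_mem_Ioo h hS'.left
  have hPi := isInterval_Icc hP.lt
  have hPD := h.Icc_subset hP.left hP.right
  have hA'i := isInterval_Icc hS'.lt
  have hA'D := h.Icc_subset hS'.left hS'.right
  have hb'i : b' ∈ interior (Icc p q) := by rw [interior_Icc]; exact ⟨hpb, hbq⟩
  have hqa : q < a' := by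
    by_contra hcon
    have := (h.germ_eq_of_mem hPi hPD hP.free hb'i
      ⟨(hpb.trans hS'.lt).le, not_lt.1 hcon⟩ hS'.germ).2.1
    exact hS'.lt.ne this
  have key : ∀ y ∈ Icc p q, GGerm δ U 1 k⁻¹ a' y → k⁻¹ * k' ∈ curveStab G δ U := fun y hy hg =>
    (h.germ_eq_of_mem hPi hPD hP.free hb'i hy (GGerm.comp hS'.germ hg)).1
  obtain ⟨r, V, hm, hqV, hr⟩ := h.exists_max (GGerm.inv hP.germ)
  rcases hm.continuation (h.toActedCurve.smul _) h.curve hqV (x := a') (y := b')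
    (h.sub (interior_subset hS'.right)) (h.sub (interior_subset hS'.left)) (by
      rw [hr, one_mul]
      exact mul_nonneg (by linarith) (by linarith)) with ⟨h1, h2⟩ | ⟨x', h1, h2, h3⟩
  · rw [hr, uIcc_of_le hpb.le] at h2
    exact key _ ⟨h2.1, h2.2.trans hbq.le⟩ (hm.germ h1)
  · rw [uIcc_of_le hqa.le] at h2
    have hg := hm.germ h1
    rw [h3] at hg
    rcases h2.2.eq_or_lt with rfl | hlt
    · exact key b' ⟨hpb.le, hbq.le⟩ hg
    · have hx'i : x' ∈ interior (Icc b' a') := by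
        rw [interior_Icc]; exact ⟨lt_of_lt_of_le hbq h2.1, hlt⟩
      have := (h.germ_eq_of_mem hA'i hA'D hS'.free hx'i (right_mem_Icc.2 hS'.lt.le)
        (GGerm.comp hg hS'.germ)).2.1
      exact absurd this hlt.ne

end PositiveSegments

end AnalyticCurve

namespace AnalyticCurve

/-! ### Description of positive curves. -/

section PositiveCurves

variable {E : Type*} [NormedAddCommGroup E] [NormedSpace ℝ E] [CompleteSpace E]
  {M : Type*} [TopologicalSpace M] [ChartedSpace E M] [IsManifold 𝓘(ℝ, E) ω M] [T2Space M]
  {G : Type*} [Group G] [MulAction G M]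
  {δ γ : ℝ → M} {U A B C D J J' V V' : Set ℝ} {g g' k k' w : G} {t r a b a' b' x y eb ea σ : ℝ}
  {kb ka : G} {μ ρ ρ' f : ℝ → ℝ} {d d' : DecompositionData G} {s n m p : ℤ}
  {Q : ℤ → PieceData G}

/-- The conjugate germ has a fixed point and the orientation `σ²`. Elements that move an arc of the
curve along the curve thus preserve `G_γ` under conjugation, although `G_γ` need not be normal in
`G`. -/
theorem ActedCurve.conj_mem_stab {s : ℝ} (h : ActedCurve E G δ U) (hg : GGerm δ U σ g t s)
    (hw : w ∈ curveStab G δ U) : g * w * g⁻¹ ∈ curveStab G δ U := by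
  have hσ := hg.sign_ne_zero
  have := GGerm.comp (GGerm.inv hg) (GGerm.comp (GGerm.of_mem_stab hg.1 h.curve.dom.1 hw) hg)
  exact h.mem_stab_of_fixed this (by
    have : σ * (1 * σ) = σ ^ 2 := by ring
    rw [this]; positivity)

theorem FreeCurve.eq_Icc_of_compact (h : FreeCurve E G δ U D) (hA : IsMaxFree G δ U D A)
    (hc : IsCompact A) (hAD : A ⊆ interior D) :
    ∃ b a : ℝ, b < a ∧ b ∈ interior D ∧ a ∈ interior D ∧ A = Icc b a := by
  have hne : A.Nonempty := hA.interval.2.mono interior_subset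
  obtain ⟨y, hy⟩ := hc.exists_isLeast hne
  obtain ⟨x, hx⟩ := hc.exists_isGreatest hne
  obtain ⟨p, hp, hpy⟩ := exists_lt_mem_of_mem_interior (hAD hy.1)
  obtain ⟨q, hq, hqx⟩ := exists_gt_mem_of_mem_interior (hAD hx.1)
  exact h.eq_Icc_of_bounded hA hq (fun z hz => (hx.2 hz).trans_lt hqx) hp
    fun z hz => hpy.trans_le (hy.2 hz)

theorem FreeCurve.exists_tile_of_compact (h : FreeCurve E G δ U D) (hA : IsMaxFree G δ U D A)
    (hc : IsCompact A) (hAD : A ⊆ interior D) :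
    ∃ (b a : ℝ) (kb ka : G) (eb ea : ℝ), A = Icc b a ∧ Tile G δ U D b a kb ka eb ea := by
  obtain ⟨b, a, hba, hb, ha, rfl⟩ := h.eq_Icc_of_compact hA hc hAD
  obtain ⟨kb, ka, eb, ea, hT⟩ := h.exists_tile hba hA hb ha
  exact ⟨b, a, kb, ka, eb, ea, rfl, hT⟩

theorem IsPos.not_isNeg (hp : IsPos μ B) (hB : IsInterval B) : ¬ IsNeg μ B := by
  obtain ⟨x, hx⟩ := hB.2
  exact fun hn => lt_asymm (hp x hx) (hn x hx)

theorem deriv_eq_of_eqOn (he : EqOn μ ρ B) (ht : t ∈ interior B) : deriv μ t = deriv ρ t := by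
  refine Filter.EventuallyEq.deriv_eq ?_
  filter_upwards [isOpen_interior.mem_nhds ht] with u hu using he (interior_subset hu)

theorem IsPos.congr (hp : IsPos ρ B) (he : EqOn μ ρ B) : IsPos μ B := fun t ht => by
  rw [deriv_eq_of_eqOn he ht]; exact hp t ht

theorem IsNeg.congr (hp : IsNeg ρ B) (he : EqOn μ ρ B) : IsNeg μ B := fun t ht => by
  rw [deriv_eq_of_eqOn he ht]; exact hp t ht

theorem isTranslationSegment_interior :
    IsTranslationSegment δ U (interior D) b a k ↔ IsTranslationSegment δ U D b a k := by
  constructor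
  · rintro ⟨h1, h2, h3, h4, h5⟩
    exact ⟨h1, interior_interior.subset h2, interior_interior.subset h3, h4, h5⟩
  · rintro ⟨h1, h2, h3, h4, h5⟩
    exact ⟨h1, interior_interior.symm.subset h2, interior_interior.symm.subset h3, h4, h5⟩

theorem tile_interior :
    Tile G δ U (interior D) b a kb ka eb ea ↔ Tile G δ U D b a kb ka eb ea := by
  constructor
  · rintro ⟨h1, h2, h3, h4, h5, h6⟩
    exact ⟨h1, interior_interior.subset h2, interior_interior.subset h3, h4, h5, h6⟩
  · rintro ⟨h1, h2, h3, h4, h5, h6⟩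
    exact ⟨h1, interior_interior.symm.subset h2, interior_interior.symm.subset h3, h4, h5, h6⟩

theorem PieceFamily.isPos (F : PieceFamily δ U D b a k⁻¹ k a b d Q)
    (h : ActedCurve E G δ U) (hba : b < a) (hn : n ∈ insert 0 d.idx) :
    IsPos (d.μ n) (d.dom n) := by
  rw [F.dom_eq, F.μ_eq]
  exact (F.max_translation h hba hn).toTransition.isPos (fun t ht => ht.2.1) (fun _ _ => rfl)
    one_pos

/-- The sign of `μ₁` decides between translation and reflection at the neighbour. Conversely, every
piece of a translation decomposition is increasing. -/
theorem FreeCurve.isPositiveInterval_iff (h : FreeCurve E G δ U D) (he : EqOn γ δ D) :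
    IsPositiveInterval G γ D A ↔ ∃ (b a : ℝ) (k : G), A = Icc b a ∧
      IsTranslationSegment δ U D b a k := by
  have h' := h.interior_curve
  have he' := he.mono (interior_subset (s := D))
  constructor
  · rintro ⟨d, hd, h1, -⟩
    have h1i := DecompositionData.one_mem_idx hd.lo_neg hd.hi_pos
    have h2i := DecompositionData.neg_one_mem_idx hd.lo_neg hd.hi_pos
    refine ⟨d.a (-1), d.a 1, d.g 1, hd.eq_Icc, isTranslationSegment_interior.1
      ⟨hd.neg_one_lt, hd.mem _ h2i, hd.mem _ h1i, hd.eq_Icc ▸ hd.isFree h' he', ?_⟩⟩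
    rcases hd.neighbour h' he' (Or.inl rfl) with ⟨hg, -⟩ | ⟨-, hn⟩
    · exact hg
    · exact absurd hn (h1.not_isNeg (hd.dom_interval h1i).1)
  · rintro ⟨b, a, k, rfl, hS⟩
    have hS' := isTranslationSegment_interior.2 hS
    obtain ⟨d, Q, F⟩ := hS'.tile.exists_family h'
    have h1i := DecompositionData.one_mem_idx F.lo_neg F.hi_pos
    have h2i := DecompositionData.neg_one_mem_idx F.lo_neg F.hi_pos
    exact ⟨d, F.isADecomposition h' hS'.tile he',
      F.isPos h.toActedCurve hS.lt (mem_insert_of_mem _ h1i),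
      F.isPos h.toActedCurve hS.lt (mem_insert_of_mem _ h2i)⟩

theorem IsTranslationSegment.isPositiveInterval (hS : IsTranslationSegment δ U D b a k)
    (h : FreeCurve E G δ U D) (he : EqOn γ δ D) : IsPositiveInterval G γ D (Icc b a) :=
  (h.isPositiveInterval_iff he).2 ⟨b, a, k, rfl, hS⟩

theorem IsTranslationSegment.isPositiveInterval_of_max (hS : IsTranslationSegment δ U D b a k)
    (h : FreeCurve E G δ U D) (he : EqOn γ δ D) (hA : IsMaxFree G δ U D A)
    (hc : IsCompact A) (hAD : A ⊆ interior D) : IsPositiveInterval G γ D A := by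
  obtain ⟨b', a', kb, ka, eb, ea, rfl, hT⟩ := h.exists_tile_of_compact hA hc hAD
  rcases hT.translation_or_reflection h with hS' | ⟨-, -, -, hg⟩
  · exact hS'.isPositiveInterval h he
  · exact absurd hg (hS.no_reflection h hT.right)

/-- The elements of any decomposition of a translation segment are the powers of the
translation. -/
theorem IsTranslationSegment.describe (hS : IsTranslationSegment δ U D b a k)
    (h : FreeCurve E G δ U D) (he : EqOn γ δ D) (hd : IsADecomposition γ D (Icc b a) d)
    (hn : n ∈ d.idx) :
    cls γ D (d.step n) = cls γ D (k ^ n.sign) ∧ cls γ D (d.g n) = cls γ D (k ^ n) ∧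
      Carries (k ^ n) γ (d.dom n) (d.μ n) (d.cell D n) ∧ IsPos (d.μ n) (d.dom n) := by
  obtain ⟨d', Q, F⟩ := hS.tile.exists_family h
  have hd' := F.isADecomposition h hS.tile he
  have hidx := (hd.same hd' h he).idx_eq
  obtain ⟨-, -, hsame⟩ := hd.same hd' h he
  have hcls : ∀ m ∈ insert 0 d.idx, (d.g m)⁻¹ * k ^ m ∈ curveStab G δ U := by
    rintro m (rfl | hm)
    · simp [hd.g_zero]
    · have h1 := (h.cls_eq_cls_iff he).1 (hsame m hm).2.1
      obtain ⟨s, hs, hsm⟩ := DecompositionData.exists_sign hm.1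
      rwa [F.g_eq, (F.translation hS.lt hs hsm (hidx ▸ hm)).1] at h1
  have hni := mem_insert_of_mem (0 : ℤ) hn
  refine ⟨?_, (h.cls_eq_cls_iff he).2 (hcls n hni), ⟨(hd.carries n hn).1, fun t ht => ?_⟩, ?_⟩
  · obtain ⟨s, hs, hsn⟩ := DecompositionData.exists_sign hn.1
    have hstep : d.step n = d.g n * (d.g (n - s))⁻¹ ∧ n.sign = s := by
      rcases hs with rfl | rfl
      · have h0 : 0 < n := by omega
        exact ⟨by rw [DecompositionData.step, if_pos h0], Int.sign_eq_one_of_pos h0⟩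
      · have h0 : n < 0 := by omega
        exact ⟨by rw [DecompositionData.step, if_neg (by omega), sub_neg_eq_add],
          Int.sign_eq_neg_one_of_neg h0⟩
    have hprev : n - s ∈ insert 0 d.idx := by
      by_cases h0 : n - s = 0
      · rw [h0]; exact mem_insert _ _
      · refine mem_insert_of_mem _ ?_
        rcases hs with rfl | rfl
        · exact hd.mem_idx_of_between (mem_insert _ _) hni h0 (by omega) (by omega)
        · exact hd.mem_idx_of_between hni (mem_insert _ _) h0 (by omega) (by omega)
    rw [hstep.1, hstep.2, h.cls_eq_cls_iff he]
    -- `gₙ` and `gₙ₋ₛ` are known only up to right factors in the stabilizer; conjugation by `k ^ (n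
    -- - s)` carries these factors past the quotient that defines `hₙ`.
    have hm := F.max_translation h.toActedCurve hS.lt (n := n - s) (hidx ▸ hprev)
    obtain ⟨x, hx⟩ := hm.dom.2.2
    have := h.conj_mem_stab (hm.germ hx) (mul_mem (inv_mem (hcls _ hprev)) (hcls n hni))
    have heq : k ^ (n - s) * (((d.g (n - s))⁻¹ * k ^ (n - s))⁻¹ * ((d.g n)⁻¹ * k ^ n)) *
        (k ^ (n - s))⁻¹ = (d.g n * (d.g (n - s))⁻¹)⁻¹ * k ^ s := by
      rw [zpow_sub]; group
    rwa [heq] at this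
  · have htD := hd.subset h ((hd.dom_interval hn).2 ht)
    rw [← (hd.carries n hn).2 t ht, he htD]
    exact curveStab_smul_eqOn (hcls n hni) (h.sub htD)
  · have hp := F.isPos h.toActedCurve hS.lt (n := n) (hidx ▸ hni)
    rw [← (hsame n hn).2.2.1] at hp
    exact hp.congr (hsame n hn).2.2.2

theorem IsTranslationSegment.positiveDescription (hS : IsTranslationSegment δ U D b a k)
    (h : FreeCurve E G δ U D) (he : EqOn γ δ D) : PositiveDescription G γ D := by
  refine ⟨?_, ?_, ?_, ?_⟩
  · intro A hA hc hAD
    exact hS.isPositiveInterval_of_max h he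
      ((h.toActedCurve.isMaximalInterval_iff h.sub he).1 hA) hc hAD
  · refine ⟨cls γ D k, ⟨(h.cls_ne_cls_one_iff he).2 (hS.tile.right_not_mem h), ?_⟩, ?_⟩
    · intro A hA d hd k' hk' n hn
      obtain ⟨b₁, a₁, k₁, rfl, hS₁⟩ := (h.isPositiveInterval_iff he).1 hA
      have h1 := mul_mem (hS₁.cls_eq h hS) (inv_mem ((h.cls_eq_cls_iff he).1 hk'))
      have h2 : k₁⁻¹ * k * (k'⁻¹ * k)⁻¹ = k₁⁻¹ * k' := by group
      rw [h2] at h1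
      exact (hS₁.congr h.curve.dom.1 h1).describe h he hd hn
    · rintro c ⟨-, hc⟩
      obtain ⟨k', rfl⟩ := QuotientGroup.mk_surjective c
      obtain ⟨d, Q, F⟩ := hS.tile.exists_family h
      have hd := F.isADecomposition h hS.tile he
      have h1i := DecompositionData.one_mem_idx hd.lo_neg hd.hi_pos
      have h1 := (hc _ (hS.isPositiveInterval h he) d hd k' rfl 1 h1i).2.1
      have h2 := (hS.describe h he hd h1i).2.1
      rw [zpow_one] at h1 h2
      exact h1.symm.trans h2
  · intro t ht
    obtain ⟨b₁, a₁, hS₁, ht₁⟩ := hS.exists_mem_Ioo h ht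
    exact ⟨_, hS₁.isPositiveInterval h he, by rwa [interior_Icc]⟩
  · intro A hA d hd
    obtain ⟨b₁, a₁, k₁, rfl, hS₁⟩ := (h.isPositiveInterval_iff he).1 hA
    obtain ⟨d', Q, F⟩ := hS₁.tile.exists_family h
    have hd' := F.isADecomposition h hS₁.tile he
    have hsame := hd.same hd' h he
    have hcell := hsame.cell_eq hd hd'
    refine ⟨fun n hlo' hn b' hb' => ?_, fun n hn hhi' b hb => ?_⟩
    · have hn1 := DecompositionData.sub_one_mem_idx hd.hi_pos hn hlo'
      have hn0 : n ∈ insert 0 d.idx := by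
        by_cases h0 : n = 0
        · rw [h0]; exact mem_insert _ _
        · exact mem_insert_of_mem _ (hd.mem_idx_of_between (mem_insert_of_mem _ hn1)
            (mem_insert _ _) h0 (by omega) hn)
      rw [hcell _ (mem_insert_of_mem _ hn1)] at hb'
      obtain ⟨x, hx, hseg⟩ := F.exists_segment_right h hS₁ he hn (hsame.1 ▸ hlo') hb'
      exact ⟨x, by rwa [hcell _ hn0], hseg.isPositiveInterval h he⟩
    · have hn1 := DecompositionData.add_one_mem_idx hd.lo_neg hn hhi'
      have hn0 : n ∈ insert 0 d.idx := by
        by_cases h0 : n = 0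
        · rw [h0]; exact mem_insert _ _
        · exact mem_insert_of_mem _ (hd.mem_idx_of_between (mem_insert _ _)
            (mem_insert_of_mem _ hn1) h0 hn (by omega))
      rw [hcell _ (mem_insert_of_mem _ hn1)] at hb
      obtain ⟨x, hx, hseg⟩ := F.exists_segment_left h hS₁ he hn (hsame.2.1 ▸ hhi') hb
      exact ⟨x, by rwa [hcell _ hn0], hseg.isPositiveInterval h he⟩

end PositiveCurves

end AnalyticCurve

namespace AnalyticCurve

/-! ### Description of negative curves. -/

section NegativeCurves

variable {E : Type*} [NormedAddCommGroup E] [NormedSpace ℝ E] [CompleteSpace E]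
  {M : Type*} [TopologicalSpace M] [ChartedSpace E M] [IsManifold 𝓘(ℝ, E) ω M] [T2Space M]
  {G : Type*} [Group G] [MulAction G M]
  {δ γ : ℝ → M} {U A B C D J J' V V' : Set ℝ} {g g' k k' : G} {t r a b a' b' x y q eb ea σ : ℝ}
  {kb ka : G} {μ ρ ρ' f : ℝ → ℝ} {d d' : DecompositionData G} {s n m p : ℤ}
  {Q : ℤ → PieceData G}

/-- Passing to the next piece multiplies on the right by the reflection at the far end of the tile;
these ends alternate, and `sigma` records which one is used. -/
theorem sigmaWord_add (w : ℤ → G) (hs : s = 1 ∨ s = -1) (hsn : 0 < s * n) :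
    sigmaWord w (n + s) = sigmaWord w n * w (sigma (n + s)) := by
  have h1 : (n + s).natAbs = n.natAbs + 1 := by rcases hs with rfl | rfl <;> omega
  have h2 : (n + s).sign = s ∧ n.sign = s := by
    rcases hs with rfl | rfl
    · exact ⟨Int.sign_eq_one_of_pos (by omega), Int.sign_eq_one_of_pos (by omega)⟩
    · exact ⟨Int.sign_eq_neg_one_of_neg (by omega), Int.sign_eq_neg_one_of_neg (by omega)⟩
  have h3 : s * ((n.natAbs : ℤ) + 1) = n + s := by rcases hs with rfl | rfl <;> omega
  rw [sigmaWord, sigmaWord, h1, h2.1, h2.2, List.range_succ, List.map_append, List.prod_append,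
    List.map_singleton, List.prod_singleton, h3]

theorem sigmaWord_one (w : ℤ → G) : sigmaWord w 1 = w 1 := by
  simp [sigmaWord, sigma]

theorem sigmaWord_neg_one (w : ℤ → G) : sigmaWord w (-1) = w (-1) := by
  simp [sigmaWord, sigma]

/-- The elements and starting points of the pieces when both neighbours are reflections. -/
theorem PieceFamily.reflection (F : PieceFamily δ U D b a kb ka b a d Q) (hba : b < a)
    {w : ℤ → G} (hw : w 1 = ka) (hw' : w (-1) = kb)
    (hs : s = 1 ∨ s = -1) (hsn : 0 < s * n) (hn : n ∈ d.idx) :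
    (Q n).g = sigmaWord w n ∧ (Even n → (Q n).e = if s = 1 then b else a) ∧
      (Odd n → (Q n).e = if s = 1 then a else b) := by
  refine DecompositionData.side_induction F.lo_neg F.hi_pos hs
    (P := fun n => (Q n).g = sigmaWord w n ∧ (Even n → (Q n).e = if s = 1 then b else a) ∧
      (Odd n → (Q n).e = if s = 1 then a else b)) ?_ ?_ hn hsn
  · rcases hs with rfl | rfl
    · refine ⟨by rw [sigmaWord_one, hw]; exact F.one.1, fun h => absurd h (by decide), fun _ => ?_⟩
      rw [if_pos rfl]; exact F.one.2.1
    · refine ⟨by rw [sigmaWord_neg_one, hw']; exact F.neg_one.1, fun h => absurd h (by decide),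
        fun _ => ?_⟩
      rw [if_neg (by norm_num)]; exact F.neg_one.2.1
  · rintro n hn hsn hend - ⟨ih1, ih2, ih3⟩
    have hnx := F.next s n hs hsn hn hend
    have hnn : n + s ≠ 0 := by rcases hs with rfl | rfl <;> omega
    have ta : turnElt a kb ka a = ka ∧ turn a b a a = a := by simp [turnElt, turn]
    have tb : turnElt a kb ka b = kb ∧ turn a b a b = b := by simp [turnElt, turn, hba.ne]
    rw [sigmaWord_add w hs hsn, hnx.g_eq, hnx.e_eq, ih1]
    rcases Int.even_or_odd n with hpar | hpar
    · have hodd : Odd (n + s) := by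
        rcases hs with rfl | rfl
        · exact hpar.add_one
        · rw [← sub_eq_add_neg]; exact hpar.sub_odd odd_one
      have hev : ¬ Even (n + s) := Int.not_even_iff_odd.2 hodd
      rw [ih2 hpar]
      rcases hs with rfl | rfl
      · have hσ : sigma (n + 1) = 1 := by
          rw [sigma, if_pos (by omega), add_sub_cancel_right, Int.negOnePow_even _ hpar]; rfl
        rw [if_pos rfl, add_sub_cancel_right, ta.1, ta.2, hσ, hw]
        exact ⟨rfl, fun h => absurd h hev, fun _ => by rw [if_pos rfl]⟩
      · have hσ : sigma (n + -1) = -1 := by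
          rw [sigma, if_neg (by omega), Int.negOnePow_odd _ hodd]; rfl
        rw [if_neg (by norm_num), add_sub_cancel_left, tb.1, tb.2, hσ, hw']
        exact ⟨rfl, fun h => absurd h hev, fun _ => by rw [if_neg (by norm_num)]⟩
    · have hev : Even (n + s) := by
        rcases hs with rfl | rfl
        · exact hpar.add_one
        · rw [← sub_eq_add_neg]; exact hpar.sub_odd odd_one
      have hodd : ¬ Odd (n + s) := Int.not_odd_iff_even.2 hev
      rw [ih3 hpar]
      rcases hs with rfl | rfl
      · have hσ : sigma (n + 1) = -1 := by
          rw [sigma, if_pos (by omega), add_sub_cancel_right, Int.negOnePow_odd _ hpar]; rfl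
        rw [if_pos rfl, add_sub_cancel_left, tb.1, tb.2, hσ, hw']
        exact ⟨rfl, fun _ => by rw [if_pos rfl], fun h => absurd h hodd⟩
      · have hσ : sigma (n + -1) = 1 := by
          rw [sigma, if_neg (by omega), Int.negOnePow_even _ hev]; rfl
        rw [if_neg (by norm_num), add_sub_cancel_right, ta.1, ta.2, hσ, hw]
        exact ⟨rfl, fun _ => by rw [if_neg (by norm_num)], fun h => absurd h hodd⟩

theorem PieceFamily.isPos_of_even (F : PieceFamily δ U D b a kb ka b a d Q) (hba : b < a)
    (hn : n ∈ d.idx) (hpar : Even n) : IsPos (d.μ n) (d.dom n) := by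
  obtain ⟨s, hs, hsn⟩ := DecompositionData.exists_sign hn.1
  have he := (F.reflection (w := fun m => if m = 1 then ka else kb) hba rfl rfl hs hsn hn).2.1 hpar
  rw [F.dom_eq, F.μ_eq]
  have hp := F.piece s n hs hsn hn
  refine hp.max.toTransition.isPos (fun t ht => ht.2.1) (fun _ _ => rfl) ?_
  rw [he]
  rcases hs with rfl | rfl
  · rw [if_pos rfl]; push_cast; linarith
  · rw [if_neg (by norm_num)]; push_cast; linarith

theorem PieceFamily.isNeg_of_odd (F : PieceFamily δ U D b a kb ka b a d Q) (hba : b < a)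
    (hn : n ∈ d.idx) (hpar : Odd n) : IsNeg (d.μ n) (d.dom n) := by
  obtain ⟨s, hs, hsn⟩ := DecompositionData.exists_sign hn.1
  have he := (F.reflection (w := fun m => if m = 1 then ka else kb) hba rfl rfl hs hsn hn).2.2 hpar
  rw [F.dom_eq, F.μ_eq]
  have hp := F.piece s n hs hsn hn
  refine hp.max.toTransition.isNeg (fun t ht => ht.2.1) (fun _ _ => rfl) ?_
  rw [he]
  rcases hs with rfl | rfl
  · rw [if_pos rfl]; push_cast; linarith
  · rw [if_neg (by norm_num)]; push_cast; linarith

theorem FreeCurve.isNegativeInterval_iff (h : FreeCurve E G δ U D) (he : EqOn γ δ D) :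
    IsNegativeInterval G γ D A ↔ ∃ (b a : ℝ) (kb ka : G), A = Icc b a ∧
      Tile G δ U D b a kb ka b a := by
  have h' := h.interior_curve
  have he' := he.mono (interior_subset (s := D))
  constructor
  · rintro ⟨d, hd, h1, h2⟩
    have h1i := DecompositionData.one_mem_idx hd.lo_neg hd.hi_pos
    have h2i := DecompositionData.neg_one_mem_idx hd.lo_neg hd.hi_pos
    refine ⟨d.a (-1), d.a 1, d.g (-1), d.g 1, hd.eq_Icc, tile_interior.1
      ⟨hd.neg_one_lt, hd.mem _ h2i, hd.mem _ h1i, hd.eq_Icc ▸ hd.isFree h' he', ?_, ?_⟩⟩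
    · rcases hd.neighbour h' he' (Or.inr rfl) with ⟨-, hp⟩ | ⟨hg, -⟩
      · exact absurd h2 (hp.not_isNeg (hd.dom_interval h2i).1)
      · exact Or.inr ⟨rfl, hg⟩
    · rcases hd.neighbour h' he' (Or.inl rfl) with ⟨-, hp⟩ | ⟨hg, -⟩
      · exact absurd h1 (hp.not_isNeg (hd.dom_interval h1i).1)
      · exact Or.inr ⟨rfl, hg⟩
  · rintro ⟨b, a, kb, ka, rfl, hT⟩
    have hT' := tile_interior.2 hT
    obtain ⟨d, Q, F⟩ := hT'.exists_family h'
    exact ⟨d, F.isADecomposition h' hT' he',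
      F.isNeg_of_odd hT.lt (DecompositionData.one_mem_idx F.lo_neg F.hi_pos) (by decide),
      F.isNeg_of_odd hT.lt (DecompositionData.neg_one_mem_idx F.lo_neg F.hi_pos) (by decide)⟩

theorem Tile.germ_reflection (hT : Tile G δ U D b a kb ka b a) :
    GGerm δ U (-1) kb b b ∧ GGerm δ U (-1) ka a a := by
  have hba := hT.lt
  exact ⟨(hT.nbr_left.resolve_left fun hh => hba.ne hh.1).2,
    (hT.nbr_right.resolve_left fun hh => hba.ne' hh.1).2⟩

/-- There is a reflection at every point `aₙ`. -/
theorem PieceFamily.exists_reflection (F : PieceFamily δ U D b a kb ka b a d Q)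
    (hT : Tile G δ U D b a kb ka b a) (hn : n ∈ d.idx) :
    ∃ g : G, GGerm δ U (-1) g (d.a n) (d.a n) := by
  obtain ⟨s, hs, hsn⟩ := DecompositionData.exists_sign hn.1
  have hp := F.piece s n hs hsn hn
  obtain ⟨k, hk⟩ : ∃ k : G, GGerm δ U (-1) k (Q n).e (Q n).e := by
    rcases hp.mem with h | h <;> rw [h]
    · exact ⟨_, hT.germ_reflection.1⟩
    · exact ⟨_, hT.germ_reflection.2⟩
  have hg := hp.max.toTransition.germ hp.memV
  have hσ := hg.sign_ne_zero
  rw [F.a_eq]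
  refine ⟨_, (GGerm.comp (GGerm.inv hg) (GGerm.comp hk hg)).of_sign ?_⟩
  have : ∀ z : ℝ, z * (-1 * z) * -1 = z ^ 2 := fun z => by ring
  rw [this]
  positivity

theorem IsADecomposition.exists_between (hd : IsADecomposition γ D A d)
    (hn : n ∈ insert 0 d.idx) (hq : q ∈ D) (hqn : q ∉ d.cell D n) :
    ∃ m ∈ d.idx, (d.a m < q ∧ ∀ y ∈ d.cell D n, y ≤ d.a m) ∨
      (q < d.a m ∧ ∀ y ∈ d.cell D n, d.a m ≤ y) := by
  have h1i := DecompositionData.one_mem_idx hd.lo_neg hd.hi_pos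
  have h2i := DecompositionData.neg_one_mem_idx hd.lo_neg hd.hi_pos
  rcases hn with rfl | hn
  · rw [hd.cell_zero, hd.eq_Icc] at hqn ⊢
    rcases lt_or_ge q (d.a (-1)) with hlt | hge
    · exact ⟨_, h2i, Or.inr ⟨hlt, fun y hy => hy.1⟩⟩
    · exact ⟨_, h1i, Or.inl ⟨not_le.1 fun hle => hqn ⟨hge, hle⟩, fun y hy => hy.2⟩⟩
  · obtain ⟨s, hs, hsn⟩ := DecompositionData.exists_sign hn.1
    by_cases hend : d.IsEnd n
    · rw [hd.mem_cell_end hs hsn hend, not_and, not_le] at hqn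
      have h1 := hqn hq
      rcases hs with rfl | rfl
      · push_cast at h1
        refine ⟨n, hn, Or.inr ⟨by linarith, fun y hy => ?_⟩⟩
        have := ((hd.mem_cell_end (Or.inl rfl) hsn hend).1 hy).2
        push_cast at this
        linarith
      · push_cast at h1
        refine ⟨n, hn, Or.inl ⟨by linarith, fun y hy => ?_⟩⟩
        have := ((hd.mem_cell_end (Or.inr rfl) hsn hend).1 hy).2
        push_cast at this
        linarith
    · have hn' := hd.next_mem hs hsn hn hend
      rw [hd.mem_cell_inner hs hsn hend, not_and_or, not_le, not_le] at hqn
      rcases hs with rfl | rfl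
      · have hc : ∀ y ∈ d.cell D n, d.a n ≤ y ∧ y ≤ d.a (n + 1) := fun y hy => by
          have := (hd.mem_cell_inner (Or.inl rfl) hsn hend).1 hy
          push_cast at this
          constructor <;> linarith
        push_cast at hqn
        rcases hqn with h1 | h1
        · exact ⟨_, hn, Or.inr ⟨by linarith, fun y hy => (hc y hy).1⟩⟩
        · exact ⟨_, hn', Or.inl ⟨by linarith, fun y hy => (hc y hy).2⟩⟩
      · have hc : ∀ y ∈ d.cell D n, d.a (n + -1) ≤ y ∧ y ≤ d.a n := fun y hy => by
          have := (hd.mem_cell_inner (Or.inr rfl) hsn hend).1 hy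
          push_cast at this
          constructor <;> linarith
        push_cast at hqn
        rcases hqn with h1 | h1
        · exact ⟨_, hn, Or.inl ⟨by linarith, fun y hy => (hc y hy).2⟩⟩
        · exact ⟨_, hn', Or.inr ⟨by linarith, fun y hy => (hc y hy).1⟩⟩

theorem PieceFamily.isFree_cell (F : PieceFamily δ U D b a kb ka eb ea d Q)
    (h : FreeCurve E G δ U D) (hT : Tile G δ U D b a kb ka eb ea) (hn : n ∈ insert 0 d.idx) :
    IsFree G δ U (d.cell D n) := by
  have hba := hT.lt
  have hAD := h.Icc_subset hT.left hT.right
  obtain ⟨⟨σ, hm⟩, -, -⟩ := F.exists_max h hba hAD hn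
  have hpre : ∀ v : ℝ, ∃ x, v ∈ interior (d.cell D n) →
      x ∈ Ioo b a ∧ x ∈ (Q n).V ∧ (Q n).ρ x = v := fun v => by
    by_cases hv : v ∈ interior (d.cell D n)
    · obtain ⟨x, hx⟩ := F.exists_preimage h hba hAD hn hv
      exact ⟨x, fun _ => hx⟩
    · exact ⟨0, fun hh => absurd hh hv⟩
  choose ψ hψ using hpre
  -- No exceptional point is needed for a single piece; `0` is a dummy.
  refine h.isFree_of_lift (isInterval_Icc hba) hAD hT.free 0 ψ (fun _ => σ) (fun _ => d.g n) ?_ ?_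
  · intro v hv _
    obtain ⟨h1, h2, h3⟩ := hψ v hv
    refine ⟨by rwa [interior_Icc], ?_⟩
    have := hm.germ h2
    rwa [h3] at this
  · intro v hv w hw _ _ hvw
    rw [← (hψ v hv).2.2, ← (hψ w hw).2.2, hvw]

/-- A free interval has no reflection point in its interior, and every `aₙ` is one; so it lies in a
single cell, and the cells themselves are free. -/
theorem PieceFamily.isMaxFree_iff (F : PieceFamily δ U D b a kb ka b a d Q)
    (h : FreeCurve E G δ U D) (hT : Tile G δ U D b a kb ka b a) :
    IsMaxFree G δ U D B ↔ ∃ n ∈ insert (0 : ℤ) d.idx, B = d.cell D n := by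
  have hd := F.isADecomposition h hT (fun _ _ => rfl)
  have hno : ∀ A', IsInterval A' → A' ⊆ D → IsFree G δ U A' → ∀ m ∈ d.idx,
      d.a m ∉ interior A' := fun A' hA' hA'D hf m hm hi => by
    obtain ⟨g, hg⟩ := F.exists_reflection hT hm
    have := (h.germ_eq hA' hA'D hf hi hi hg).2.2
    norm_num at this
  have hsub : ∀ A', IsInterval A' → A' ⊆ D → IsFree G δ U A' → ∀ n ∈ insert (0 : ℤ) d.idx,
      ∀ t ∈ interior A', t ∈ d.cell D n → A' ⊆ d.cell D n := by
    intro A' hA' hA'D hf n hn t ht htn q hq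
    by_contra hqn
    obtain ⟨m, hm, ⟨h1, h2⟩ | ⟨h1, h2⟩⟩ := hd.exists_between hn (hA'D hq) hqn
    · obtain ⟨t', ht', hlt⟩ := exists_lt_mem_of_mem_interior ht
      exact hno A' hA' hA'D hf m hm
        (mem_interior_of_between hA'.1 ht' hq (hlt.trans_le (h2 t htn)) h1)
    · obtain ⟨t', ht', hlt⟩ := exists_gt_mem_of_mem_interior ht
      exact hno A' hA' hA'D hf m hm
        (mem_interior_of_between hA'.1 hq ht' h1 ((h2 t htn).trans_lt hlt))
  constructor
  · intro hB
    obtain ⟨t, ht⟩ := hB.interval.2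
    obtain ⟨n, hn, htn⟩ := hd.exists_mem_cell h (fun _ _ => rfl) (hB.sub (interior_subset ht))
    have h1 := hsub B hB.interval hB.sub hB.free n hn t ht htn
    exact ⟨n, hn, h1.antisymm (hB.max _ (hd.isInterval_cell h hn) (hd.cell_subset h hn) h1
      (F.isFree_cell h hT hn))⟩
  · rintro ⟨n, hn, rfl⟩
    refine ⟨hd.isInterval_cell h hn, hd.cell_subset h hn, F.isFree_cell h hT hn, ?_⟩
    intro A' hA' hA'D hnA' hf
    obtain ⟨t, ht⟩ := (hd.isInterval_cell h hn).2
    exact hsub A' hA' hA'D hf n hn t (interior_mono hnA' ht) (interior_subset ht)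

theorem FreeCurve.negativeDescription (h : FreeCurve E G δ U D) (he : EqOn γ δ D)
    (hno : ∀ (b a : ℝ) (k : G), ¬ IsTranslationSegment δ U D b a k) :
    NegativeDescription G γ D := by
  refine ⟨?_, ?_⟩
  · intro A hA hc hAD
    obtain ⟨b, a, kb, ka, eb, ea, rfl, hT⟩ := h.exists_tile_of_compact
      ((h.toActedCurve.isMaximalInterval_iff h.sub he).1 hA) hc hAD
    rcases hT.translation_or_reflection h with hS | ⟨rfl, rfl, -, -⟩
    · exact absurd hS (hno _ _ _)
    · exact (h.isNegativeInterval_iff he).2 ⟨_, _, _, _, rfl, hT⟩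
  · intro A d hd
    have h1i := DecompositionData.one_mem_idx hd.lo_neg hd.hi_pos
    have h2i := DecompositionData.neg_one_mem_idx hd.lo_neg hd.hi_pos
    have hfree := hd.isFree h he
    obtain rfl := hd.eq_Icc
    have hT : Tile G δ U D (d.a (-1)) (d.a 1) (d.g (-1)) (d.g 1) (d.a (-1)) (d.a 1) := by
      refine ⟨hd.neg_one_lt, hd.mem _ h2i, hd.mem _ h1i, hfree, ?_, ?_⟩
      · rcases hd.neighbour h he (Or.inr rfl) with ⟨hg, -⟩ | ⟨hg, -⟩
        · rw [neg_neg] at hg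
          exact absurd ⟨hd.neg_one_lt, hd.mem _ h2i, hd.mem _ h1i, hfree, GGerm.inv hg⟩
            (hno _ _ _)
        · exact Or.inr ⟨rfl, hg⟩
      · rcases hd.neighbour h he (Or.inl rfl) with ⟨hg, -⟩ | ⟨hg, -⟩
        · exact absurd ⟨hd.neg_one_lt, hd.mem _ h2i, hd.mem _ h1i, hfree, hg⟩ (hno _ _ _)
        · exact Or.inr ⟨rfl, hg⟩
    obtain ⟨d', Q, F⟩ := hT.exists_family h
    have hd' := F.isADecomposition h hT he
    have hidx := (hd.same hd' h he).idx_eq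
    have hcell := (hd.same hd' h he).cell_eq hd hd'
    obtain ⟨-, -, hsame⟩ := hd.same hd' h he
    refine ⟨fun B => ?_, fun n hn => ⟨fun hpar => ?_, fun hpar => ?_, ?_⟩⟩
    · rw [h.toActedCurve.isMaximalInterval_iff h.sub he, F.isMaxFree_iff h hT, ← hidx]
      exact exists_congr fun n => and_congr_right fun hn => by rw [hcell n hn]
    · have hp := F.isPos_of_even hT.lt (n := n) (hidx ▸ hn) hpar
      rw [← (hsame n hn).2.2.1] at hp
      exact hp.congr (hsame n hn).2.2.2
    · have hp := F.isNeg_of_odd hT.lt (n := n) (hidx ▸ hn) hpar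
      rw [← (hsame n hn).2.2.1] at hp
      exact hp.congr (hsame n hn).2.2.2
    · obtain ⟨s, hs, hsn⟩ := DecompositionData.exists_sign hn.1
      rw [(hsame n hn).2.1, F.g_eq,
        (F.reflection (w := d.g) hT.lt rfl rfl hs hsn (hidx ▸ hn)).1]

end NegativeCurves

end AnalyticCurve

/-! ### The classification theorem. -/

theorem mainTheorem6
    {E : Type*} [NormedAddCommGroup E] [NormedSpace ℝ E] [FiniteDimensional ℝ E]
    {F : Type*} [NormedAddCommGroup F] [NormedSpace ℝ F] [FiniteDimensional ℝ F]
    {M : Type*} [TopologicalSpace M] [ChartedSpace E M] [IsManifold 𝓘(ℝ, E) ω M]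
    [T2Space M] [SecondCountableTopology M]
    {G : Type*} [Group G] [TopologicalSpace G] [ChartedSpace F G] [LieGroup 𝓘(ℝ, F) ω G]
    [T2Space G] [SecondCountableTopology G]
    [MulAction G M]
    (hG : ∀ x : M, ContMDiff 𝓘(ℝ, F) 𝓘(ℝ, E) ω (fun g : G => g • x))
    (hM : ∀ g : G, ContMDiff 𝓘(ℝ, E) 𝓘(ℝ, E) ω (fun x : M => g • x))
    (hsated : AnalyticCurve.IsSated G M)
    (γ : ℝ → M) (D : Set ℝ) (hD : AnalyticCurve.IsInterval D)
    (hγ : AnalyticCurve.IsAnalyticImmersion E γ D)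
    (hfree : AnalyticCurve.IsFreeCurve G γ D)
    (hnot : ¬ AnalyticCurve.IsFreeSegment G γ D) :
    -- first alternative: a unique `τ`-decomposition, which is faithful
    ((∃ (τ : ℝ) (g : G) (B : Set ℝ) (μ : ℝ → ℝ),
        AnalyticCurve.IsTauDecomposition γ D τ g B μ ∧
        AnalyticCurve.IsFaithfulTau γ D τ g B μ ∧
        ∀ (τ' : ℝ) (g' : G) (B' : Set ℝ) (μ' : ℝ → ℝ),
          AnalyticCurve.IsTauDecomposition γ D τ' g' B' μ' →
            τ' = τ ∧ AnalyticCurve.cls γ D g' = AnalyticCurve.cls γ D g ∧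
            B' = B ∧ EqOn μ' μ B) ∧
      ¬ ∃ A, AnalyticCurve.IsMaximalInterval G γ D A ∧ IsCompact A ∧ A ⊆ interior D) ∨
    -- second alternative: a compact maximal interval in the interior of `D`
    ((∃ A, AnalyticCurve.IsMaximalInterval G γ D A ∧ IsCompact A ∧ A ⊆ interior D) ∧
      (¬ ∃ (τ : ℝ) (g : G) (B : Set ℝ) (μ : ℝ → ℝ),
        AnalyticCurve.IsTauDecomposition γ D τ g B μ) ∧
      -- each such interval has a unique decomposition, and it is faithful
      (∀ A, AnalyticCurve.IsMaximalInterval G γ D A → IsCompact A → A ⊆ interior D →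
        ∃ d : AnalyticCurve.DecompositionData G,
          AnalyticCurve.IsADecomposition γ D A d ∧ AnalyticCurve.IsFaithful γ D A d ∧
          ∀ d' : AnalyticCurve.DecompositionData G, AnalyticCurve.IsADecomposition γ D A d' →
            AnalyticCurve.SameDecomposition γ D d d') ∧
      -- the curve is either positive or negative, with the corresponding description
      (AnalyticCurve.IsPositiveCurve G γ D ∨ AnalyticCurve.IsNegativeCurve G γ D) ∧
      ¬ (AnalyticCurve.IsPositiveCurve G γ D ∧ AnalyticCurve.IsNegativeCurve G γ D) ∧
      (AnalyticCurve.IsPositiveCurve G γ D → AnalyticCurve.PositiveDescription G γ D) ∧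
      (AnalyticCurve.IsNegativeCurve G γ D → AnalyticCurve.NegativeDescription G γ D)) := by
  have : CompleteSpace E := FiniteDimensional.complete ℝ E
  obtain ⟨δ, U, hU, hDU, hsm, himm, heq⟩ := hγ
  have he : EqOn γ δ D := heq.symm
  have hac : AnalyticCurve.ActedCurve E G δ U := ⟨⟨hU, hsm, himm⟩, hM, hsated⟩
  have h : AnalyticCurve.FreeCurve E G δ U D := by
    obtain ⟨D', hD', hD'D, hf⟩ := hfree
    exact ⟨hac, hD, hDU, ⟨D', hD', hD'D,
      (hac.isFreeSegment_iff (hD'D.trans hDU) (he.mono hD'D)).1 hf⟩,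
      fun hf' => hnot ((hac.isFreeSegment_iff hDU he).2 hf')⟩
  rcases h.dichotomy with ⟨b, a, hba, hb, ha, hA⟩ | ⟨τ, hτ, g, hg, hL, hR⟩
  · right
    obtain ⟨kb, ka, eb, ea, hT⟩ := h.exists_tile hba hA hb ha
    have hpos : AnalyticCurve.IsPositiveCurve G γ D → ∃ (b a : ℝ) (k : G),
        AnalyticCurve.IsTranslationSegment δ U D b a k := fun ⟨A, hA⟩ => by
      obtain ⟨b, a, k, -, hS⟩ := (h.isPositiveInterval_iff he).1 hA
      exact ⟨b, a, k, hS⟩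
    -- The end points of a negative interval are reflection points, which a translation segment
    -- excludes anywhere in the interior of `D`.
    have hneg : AnalyticCurve.IsNegativeCurve G γ D → ∀ (b a : ℝ) (k : G),
        ¬ AnalyticCurve.IsTranslationSegment δ U D b a k := fun ⟨A, hA⟩ b a k hS => by
      obtain ⟨b', a', kb', ka', -, hT'⟩ := (h.isNegativeInterval_iff he).1 hA
      exact hS.no_reflection h hT'.right hT'.germ_reflection.2
    refine ⟨⟨Icc b a, (hac.isMaximalInterval_iff hDU he).2 hA, isCompact_Icc, fun t ht => ?_⟩,
      ?_, ?_, ?_, ?_, ?_, ?_⟩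
    · exact hD.interior_interval.1.out hb ha ht
    · rintro ⟨τ, g, B, μ, hd⟩
      exact (h.isReflectionPoint_of he hd).1.not_compact h hA isCompact_Icc
        (hD.interior_interval.1.out hb ha)
    · intro A hA hc hAD
      obtain ⟨b', a', kb', ka', eb', ea', rfl, hT'⟩ := h.exists_tile_of_compact
        ((hac.isMaximalInterval_iff hDU he).1 hA) hc hAD
      obtain ⟨d, Q, F⟩ := hT'.exists_family h
      have hd := F.isADecomposition h hT' he
      exact ⟨d, hd, F.isFaithful h hT' he, fun d' hd' => hd.same hd' h he⟩
    · rcases hT.translation_or_reflection h with hS | ⟨rfl, rfl, -, -⟩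
      · exact Or.inl ⟨_, hS.isPositiveInterval h he⟩
      · exact Or.inr ⟨_, (h.isNegativeInterval_iff he).2 ⟨_, _, _, _, rfl, hT⟩⟩
    · rintro ⟨hp, hn⟩
      obtain ⟨b', a', k, hS⟩ := hpos hp
      exact hneg hn _ _ _ hS
    · intro hp
      obtain ⟨b', a', k, hS⟩ := hpos hp
      exact hS.positiveDescription h he
    · exact fun hn => h.negativeDescription he (hneg hn)
  · left
    have hr : AnalyticCurve.IsReflectionPoint G δ U D τ g := ⟨hτ, hg, hL, hR⟩
    obtain ⟨B, μ, hd, hf, huniq⟩ := hr.exists_decomposition h he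
    refine ⟨⟨τ, g, B, μ, hd, hf, huniq⟩, ?_⟩
    rintro ⟨A, hA, hc, hAD⟩
    exact hr.not_compact h ((hac.isMaximalInterval_iff hDU he).1 hA) hc hAD
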